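/- Let $\mu>0$ and let $V_1,V_2:\mathbb R^3\to\mathbb R$ be measurable functions such that, for some $\beta>5$ and $C<\infty$, $|V_1(x)|+|V_2(x)|\le C\langle x\rangle^{-\beta}$ for a.e. $x$, where $\langle x\rangle=(1+|x|^2)^{1/2}$. On $L^2(\mathbb R^3)\times L^2(\mathbb R^3)$ consider the operator with domain $H^2\times H^2$ $$\mathcal H=\begin{pmatrix}-\Delta+\mu&0\\0&\Delta-\mu\end{pmatrix}+V,\qquad V=\begin{pmatrix}-V_1&-V_2\\V_2&V_1\end{pmatrix},\qquad \sigma_3=\begin{pmatrix}1&0\\0&-1\end{pmatrix}.$$ Assume that $-\sigma_3V(x)$ is positive definite for a.e. $x$ and that $L_-=-\Delta+\mu-V_1+V_2\ge0$ on $H^2(\mathbb R^3)$. Let $v(x)$ be the positive square root of $-\sigma_3V(x)$, and put $v_1=-\sigma_3v$, so that $V=v_1v$. Let $R_0(\mu)$ be the integral operator with kernel $$\frac1{4\pi|x-y|}\begin{pmatrix}1&0\\0&-e^{-\sqrt{2\mu}|x-y|}\end{pmatrix}.$$ Let $A_0=I+vR_0(\mu)v_1$, and let $S_1$ be the orthogonal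 projection onto $\ker A_0$. Let $m(0)=\frac{i}{4\pi}S_1vP_1v_1S_1$ with $P_1f=\int_{\mathbb R^3}\begin{pmatrix}1&0\\0&0\end{pmatrix}f\,dx$, and let $S_2$ be the orthogonal projection onto the kernel of $m(0)$ in $\operatorname{Ran}S_1$. Finally let $$b(0)=\frac1{8\pi}S_2\,v\begin{pmatrix}|x-y|&0\\0&\frac1{\sqrt{2\mu}}e^{-\sqrt{2\mu}|x-y|}\end{pmatrix}v\,S_2$$ as an operator on $\operatorname{Ran}S_2$. (When $S_2=0$, the operator $P_\mu$ below is $0$.) Then $\mathcal H$ is densely defined, the integral operators with kernels $v(x)R_0(\mu)(x,y)v_1(y)$, $\frac{i}{4\pi}v(x)\begin{pmatrix}1&0\\0&0\end{pmatrix}v_1(y)$ and $\frac1{8\pi}v(x)\begin{pmatrix}|x-y|&0\\0&\frac1{\sqrt{2\mu}}e^{-\sqrt{2\mu}|x-y|}\end{pmatrix}v(y)$ are bounded on $L^2\times L^2$, and $b(0)$ is invertible on $\operatorname{Ran}S_2$. The formula $$P_\mu=-R_0(\mu)\,\sigma_3\,v\,S_2\,b(0)^{-1}S_2\,v\,R_0(\mu),$$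 which makes sense, with absolutely convergent integrals, on $\langle x\rangle^{-s}(L^2\times L^2)$ for every $s>1$, extends to a unique bounded operator $P_\mu$ on $L^2(\mathbb R^3)\times L^2(\mathbb R^3)$. It has the following properties. 1. $P_\mu$ is a (not necessarily orthogonal) projection, $P_\mu^2=P_\mu$, with $$\operatorname{Ran}P_\mu=\ker(\mathcal H-\mu),\qquad \ker P_\mu=\ker(\mathcal H^*-\mu)^\perp .$$ 2. Up to sign, $P_\mu$ is the coefficient of $z^{-2}$ in the expansion of the resolvent at the threshold $\mu$: for every $s>3/2$ there are $C_s<\infty$ and $\delta_s>0$ such that for all $z$ with $\operatorname{Im}z>0$ and $|z|<\delta_s$ the resolvent $(\mathcal H-(\mu+z^2))^{-1}$ exists as a bounded operator on $L^2\times L^2$ and $$\Big\|\langle x\rangle^{-s}\Big(\big(\mathcal H-(\mu+z^2)\big)^{-1}f+\frac1{z^2}P_\mu f\Big)\Big\|_{L^2}\le\frac{C_s}{|z|}\,\|\langle x\rangle^{s}f\|_{L^2}$$ for all $f\in L^2\times L^2$ with $\langle x\rangle^sf\in L^2\times L^2$. -/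

import Mathlib

open MeasureTheory TemperedDistribution
open scoped ComplexOrder Laplacian SchwartzMap ENNReal

noncomputable section

namespace ThresholdProjection

/-- Physical space `ℝ³`. -/
abbrev E3 : Type := EuclideanSpace ℝ (Fin 3)

/-- The space of values `ℂ²` with its Euclidean norm. -/
abbrev C2 : Type := EuclideanSpace ℂ (Fin 2)

/-- Complex `2 × 2` matrices. -/
abbrev Mat2 : Type := Matrix (Fin 2) (Fin 2) ℂ

/-- The Hilbert space `L²(ℝ³) × L²(ℝ³)`, realised as `L²(ℝ³; ℂ²)`. -/
abbrev L2 : Type := Lp C2 2 (volume : Measure E3)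

/-- A matrix acting on a vector of `ℂ²`. -/
def act (M : Mat2) (w : C2) : C2 := Matrix.toEuclideanCLM (n := Fin 2) (𝕜 := ℂ) M w

lemma act_add (M : Mat2) (w w' : C2) : act M (w + w') = act M w + act M w' := by
  simp [act]

lemma act_smul (M : Mat2) (c : ℂ) (w : C2) : act M (c • w) = c • act M w := by
  simp [act]

/-- The Japanese bracket `⟨x⟩ = (1 + |x|²)^{1/2}`. -/
def bracket (x : E3) : ℝ := (1 + ‖x‖ ^ 2) ^ (1 / 2 : ℝ)

/-! ### The Laplacian on `H²` and the matrix Schrödinger operator -/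

section Sobolev

variable (F : Type*) [NormedAddCommGroup F] [InnerProductSpace ℂ F] [CompleteSpace F]

/-- The Sobolev space `H²(ℝ³; F)` as a subspace of `L²(ℝ³; F)`. -/
def H2 : Submodule ℂ (Lp F 2 (volume : Measure E3)) where
  carrier := {f | MemSobolev 2 2 (f : 𝓢'(E3, F))}
  zero_mem' := by
    have h := memSobolev_fun_zero E3 F 2 2
    rw [← map_zero (Lp.toTemperedDistributionCLM F (volume : Measure E3) 2)] at h
    exact h
  add_mem' := by
    intro f g hf hg
    have h := MemSobolev.add hf hg
    have e : ((f + g : Lp F 2 (volume : Measure E3)) : 𝓢'(E3, F)) = (f : 𝓢'(E3, F)) + g :=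
      map_add (Lp.toTemperedDistributionCLM F (volume : Measure E3) 2) f g
    change MemSobolev 2 2 ((f + g : Lp F 2 (volume : Measure E3)) : 𝓢'(E3, F))
    rw [e]
    exact h
  smul_mem' := by
    intro c f hf
    have h := MemSobolev.smul c hf
    have e : ((c • f : Lp F 2 (volume : Measure E3)) : 𝓢'(E3, F)) = c • (f : 𝓢'(E3, F)) :=
      map_smul (Lp.toTemperedDistributionCLM F (volume : Measure E3) 2) c f
    change MemSobolev 2 2 ((c • f : Lp F 2 (volume : Measure E3)) : 𝓢'(E3, F))
    rw [e]
    exact h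

variable {F}

lemma exists_laplacian (f : H2 F) :
    ∃ g : Lp F 2 (volume : Measure E3), Δ ((f : Lp F 2 (volume : Measure E3)) : 𝓢'(E3, F)) = g := by
  have h : MemSobolev 2 2 ((f : Lp F 2 (volume : Measure E3)) : 𝓢'(E3, F)) := f.2
  have h' := h.laplacian
  rw [sub_self] at h'
  exact memSobolev_zero_iff.1 h'

lemma toTemperedDistribution_inj {f g : Lp F 2 (volume : Measure E3)}
    (h : (f : 𝓢'(E3, F)) = g) : f = g :=
  LinearMap.ker_eq_bot.1 (Lp.ker_toTemperedDistributionCLM_eq_bot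
    (F := F) (μ := (volume : Measure E3)) (p := 2)) h

/-- The distributional Laplacian as a linear map `H²(ℝ³; F) → L²(ℝ³; F)`. -/
def laplaceH2 : H2 F →ₗ[ℂ] Lp F 2 (volume : Measure E3) where
  toFun f := (exists_laplacian f).choose
  map_add' f g := by
    apply toTemperedDistribution_inj
    rw [← (exists_laplacian (f + g)).choose_spec]
    have e : ∀ a b : Lp F 2 (volume : Measure E3),
        ((a + b : Lp F 2 (volume : Measure E3)) : 𝓢'(E3, F)) = (a : 𝓢'(E3, F)) + b :=
      map_add (Lp.toTemperedDistributionCLM F (volume : Measure E3) 2)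
    rw [Submodule.coe_add, e, e, ← (exists_laplacian f).choose_spec,
      ← (exists_laplacian g).choose_spec, ← laplacianCLM_apply, ← laplacianCLM_apply,
      ← laplacianCLM_apply, map_add]
  map_smul' c f := by
    apply toTemperedDistribution_inj
    rw [← (exists_laplacian (c • f)).choose_spec]
    have e : ∀ a : Lp F 2 (volume : Measure E3),
        ((c • a : Lp F 2 (volume : Measure E3)) : 𝓢'(E3, F)) = c • (a : 𝓢'(E3, F)) :=
      map_smul (Lp.toTemperedDistributionCLM F (volume : Measure E3) 2) c
    rw [Submodule.coe_smul, e, RingHom.id_apply, e, ← (exists_laplacian f).choose_spec,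
      ← laplacianCLM_apply, ← laplacianCLM_apply, map_smul]

lemma laplaceH2_spec (f : H2 F) :
    ((laplaceH2 f : Lp F 2 (volume : Measure E3)) : 𝓢'(E3, F)) =
      Δ ((f : Lp F 2 (volume : Measure E3)) : 𝓢'(E3, F)) :=
  (exists_laplacian f).choose_spec.symm

end Sobolev

/-- The Pauli matrix `σ₃`. -/
def sigma3 : Mat2 := !![1, 0; 0, -1]

/-- The matrix potential `V = [[-V₁, -V₂], [V₂, V₁]]`. -/
def potV (V1 V2 : E3 → ℝ) (x : E3) : Mat2 :=
  !![-(V1 x : ℂ), -(V2 x : ℂ); (V2 x : ℂ), (V1 x : ℂ)]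

/-- The natural domain `{f ∈ H² × H² : V f ∈ L²}` of the matrix Schrödinger operator; it is
`H² × H²` for bounded `V`. -/
def domH (V1 V2 : E3 → ℝ) : Submodule ℂ L2 where
  carrier := {f | f ∈ H2 C2 ∧ MemLp (fun x => act (potV V1 V2 x) (f x)) 2 volume}
  zero_mem' := by
    refine ⟨zero_mem _, (MemLp.zero (ε := C2) (p := 2) (μ := volume)).ae_eq ?_⟩
    filter_upwards [Lp.coeFn_zero C2 2 (volume : Measure E3)] with x hx
    simp only [hx, Pi.zero_apply, act, map_zero]
  add_mem' := by
    rintro f g ⟨hf, hf'⟩ ⟨hg, hg'⟩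
    refine ⟨add_mem hf hg, (hf'.add hg').ae_eq ?_⟩
    filter_upwards [Lp.coeFn_add f g] with x hx
    simp only [hx, Pi.add_apply, act_add]
  smul_mem' := by
    rintro c f ⟨hf, hf'⟩
    refine ⟨Submodule.smul_mem _ c hf, (hf'.const_smul c).ae_eq ?_⟩
    filter_upwards [Lp.coeFn_smul c f] with x hx
    simp only [hx, Pi.smul_apply, act_smul]

lemma domH_le (V1 V2 : E3 → ℝ) : domH V1 V2 ≤ H2 C2 := fun _ hf => hf.1

/-- Multiplication by `V`. -/
def mulV (V1 V2 : E3 → ℝ) : domH V1 V2 →ₗ[ℂ] L2 where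
  toFun f := MemLp.toLp (fun x => act (potV V1 V2 x) ((f : L2) x)) f.2.2
  map_add' f g := by
    rw [← MemLp.toLp_add, MemLp.toLp_eq_toLp_iff]
    filter_upwards [Lp.coeFn_add (f : L2) (g : L2)] with x hx
    rw [Submodule.coe_add, hx]
    simp only [Pi.add_apply, act_add]
  map_smul' c f := by
    rw [RingHom.id_apply, ← MemLp.toLp_const_smul, MemLp.toLp_eq_toLp_iff]
    filter_upwards [Lp.coeFn_smul c (f : L2)] with x hx
    rw [Submodule.coe_smul, hx]
    simp only [Pi.smul_apply, act_smul]

/-- The action of `σ₃` on `L² × L²`. -/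
def sigma3L : L2 →L[ℂ] L2 :=
  (Matrix.toEuclideanCLM (n := Fin 2) (𝕜 := ℂ) sigma3).compLpL 2 volume

/-- The matrix Schrödinger operator
`H = [[-Δ + μ, 0], [0, Δ - μ]] + V = σ₃ (-Δ + μ) + V` on `L² × L²`. -/
def opH (μ : ℝ) (V1 V2 : E3 → ℝ) : L2 →ₗ.[ℂ] L2 where
  domain := domH V1 V2
  toFun := sigma3L.toLinearMap ∘ₗ
      (-(laplaceH2 ∘ₗ Submodule.inclusion (domH_le V1 V2)) + (μ : ℂ) • (domH V1 V2).subtype) +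
    mulV V1 V2

/-- `L₋ = -Δ + μ - V₁ + V₂` is nonnegative: `⟨L₋ f, f⟩ ≥ 0` for all `f ∈ H²(ℝ³)`. -/
def LminusNonneg (μ : ℝ) (V1 V2 : E3 → ℝ) : Prop :=
  ∀ f : H2 ℂ, 0 ≤ (∫ x, (-(laplaceH2 f x) + ((μ - V1 x + V2 x : ℝ) : ℂ) * f.1 x) *
    star (f.1 x)).re

/-- `ker (T - c)` for an unbounded operator `T`. -/
def kerSub (T : L2 →ₗ.[ℂ] L2) (c : ℂ) : Submodule ℂ L2 :=
  (LinearMap.ker (T.toFun - c • T.domain.subtype)).map T.domain.subtype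

/-- The bounded operator `R` is the resolvent `(T - c)⁻¹`. -/
def IsResolventAt (T : L2 →ₗ.[ℂ] L2) (c : ℂ) (R : L2 →L[ℂ] L2) : Prop :=
  (∀ f : L2, ∃ h : R f ∈ T.domain, T ⟨R f, h⟩ - c • R f = f) ∧
    ∀ f : T.domain, R (T f - c • (f : L2)) = f

/-! ### Integral operators -/

/-- `u(x) = ∫ K(x, y) f(y) dy` for almost every `x`, with an absolutely convergent integral. -/
def IsKernelIntegral (K : E3 → E3 → Mat2) (f u : E3 → C2) : Prop :=
  ∀ᵐ x, Integrable (fun y => act (K x y) (f y)) ∧ u x = ∫ y, act (K x y) (f y)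

/-- The bounded operator `T` on `L² × L²` has the integral kernel `K`. -/
def IsKernelOp (K : E3 → E3 → Mat2) (T : L2 →L[ℂ] L2) : Prop :=
  ∀ f : L2, IsKernelIntegral K f (T f)

open Classical in
/-- The bounded operator on `L² × L²` with integral kernel `K` (and `0` if there is none). -/
def kernelOp (K : E3 → E3 → Mat2) : L2 →L[ℂ] L2 :=
  if h : ∃ T, IsKernelOp K T then h.choose else 0

/-! ### The objects of the expansion at the threshold `μ` -/

/-- The positive square root `v` of `-σ₃ V = [[V₁, V₂], [V₂, V₁]]`, see `v_posSemidef`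
and `v_mul_v`. -/
def v (V1 V2 : E3 → ℝ) (x : E3) : Mat2 :=
  let a : ℝ := (√(V1 x + V2 x) + √(V1 x - V2 x)) / 2
  let b : ℝ := (√(V1 x + V2 x) - √(V1 x - V2 x)) / 2
  !![(a : ℂ), (b : ℂ); (b : ℂ), (a : ℂ)]

lemma v_mul_v {V1 V2 : E3 → ℝ} {x : E3} (h : |V2 x| ≤ V1 x) :
    v V1 V2 x * v V1 V2 x = -(sigma3 * potV V1 V2 x) := by
  have h1 := Real.sq_sqrt (show 0 ≤ V1 x + V2 x by linarith [(abs_le.1 h).1])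
  have h2 := Real.sq_sqrt (show 0 ≤ V1 x - V2 x by linarith [(abs_le.1 h).2])
  have e1 : ((√(V1 x + V2 x) + √(V1 x - V2 x)) / 2) * ((√(V1 x + V2 x) + √(V1 x - V2 x)) / 2) +
      ((√(V1 x + V2 x) - √(V1 x - V2 x)) / 2) * ((√(V1 x + V2 x) - √(V1 x - V2 x)) / 2)
      = V1 x := by linear_combination (h1 + h2) / 2
  have e2 : ((√(V1 x + V2 x) + √(V1 x - V2 x)) / 2) * ((√(V1 x + V2 x) - √(V1 x - V2 x)) / 2) +
      ((√(V1 x + V2 x) - √(V1 x - V2 x)) / 2) * ((√(V1 x + V2 x) + √(V1 x - V2 x)) / 2)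
      = V2 x := by linear_combination (h1 - h2) / 2
  have e1' := congrArg (fun t : ℝ => (t : ℂ)) e1
  have e2' := congrArg (fun t : ℝ => (t : ℂ)) e2
  push_cast at e1' e2'
  ext i j
  fin_cases i <;> fin_cases j <;>
    simp [v, sigma3, potV, Matrix.mul_apply, Fin.sum_univ_two] <;>
    first
      | linear_combination e1'
      | linear_combination e2'

lemma v_posSemidef (V1 V2 : E3 → ℝ) (x : E3) : (v V1 V2 x).PosSemidef := by
  have h1 : (Matrix.vecMulVec (![1, 1] : Fin 2 → ℂ) (star ![1, 1])).PosSemidef :=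
    Matrix.posSemidef_vecMulVec_self_star _
  have h2 : (Matrix.vecMulVec (![1, -1] : Fin 2 → ℂ) (star ![1, -1])).PosSemidef :=
    Matrix.posSemidef_vecMulVec_self_star _
  have p1 : (0 : ℂ) ≤ ((√(V1 x + V2 x) / 2 : ℝ) : ℂ) := by
    exact_mod_cast (by positivity : (0 : ℝ) ≤ √(V1 x + V2 x) / 2)
  have p2 : (0 : ℂ) ≤ ((√(V1 x - V2 x) / 2 : ℝ) : ℂ) := by
    exact_mod_cast (by positivity : (0 : ℝ) ≤ √(V1 x - V2 x) / 2)
  have h := (h1.smul p1).add (h2.smul p2)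
  convert h using 1
  ext i j
  rw [Matrix.add_apply, Matrix.smul_apply, Matrix.smul_apply, Matrix.vecMulVec_apply,
    Matrix.vecMulVec_apply]
  fin_cases i <;> fin_cases j <;> simp [v] <;> ring

/-- `v₁ = -σ₃ v`, so that `V = v₁ v₂` with `v₂ = v`. -/
def v1 (V1 V2 : E3 → ℝ) (x : E3) : Mat2 := -(sigma3 * v V1 V2 x)

/-- The kernel of the free resolvent `R₀(μ)`. -/
def kerR0 (μ : ℝ) (x y : E3) : Mat2 :=
  !![((1 / (4 * Real.pi * ‖x - y‖) : ℝ) : ℂ), 0;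
    0, ((-Real.exp (-√(2 * μ) * ‖x - y‖) / (4 * Real.pi * ‖x - y‖) : ℝ) : ℂ)]

/-- The kernel of `v₂ R₀(μ) v₁`. -/
def kerVRV (μ : ℝ) (V1 V2 : E3 → ℝ) (x y : E3) : Mat2 :=
  v V1 V2 x * kerR0 μ x y * v1 V1 V2 y

/-- The kernel of `A₁(0) = (i / 4π) v₂ P₁ v₁`, where `P₁ f = ∫ diag(1, 0) f(x) dx`. -/
def kerA1 (V1 V2 : E3 → ℝ) (x y : E3) : Mat2 :=
  (Complex.I / (4 * Real.pi)) • (v V1 V2 x * !![1, 0; 0, 0] * v1 V1 V2 y)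

/-- The kernel `(1 / 8π) v(x) diag(|x - y|, exp(-√(2μ) |x - y|) / √(2μ)) v(y)`. -/
def kerB (μ : ℝ) (V1 V2 : E3 → ℝ) (x y : E3) : Mat2 :=
  (1 / (8 * Real.pi) : ℂ) • (v V1 V2 x *
    !![((‖x - y‖ : ℝ) : ℂ), 0; 0, ((Real.exp (-√(2 * μ) * ‖x - y‖) / √(2 * μ) : ℝ) : ℂ)] *
    v V1 V2 y)

/-- `A₀ = I + v₂ R₀(μ) v₁`. -/
def A0 (μ : ℝ) (V1 V2 : E3 → ℝ) : L2 →L[ℂ] L2 := 1 + kernelOp (kerVRV μ V1 V2)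

/-- `S₁ L² = ker A₀`. -/
def S1space (μ : ℝ) (V1 V2 : E3 → ℝ) : Submodule ℂ L2 := LinearMap.ker (A0 μ V1 V2).toLinearMap

instance (μ : ℝ) (V1 V2 : E3 → ℝ) : CompleteSpace (S1space μ V1 V2) :=
  (A0 μ V1 V2).isClosed_ker.completeSpace_coe

/-- `S₁`, the orthogonal projection onto `ker A₀`. -/
def S1 (μ : ℝ) (V1 V2 : E3 → ℝ) : L2 →L[ℂ] L2 := (S1space μ V1 V2).starProjection

/-- `m(0) = S₁ A₁(0) S₁`. -/
def m0 (μ : ℝ) (V1 V2 : E3 → ℝ) : L2 →L[ℂ] L2 :=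
  S1 μ V1 V2 * kernelOp (kerA1 V1 V2) * S1 μ V1 V2

/-- `S₂ L²`, the kernel of `m(0)` in `S₁ L²`. -/
def S2space (μ : ℝ) (V1 V2 : E3 → ℝ) : Submodule ℂ L2 :=
  S1space μ V1 V2 ⊓ LinearMap.ker (m0 μ V1 V2).toLinearMap

instance (μ : ℝ) (V1 V2 : E3 → ℝ) : CompleteSpace (S2space μ V1 V2) :=
  ((A0 μ V1 V2).isClosed_ker.inter (m0 μ V1 V2).isClosed_ker).completeSpace_coe

/-- `b(0) = (1 / 8π) S₂ v [diag(|x - y|, exp(-√(2μ) |x - y|) / √(2μ))] v S₂`, as an operator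
in `S₂ L²`. -/
def b0 (μ : ℝ) (V1 V2 : E3 → ℝ) : S2space μ V1 V2 →L[ℂ] S2space μ V1 V2 :=
  (S2space μ V1 V2).orthogonalProjectionOnto ∘L kernelOp (kerB μ V1 V2) ∘L (S2space μ V1 V2).subtypeL

/-- `S₂ b(0)⁻¹ S₂` as an operator on `L² × L²`. -/
def S2b0invS2 (μ : ℝ) (V1 V2 : E3 → ℝ) : L2 →L[ℂ] L2 :=
  (S2space μ V1 V2).subtypeL ∘L (b0 μ V1 V2).inverse ∘L (S2space μ V1 V2).orthogonalProjectionOnto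

/-- The bounded operator `P` on `L² × L²` is `-R₀(μ) σ₃ v S₂ b(0)⁻¹ S₂ v R₀(μ)`.
The integral operator `R₀(μ)` is not defined on all of `L² × L²`; the formula is required on each
weighted space `⟨x⟩^{-s} (L² × L²)` with `s > 1`, where every step makes sense: `u = R₀(μ) f`,
`g = v u ∈ L² × L²`, and `P f = -R₀(μ) (σ₃ v S₂ b(0)⁻¹ S₂ g)`. These spaces are dense. -/
def IsPmu (μ : ℝ) (V1 V2 : E3 → ℝ) (P : L2 →L[ℂ] L2) : Prop :=
  ∀ s : ℝ, 1 < s → ∀ f : L2, MemLp (fun x => bracket x ^ s • f x) 2 volume →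
    ∃ (u : E3 → C2) (g : L2), IsKernelIntegral (kerR0 μ) f u ∧
      (∀ᵐ x, g x = act (v V1 V2 x) (u x)) ∧
      IsKernelIntegral (kerR0 μ)
        (fun y => act (sigma3 * v V1 V2 y) (S2b0invS2 μ V1 V2 g y)) (fun x => -(P f x))

/-- `(H - (μ + z²))⁻¹ = -z⁻² P + O(z⁻¹)` as `z → 0` in the upper half plane, in the norm of
bounded operators from `⟨x⟩^{-s} (L² × L²)` to `⟨x⟩^{s} (L² × L²)`, for every `s > 3/2`. -/
def LeadingResolventTerm (μ : ℝ) (V1 V2 : E3 → ℝ) (P : L2 →L[ℂ] L2) : Prop :=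
  ∀ s : ℝ, 3 / 2 < s → ∃ C δ : ℝ, 0 < C ∧ 0 < δ ∧ ∀ z : ℂ, 0 < z.im → ‖z‖ < δ →
    ∃ R : L2 →L[ℂ] L2, IsResolventAt (opH μ V1 V2) ((μ : ℂ) + z ^ 2) R ∧
      ∀ f : L2,
        eLpNorm (fun x => bracket x ^ (-s) • (R f + (z ^ 2)⁻¹ • P f : L2) x) 2 volume ≤
          ENNReal.ofReal (C / ‖z‖) * eLpNorm (fun x => bracket x ^ s • f x) 2 volume

end ThresholdProjection

end

noncomputable section

namespace ThresholdProjection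

/-! ### Matrices acting on `ℂ²` -/

/-! Since `V = -σ₃ v²`, one has `H - (μ + z²) = σ₃ (G(z)⁻¹ - v²)`, where `G(z) = diag((-Δ - z²)⁻¹,
(-Δ + 2μ + z²)⁻¹)`. So `(H - (μ + z²))⁻¹ = (G + G v A(z)⁻¹ v G) σ₃` with `A(z) = 1 - v G(z) v`
(`Pot.isResolventAt_Rop`), and everything reduces to inverting `A(z)` near `z = 0`. The factor `σ₃`
cancels in `v R₀(μ) v₁`, so `A₀ = 1 - T₀` with `T₀` Hilbert–Schmidt and self-adjoint.

Expanding `e^{izr} / 4πr` gives `A(z) = A₀ - (iz/4π) ⟨e, ·⟩ e + O(z²)` with `e = v (1, 0)ᵗ`. Hence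
`S₂ = ker A₀ ∩ e^⊥`, and on `S₂` the form of `A(z)` is `z² B + O(z³)`, where `b(0)` is the
compression of `B`. The cubic error needs more decay than `v` supplies; on `S₂` it is found in the
identity `φ = v Θ φ`, which puts `v²` on both sides of the kernel (`Pot.norm_inner_Az_sub_le`).

Here `Θ φ = G(0) v φ` (`Th`). Orthogonality to `e` removes the `1/|x|` tail of this potential, so
`Θ` maps `S₂` into `ker (H - μ)`, with inverse `ψ ↦ v ψ` (`Pot.isSol_Th`, `Pot.mem_S2_of_isSol`).
Comparing the expansion of `⟨φ', A(z) φ⟩` with its exact value from the resolvent identity yields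
`⟨φ', B φ⟩ = -⟨Θ φ', σ₃ Θ φ⟩` (`Pot.inner_Bop`). Thus `b(0)` is, up to sign, the indefinite form
`⟨·, σ₃ ·⟩` on `ker (H - μ)`.

This form has no null vectors. For a solution `ψ` put `u = ψ₁ + ψ₂`, `w = ψ₁ - ψ₂`; then `L₋ w = μ
u` and `Re ⟨w, u⟩ = ⟨ψ, σ₃ ψ⟩`. If the latter vanishes, `L₋ ≥ 0` tested on `w + t u` with small
negative `t` forces `u = 0`, and the equation for `u` then gives `ψ₂ = 0` (`Pot.eq_zero_of_isSol`).
As `S₂` is finite dimensional, `b(0)` is invertible.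

With `Γ = S₂ b(0)⁻¹ S₂` the projection is `P = -Θ Γ Θ* σ₃` (`Pop`). The form identity says `Γ Θ* σ₃
Θ = -1` on `S₂`, so `P` is the identity on `Ran Θ = ker (H - μ)`; its kernel is `(σ₃ Ran Θ)^⊥`, and
`σ₃` carries `ker (H - μ)` onto `ker (H* - μ)`.

For the resolvent, `φ` is split along `S₁^⊥`, `S₁ ⊖ S₂` (at most a line) and `S₂`, where `A(z)` has
size `1`, `z` and `z²` respectively. This gives the a priori bound `‖φ - z⁻² Γ A(z) φ‖ ≤ (K/|z|)
‖A(z) φ‖` (`exists_norm_sub_le_of_nearThreshold`). The Fredholm alternative turns it into `A(z)⁻¹ =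
z⁻² Γ + O(1/z)`, and sandwiching with the weighted `G(z) = G(0) + O(z)` leaves `-z⁻² P + O(1/z)`. -/

lemma act_apply (M : Mat2) (w : C2) (i : Fin 2) : act M w i = M i 0 * w 0 + M i 1 * w 1 := by
  simp [act, Matrix.mulVec, dotProduct, Fin.sum_univ_two]

lemma act_mul (M N : Mat2) (w : C2) : act (M * N) w = act M (act N w) := by
  simp [act]

lemma act_add_left (M N : Mat2) (w : C2) : act (M + N) w = act M w + act N w := by
  simp [act]

lemma act_sub_left (M N : Mat2) (w : C2) : act (M - N) w = act M w - act N w := by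
  simp [act]

lemma act_neg_left (M : Mat2) (w : C2) : act (-M) w = -act M w := by
  simp [act]

lemma act_smul_left (c : ℂ) (M : Mat2) (w : C2) : act (c • M) w = c • act M w := by
  simp [act]

lemma act_one (w : C2) : act 1 w = w := by
  simp [act]

lemma inner_act (M : Mat2) (w w' : C2) :
    inner ℂ (act M w) w' = inner ℂ w (act M.conjTranspose w') := by
  simp only [PiLp.inner_apply, Fin.sum_univ_two, act_apply, RCLike.inner_apply,
    Matrix.conjTranspose_apply, map_add, map_mul, RCLike.star_def]
  ring

/-- A matrix valued function with measurable entries. -/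
def MeasMat {α : Type*} [MeasurableSpace α] (K : α → Mat2) : Prop :=
  ∀ i j, Measurable fun a => K a i j

section MeasMat

variable {α : Type*} [MeasurableSpace α] {K K' : α → Mat2}

lemma MeasMat.mul (h : MeasMat K) (h' : MeasMat K') : MeasMat fun a => K a * K' a := by
  intro i j
  simp only [Matrix.mul_apply, Fin.sum_univ_two]
  exact ((h i 0).mul (h' 0 j)).add ((h i 1).mul (h' 1 j))

lemma MeasMat.add (h : MeasMat K) (h' : MeasMat K') : MeasMat fun a => K a + K' a :=
  fun i j => (h i j).add (h' i j)

lemma MeasMat.sub (h : MeasMat K) (h' : MeasMat K') : MeasMat fun a => K a - K' a :=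
  fun i j => (h i j).sub (h' i j)

lemma MeasMat.smul {c : α → ℂ} (hc : Measurable c) (h : MeasMat K) :
    MeasMat fun a => c a • K a :=
  fun i j => hc.mul (h i j)

lemma MeasMat.const (M : Mat2) : MeasMat fun _ : α => M := fun _ _ => measurable_const

lemma MeasMat.comp {γ : Type*} [MeasurableSpace γ] (h : MeasMat K) {g : γ → α}
    (hg : Measurable g) : MeasMat fun a => K (g a) :=
  fun i j => (h i j).comp hg

lemma MeasMat.conjTranspose (h : MeasMat K) : MeasMat fun a => (K a).conjTranspose :=
  fun i j => by
    simp only [Matrix.conjTranspose_apply]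
    exact (continuous_star.measurable).comp (h j i)

/-- Decomposition into matrix units: it reduces measurability questions about `act` to those of the
scalar entries. -/
lemma act_eq_sum (M : Mat2) (w : C2) :
    act M w = ∑ i, ∑ j, M i j • act (Matrix.single i j 1) w := by
  conv_lhs => rw [Matrix.matrix_eq_sum_single M]
  simp only [act, map_sum, _root_.sum_apply]
  refine Finset.sum_congr rfl fun i _ => Finset.sum_congr rfl fun j _ => ?_
  have : Matrix.single i j (M i j) = M i j • Matrix.single i j (1 : ℂ) := by
    rw [Matrix.smul_single, smul_eq_mul, mul_one]
  rw [this, map_smul, _root_.smul_apply]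

lemma MeasMat.act {ν : Measure α} (h : MeasMat K) {f : α → C2} (hf : AEStronglyMeasurable f ν) :
    AEStronglyMeasurable (fun a => act (K a) (f a)) ν := by
  simp_rw [act_eq_sum (K _)]
  refine Finset.aestronglyMeasurable_fun_sum _ fun i _ =>
    Finset.aestronglyMeasurable_fun_sum _ fun j _ => ?_
  exact (h i j).aestronglyMeasurable.smul
    ((Matrix.toEuclideanCLM (n := Fin 2) (𝕜 := ℂ)
      (Matrix.single i j 1)).continuous.comp_aestronglyMeasurable hf)

end MeasMat

/-! ### Square integrable majorants and Hilbert–Schmidt operators -/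

/-- A nonnegative measurable function of two variables which is square integrable. -/
structure HS (k : E3 → E3 → ℝ) : Prop where
  nonneg : ∀ x y, 0 ≤ k x y
  meas : Measurable (Function.uncurry k)
  sq : Integrable (fun p : E3 × E3 => k p.1 p.2 ^ 2) (volume.prod volume)

/-- The Hilbert–Schmidt norm. -/
def hsNorm (k : E3 → E3 → ℝ) : ℝ := √(∫ x, ∫ y, k x y ^ 2)

lemma hsNorm_nonneg (k : E3 → E3 → ℝ) : 0 ≤ hsNorm k := Real.sqrt_nonneg _

lemma HS.swap {k : E3 → E3 → ℝ} (h : HS k) : HS fun x y => k y x :=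
  ⟨fun x y => h.nonneg y x, h.meas.comp measurable_swap, h.sq.swap⟩

/-- The kernel `K` is measurable and dominated by `k`. -/
structure DomBy (K : E3 → E3 → Mat2) (k : E3 → E3 → ℝ) : Prop where
  meas : MeasMat fun p : E3 × E3 => K p.1 p.2
  bound : ∀ᵐ x, ∀ᵐ y, ∀ w, ‖act (K x y) w‖ ≤ k x y * ‖w‖

/-! ### Kernels with a square integrable majorant define bounded operators -/

section HSlemmas

variable {k : E3 → E3 → ℝ}

lemma HS.ae_memLp (h : HS k) : ∀ᵐ x, MemLp (k x) 2 volume := by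
  filter_upwards [h.sq.prod_right_ae] with x hx
  exact (memLp_two_iff_integrable_sq
    (h.meas.comp (measurable_const.prodMk measurable_id)).aestronglyMeasurable).2 hx

lemma memLp_two_integrable_norm_sq {F : Type*} [NormedAddCommGroup F] {α : Type*}
    [MeasurableSpace α] {ν : Measure α} {f : α → F} (hf : MemLp f 2 ν) :
    Integrable (fun x => ‖f x‖ ^ 2) ν :=
  (memLp_two_iff_integrable_sq_norm hf.1).1 hf

lemma norm_sq_eq_integral {F : Type*} [NormedAddCommGroup F] {α : Type*}
    [MeasurableSpace α] {ν : Measure α} (f : Lp F 2 ν) : ‖f‖ ^ 2 = ∫ x, ‖f x‖ ^ 2 ∂ν := by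
  rw [Lp.norm_def, eLpNorm_eq_lintegral_rpow_enorm_toReal (by norm_num) (by norm_num),
    integral_eq_lintegral_of_nonneg_ae (.of_forall fun x => by positivity)
      (by fun_prop)]
  simp only [ENNReal.toReal_ofNat, one_div]
  rw [← ENNReal.toReal_rpow, ← Real.rpow_natCast, ← Real.rpow_mul ENNReal.toReal_nonneg]
  norm_num

lemma integral_mul_norm_le {F : Type*} [NormedAddCommGroup F] {α : Type*}
    [MeasurableSpace α] {ν : Measure α} {g : α → ℝ} (hg0 : ∀ x, 0 ≤ g x)
    (hg : MemLp g 2 ν) (f : Lp F 2 ν) :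
    Integrable (fun y => g y * ‖f y‖) ν ∧ ∫ y, g y * ‖f y‖ ∂ν ≤ √(∫ y, g y ^ 2 ∂ν) * ‖f‖ := by
  have hf := (Lp.memLp f).norm
  refine ⟨MemLp.integrable_mul (p := 2) (q := 2) hg hf, ?_⟩
  have h := integral_mul_le_Lp_mul_Lq_of_nonneg (μ := ν) Real.HolderConjugate.two_two
    (.of_forall hg0) (.of_forall fun y => norm_nonneg (f y)) (by simpa using hg) (by simpa using hf)
  refine h.trans (le_of_eq ?_)
  simp only [Real.rpow_two, ← Real.sqrt_eq_rpow]
  rw [← norm_sq_eq_integral, Real.sqrt_sq (norm_nonneg _)]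

lemma DomBy.integrable {K : E3 → E3 → Mat2} (hK : DomBy K k) (h : HS k) (f : L2) :
    ∀ᵐ x, Integrable (fun y => act (K x y) (f y)) ∧
      ‖∫ y, act (K x y) (f y)‖ ≤ √(∫ y, k x y ^ 2) * ‖f‖ := by
  filter_upwards [hK.bound, h.ae_memLp] with x hx hk
  obtain ⟨hi, hle⟩ := integral_mul_norm_le (h.nonneg x) hk f
  have hint : Integrable (fun y => act (K x y) (f y)) := by
    refine hi.mono' ?_ (hx.mono fun y hy => hy _)
    exact (hK.meas.comp (measurable_const.prodMk measurable_id)).act (Lp.aestronglyMeasurable f)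
  refine ⟨hint, (norm_integral_le_integral_norm _).trans (le_trans ?_ hle)⟩
  exact integral_mono_ae hint.norm hi (hx.mono fun y hy => hy _)

lemma HS.integrable_left (h : HS k) : Integrable fun x => ∫ y, k x y ^ 2 :=
  h.sq.integral_prod_left

lemma hsNorm_sq (k : E3 → E3 → ℝ) : hsNorm k ^ 2 = ∫ x, ∫ y, k x y ^ 2 :=
  Real.sq_sqrt (integral_nonneg fun _ => integral_nonneg fun _ => sq_nonneg _)

lemma aesm_kernel {K : E3 → E3 → Mat2} (hK : MeasMat fun p : E3 × E3 => K p.1 p.2)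
    {f : E3 → C2} (hf : AEStronglyMeasurable f volume) :
    AEStronglyMeasurable (fun x => ∫ y, act (K x y) (f y)) volume := by
  have : AEStronglyMeasurable (fun p : E3 × E3 => act (K p.1 p.2) (f p.2))
      (volume.prod volume) := hK.act hf.comp_snd
  exact this.integral_prod_right'

lemma DomBy.memLp {K : E3 → E3 → Mat2} (hK : DomBy K k) (h : HS k) (f : L2) :
    MemLp (fun x => ∫ y, act (K x y) (f y)) 2 volume := by
  have hm := aesm_kernel hK.meas (Lp.aestronglyMeasurable f)
  rw [memLp_two_iff_integrable_sq_norm hm]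
  refine (h.integrable_left.mul_const (‖f‖ ^ 2)).mono' (hm.norm.pow 2) ?_
  filter_upwards [hK.integrable h f] with x hx
  rw [Real.norm_of_nonneg (by positivity)]
  refine (pow_le_pow_left₀ (norm_nonneg _) hx.2 2).trans (le_of_eq ?_)
  rw [mul_pow, Real.sq_sqrt (integral_nonneg fun _ => sq_nonneg _)]

lemma IsKernelOp.unique {K : E3 → E3 → Mat2} {T T' : L2 →L[ℂ] L2} (h : IsKernelOp K T)
    (h' : IsKernelOp K T') : T = T' := by
  ext1 f
  refine Lp.ext ?_
  filter_upwards [h f, h' f] with x hx hx'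
  rw [hx.2, hx'.2]

/-- Cauchy–Schwarz in `y` for almost every fixed `x`, followed by integration in `x`: the operator
norm is at most the Hilbert–Schmidt norm of any majorant. -/
lemma IsKernelOp.norm_le {K : E3 → E3 → Mat2} {T : L2 →L[ℂ] L2} (hT : IsKernelOp K T)
    (hK : DomBy K k) (h : HS k) (f : L2) : ‖T f‖ ≤ hsNorm k * ‖f‖ := by
  refine le_of_sq_le_sq ?_ (by positivity [hsNorm_nonneg k])
  rw [norm_sq_eq_integral, mul_pow, hsNorm_sq, ← integral_mul_const]
  refine integral_mono_ae (memLp_two_integrable_norm_sq (Lp.memLp _))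
    (h.integrable_left.mul_const _) ?_
  filter_upwards [hK.integrable h f, hT f] with x hx hx'
  rw [hx'.2]
  refine (pow_le_pow_left₀ (norm_nonneg _) hx.2 2).trans (le_of_eq ?_)
  rw [mul_pow, Real.sq_sqrt (integral_nonneg fun _ => sq_nonneg _)]

lemma DomBy.exists_op {K : E3 → E3 → Mat2} (hK : DomBy K k) (h : HS k) :
    ∃ T : L2 →L[ℂ] L2, IsKernelOp K T := by
  let T₀ : L2 →ₗ[ℂ] L2 :=
    { toFun := fun f => (hK.memLp h f).toLp _
      map_add' := fun f g => by
        rw [← MemLp.toLp_add, MemLp.toLp_eq_toLp_iff]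
        filter_upwards [hK.integrable h f, hK.integrable h g] with x hx hx'
        rw [Pi.add_apply, ← integral_add hx.1 hx'.1]
        refine integral_congr_ae ?_
        filter_upwards [Lp.coeFn_add f g] with y hy
        rw [hy, Pi.add_apply, act_add]
      map_smul' := fun c f => by
        rw [RingHom.id_apply, ← MemLp.toLp_const_smul, MemLp.toLp_eq_toLp_iff]
        refine .of_forall fun x => ?_
        rw [Pi.smul_apply, ← integral_smul]
        refine integral_congr_ae ?_
        filter_upwards [Lp.coeFn_smul c f] with y hy
        rw [hy, Pi.smul_apply, act_smul] }
  have key : ∀ f : L2, IsKernelIntegral K f (T₀ f) := fun f => by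
    filter_upwards [hK.integrable h f, (hK.memLp h f).coeFn_toLp] with x hx hx'
    exact ⟨hx.1, hx'⟩
  refine ⟨T₀.mkContinuous (hsNorm k) fun f => ?_, key⟩
  refine le_of_sq_le_sq ?_ (by positivity [hsNorm_nonneg k])
  rw [norm_sq_eq_integral, mul_pow, hsNorm_sq, ← integral_mul_const]
  refine integral_mono_ae (memLp_two_integrable_norm_sq (Lp.memLp _))
    (h.integrable_left.mul_const _) ?_
  filter_upwards [hK.integrable h f, key f] with x hx hx'
  rw [hx'.2]
  refine (pow_le_pow_left₀ (norm_nonneg _) hx.2 2).trans (le_of_eq ?_)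
  rw [mul_pow, Real.sq_sqrt (integral_nonneg fun _ => sq_nonneg _)]

lemma IsKernelOp.kernelOp_eq {K : E3 → E3 → Mat2} {T : L2 →L[ℂ] L2} (h : IsKernelOp K T) :
    kernelOp K = T := by
  have hex : ∃ T, IsKernelOp K T := ⟨T, h⟩
  rw [kernelOp, dif_pos hex]
  exact hex.choose_spec.unique h

end HSlemmas

/-! ### Algebra, adjoints and compactness of kernel operators -/

section KernelOps

variable {K K' : E3 → E3 → Mat2} {T T' : L2 →L[ℂ] L2} {k : E3 → E3 → ℝ}

lemma IsKernelIntegral.add {f u u' : E3 → C2} (h : IsKernelIntegral K f u)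
    (h' : IsKernelIntegral K' f u') :
    IsKernelIntegral (fun x y => K x y + K' x y) f (fun x => u x + u' x) := by
  filter_upwards [h, h'] with x hx hx'
  simp only [act_add_left]
  exact ⟨hx.1.add hx'.1, by rw [hx.2, hx'.2, integral_add hx.1 hx'.1]⟩

lemma IsKernelIntegral.smul {f u : E3 → C2} (c : ℂ) (h : IsKernelIntegral K f u) :
    IsKernelIntegral (fun x y => c • K x y) f (fun x => c • u x) := by
  filter_upwards [h] with x hx
  simp only [act_smul_left]
  exact ⟨hx.1.smul c, by rw [hx.2, integral_smul]⟩

lemma IsKernelIntegral.congr {f f' u u' : E3 → C2} (h : IsKernelIntegral K f u)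
    (hf : f =ᵐ[volume] f') (hu : u =ᵐ[volume] u') : IsKernelIntegral K f' u' := by
  filter_upwards [h, hu] with x hx hux
  have e : (fun y => act (K x y) (f y)) =ᵐ[volume] fun y => act (K x y) (f' y) := by
    filter_upwards [hf] with y hy
    rw [hy]
  exact ⟨hx.1.congr e, by rw [← hux, hx.2, integral_congr_ae e]⟩

lemma IsKernelOp.add (h : IsKernelOp K T) (h' : IsKernelOp K' T') :
    IsKernelOp (fun x y => K x y + K' x y) (T + T') := fun f =>
  ((h f).add (h' f)).congr .rfl (Lp.coeFn_add (T f) (T' f)).symm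

lemma IsKernelOp.smul (c : ℂ) (h : IsKernelOp K T) :
    IsKernelOp (fun x y => c • K x y) (c • T) := fun f =>
  ((h f).smul c).congr .rfl (Lp.coeFn_smul c (T f)).symm

lemma IsKernelOp.neg (h : IsKernelOp K T) : IsKernelOp (fun x y => -K x y) (-T) := by
  simpa using h.smul (-1)

lemma IsKernelOp.sub (h : IsKernelOp K T) (h' : IsKernelOp K' T') :
    IsKernelOp (fun x y => K x y - K' x y) (T - T') := by
  simpa [sub_eq_add_neg] using h.add h'.neg

/-- The C*-argument `‖M* w‖² = ⟨M M* w, w⟩ ≤ c ‖M* w‖ ‖w‖`, divided by `‖M* w‖`. -/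
lemma norm_act_conjTranspose_le {M : Mat2} {c : ℝ} (hc : 0 ≤ c) (h : ∀ w, ‖act M w‖ ≤ c * ‖w‖)
    (w : C2) : ‖act M.conjTranspose w‖ ≤ c * ‖w‖ := by
  have e : ‖act M.conjTranspose w‖ ^ 2 ≤ (c * ‖w‖) * ‖act M.conjTranspose w‖ := by
    have h1 : (‖act M.conjTranspose w‖ : ℂ) ^ 2 = inner ℂ (act M (act M.conjTranspose w)) w := by
      rw [inner_act, inner_self_eq_norm_sq_to_K]
      rfl
    have h2 : ‖act M.conjTranspose w‖ ^ 2 = ‖inner ℂ (act M (act M.conjTranspose w)) w‖ := by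
      rw [← h1]; simp
    rw [h2]
    refine (norm_inner_le_norm _ _).trans ?_
    nlinarith [h (act M.conjTranspose w), norm_nonneg w]
  by_contra hlt
  push Not at hlt
  nlinarith [mul_nonneg hc (norm_nonneg w)]

lemma DomBy.conjTranspose (hK : DomBy K k) (h : HS k) :
    DomBy (fun x y => (K y x).conjTranspose) fun x y => k y x := by
  refine ⟨(hK.meas.comp measurable_swap).conjTranspose, ?_⟩
  -- Exchanging the order of the two almost-everywhere quantifiers requires this set to be
  -- measurable; by continuity in `w` the uncountable quantifier reduces to a countable dense set.
  have hk : MeasurableSet {p : E3 × E3 | ∀ w, ‖act (K p.1 p.2) w‖ ≤ k p.1 p.2 * ‖w‖} := by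
    obtain ⟨s, hs, hd⟩ := TopologicalSpace.exists_countable_dense C2
    have : {p : E3 × E3 | ∀ w, ‖act (K p.1 p.2) w‖ ≤ k p.1 p.2 * ‖w‖} =
        ⋂ w ∈ s, {p : E3 × E3 | ‖act (K p.1 p.2) w‖ ≤ k p.1 p.2 * ‖w‖} := by
      ext p
      simp only [Set.mem_ofPred_eq, Set.mem_iInter]
      refine ⟨fun hp w _ => hp w, fun hp w => ?_⟩
      have hcl : IsClosed {w | ‖act (K p.1 p.2) w‖ ≤ k p.1 p.2 * ‖w‖} :=
        isClosed_le (Matrix.toEuclideanCLM (n := Fin 2) (𝕜 := ℂ) (K p.1 p.2)).continuous.norm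
          (continuous_const.mul continuous_norm)
      exact hcl.closure_subset_iff.2 hp (hd w)
    rw [this]
    refine MeasurableSet.biInter hs fun w _ => measurableSet_le ?_ ?_
    · simp_rw [act_eq_sum (K _ _)]
      refine Measurable.norm ?_
      refine Finset.measurable_fun_sum _ fun i _ => Finset.measurable_fun_sum _ fun j _ => ?_
      exact (hK.meas i j).smul_const _
    · exact h.meas.mul_const _
  have h1 : ∀ᵐ p : E3 × E3 ∂(volume.prod volume), ∀ w, ‖act (K p.1 p.2) w‖ ≤ k p.1 p.2 * ‖w‖ :=
    (Measure.ae_prod_iff_ae_ae hk).2 hK.bound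
  have h2 := Measure.ae_ae_of_ae_prod
    ((Measure.measurePreserving_swap (μ := (volume : Measure E3))
      (ν := (volume : Measure E3))).quasiMeasurePreserving.ae h1)
  filter_upwards [h2] with x hx
  filter_upwards [hx] with y hy
  exact norm_act_conjTranspose_le (h.nonneg y x) hy

/-- Integrability of `⟨g(x), K(x, y) f(y)⟩` on the product space. -/
lemma DomBy.integrable_prod (hK : DomBy K k) (h : HS k) (f g : L2) :
    Integrable (fun p : E3 × E3 => inner ℂ (g p.1) (act (K p.1 p.2) (f p.2)))
      (volume.prod volume) := by
  have hm : AEStronglyMeasurable (fun p : E3 × E3 => inner ℂ (g p.1) (act (K p.1 p.2) (f p.2)))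
      (volume.prod volume) :=
    (Lp.aestronglyMeasurable g).comp_fst.inner (hK.meas.act (Lp.aestronglyMeasurable f).comp_snd)
  rw [integrable_prod_iff hm]
  constructor
  · filter_upwards [hK.integrable h f] with x hx
    exact hx.1.const_inner (g x)
  · have hsq : MemLp (fun x => √(∫ y, k x y ^ 2)) 2 volume := by
      rw [memLp_two_iff_integrable_sq
        h.integrable_left.aestronglyMeasurable.aemeasurable.sqrt.aestronglyMeasurable]
      refine h.integrable_left.congr (.of_forall fun x => ?_)
      exact (Real.sq_sqrt (integral_nonneg fun _ => sq_nonneg _)).symm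
    have hi : Integrable (fun x => √(∫ y, k x y ^ 2) * ‖g x‖) :=
      MemLp.integrable_mul (p := 2) (q := 2) hsq (Lp.memLp g).norm
    refine (hi.mul_const ‖f‖).mono' hm.norm.integral_prod_right' ?_
    filter_upwards [hK.bound, hK.integrable h f, h.ae_memLp] with x hx hxi hk
    rw [Real.norm_of_nonneg (integral_nonneg fun _ => norm_nonneg _)]
    obtain ⟨hi, hle⟩ := integral_mul_norm_le (h.nonneg x) hk f
    calc ∫ y, ‖inner ℂ (g x) (act (K x y) (f y))‖ ≤ ∫ y, ‖g x‖ * (k x y * ‖f y‖) := by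
          refine integral_mono_ae (hxi.1.const_inner (g x)).norm (hi.const_mul _) ?_
          filter_upwards [hx] with y hy
          exact (norm_inner_le_norm _ _).trans
            (mul_le_mul_of_nonneg_left (hy _) (norm_nonneg _))
      _ = ‖g x‖ * ∫ y, k x y * ‖f y‖ := integral_const_mul _ _
      _ ≤ ‖g x‖ * (√(∫ y, k x y ^ 2) * ‖f‖) := mul_le_mul_of_nonneg_left hle (norm_nonneg _)
      _ = _ := by ring

/-- Fubini for `⟨g(x), K(x, y) f(y)⟩`, legitimate by `DomBy.integrable_prod`. -/
lemma IsKernelOp.adjoint (hT : IsKernelOp K T) (hK : DomBy K k) (h : HS k) :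
    IsKernelOp (fun x y => (K y x).conjTranspose) (ContinuousLinearMap.adjoint T) := by
  obtain ⟨S, hS⟩ := (hK.conjTranspose h).exists_op h.swap
  convert hS
  symm
  rw [ContinuousLinearMap.eq_adjoint_iff]
  intro g f
  have e1 : inner ℂ (S g) f =
      ∫ y, ∫ x, inner ℂ (g x) (act (K x y) (f y)) := by
    rw [L2.inner_def]
    refine integral_congr_ae ?_
    filter_upwards [hS g] with y hy
    rw [hy.2]
    have := integral_inner (𝕜 := ℂ) hy.1 (f y)
    rw [← inner_conj_symm, ← this, ← integral_conj]
    refine integral_congr_ae (.of_forall fun x => ?_)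
    simp only [inner_conj_symm, inner_act, Matrix.conjTranspose_conjTranspose]
  have e2 : inner ℂ g (T f) =
      ∫ x, ∫ y, inner ℂ (g x) (act (K x y) (f y)) := by
    rw [L2.inner_def]
    refine integral_congr_ae ?_
    filter_upwards [hT f] with x hx
    rw [hx.2]
    exact (integral_inner (𝕜 := ℂ) hx.1 (g x)).symm
  rw [e1, e2]
  exact (integral_integral_swap (hK.integrable_prod h f g)).symm

/-- Sum of squares of the images of an orthonormal system under an operator with values in `ℂ²`. -/
lemma sum_norm_sq_le_of_orthonormal {H ι : Type*} [NormedAddCommGroup H] [InnerProductSpace ℂ H]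
    [CompleteSpace H] {e : ι → H} (he : Orthonormal ℂ e) (L : H →L[ℂ] C2) (s : Finset ι) :
    ∑ i ∈ s, ‖L (e i)‖ ^ 2 ≤ 2 * ‖L‖ ^ 2 := by
  let b := EuclideanSpace.basisFun (Fin 2) ℂ
  have h1 : ∀ i, ‖L (e i)‖ ^ 2 = ∑ j, ‖inner ℂ (e i) (ContinuousLinearMap.adjoint L (b j))‖ ^ 2 := by
    intro i
    rw [← b.sum_sq_norm_inner_left (L (e i))]
    simp only [ContinuousLinearMap.adjoint_inner_right]
  simp only [h1]
  rw [Finset.sum_comm]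
  calc ∑ j, ∑ i ∈ s, ‖inner ℂ (e i) (ContinuousLinearMap.adjoint L (b j))‖ ^ 2
      ≤ ∑ j : Fin 2, ‖L‖ ^ 2 := by
        refine Finset.sum_le_sum fun j _ => (he.sum_inner_products_le _).trans ?_
        refine pow_le_pow_left₀ (norm_nonneg _) ?_ 2
        refine (ContinuousLinearMap.le_opNorm _ _).trans ?_
        rw [LinearIsometryEquiv.norm_map, b.orthonormal.1 j, mul_one]
    _ = 2 * ‖L‖ ^ 2 := by simp

/-- For fixed `x` the map `f ↦ (T f)(x)` is a bounded `ℂ²`-valued functional with norm at most that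
of the row `k x`. Bessel's inequality for each of its two components, integrated in `x`, gives the
factor `2`. -/
lemma IsKernelOp.sum_norm_sq_le (hT : IsKernelOp K T) (hK : DomBy K k) (h : HS k) {ι : Type*}
    {e : ι → L2} (he : Orthonormal ℂ e) (s : Finset ι) :
    ∑ i ∈ s, ‖T (e i)‖ ^ 2 ≤ 2 * hsNorm k ^ 2 := by
  simp only [norm_sq_eq_integral, hsNorm_sq]
  rw [← integral_finsetSum _ fun i _ => memLp_two_integrable_norm_sq (Lp.memLp _),
    ← integral_const_mul]
  refine integral_mono_ae
    (integrable_finsetSum _ fun i _ => memLp_two_integrable_norm_sq (Lp.memLp _))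
    (h.integrable_left.const_mul _) ?_
  have hall : ∀ᵐ x, ∀ i ∈ s, T (e i) x = ∫ y, act (K x y) (e i y) := by
    rw [Filter.eventually_all_finset]
    exact fun i _ => (hT (e i)).mono fun x hx => hx.2
  filter_upwards [hall, hK.bound, h.ae_memLp] with x hx hb hk
  -- The exceptional null set of `x` must not depend on `f`, because evaluation at this `x` becomes
  -- a linear functional on all of `L2`; hence the row bound is derived again at a fixed good `x`.
  have hint : ∀ f : L2, Integrable (fun y => act (K x y) (f y)) ∧
      ‖∫ y, act (K x y) (f y)‖ ≤ √(∫ y, k x y ^ 2) * ‖f‖ := fun f => by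
    obtain ⟨hi, hle⟩ := integral_mul_norm_le (h.nonneg x) hk f
    have hint : Integrable (fun y => act (K x y) (f y)) := by
      refine hi.mono' ?_ (hb.mono fun y hy => hy _)
      exact (hK.meas.comp (measurable_const.prodMk measurable_id)).act (Lp.aestronglyMeasurable f)
    refine ⟨hint, (norm_integral_le_integral_norm _).trans (le_trans ?_ hle)⟩
    exact integral_mono_ae hint.norm hi (hb.mono fun y hy => hy _)
  let L₀ : L2 →ₗ[ℂ] C2 :=
    { toFun := fun f => ∫ y, act (K x y) (f y)
      map_add' := fun f g => by
        rw [← integral_add (hint f).1 (hint g).1]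
        refine integral_congr_ae ?_
        filter_upwards [Lp.coeFn_add f g] with y hy
        rw [hy, Pi.add_apply, act_add]
      map_smul' := fun c f => by
        rw [RingHom.id_apply, ← integral_smul]
        refine integral_congr_ae ?_
        filter_upwards [Lp.coeFn_smul c f] with y hy
        rw [hy, Pi.smul_apply, act_smul] }
  let L : L2 →L[ℂ] C2 := L₀.mkContinuous _ fun f => (hint f).2
  have hL : ‖L‖ ≤ √(∫ y, k x y ^ 2) := L₀.mkContinuous_norm_le (Real.sqrt_nonneg _) _
  calc ∑ i ∈ s, ‖T (e i) x‖ ^ 2 = ∑ i ∈ s, ‖L (e i)‖ ^ 2 :=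
        Finset.sum_congr rfl fun i hi => by rw [hx i hi]; rfl
    _ ≤ 2 * ‖L‖ ^ 2 := sum_norm_sq_le_of_orthonormal he L s
    _ ≤ 2 * (√(∫ y, k x y ^ 2)) ^ 2 := by gcongr
    _ = 2 * ∫ y, k x y ^ 2 := by rw [Real.sq_sqrt (integral_nonneg fun _ => sq_nonneg _)]

/-- An operator which is square summable on a Hilbert basis is compact. -/
lemma isCompactOperator_of_summable {H ι : Type*} [NormedAddCommGroup H] [InnerProductSpace ℂ H]
    [CompleteSpace H] (b : HilbertBasis ι ℂ H) (T : H →L[ℂ] H)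
    (hs : Summable fun i => ‖T (b i)‖ ^ 2) : IsCompactOperator T := by
  classical
  -- Finite-rank truncations of `T` along the basis. `T - F s` is the limit of `F t - F s`, a sum
  -- over `t \ s`, which Bessel and Cauchy–Schwarz bound by the square root of the tail of `∑ ‖T (b
  -- i)‖²`.
  let F : Finset ι → (H →L[ℂ] H) := fun s =>
    ∑ i ∈ s, (innerSL ℂ (b i)).smulRight (T (b i))
  have hF : ∀ s, IsCompactOperator (F s) := by
    intro s
    have : F s ∈ compactOperator (RingHom.id ℂ) H H := by
      refine Submodule.sum_mem _ fun i _ => ?_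
      change IsCompactOperator _
      have h1 : IsCompactOperator ((ContinuousLinearMap.toSpanSingleton ℂ (T (b i)))) := by
        have : IsCompactOperator (id : ℂ → ℂ) :=
          isCompactOperator_id_iff_finiteDimensional (𝕜 := ℂ).2 inferInstance
        exact this.clm_comp (ContinuousLinearMap.toSpanSingleton ℂ (T (b i)))
      exact h1.comp_clm (innerSL ℂ (b i))
    exact this
  refine isCompactOperator_of_tendsto (F := F) (l := Filter.atTop) ?_ (.of_forall hF)
  rw [Metric.tendsto_atTop]
  intro ε hε
  obtain ⟨s₀, hs₀⟩ := summable_iff_vanishing_norm.1 hs ((ε / 2) ^ 2) (by positivity)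
  refine ⟨s₀, fun s hs₁ => ?_⟩
  rw [dist_comm, dist_eq_norm]
  refine lt_of_le_of_lt ?_ (half_lt_self hε)
  refine ContinuousLinearMap.opNorm_le_bound _ (by positivity) fun f => ?_
  have hf : Filter.Tendsto (fun t => F t f) Filter.atTop (nhds (T f)) := by
    have := (b.hasSum_repr f).mapL T
    simpa [F, HasSum, b.repr_apply_apply] using this
  refine le_of_tendsto (hf.sub_const (F s f)).norm ?_
  filter_upwards [Filter.eventually_ge_atTop s] with t ht
  have e : F t f - F s f = ∑ i ∈ t \ s, inner ℂ (b i) f • T (b i) := by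
    rw [sub_eq_iff_eq_add, eq_comm]
    simpa [F] using Finset.sum_sdiff (f := fun i => inner ℂ (b i) f • T (b i)) ht
  rw [e]
  have h1 : ∑ i ∈ t \ s, ‖T (b i)‖ ^ 2 ≤ (ε / 2) ^ 2 := by
    have := hs₀ (t \ s) (Finset.sdiff_disjoint.mono_right hs₁)
    exact (le_abs_self _).trans this.le
  have h2 : ∑ i ∈ t \ s, ‖inner ℂ (b i) f‖ ^ 2 ≤ ‖f‖ ^ 2 :=
    b.orthonormal.sum_inner_products_le f
  calc ‖∑ i ∈ t \ s, inner ℂ (b i) f • T (b i)‖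
      ≤ ∑ i ∈ t \ s, ‖inner ℂ (b i) f‖ * ‖T (b i)‖ :=
        (norm_sum_le _ _).trans (Finset.sum_le_sum fun i _ => (norm_smul _ _).le)
    _ ≤ √(∑ i ∈ t \ s, ‖inner ℂ (b i) f‖ ^ 2) * √(∑ i ∈ t \ s, ‖T (b i)‖ ^ 2) :=
        Real.sum_mul_le_sqrt_mul_sqrt _ _ _
    _ ≤ √(‖f‖ ^ 2) * √((ε / 2) ^ 2) := by gcongr
    _ = ε / 2 * ‖f‖ := by
        rw [Real.sqrt_sq (norm_nonneg _), Real.sqrt_sq (by positivity), mul_comm]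

lemma IsKernelOp.isCompactOperator (hT : IsKernelOp K T) (hK : DomBy K k) (h : HS k) :
    IsCompactOperator T := by
  obtain ⟨w, b, -⟩ := exists_hilbertBasis ℂ L2
  refine isCompactOperator_of_summable b T ?_
  exact summable_of_sum_le (fun _ => sq_nonneg _) fun s => hT.sum_norm_sq_le hK h b.orthonormal s

end KernelOps

/-! ### Weights and radial integrals -/

lemma bracket_sq (x : E3) : bracket x ^ 2 = 1 + ‖x‖ ^ 2 := by
  rw [bracket, ← Real.sqrt_eq_rpow, Real.sq_sqrt (by positivity)]

lemma one_le_bracket (x : E3) : 1 ≤ bracket x :=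
  Real.one_le_rpow (by nlinarith [norm_nonneg x]) (by norm_num)

lemma bracket_pos (x : E3) : 0 < bracket x := one_pos.trans_le (one_le_bracket x)

lemma norm_le_bracket (x : E3) : ‖x‖ ≤ bracket x := by
  refine le_of_sq_le_sq ?_ (bracket_pos x).le
  rw [bracket_sq]; linarith

lemma bracket_le (x : E3) : bracket x ≤ 1 + ‖x‖ := by
  refine le_of_sq_le_sq ?_ (by positivity)
  rw [bracket_sq]; nlinarith [norm_nonneg x]

lemma continuous_bracket : Continuous bracket :=
  Continuous.rpow_const (by fun_prop) fun _ => Or.inr (by norm_num)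

lemma continuous_bracket_rpow (p : ℝ) : Continuous fun x => bracket x ^ p :=
  continuous_bracket.rpow_const fun x => Or.inl (bracket_pos x).ne'

lemma bracket_rpow_pos (x : E3) (p : ℝ) : 0 < bracket x ^ p := Real.rpow_pos_of_pos (bracket_pos x) p

lemma bracket_rpow_sq (x : E3) (p : ℝ) : (bracket x ^ p) ^ 2 = bracket x ^ (2 * p) := by
  rw [← Real.rpow_natCast, ← Real.rpow_mul (bracket_pos x).le, mul_comm]
  norm_num

lemma bracket_rpow_mul (x : E3) (p q : ℝ) : bracket x ^ p * bracket x ^ q = bracket x ^ (p + q) :=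
  (Real.rpow_add (bracket_pos x) p q).symm

lemma norm_sub_le_bracket (x y : E3) : ‖x - y‖ ≤ 2 * bracket x * bracket y := by
  have := norm_sub_le x y
  nlinarith [norm_le_bracket x, norm_le_bracket y, one_le_bracket x, one_le_bracket y]

lemma bracket_le_mul (x y : E3) : bracket x ≤ 2 * (1 + ‖x - y‖) * bracket y := by
  have h1 : ‖x‖ ≤ ‖x - y‖ + ‖y‖ := by simpa using norm_add_le (x - y) y
  nlinarith [bracket_le x, norm_le_bracket y, one_le_bracket y, norm_nonneg (x - y)]

lemma integrable_bracket {q : ℝ} (hq : 3 < q) : Integrable fun x : E3 => bracket x ^ (-q) := by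
  refine (integrable_rpow_neg_one_add_norm_sq (E := E3) (r := q) (μ := volume)
    (by simpa using hq)).congr
    (.of_forall fun x => ?_)
  simp only [bracket]
  rw [← Real.rpow_mul (by positivity)]
  ring_nf

lemma memLp_bracket {q : ℝ} (hq : 3 / 2 < q) : MemLp (fun x : E3 => bracket x ^ (-q)) 2 volume := by
  rw [memLp_two_iff_integrable_sq (continuous_bracket_rpow _).aestronglyMeasurable]
  simp only [bracket_rpow_sq]
  exact (integrable_bracket (q := 2 * q) (by linarith)).congr (.of_forall fun x => by ring_nf)

lemma integrable_radial {F : Type*} [NormedAddCommGroup F] [NormedSpace ℝ F] {f : ℝ → F} :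
    Integrable (fun x : E3 => f ‖x‖) ↔ IntegrableOn (fun r : ℝ => r ^ 2 • f r) (Set.Ioi 0) := by
  have := integrable_fun_norm_addHaar (volume : Measure E3) (f := f)
  simpa using this

lemma integral_radial {F : Type*} [NormedAddCommGroup F] [NormedSpace ℝ F] (f : ℝ → F) :
    ∫ x : E3, f ‖x‖ = (4 * Real.pi) • ∫ r in Set.Ioi (0 : ℝ), r ^ 2 • f r := by
  have := integral_fun_norm_addHaar (volume : Measure E3) f
  rw [this, Measure.real, EuclideanSpace.volume_ball_fin_three]
  simp only [finrank_euclideanSpace, Fintype.card_fin]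
  rw [← Nat.cast_smul_eq_nsmul ℝ, smul_smul]
  congr 1
  rw [ENNReal.ofReal_one, one_pow, one_mul, ENNReal.toReal_ofReal (by positivity)]
  norm_num
  ring

/-- `⟨x⟩⁻¹` is not square integrable on `ℝ³`: in polar coordinates its square has density `r² / (1 +
r²)`, and adding the integrable `1 / (1 + r²)` would make the constant `1` integrable on a half
line. This later forces the `1/|x|` tail of a bound state to vanish. -/
lemma eq_zero_of_memLp_inv_bracket {c : ℂ}
    (h : MemLp (fun x : E3 => c * ((bracket x ^ (-1 : ℝ) : ℝ) : ℂ)) 2 volume) : c = 0 := by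
  by_contra hc
  have h1 := (memLp_two_iff_integrable_sq_norm h.1).1 h
  have h2 : Integrable fun x : E3 => (fun r : ℝ => (1 + r ^ 2)⁻¹) ‖x‖ := by
    refine (h1.const_mul ((‖c‖ ^ 2)⁻¹)).congr (.of_forall fun x => ?_)
    have : ‖c‖ ≠ 0 := norm_ne_zero_iff.2 hc
    simp only [norm_mul, Complex.norm_real, Real.norm_of_nonneg (bracket_rpow_pos x _).le, mul_pow]
    rw [Real.rpow_neg_one, inv_pow, bracket_sq]
    field_simp
  replace h2 := (integrable_radial (f := fun r : ℝ => (1 + r ^ 2)⁻¹)).1 h2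
  have h3 : IntegrableOn (fun r : ℝ => (1 : ℝ)) (Set.Ioi 0) := by
    refine (h2.add (integrable_inv_one_add_sq.integrableOn)).congr (.of_forall fun r => ?_)
    have : (1 : ℝ) + r ^ 2 ≠ 0 := by positivity
    simp only [Pi.add_apply, smul_eq_mul]
    field_simp
    ring
  rw [integrableOn_const_iff] at h3
  simp at h3

lemma hs_bracket_bracket {p q : ℝ} (hp : 3 / 2 < p) (hq : 3 / 2 < q) :
    HS fun x y => bracket x ^ (-p) * bracket y ^ (-q) := by
  refine ⟨fun x y => by positivity [bracket_rpow_pos x (-p), bracket_rpow_pos y (-q)], ?_, ?_⟩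
  · exact ((continuous_bracket_rpow _).comp continuous_fst).measurable.mul
      ((continuous_bracket_rpow _).comp continuous_snd).measurable
  · simp only [mul_pow]
    exact (memLp_two_iff_integrable_sq (continuous_bracket_rpow _).aestronglyMeasurable).1
      (memLp_bracket hp) |>.mul_prod
      ((memLp_two_iff_integrable_sq (continuous_bracket_rpow _).aestronglyMeasurable).1
      (memLp_bracket hq))

lemma integrable_local_inv_sq :
    Integrable fun x : E3 => (Set.Iio (1 : ℝ)).indicator (fun r => (r⁻¹) ^ 2) ‖x‖ := by
  rw [integrable_radial]
  have : IntegrableOn (fun _ : ℝ => (1 : ℝ)) (Set.Ioo 0 1) := by simp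
  rw [← integrable_indicator_iff measurableSet_Ioo] at this
  refine Integrable.congr this.integrableOn ?_
  filter_upwards [ae_restrict_mem measurableSet_Ioi] with r hr
  have hr0 : r ≠ 0 := (show (0:ℝ) < r from hr).ne'
  by_cases h : r < 1
  · rw [Set.indicator_of_mem (show r ∈ Set.Ioo 0 1 from ⟨hr, h⟩),
      Set.indicator_of_mem (show r ∈ Set.Iio 1 from h), smul_eq_mul]
    field_simp
  · rw [Set.indicator_of_notMem (fun hh => h hh.2),
      Set.indicator_of_notMem (show r ∉ Set.Iio 1 from h), smul_zero]

/-- Three regions: `|w| < 1`, where the singularity is isolated; and for `|w| ≥ 1`, where the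
smaller of `⟨x⟩` and `|w|` replaces the other one. The result is a sum of functions of `x` alone and
of `w` alone, so that after `w = x - y` the integral is bounded uniformly in `y`. -/
lemma bracket_mul_inv_sq_le {p : ℝ} (hp : 0 < p) (x w : E3) :
    (bracket x ^ (-p) * ‖w‖⁻¹) ^ 2 ≤
      (Set.Iio (1 : ℝ)).indicator (fun r => (r⁻¹) ^ 2) ‖w‖ +
        (bracket x ^ (-(2 * p + 2)) + 2 ^ (p + 1) * bracket w ^ (-(2 * p + 2))) := by
  have hb : bracket x ^ (-p) ≤ 1 :=
    Real.rpow_le_one_of_one_le_of_nonpos (one_le_bracket x) (by linarith)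
  have hb0 := bracket_rpow_pos x (-p)
  have h1 := bracket_rpow_pos x (-(2 * p + 2))
  have h2 := bracket_rpow_pos w (-(2 * p + 2))
  have h3 : (0 : ℝ) < 2 ^ (p + 1) := by positivity
  by_cases h : ‖w‖ < 1
  · rw [Set.indicator_of_mem (show ‖w‖ ∈ Set.Iio (1 : ℝ) from h), mul_pow]
    have : (bracket x ^ (-p)) ^ 2 ≤ 1 := pow_le_one₀ hb0.le hb
    nlinarith [sq_nonneg ‖w‖⁻¹, mul_pos h3 h2]
  · rw [Set.indicator_of_notMem (show ‖w‖ ∉ Set.Iio (1 : ℝ) from h), zero_add]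
    push Not at h
    have hw : 0 < ‖w‖ := by linarith
    -- The constant comes from `⟨w⟩² ≤ 2 |w|²` for `|w| ≥ 1`, raised to the power `p + 1`.
    have hw2 : ‖w‖ ^ (-(2 * p + 2)) ≤ 2 ^ (p + 1) * bracket w ^ (-(2 * p + 2)) := by
      have e1 : ‖w‖ ^ (-(2 * p + 2)) = (‖w‖ ^ 2) ^ (-(p + 1)) := by
        rw [← Real.rpow_natCast, ← Real.rpow_mul hw.le]; norm_num; ring_nf
      have e2 : bracket w ^ (-(2 * p + 2)) = (1 + ‖w‖ ^ 2) ^ (-(p + 1)) := by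
        rw [← bracket_sq, ← Real.rpow_natCast, ← Real.rpow_mul (bracket_pos w).le]; norm_num
        ring_nf
      have e3 : (2 : ℝ) ^ (p + 1) = (2⁻¹) ^ (-(p + 1)) := by
        rw [Real.inv_rpow (by norm_num), Real.rpow_neg (by norm_num), inv_inv]
      rw [e1, e2, e3, ← Real.mul_rpow (by norm_num) (by positivity)]
      refine Real.rpow_le_rpow_of_nonpos (by positivity) ?_ (by linarith)
      nlinarith
    rcases le_total (bracket x) ‖w‖ with hxw | hxw
    · have : (bracket x ^ (-p) * ‖w‖⁻¹) ^ 2 ≤ (bracket x ^ (-p) * bracket x ^ (-1 : ℝ)) ^ 2 := by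
        rw [Real.rpow_neg_one]
        have := bracket_pos x
        gcongr
      refine this.trans ?_
      rw [bracket_rpow_mul, bracket_rpow_sq, show 2 * (-p + -1) = -(2 * p + 2) by ring]
      nlinarith [mul_pos h3 h2]
    · have : (bracket x ^ (-p) * ‖w‖⁻¹) ^ 2 ≤ (‖w‖ ^ (-p) * ‖w‖ ^ (-1 : ℝ)) ^ 2 := by
        rw [Real.rpow_neg_one ‖w‖]
        have := Real.rpow_le_rpow_of_nonpos hw hxw (show -p ≤ 0 by linarith)
        gcongr
      refine this.trans ?_
      rw [← Real.rpow_add hw, ← Real.rpow_natCast, ← Real.rpow_mul hw.le,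
        show (-p + -1) * ((2 : ℕ) : ℝ) = -(2 * p + 2) by push_cast; ring]
      linarith

/-- `p > 1/2` is exactly what makes the exponent `2p + 2` of the majorant exceed the dimension `3`;
uniformity in `y` is translation invariance. -/
lemma exists_integral_bracket_inv_le {p : ℝ} (hp : 1 / 2 < p) :
    ∃ C, ∀ y : E3, Integrable (fun x : E3 => (bracket x ^ (-p) * ‖x - y‖⁻¹) ^ 2) ∧
      ∫ x : E3, (bracket x ^ (-p) * ‖x - y‖⁻¹) ^ 2 ≤ C := by
  have hb := integrable_bracket (q := 2 * p + 2) (by linarith)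
  have h1 := integrable_local_inv_sq
  let g₁ : E3 → ℝ := fun x => (Set.Iio (1 : ℝ)).indicator (fun r => (r⁻¹) ^ 2) ‖x‖
  let g₂ : E3 → ℝ := fun x => bracket x ^ (-(2 * p + 2))
  let g₃ : E3 → ℝ := fun x => 2 ^ (p + 1) * bracket x ^ (-(2 * p + 2))
  refine ⟨(∫ x, g₁ x) + ((∫ x, g₂ x) + ∫ x, g₃ x), fun y => ?_⟩
  have i1 : Integrable (fun x => g₁ (x - y)) := h1.comp_sub_right y
  have i3 : Integrable (fun x => g₃ (x - y)) := (hb.const_mul _).comp_sub_right y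
  have i23 : Integrable (fun x => g₂ x + g₃ (x - y)) := hb.add i3
  have i123 : Integrable (fun x => g₁ (x - y) + (g₂ x + g₃ (x - y))) := i1.add i23
  have hle : ∀ x, (bracket x ^ (-p) * ‖x - y‖⁻¹) ^ 2 ≤ g₁ (x - y) + (g₂ x + g₃ (x - y)) :=
    fun x => bracket_mul_inv_sq_le (by linarith) x (x - y)
  have hint : Integrable (fun x : E3 => (bracket x ^ (-p) * ‖x - y‖⁻¹) ^ 2) := by
    refine i123.mono' ?_ (.of_forall fun x => ?_)
    · exact ((continuous_bracket_rpow _).measurable.mul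
        ((measurable_id.sub_const y).norm.inv)).pow_const 2 |>.aestronglyMeasurable
    · rw [Real.norm_of_nonneg (sq_nonneg _)]; exact hle x
  refine ⟨hint, (integral_mono hint i123 hle).trans (le_of_eq ?_)⟩
  rw [integral_add i1 i23, integral_add hb i3, integral_sub_right_eq_self g₁ y,
    integral_sub_right_eq_self g₃ y]

/-- Integrate in `x` first, with a bound uniform in `y`; the weight in `y` then has to be square
integrable by itself. This explains the asymmetry between `1/2` and `3/2`. -/
lemma hs_bracket_inv_bracket {p q : ℝ} (hp : 1 / 2 < p) (hq : 3 / 2 < q) :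
    HS fun x y => bracket x ^ (-p) * ‖x - y‖⁻¹ * bracket y ^ (-q) := by
  have hmeas : Measurable (Function.uncurry fun x y : E3 =>
      bracket x ^ (-p) * ‖x - y‖⁻¹ * bracket y ^ (-q)) :=
    (((continuous_bracket_rpow _).comp continuous_fst).measurable.mul
      (measurable_fst.sub measurable_snd).norm.inv).mul
      ((continuous_bracket_rpow _).comp continuous_snd).measurable
  refine ⟨fun x y => by positivity [bracket_rpow_pos x (-p), bracket_rpow_pos y (-q)], hmeas, ?_⟩
  obtain ⟨C, hC⟩ := exists_integral_bracket_inv_le hp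
  have hm : AEStronglyMeasurable (fun z : E3 × E3 =>
      (bracket z.1 ^ (-p) * ‖z.1 - z.2‖⁻¹ * bracket z.2 ^ (-q)) ^ 2) (volume.prod volume) :=
    (hmeas.pow_const 2).aestronglyMeasurable
  rw [integrable_prod_iff' hm]
  constructor
  · refine .of_forall fun y => ?_
    simp only [mul_pow _ (bracket y ^ (-q))]
    exact (hC y).1.mul_const _
  · have hb := (memLp_two_iff_integrable_sq (continuous_bracket_rpow _).aestronglyMeasurable).1
      (memLp_bracket hq)
    refine (hb.const_mul C).mono' hm.norm.prod_swap.integral_prod_right' (.of_forall fun y => ?_)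
    rw [Real.norm_of_nonneg (integral_nonneg fun _ => norm_nonneg _)]
    simp only [norm_pow, Real.norm_eq_abs, sq_abs]
    simp only [mul_pow _ (bracket y ^ (-q))]
    rw [integral_mul_const]
    exact mul_le_mul_of_nonneg_right (hC y).2 (sq_nonneg _)

lemma HS.const_mul {k : E3 → E3 → ℝ} (h : HS k) {c : ℝ} (hc : 0 ≤ c) : HS fun x y => c * k x y := by
  refine ⟨fun x y => mul_nonneg hc (h.nonneg x y), h.meas.const_mul c, ?_⟩
  simp only [mul_pow]
  exact h.sq.const_mul _

lemma hsNorm_const_mul (k : E3 → E3 → ℝ) {c : ℝ} (hc : 0 ≤ c) :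
    hsNorm (fun x y => c * k x y) = c * hsNorm k := by
  simp only [hsNorm, mul_pow, integral_const_mul]
  rw [Real.sqrt_mul (sq_nonneg c), Real.sqrt_sq hc]

section

open scoped LineDeriv

/-! ### Schwartz functions -/

lemma bracket_sq_hasTemperateGrowth : (fun x : E3 => ((1 + ‖x‖ ^ 2 : ℝ) : ℂ)).HasTemperateGrowth := by
  fun_prop

lemma memLp_bracket_sq_smul {F : Type*} [NormedAddCommGroup F] [NormedSpace ℂ F] (η : 𝓢(E3, F))
    (p : ℝ≥0∞) : MemLp (fun x => bracket x ^ 2 • η x) p volume := by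
  have h := (SchwartzMap.smulLeftCLM F (fun x : E3 => ((1 + ‖x‖ ^ 2 : ℝ) : ℂ)) η).memLp p
    (volume : Measure E3)
  refine h.ae_eq (.of_forall fun x => ?_)
  rw [SchwartzMap.smulLeftCLM_apply_apply bracket_sq_hasTemperateGrowth]
  simp only [bracket_sq]
  exact RCLike.real_smul_eq_coe_smul (K := ℂ) _ _ |>.symm

lemma integrable_mul_schwartz (η : 𝓢(E3, ℂ)) {g : E3 → ℂ} (hg : AEStronglyMeasurable g volume)
    {C : ℝ} (hC : ∀ x, ‖g x‖ ≤ C * bracket x ^ 2) : Integrable fun x => g x * η x := by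
  have h := (memLp_one_iff_integrable.1 (memLp_bracket_sq_smul η 1)).norm.const_mul C
  refine h.mono' (hg.mul η.continuous.aestronglyMeasurable) (.of_forall fun x => ?_)
  rw [norm_mul, norm_smul, ← mul_assoc, Real.norm_of_nonneg (sq_nonneg _)]
  gcongr
  exact hC x

lemma integrable_inv_norm_sub_mul_schwartz {F : Type*} [NormedAddCommGroup F] [NormedSpace ℂ F]
    (η : 𝓢(E3, F)) (x : E3) : Integrable fun y => ‖y - x‖⁻¹ * ‖η y‖ := by
  obtain ⟨C, hC⟩ := exists_integral_bracket_inv_le (p := 2) (by norm_num)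
  have hm : AEStronglyMeasurable (fun y : E3 => bracket y ^ (-2 : ℝ) * ‖y - x‖⁻¹) volume :=
    ((continuous_bracket_rpow _).measurable.mul
        ((measurable_id.sub_const x).norm.inv)).aestronglyMeasurable
  have h1 : MemLp (fun y : E3 => bracket y ^ (-2 : ℝ) * ‖y - x‖⁻¹) 2 volume :=
    (memLp_two_iff_integrable_sq hm).2 (hC x).1
  refine (MemLp.integrable_mul (p := 2) (q := 2) h1 (memLp_bracket_sq_smul η 2).norm).congr
    (.of_forall fun y => ?_)
  have := (bracket_pos y).ne'
  simp only [Pi.mul_apply, norm_smul, Real.norm_of_nonneg (sq_nonneg (bracket y))]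
  rw [Real.rpow_neg (bracket_pos y).le, Real.rpow_two]
  field_simp

/-! ### The fundamental solution of `-Δ + a²` -/

/-- The radial profile `e^{-ar} / 4πr` of the fundamental solution of `-Δ + a²`. -/
def gK (a : ℂ) (r : ℝ) : ℂ := Complex.exp (-(a * r)) / (4 * Real.pi * r)

lemma norm_exp_neg_mul (a : ℂ) (r : ℝ) :
    ‖Complex.exp (-(a * r))‖ = Real.exp (-(a.re * r)) := by
  rw [Complex.norm_exp]; simp

lemma norm_exp_neg_mul_le {a : ℂ} (ha : 0 ≤ a.re) {r : ℝ} (hr : 0 ≤ r) :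
    ‖Complex.exp (-(a * r))‖ ≤ 1 := by
  rw [norm_exp_neg_mul]
  exact Real.exp_le_one_iff.2 (by nlinarith [mul_nonneg ha hr])

lemma norm_gK (a : ℂ) {r : ℝ} (hr : 0 ≤ r) :
    ‖gK a r‖ = Real.exp (-(a.re * r)) / (4 * Real.pi * r) := by
  rw [gK, norm_div, norm_exp_neg_mul]
  simp [abs_of_nonneg hr, abs_of_nonneg Real.pi_pos.le]

lemma norm_gK_le {a : ℂ} (ha : 0 ≤ a.re) {r : ℝ} (hr : 0 ≤ r) :
    ‖gK a r‖ ≤ (4 * Real.pi)⁻¹ * r⁻¹ := by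
  have h := norm_exp_neg_mul_le ha hr
  rw [gK, norm_div, div_eq_mul_inv]
  have : ‖(4 * Real.pi * r : ℂ)‖⁻¹ = (4 * Real.pi)⁻¹ * r⁻¹ := by
    simp [abs_of_nonneg hr, abs_of_nonneg Real.pi_pos.le]
    ring
  rw [this]
  have : 0 ≤ (4 * Real.pi)⁻¹ * r⁻¹ := by positivity
  nlinarith

lemma measurable_gK (a : ℂ) : Measurable (gK a) := by
  unfold gK
  fun_prop

lemma integral_mul_lineDeriv_schwartz (η : 𝓢(E3, ℂ)) {f f' : E3 → ℂ} {v : E3} {C C' : ℝ}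
    (hf : Continuous f) (hf' : Continuous f') (hC : ∀ x, ‖f x‖ ≤ C * bracket x ^ 2)
    (hC' : ∀ x, ‖f' x‖ ≤ C' * bracket x ^ 2) (h : ∀ x, HasLineDerivAt ℝ f (f' x) x v) :
    ∫ y, f y * (∂_{v} η : 𝓢(E3, ℂ)) y = -∫ y, f' y * η y := by
  have := integral_bilinear_hasLineDerivAt_right_eq_neg_left_of_integrable
      (μ := (volume : Measure E3)) (B := ContinuousLinearMap.mul ℝ ℂ)
      (f := f) (f' := f') (g := η) (g' := (∂_{v} η : 𝓢(E3, ℂ))) (v := v)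
      (integrable_mul_schwartz _ hf'.aestronglyMeasurable hC')
      (integrable_mul_schwartz _ hf.aestronglyMeasurable hC)
      (integrable_mul_schwartz _ hf.aestronglyMeasurable hC)
      (fun y _ => h y) (fun y _ => by
        rw [SchwartzMap.lineDerivOp_apply_eq_fderiv]
        exact (η.hasFDerivAt y).hasLineDerivAt v)
  simpa using this

/-- Green's identity for functions of `‖y - x‖²`. -/
lemma integral_comp_norm_sq_mul_laplacian {F F' F'' : ℝ → ℂ}
    (hF : ∀ s, 0 ≤ s → HasDerivAt F (F' s) s) (hF' : ∀ s, 0 ≤ s → HasDerivAt F' (F'' s) s)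
    (hcont : ContinuousOn F'' (Set.Ici 0)) {C : ℝ}
    (hC : ∀ s, 0 ≤ s → ‖F s‖ ≤ C ∧ ‖F' s‖ ≤ C ∧ ‖F'' s‖ ≤ C) (x : E3) (η : 𝓢(E3, ℂ)) :
    ∫ y, F (‖y - x‖ ^ 2) * (Δ η) y =
      ∫ y, (4 * (‖y - x‖ ^ 2 : ℝ) * F'' (‖y - x‖ ^ 2) + 6 * F' (‖y - x‖ ^ 2)) * η y := by
  let b := EuclideanSpace.basisFun (Fin 3) ℝ
  have hcs : Continuous fun y : E3 => ‖y - x‖ ^ 2 := by fun_prop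
  have hs0 : ∀ y : E3, 0 ≤ ‖y - x‖ ^ 2 := fun y => sq_nonneg _
  have c0 : Continuous fun y : E3 => F (‖y - x‖ ^ 2) := continuous_iff_continuousAt.2 fun y =>
    (hF _ (hs0 y)).continuousAt.comp (f := fun y : E3 => ‖y - x‖ ^ 2) hcs.continuousAt
  have c1 : Continuous fun y : E3 => F' (‖y - x‖ ^ 2) := continuous_iff_continuousAt.2 fun y =>
    (hF' _ (hs0 y)).continuousAt.comp (f := fun y : E3 => ‖y - x‖ ^ 2) hcs.continuousAt
  have c2 : Continuous fun y : E3 => F'' (‖y - x‖ ^ 2) := hcont.comp_continuous hcs hs0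
  have hC0 : 0 ≤ C := (norm_nonneg _).trans (hC 0 le_rfl).1
  let c : Fin 3 → E3 → ℝ := fun i y => inner ℝ (y - x) (b i)
  have cc : ∀ i, Continuous (c i) := fun i => by fun_prop
  have hcle : ∀ i y, |c i y| ≤ 2 * bracket x * bracket y := fun i y => by
    refine (abs_real_inner_le_norm _ _).trans ?_
    rw [b.orthonormal.1 i, mul_one]
    refine (norm_sub_le_bracket y x).trans (le_of_eq (by ring))
  have hsderiv : ∀ i y, HasDerivAt (fun t : ℝ => ‖y + t • b i - x‖ ^ 2) (2 * c i y) 0 := by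
    intro i y
    have h1 : HasDerivAt (fun t : ℝ => y + t • b i - x) (b i) 0 := by
      simpa using (((hasDerivAt_id (0 : ℝ)).smul_const (b i)).const_add y).sub_const x
    simpa [c] using h1.norm_sq
  have hcderiv : ∀ i y, HasDerivAt (fun t : ℝ => ((c i (y + t • b i) : ℝ) : ℂ)) 1 0 := by
    intro i y
    have e : ∀ t : ℝ, c i (y + t • b i) = c i y + t := fun t => by
      simp only [c, add_sub_right_comm, inner_add_left, inner_smul_left, b.inner_eq_one]
      simp
    simp only [e]
    have := ((hasDerivAt_id (0 : ℝ)).const_add (c i y)).ofReal_comp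
    simpa using this
  let f₁ : Fin 3 → E3 → ℂ := fun i y => F' (‖y - x‖ ^ 2) * ((2 * c i y : ℝ) : ℂ)
  let f₂ : Fin 3 → E3 → ℂ := fun i y =>
    F'' (‖y - x‖ ^ 2) * ((4 * c i y ^ 2 : ℝ) : ℂ) + 2 * F' (‖y - x‖ ^ 2)
  have d0 : ∀ i y, HasLineDerivAt ℝ (fun y : E3 => F (‖y - x‖ ^ 2)) (f₁ i y) y (b i) := by
    intro i y
    have := HasDerivAt.scomp_of_eq (g₁ := F) (0 : ℝ) (hF _ (hs0 y)) (hsderiv i y) (by simp)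
    simpa [HasLineDerivAt, f₁, Function.comp_def, mul_comm] using this
  have d1 : ∀ i y, HasLineDerivAt ℝ (f₁ i) (f₂ i y) y (b i) := by
    intro i y
    have h1 := HasDerivAt.scomp_of_eq (g₁ := F') (0 : ℝ) (hF' _ (hs0 y)) (hsderiv i y) (by simp)
    have h2 := h1.mul ((hcderiv i y).const_mul 2)
    refine (h2.congr_deriv ?_).congr_of_eventuallyEq (.of_forall fun t => ?_)
    · simp [f₂]; ring
    · simp [f₁]
  have hbx := one_le_bracket x
  have b0 : ∀ y : E3, ‖F (‖y - x‖ ^ 2)‖ ≤ C * bracket y ^ 2 := fun y => by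
    nlinarith [(hC _ (hs0 y)).1, one_le_bracket y, mul_nonneg hC0 (sq_nonneg (bracket y - 1)),
      mul_nonneg hC0 (sub_nonneg.2 (one_le_bracket y))]
  have b1 : ∀ i y, ‖f₁ i y‖ ≤ (4 * C * bracket x) * bracket y ^ 2 := fun i y => by
    simp only [f₁, norm_mul, Complex.norm_real, Real.norm_eq_abs, abs_two]
    have h1 := hcle i y
    have h2 := (hC _ (hs0 y)).2.1
    have h3 : ‖F' (‖y - x‖ ^ 2)‖ * (2 * |c i y|) ≤ C * (2 * (2 * bracket x * bracket y)) := by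
      gcongr
    have h4 : bracket y ≤ bracket y ^ 2 := by nlinarith [one_le_bracket y]
    have h5 : 0 ≤ C * bracket x := by positivity
    nlinarith
  have b2 : ∀ i y, ‖f₂ i y‖ ≤ (16 * C * bracket x ^ 2 + 2 * C) * bracket y ^ 2 := fun i y => by
    refine (norm_add_le _ _).trans ?_
    simp only [norm_mul, Complex.norm_real, Real.norm_eq_abs, abs_pow, sq_abs]
    rw [abs_of_nonneg (by norm_num : (0:ℝ) ≤ 4), Complex.norm_ofNat]
    have h1 : c i y ^ 2 ≤ (2 * bracket x * bracket y) ^ 2 := by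
      rw [← sq_abs]; gcongr; exact hcle i y
    have h2 := (hC _ (hs0 y)).2
    have h3 : ‖F'' (‖y - x‖ ^ 2)‖ * (4 * c i y ^ 2) ≤ C * (4 * (2 * bracket x * bracket y) ^ 2) := by
      gcongr; exact h2.2
    have h4 : 1 ≤ bracket y ^ 2 := by nlinarith [one_le_bracket y]
    nlinarith [h2.1]
  have m1 : ∀ i, Continuous (f₁ i) := fun i =>
    c1.mul (Complex.continuous_ofReal.comp (continuous_const.mul (cc i)))
  have m2 : ∀ i, Continuous (f₂ i) := fun i =>
    (c2.mul (Complex.continuous_ofReal.comp (continuous_const.mul ((cc i).pow 2)))).add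
      (continuous_const.mul c1)
  have key : ∀ i, ∫ y, F (‖y - x‖ ^ 2) * (∂_{b i} (∂_{b i} η : 𝓢(E3, ℂ)) : 𝓢(E3, ℂ)) y = ∫ y, f₂ i y * η y := by
    intro i
    rw [integral_mul_lineDeriv_schwartz _ c0 (m1 i) b0 (b1 i) (d0 i),
      integral_mul_lineDeriv_schwartz _ (m1 i) (m2 i) (b1 i) (b2 i) (d1 i), neg_neg]
  have hlap : ∀ y, (Δ η) y = ∑ i, (∂_{b i} (∂_{b i} η : 𝓢(E3, ℂ)) : 𝓢(E3, ℂ)) y := fun y => by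
    rw [SchwartzMap.laplacian_eq_sum b, _root_.sum_apply]
  simp only [hlap, Finset.mul_sum]
  rw [integral_finsetSum _ fun i _ => integrable_mul_schwartz _ c0.aestronglyMeasurable b0]
  simp only [key]
  rw [← integral_finsetSum _ fun i _ =>
    integrable_mul_schwartz _ (m2 i).aestronglyMeasurable (b2 i)]
  refine integral_congr_ae (.of_forall fun y => ?_)
  -- Summation over the three directions: `∑ cᵢ² = s` produces `4 s F''`, and three copies of `2 F'`
  -- produce `6 F'`, which is `Δ` applied to `F(|y - x|²)`.
  have hn : ‖y - x‖ ^ 2 = ∑ i, c i y ^ 2 := (b.sum_sq_inner_left (y - x)).symm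
  simp only [← Finset.sum_mul]
  congr 1
  simp only [f₂, Finset.sum_add_distrib, ← Finset.mul_sum]
  rw [← Complex.ofReal_sum, ← Finset.mul_sum, ← hn]
  simp
  ring

end

/-! ### The regularized fundamental solution -/

section Regularization

variable (a : ℂ) (ε : ℝ)

/-- The regularized fundamental solution as a function of `s = r²`. -/
def regG (s : ℝ) : ℂ :=
  (((√(ε ^ 2 + s))⁻¹ : ℝ) : ℂ) * Complex.exp (-(a * √(ε ^ 2 + s))) / (4 * Real.pi)

/-- The derivative of `regG`. -/
def regG' (s : ℝ) : ℂ :=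
  -(a * (((√(ε ^ 2 + s))⁻¹ : ℝ) : ℂ) ^ 2 + (((√(ε ^ 2 + s))⁻¹ : ℝ) : ℂ) ^ 3) *
    Complex.exp (-(a * √(ε ^ 2 + s))) / (8 * Real.pi)

/-- The second derivative of `regG`. -/
def regG'' (s : ℝ) : ℂ :=
  (a ^ 2 * (((√(ε ^ 2 + s))⁻¹ : ℝ) : ℂ) ^ 3 + 3 * a * (((√(ε ^ 2 + s))⁻¹ : ℝ) : ℂ) ^ 4 +
    3 * (((√(ε ^ 2 + s))⁻¹ : ℝ) : ℂ) ^ 5) * Complex.exp (-(a * √(ε ^ 2 + s))) / (16 * Real.pi)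

variable {ε}

lemma hasDerivAt_rho (hε : 0 < ε) {s : ℝ} (hs : 0 ≤ s) :
    HasDerivAt (fun s : ℝ => ((√(ε ^ 2 + s) : ℝ) : ℂ))
      ((((√(ε ^ 2 + s))⁻¹ : ℝ) : ℂ) / 2) s := by
  have h0 : ε ^ 2 + s ≠ 0 := by positivity
  have h := ((hasDerivAt_id s).const_add (ε ^ 2)).sqrt h0
  refine h.ofReal_comp.congr_deriv ?_
  have : √(ε ^ 2 + s) ≠ 0 := by positivity
  push_cast
  simp
  ring

lemma hasDerivAt_inv_rho (hε : 0 < ε) {s : ℝ} (hs : 0 ≤ s) :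
    HasDerivAt (fun s : ℝ => (((√(ε ^ 2 + s))⁻¹ : ℝ) : ℂ))
      (-(((√(ε ^ 2 + s))⁻¹ : ℝ) : ℂ) ^ 3 / 2) s := by
  have h0 : ε ^ 2 + s ≠ 0 := by positivity
  have h := ((hasDerivAt_id s).const_add (ε ^ 2)).sqrt h0
  have h2 : √(ε ^ 2 + s) ≠ 0 := by positivity
  refine (h.inv h2).ofReal_comp.congr_deriv ?_
  have h3 : ((√(ε ^ 2 + s) : ℝ) : ℂ) ≠ 0 := Complex.ofReal_ne_zero.2 h2
  push_cast
  simp only [id]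
  field_simp

lemma hasDerivAt_exp_rho (hε : 0 < ε) {s : ℝ} (hs : 0 ≤ s) :
    HasDerivAt (fun s : ℝ => Complex.exp (-(a * √(ε ^ 2 + s))))
      (-(a * (((√(ε ^ 2 + s))⁻¹ : ℝ) : ℂ) / 2) * Complex.exp (-(a * √(ε ^ 2 + s)))) s := by
  have h := ((hasDerivAt_rho hε hs).const_mul a).neg.cexp
  refine h.congr_deriv ?_
  simp only [Pi.neg_apply]
  ring

lemma hasDerivAt_regG (hε : 0 < ε) {s : ℝ} (hs : 0 ≤ s) :
    HasDerivAt (regG a ε) (regG' a ε s) s := by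
  have h := ((hasDerivAt_inv_rho hε hs).mul (hasDerivAt_exp_rho a hε hs)).div_const
    (4 * Real.pi : ℂ)
  refine h.congr_deriv ?_
  have : (Real.pi : ℂ) ≠ 0 := Complex.ofReal_ne_zero.2 Real.pi_ne_zero
  simp only [regG']
  field_simp
  ring

lemma hasDerivAt_regG' (hε : 0 < ε) {s : ℝ} (hs : 0 ≤ s) :
    HasDerivAt (regG' a ε) (regG'' a ε s) s := by
  have hi := hasDerivAt_inv_rho hε hs
  have h := ((((hi.pow 2).const_mul a).add (hi.pow 3)).neg.mul
    (hasDerivAt_exp_rho a hε hs)).div_const (8 * Real.pi : ℂ)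
  refine h.congr_deriv ?_
  have : (Real.pi : ℂ) ≠ 0 := Complex.ofReal_ne_zero.2 Real.pi_ne_zero
  simp only [regG'', Pi.add_apply, Pi.neg_apply, Pi.pow_apply]
  field_simp
  push_cast
  ring

/-- With `ρ² = ε² + s` the function `e^{-aρ}/ρ` satisfies the radial equation in `ρ` exactly, i.e.
with `4ρ²` in front of the second derivative. Writing `s = ρ² - ε²` leaves the defect `-4ε² G''`,
which will turn into the delta function. -/
lemma regG_identity (hε : 0 < ε) {s : ℝ} (hs : 0 ≤ s) :
    4 * (s : ℂ) * regG'' a ε s + 6 * regG' a ε s =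
      a ^ 2 * regG a ε s - 4 * (ε : ℂ) ^ 2 * regG'' a ε s := by
  have h2 : √(ε ^ 2 + s) ≠ 0 := by positivity
  have h3 : ((√(ε ^ 2 + s) : ℝ) : ℂ) ≠ 0 := Complex.ofReal_ne_zero.2 h2
  have hs2 : (s : ℂ) = ((√(ε ^ 2 + s) : ℝ) : ℂ) ^ 2 - (ε : ℂ) ^ 2 := by
    rw [← Complex.ofReal_pow, Real.sq_sqrt (by positivity)]; push_cast; ring
  have : (Real.pi : ℂ) ≠ 0 := Complex.ofReal_ne_zero.2 Real.pi_ne_zero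
  conv_lhs => rw [hs2]
  simp only [regG, regG', regG'']
  push_cast
  field_simp
  ring

variable {a}

lemma norm_exp_rho_le (ha : 0 ≤ a.re) (s : ℝ) :
    ‖Complex.exp (-(a * √(ε ^ 2 + s)))‖ ≤ 1 := norm_exp_neg_mul_le ha (Real.sqrt_nonneg _)

lemma inv_rho_le (hε : 0 < ε) {s : ℝ} (hs : 0 ≤ s) : (√(ε ^ 2 + s))⁻¹ ≤ ε⁻¹ := by
  have : ε ≤ √(ε ^ 2 + s) := Real.le_sqrt_of_sq_le (by linarith)
  exact inv_anti₀ hε this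

lemma norm_regG_le (hε : 0 < ε) (ha : 0 ≤ a.re) {s : ℝ} (hs : 0 ≤ s) : ‖regG a ε s‖ ≤ ε⁻¹ := by
  have h := norm_exp_rho_le (ε := ε) ha s
  have h1 := inv_rho_le hε hs
  have h0 : 0 ≤ (√(ε ^ 2 + s))⁻¹ := by positivity
  have hpi := Real.pi_gt_three
  rw [regG, norm_div, norm_mul, Complex.norm_real, Real.norm_of_nonneg h0]
  have : ‖(4 * Real.pi : ℂ)‖ = 4 * Real.pi := by simp [abs_of_pos Real.pi_pos]
  rw [this, div_le_iff₀ (by positivity)]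
  have hε' : 0 < ε⁻¹ := by positivity
  nlinarith [norm_nonneg (Complex.exp (-(a * √(ε ^ 2 + s))))]

lemma exists_bound_regG (hε : 0 < ε) (ha : 0 ≤ a.re) : ∃ C, ∀ s, 0 ≤ s →
    ‖regG a ε s‖ ≤ C ∧ ‖regG' a ε s‖ ≤ C ∧ ‖regG'' a ε s‖ ≤ C := by
  let B1 := ε⁻¹
  let B2 := (‖a‖ * ε⁻¹ ^ 2 + ε⁻¹ ^ 3)
  let B3 := (‖a‖ ^ 2 * ε⁻¹ ^ 3 + 3 * ‖a‖ * ε⁻¹ ^ 4 + 3 * ε⁻¹ ^ 5)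
  have p1 : 0 < B1 := by positivity
  have p2 : 0 < B2 := by positivity
  have p3 : 0 < B3 := by positivity
  have hpi := Real.pi_gt_three
  refine ⟨B1 + B2 + B3, fun s hs => ⟨?_, ?_, ?_⟩⟩
  · linarith [norm_regG_le hε ha hs]
  all_goals
    have h := norm_exp_rho_le (ε := ε) ha s
    have h1 := inv_rho_le hε hs
    have h0 : 0 ≤ (√(ε ^ 2 + s))⁻¹ := by positivity
    have hn : ‖(((√(ε ^ 2 + s))⁻¹ : ℝ) : ℂ)‖ ≤ ε⁻¹ := by
      rwa [Complex.norm_real, Real.norm_of_nonneg h0]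
  · have e : ‖regG' a ε s‖ ≤ B2 * 1 / 1 := by
      rw [regG', norm_div, norm_mul, norm_neg]
      have : ‖(8 * Real.pi : ℂ)‖ = 8 * Real.pi := by simp [abs_of_pos Real.pi_pos]
      rw [this]
      gcongr
      · refine (norm_add_le _ _).trans ?_
        rw [norm_mul, norm_pow, norm_pow]
        exact add_le_add (mul_le_mul_of_nonneg_left (pow_le_pow_left₀ (norm_nonneg _) hn 2)
          (norm_nonneg _)) (pow_le_pow_left₀ (norm_nonneg _) hn 3)
      · linarith
    linarith
  · have e : ‖regG'' a ε s‖ ≤ B3 * 1 / 1 := by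
      rw [regG'', norm_div, norm_mul]
      have : ‖(16 * Real.pi : ℂ)‖ = 16 * Real.pi := by simp [abs_of_pos Real.pi_pos]
      rw [this]
      gcongr
      · refine (norm_add_le _ _).trans (add_le_add ((norm_add_le _ _).trans ?_) ?_)
        · rw [norm_mul, norm_mul, norm_mul, norm_pow, norm_pow, norm_pow, Complex.norm_ofNat]
          exact add_le_add (mul_le_mul_of_nonneg_left (pow_le_pow_left₀ (norm_nonneg _) hn 3)
            (by positivity)) (mul_le_mul_of_nonneg_left (pow_le_pow_left₀ (norm_nonneg _) hn 4)
            (by positivity))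
        · rw [norm_mul, norm_pow, Complex.norm_ofNat]
          exact mul_le_mul_of_nonneg_left (pow_le_pow_left₀ (norm_nonneg _) hn 5) (by norm_num)
      · linarith
    linarith

variable (a) in
lemma continuousOn_regG'' (hε : 0 < ε) : ContinuousOn (regG'' a ε) (Set.Ici 0) := fun s hs => by
  have hi := (hasDerivAt_inv_rho hε hs).continuousAt
  have he := (hasDerivAt_exp_rho a hε hs).continuousAt
  have : ContinuousAt (regG'' a ε) s := by
    unfold regG''
    fun_prop
  exact this.continuousWithinAt

variable (a) in
lemma continuousOn_regG (hε : 0 < ε) : ContinuousOn (regG a ε) (Set.Ici 0) := fun _ hs =>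
  (hasDerivAt_regG a hε hs).continuousAt.continuousWithinAt

lemma integral_regG (hε : 0 < ε) (ha : 0 ≤ a.re) (x : E3) (η : 𝓢(E3, ℂ)) :
    ∫ y, regG a ε (‖y - x‖ ^ 2) * (-(Δ η) y + a ^ 2 * η y) =
      ∫ y, (4 * (ε : ℂ) ^ 2 * regG'' a ε (‖y - x‖ ^ 2)) * η y := by
  obtain ⟨C, hC⟩ := exists_bound_regG hε ha
  have hs0 : ∀ y : E3, 0 ≤ ‖y - x‖ ^ 2 := fun y => sq_nonneg _
  have hcs : Continuous fun y : E3 => ‖y - x‖ ^ 2 := by fun_prop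
  have c0 : Continuous fun y : E3 => regG a ε (‖y - x‖ ^ 2) :=
    (continuousOn_regG a hε).comp_continuous hcs hs0
  have c2 : Continuous fun y : E3 => regG'' a ε (‖y - x‖ ^ 2) :=
    (continuousOn_regG'' a hε).comp_continuous hcs hs0
  have hb : ∀ y : E3, 1 ≤ bracket y ^ 2 := fun y => by nlinarith [one_le_bracket y]
  have hC0 : 0 ≤ C := (norm_nonneg _).trans (hC 0 le_rfl).1
  have g := integral_comp_norm_sq_mul_laplacian (fun s hs => hasDerivAt_regG a hε hs)
    (fun s hs => hasDerivAt_regG' a hε hs) (continuousOn_regG'' a hε) hC x η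
  have i0 : ∀ ζ : 𝓢(E3, ℂ), Integrable fun y => regG a ε (‖y - x‖ ^ 2) * ζ y := fun ζ =>
    integrable_mul_schwartz ζ c0.aestronglyMeasurable (C := C) fun y => by
      nlinarith [(hC _ (hs0 y)).1, hb y]
  have i2 : Integrable fun y => regG'' a ε (‖y - x‖ ^ 2) * η y :=
    integrable_mul_schwartz η c2.aestronglyMeasurable (C := C) fun y => by
      nlinarith [(hC _ (hs0 y)).2.2, hb y]
  have e1 : ∫ y, regG a ε (‖y - x‖ ^ 2) * (-(Δ η) y + a ^ 2 * η y) =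
      -(∫ y, regG a ε (‖y - x‖ ^ 2) * (Δ η) y) + a ^ 2 * ∫ y, regG a ε (‖y - x‖ ^ 2) * η y := by
    rw [← integral_neg, ← integral_const_mul, ← integral_add (i0 (Δ η)).fun_neg ((i0 η).const_mul _)]
    congr 1; funext y; ring
  rw [e1, g]
  simp only [regG_identity a hε (hs0 _)]
  have e2 : ∫ y, (a ^ 2 * regG a ε (‖y - x‖ ^ 2) - 4 * (ε : ℂ) ^ 2 * regG'' a ε (‖y - x‖ ^ 2)) * η y
      = a ^ 2 * (∫ y, regG a ε (‖y - x‖ ^ 2) * η y) -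
        4 * (ε : ℂ) ^ 2 * ∫ y, regG'' a ε (‖y - x‖ ^ 2) * η y := by
    rw [← integral_const_mul, ← integral_const_mul,
      ← integral_sub ((i0 η).const_mul _) (i2.const_mul _)]
    congr 1; funext y; ring
  rw [e2, neg_sub, sub_add_cancel, ← integral_const_mul]
  congr 1; funext y; ring

end Regularization

/-- Normalization of the approximate identity obtained from the defect `4ε² G''`. The radial density
`r² (1 + r²)^{-5/2}` has the antiderivative `r³ (1 + r²)^{-3/2} / 3`, with limit `1/3`. -/
lemma integral_bracket_five : ∫ w : E3, 3 / (4 * Real.pi) * bracket w ^ (-5 : ℝ) = 1 := by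
  have e : ∀ w : E3, bracket w ^ (-5 : ℝ) = (fun r : ℝ => (√(1 + r ^ 2))⁻¹ ^ 5) ‖w‖ := fun w => by
    rw [Real.rpow_neg (bracket_pos w).le]
    simp only [bracket, ← Real.sqrt_eq_rpow, inv_pow]
    norm_cast
  simp only [integral_const_mul, e]
  rw [integral_radial (fun r : ℝ => (√(1 + r ^ 2))⁻¹ ^ 5)]
  have hd : ∀ r : ℝ, HasDerivAt (fun r : ℝ => r ^ 3 * (√(1 + r ^ 2))⁻¹ ^ 3 / 3)
      (r ^ 2 • (√(1 + r ^ 2))⁻¹ ^ 5) r := fun r => by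
    have h0 : (1 : ℝ) + r ^ 2 ≠ 0 := by positivity
    have h1 : √(1 + r ^ 2) ≠ 0 := by positivity
    have hs := (((hasDerivAt_pow 2 r).const_add 1).sqrt h0).inv h1
    have h := ((hasDerivAt_pow 3 r).mul (hs.pow 3)).div_const 3
    refine h.congr_deriv ?_
    have h2 : √(1 + r ^ 2) ^ 2 = 1 + r ^ 2 := Real.sq_sqrt (by positivity)
    have h3 : r ^ 2 = √(1 + r ^ 2) ^ 2 - 1 := by linarith
    simp only [Pi.inv_apply, Pi.pow_apply, smul_eq_mul]
    generalize √(1 + r ^ 2) = q at *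
    field_simp
    have h4 : q ^ 2 * q⁻¹ ^ 2 = 1 := by field_simp
    push_cast
    linear_combination (6 * r ^ 2) * h2 - 6 * r ^ 4 * h4
  have hlim : Filter.Tendsto (fun r : ℝ => r ^ 3 * (√(1 + r ^ 2))⁻¹ ^ 3 / 3) Filter.atTop
      (nhds (1 / 3)) := by
    have h1 : Filter.Tendsto (fun r : ℝ => (√(1 + (r⁻¹) ^ 2))⁻¹ ^ 3 / 3) Filter.atTop
        (nhds ((√(1 + 0 ^ 2))⁻¹ ^ 3 / 3)) := by
      have hc : ContinuousAt (fun t : ℝ => (√(1 + t ^ 2))⁻¹ ^ 3 / 3) 0 := by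
        have : √(1 + (0 : ℝ) ^ 2) ≠ 0 := by norm_num
        fun_prop (disch := assumption)
      exact hc.tendsto.comp tendsto_inv_atTop_zero
    have h2 : (√(1 + (0 : ℝ) ^ 2))⁻¹ ^ 3 / 3 = 1 / 3 := by norm_num
    rw [h2] at h1
    refine h1.congr' ?_
    filter_upwards [Filter.eventually_gt_atTop 0] with r hr
    have : 1 + r⁻¹ ^ 2 = (1 + r ^ 2) / r ^ 2 := by field_simp; ring
    rw [this, Real.sqrt_div (by positivity), Real.sqrt_sq hr.le]
    have : √(1 + r ^ 2) ≠ 0 := by positivity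
    field_simp
  rw [integral_Ioi_of_hasDerivAt_of_nonneg' (fun r _ => hd r)
    (fun r _ => by rw [smul_eq_mul]; positivity) hlim]
  have := Real.pi_ne_zero
  simp
  field_simp

/-! ### Limit of the regularization: the fundamental solution -/

section

open Filter Topology

lemma regG_eq_gK (a : ℂ) {r : ℝ} (hr : 0 ≤ r) : regG a 0 (r ^ 2) = gK a r := by
  simp only [regG, gK, zero_pow two_ne_zero, zero_add, Real.sqrt_sq hr]
  push_cast
  rw [div_eq_mul_inv, div_eq_mul_inv, mul_inv]
  ring

lemma norm_regG_le_inv {a : ℂ} (ha : 0 ≤ a.re) {ε r : ℝ} (hr : 0 < r) :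
    ‖regG a ε (r ^ 2)‖ ≤ r⁻¹ := by
  have h := norm_exp_rho_le (ε := ε) ha (r ^ 2)
  have h0 : 0 ≤ (√(ε ^ 2 + r ^ 2))⁻¹ := by positivity
  have h1 : (√(ε ^ 2 + r ^ 2))⁻¹ ≤ r⁻¹ :=
    inv_anti₀ hr (Real.le_sqrt_of_sq_le (by nlinarith [sq_nonneg ε]))
  have hpi := Real.pi_gt_three
  rw [regG, norm_div, norm_mul, Complex.norm_real, Real.norm_of_nonneg h0]
  have : ‖(4 * Real.pi : ℂ)‖ = 4 * Real.pi := by simp [abs_of_pos Real.pi_pos]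
  rw [this, div_le_iff₀ (by positivity)]
  have hε' : 0 < r⁻¹ := by positivity
  nlinarith [norm_nonneg (Complex.exp (-(a * √(ε ^ 2 + r ^ 2))))]

lemma tendsto_regG (a : ℂ) {r : ℝ} (hr : 0 < r) :
    Tendsto (fun ε => regG a ε (r ^ 2)) (𝓝[>] 0) (𝓝 (gK a r)) := by
  rw [← regG_eq_gK a hr.le]
  have : ContinuousAt (fun ε => regG a ε (r ^ 2)) 0 := by
    have : √((0 : ℝ) ^ 2 + r ^ 2) ≠ 0 := by positivity
    unfold regG
    fun_prop (disch := assumption)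
  exact this.tendsto.mono_left nhdsWithin_le_nhds

lemma sqrt_scale {ε : ℝ} (hε : 0 < ε) (w : E3) :
    √(ε ^ 2 + ‖ε • w‖ ^ 2) = ε * bracket w := by
  rw [norm_smul, Real.norm_of_nonneg hε.le,
    show ε ^ 2 + (ε * ‖w‖) ^ 2 = (ε * bracket w) ^ 2 by rw [mul_pow ε (bracket w), bracket_sq]; ring,
    Real.sqrt_sq (mul_pos hε (bracket_pos w)).le]

/-- The rescaled right hand side of the regularized equation. -/
lemma scaled_regG'' (a : ℂ) {ε : ℝ} (hε : 0 < ε) (w : E3) :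
    (ε : ℂ) ^ 3 * (4 * (ε : ℂ) ^ 2 * regG'' a ε (‖ε • w‖ ^ 2)) =
      (a ^ 2 * (ε : ℂ) ^ 2 * (((bracket w)⁻¹ : ℝ) : ℂ) ^ 3 +
        3 * a * ε * (((bracket w)⁻¹ : ℝ) : ℂ) ^ 4 + 3 * (((bracket w)⁻¹ : ℝ) : ℂ) ^ 5) *
        Complex.exp (-(a * ((ε * bracket w : ℝ) : ℂ))) / (4 * Real.pi) := by
  rw [regG'', sqrt_scale hε]
  have h1 : (ε : ℂ) ≠ 0 := Complex.ofReal_ne_zero.2 hε.ne'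
  have h2 : (bracket w : ℂ) ≠ 0 := Complex.ofReal_ne_zero.2 (bracket_pos w).ne'
  have h3 : (Real.pi : ℂ) ≠ 0 := Complex.ofReal_ne_zero.2 Real.pi_ne_zero
  push_cast
  field_simp
  ring

lemma schwartz_bound (η : 𝓢(E3, ℂ)) : ∃ C, 0 ≤ C ∧ ∀ x, (1 + ‖x‖) * ‖η x‖ ≤ C := by
  obtain ⟨C₀, hC₀⟩ := η.decay 0 0
  obtain ⟨C₁, hC₁⟩ := η.decay 1 0
  refine ⟨C₀ + C₁, by linarith [hC₀.1, hC₁.1], fun x => ?_⟩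
  have h0 := hC₀.2 x
  have h1 := hC₁.2 x
  simp only [norm_iteratedFDeriv_zero, pow_zero, pow_one, one_mul] at h0 h1
  linarith

/-- After `y = x + ε w` the defect becomes a fixed profile: the terms containing `a` carry powers of
`ε`, and what survives is `3/(4π) ⟨w⟩⁻⁵`, of total mass one. -/
lemma tendsto_integral_regG'' {a : ℂ} (ha : 0 ≤ a.re) (x : E3) (η : 𝓢(E3, ℂ)) :
    Tendsto (fun ε : ℝ => ∫ y, (4 * (ε : ℂ) ^ 2 * regG'' a ε (‖y - x‖ ^ 2)) * η y)
      (𝓝[>] 0) (𝓝 (η x)) := by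
  let Φ : ℝ → E3 → ℂ := fun ε w =>
    (a ^ 2 * (ε : ℂ) ^ 2 * (((bracket w)⁻¹ : ℝ) : ℂ) ^ 3 +
        3 * a * ε * (((bracket w)⁻¹ : ℝ) : ℂ) ^ 4 + 3 * (((bracket w)⁻¹ : ℝ) : ℂ) ^ 5) *
        Complex.exp (-(a * ((ε * bracket w : ℝ) : ℂ))) / (4 * Real.pi) * η (x + ε • w)
  have e1 : ∀ ε : ℝ, 0 < ε →
      ∫ y, (4 * (ε : ℂ) ^ 2 * regG'' a ε (‖y - x‖ ^ 2)) * η y = ∫ w, Φ ε w := by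
    intro ε hε
    rw [← integral_add_right_eq_self _ x]
    have := Measure.integral_comp_smul (volume : Measure E3)
      (fun y => (4 * (ε : ℂ) ^ 2 * regG'' a ε (‖y‖ ^ 2)) * η (x + y)) ε
    simp only [finrank_euclideanSpace, Fintype.card_fin] at this
    simp only [add_sub_cancel_right]
    have e2 : ∫ w, Φ ε w =
        ∫ w, ((ε : ℂ) ^ 3) * ((4 * (ε : ℂ) ^ 2 * regG'' a ε (‖ε • w‖ ^ 2)) * η (x + ε • w)) := by
      congr 1; funext w
      simp only [Φ]
      rw [← scaled_regG'' a hε w]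
      ring
    rw [e2, integral_const_mul, this, abs_of_pos (by positivity)]
    have h1 : (ε : ℂ) ≠ 0 := Complex.ofReal_ne_zero.2 hε.ne'
    rw [RCLike.real_smul_eq_coe_mul (K := ℂ), ← mul_assoc]
    simp only [Complex.coe_algebraMap]
    push_cast
    rw [mul_inv_cancel₀ (pow_ne_zero 3 h1), one_mul]
    simp only [add_comm x]
  have hlim0 : ∫ w : E3, (3 * (((bracket w)⁻¹ : ℝ) : ℂ) ^ 5) / (4 * Real.pi) * η x = η x := by
    rw [integral_mul_const]
    have : ∫ w : E3, (3 * (((bracket w)⁻¹ : ℝ) : ℂ) ^ 5) / (4 * Real.pi) = 1 := by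
      have h := congrArg (fun t : ℝ => (t : ℂ)) integral_bracket_five
      simp only [← integral_complex_ofReal] at h
      rw [← Complex.ofReal_one, ← h]
      congr 1; funext w
      rw [Real.rpow_neg (bracket_pos w).le]
      norm_cast
      rw [inv_pow]
      ring
    rw [this, one_mul]
  obtain ⟨C, hC0, hC⟩ := schwartz_bound η
  have hCη : ∀ y, ‖η y‖ ≤ C := fun y => by nlinarith [hC y, norm_nonneg y, norm_nonneg (η y)]
  have key : Tendsto (fun ε => ∫ w, Φ ε w) (𝓝[>] 0)
      (𝓝 (∫ w : E3, (3 * (((bracket w)⁻¹ : ℝ) : ℂ) ^ 5) / (4 * Real.pi) * η x)) := by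
    refine tendsto_integral_filter_of_dominated_convergence
      (fun w => (‖a‖ ^ 2 * ((2 + ‖x‖) * C) + 3 * ‖a‖ * C + 3 * C) * bracket w ^ (-4 : ℝ)) ?_ ?_ ?_ ?_
    · refine .of_forall fun ε => ?_
      have hc : Continuous fun w : E3 => (bracket w)⁻¹ :=
        continuous_bracket.inv₀ fun w => (bracket_pos w).ne'
      have hb := continuous_bracket
      have hη := η.continuous
      simp only [Φ]
      refine Continuous.aestronglyMeasurable ?_
      fun_prop
    · have hmem : Set.Ioc (0 : ℝ) 1 ∈ 𝓝[>] (0 : ℝ) := Ioc_mem_nhdsGT one_pos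
      filter_upwards [hmem] with ε hε
      refine .of_forall fun w => ?_
      have hE := norm_exp_neg_mul_le ha (mul_pos hε.1 (bracket_pos w)).le
      have hb := one_le_bracket w
      have hb0 : 0 < (bracket w)⁻¹ := inv_pos.2 (bracket_pos w)
      have hb1 : (bracket w)⁻¹ ≤ 1 := inv_le_one_of_one_le₀ hb
      have e4 : bracket w ^ (-4 : ℝ) = (bracket w)⁻¹ ^ 4 := by
        rw [Real.rpow_neg (bracket_pos w).le, inv_pow]; norm_cast
      have hn : ‖(((bracket w)⁻¹ : ℝ) : ℂ)‖ = (bracket w)⁻¹ := by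
        rw [Complex.norm_real, Real.norm_of_nonneg hb0.le]
      have hεn : ‖(ε : ℂ)‖ = ε := by rw [Complex.norm_real, Real.norm_of_nonneg hε.1.le]
      -- The term `ε² ⟨w⟩⁻³` is not integrable uniformly in `ε` on its own. Rewriting it as `ε (ε
      -- ⟨w⟩) ⟨w⟩⁻⁴`, the factor `ε ⟨w⟩` is absorbed by the decay of `η` at `x + ε w`.
      have hdec : ε * bracket w * ‖η (x + ε • w)‖ ≤ (2 + ‖x‖) * C := by
        have h1 : ε * bracket w ≤ (2 + ‖x‖) * (1 + ‖x + ε • w‖) := by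
          have h2 : ε * ‖w‖ ≤ ‖x + ε • w‖ + ‖x‖ := by
            have := norm_sub_le (x + ε • w) x
            rwa [add_sub_cancel_left, norm_smul, Real.norm_of_nonneg hε.1.le] at this
          have h3 := mul_le_mul_of_nonneg_left (bracket_le w) hε.1.le
          have h4 := hε.2
          nlinarith [norm_nonneg x, norm_nonneg (x + ε • w)]
        calc ε * bracket w * ‖η (x + ε • w)‖
            ≤ (2 + ‖x‖) * (1 + ‖x + ε • w‖) * ‖η (x + ε • w)‖ := by gcongr
          _ = (2 + ‖x‖) * ((1 + ‖x + ε • w‖) * ‖η (x + ε • w)‖) := by ring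
          _ ≤ _ := by gcongr; exact hC _
      have hpi := Real.pi_gt_three
      have hpin : ‖(4 * Real.pi : ℂ)‖ = 4 * Real.pi := by simp [abs_of_pos Real.pi_pos]
      simp only [Φ]
      rw [norm_mul, norm_div, norm_mul, hpin, e4]
      have hsum : ‖a ^ 2 * (ε : ℂ) ^ 2 * (((bracket w)⁻¹ : ℝ) : ℂ) ^ 3 +
          3 * a * ε * (((bracket w)⁻¹ : ℝ) : ℂ) ^ 4 + 3 * (((bracket w)⁻¹ : ℝ) : ℂ) ^ 5‖ ≤
          ‖a‖ ^ 2 * ε ^ 2 * (bracket w)⁻¹ ^ 3 + 3 * ‖a‖ * ε * (bracket w)⁻¹ ^ 4 +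
            3 * (bracket w)⁻¹ ^ 5 := by
        refine (norm_add_le _ _).trans (add_le_add ((norm_add_le _ _).trans ?_) ?_)
        · simp [norm_pow, abs_of_pos (bracket_pos w), abs_of_pos hε.1]
        · simp [norm_pow, abs_of_pos (bracket_pos w)]
      have h1 : ‖a ^ 2 * (ε : ℂ) ^ 2 * (((bracket w)⁻¹ : ℝ) : ℂ) ^ 3 +
          3 * a * ε * (((bracket w)⁻¹ : ℝ) : ℂ) ^ 4 + 3 * (((bracket w)⁻¹ : ℝ) : ℂ) ^ 5‖ *
          ‖Complex.exp (-(a * ((ε * bracket w : ℝ) : ℂ)))‖ / (4 * Real.pi) ≤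
          (‖a‖ ^ 2 * ε ^ 2 * (bracket w)⁻¹ ^ 3 + 3 * ‖a‖ * ε * (bracket w)⁻¹ ^ 4 +
            3 * (bracket w)⁻¹ ^ 5) * 1 / 1 := by
        have hε0 := hε.1
        gcongr
        linarith
      refine (mul_le_mul_of_nonneg_right h1 (norm_nonneg _)).trans ?_
      rw [mul_one, div_one]
      have t1 : ‖a‖ ^ 2 * ε ^ 2 * (bracket w)⁻¹ ^ 3 * ‖η (x + ε • w)‖ ≤
          ‖a‖ ^ 2 * ((2 + ‖x‖) * C) * (bracket w)⁻¹ ^ 4 := by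
        have e : ‖a‖ ^ 2 * ε ^ 2 * (bracket w)⁻¹ ^ 3 * ‖η (x + ε • w)‖ =
            ‖a‖ ^ 2 * (ε * (ε * bracket w * ‖η (x + ε • w)‖)) * (bracket w)⁻¹ ^ 4 := by
          have := (bracket_pos w).ne'
          field_simp
        rw [e]
        refine mul_le_mul_of_nonneg_right (mul_le_mul_of_nonneg_left ?_ (by positivity))
          (by positivity)
        have h0 : 0 ≤ ε * bracket w * ‖η (x + ε • w)‖ := by
          have := bracket_pos w; have := hε.1; positivity
        nlinarith [hε.2]
      have t2 : 3 * ‖a‖ * ε * (bracket w)⁻¹ ^ 4 * ‖η (x + ε • w)‖ ≤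
          3 * ‖a‖ * 1 * (bracket w)⁻¹ ^ 4 * C := by
        gcongr
        · exact hε.2
        · exact hCη _
      have t3 : 3 * (bracket w)⁻¹ ^ 5 * ‖η (x + ε • w)‖ ≤ 3 * (bracket w)⁻¹ ^ 4 * C := by
        gcongr ?_ * ?_ * ?_
        · exact pow_le_pow_of_le_one hb0.le hb1 (by norm_num)
        · exact hCη _
      nlinarith
    · exact (integrable_bracket (by norm_num)).const_mul _
    · refine .of_forall fun w => ?_
      have hcont : ContinuousAt (fun ε => Φ ε w) 0 := by
        have hη := η.continuous
        simp only [Φ]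
        fun_prop
      have := hcont.tendsto.mono_left (nhdsWithin_le_nhds (s := Set.Ioi 0))
      simpa [Φ] using this
  rw [hlim0] at key
  refine key.congr' ?_
  filter_upwards [self_mem_nhdsWithin] with ε hε
  exact (e1 ε hε).symm

/-- `e^{-ar} / 4πr` is a fundamental solution of `-Δ + a²`. -/
theorem integral_gK_mul_schwartz {a : ℂ} (ha : 0 ≤ a.re) (x : E3) (η : 𝓢(E3, ℂ)) :
    ∫ y, gK a ‖y - x‖ * (-(Δ η) y + a ^ 2 * η y) = η x := by
  have h1 := tendsto_integral_regG'' ha x η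
  have h2 : Tendsto (fun ε : ℝ => ∫ y, regG a ε (‖y - x‖ ^ 2) * (-(Δ η) y + a ^ 2 * η y))
      (𝓝[>] 0) (𝓝 (∫ y, gK a ‖y - x‖ * (-(Δ η) y + a ^ 2 * η y))) := by
    have hi : Integrable fun y => ‖y - x‖⁻¹ * (‖(Δ η) y‖ + ‖a‖ ^ 2 * ‖η y‖) := by
      refine ((integrable_inv_norm_sub_mul_schwartz (Δ η) x).add
        ((integrable_inv_norm_sub_mul_schwartz η x).const_mul (‖a‖ ^ 2))).congr
        (.of_forall fun y => ?_)
      simp only [Pi.add_apply]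
      ring
    have hne : ∀ᵐ y : E3, y ≠ x := by
      simp [ae_iff]
    refine tendsto_integral_filter_of_dominated_convergence _ ?_ ?_ hi ?_
    · filter_upwards [self_mem_nhdsWithin] with ε hε
      have hcs : Continuous fun y : E3 => ‖y - x‖ ^ 2 := by fun_prop
      have c0 : Continuous fun y : E3 => regG a ε (‖y - x‖ ^ 2) :=
        (continuousOn_regG a hε).comp_continuous hcs fun y =>
          Set.mem_Ici.2 (sq_nonneg _)
      have hη := η.continuous
      have hη' := (Δ η).continuous
      exact (c0.mul (hη'.neg.add (continuous_const.mul hη))).aestronglyMeasurable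
    · refine .of_forall fun ε => ?_
      filter_upwards [hne] with y hy
      rw [norm_mul]
      have hr : 0 < ‖y - x‖ := norm_pos_iff.2 (sub_ne_zero.2 hy)
      refine mul_le_mul (norm_regG_le_inv ha hr) ?_ (norm_nonneg _) (by positivity)
      refine (norm_add_le _ _).trans (le_of_eq ?_)
      rw [norm_neg, norm_mul, norm_pow]
    · filter_upwards [hne] with y hy
      have hr : 0 < ‖y - x‖ := norm_pos_iff.2 (sub_ne_zero.2 hy)
      exact (tendsto_regG a hr).mul_const _
  refine tendsto_nhds_unique h2 (h1.congr' ?_)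
  filter_upwards [self_mem_nhdsWithin] with ε hε
  exact (integral_regG hε ha x η).symm

end

section

open scoped FourierTransform

/-! ### The Laplacian on `H²` -/

section H2lemmas

variable {F : Type*} [NormedAddCommGroup F] [InnerProductSpace ℂ F] [CompleteSpace F]

/-- `L²` functions valued in `F`. -/
abbrev L2v (F : Type*) [NormedAddCommGroup F] : Type _ := Lp F 2 (volume : Measure E3)

/-- In the normalization `e^{-2πi x·ξ}` of the Fourier transform, `-Δ` has symbol `(2π)² |ξ|²`,
while the Bessel symbol is `1 + |ξ|²`; hence the factor `(2π)⁻²`. -/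
lemma besselPotential_two_eq (f : 𝓢'(E3, F)) :
    besselPotential E3 F 2 f = f - (((2 * Real.pi) ^ 2 : ℝ)⁻¹ : ℂ) • Δ f := by
  have h1 : (fun x : E3 => (((1 + ‖x‖ ^ 2) ^ ((2 : ℝ) / 2) : ℝ) : ℂ)) =
      (fun _ => (1 : ℂ)) + fun x => Complex.ofReal (‖x‖ ^ 2) := by
    funext x
    simp
  have h3 : (fun x : E3 => Complex.ofReal (‖x‖ ^ 2)).HasTemperateGrowth := by fun_prop
  have h4 : (fun _ : E3 => (1 : ℂ)).HasTemperateGrowth := by fun_prop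
  have hpi : ((2 * Real.pi) ^ 2 : ℝ) ≠ 0 := by positivity
  rw [besselPotential, h1, laplacian_eq_fourierMultiplierCLM, fourierMultiplierCLM_apply,
    smulLeftCLM_add h4 h3, _root_.add_apply, FourierTransform.fourierInv_add]
  rw [smulLeftCLM_const, one_smul, FourierTransform.fourierInv_fourier_eq,
    fourierMultiplierCLM_apply, sub_eq_add_neg]
  congr 1
  rw [neg_smul, smul_neg, neg_neg, RCLike.real_smul_eq_coe_smul (K := ℂ), smul_smul]
  rw [← Complex.ofReal_inv, RCLike.ofReal_eq_complex_ofReal, ← Complex.ofReal_mul,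
    inv_mul_cancel₀ hpi, Complex.ofReal_one, one_smul]

lemma toTD_sub (f g : L2v F) : ((f - g : L2v F) : 𝓢'(E3, F)) = (f : 𝓢'(E3, F)) - g :=
  map_sub (Lp.toTemperedDistributionCLM F (volume : Measure E3) 2) f g

lemma toTD_smul (c : ℂ) (f : L2v F) : ((c • f : L2v F) : 𝓢'(E3, F)) = c • (f : 𝓢'(E3, F)) :=
  map_smul (Lp.toTemperedDistributionCLM F (volume : Measure E3) 2) c f

/-- An `L²` function whose distributional Laplacian is in `L²` belongs to `H²`. -/
lemma mem_H2_of_laplacian {f g : L2v F} (h : Δ (f : 𝓢'(E3, F)) = (g : 𝓢'(E3, F))) :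
    ∃ hf : f ∈ H2 F, laplaceH2 ⟨f, hf⟩ = g := by
  have hf : f ∈ H2 F := by
    refine ⟨f - (((2 * Real.pi) ^ 2 : ℝ)⁻¹ : ℂ) • g, ?_⟩
    rw [besselPotential_two_eq, h, toTD_sub, toTD_smul]
  exact ⟨hf, toTemperedDistribution_inj (by rw [laplaceH2_spec, h])⟩

lemma mem_H2_of_forall_schwartz {f g : L2v F}
    (h : ∀ φ : 𝓢(E3, ℂ), ∫ x, (Δ φ) x • f x = ∫ x, φ x • g x) :
    ∃ hf : f ∈ H2 F, laplaceH2 ⟨f, hf⟩ = g := by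
  refine mem_H2_of_laplacian ?_
  ext φ
  rw [laplacian_apply_apply, Lp.toTemperedDistribution_apply, Lp.toTemperedDistribution_apply]
  exact h φ

lemma integral_laplace_smul (f : H2 F) (φ : 𝓢(E3, ℂ)) :
    ∫ x, (Δ φ) x • (f : L2v F) x = ∫ x, φ x • laplaceH2 f x := by
  have h := laplaceH2_spec f
  have h2 := congrArg (fun T : 𝓢'(E3, F) => T φ) h
  simp only [laplacian_apply_apply, Lp.toTemperedDistribution_apply] at h2
  exact h2.symm

/-- The function `(1 + |ξ|²)^{-1}`. -/
def besselSymbol (ξ : E3) : ℂ := ((1 + ‖ξ‖ ^ 2) ^ ((-2 : ℝ) / 2) : ℝ)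

lemma hasTemperateGrowth_besselSymbol : besselSymbol.HasTemperateGrowth := by
  unfold besselSymbol
  fun_prop

lemma memLp_besselSymbol : MemLp besselSymbol ⊤ (volume : Measure E3) := by
  refine memLp_top_of_bound
    hasTemperateGrowth_besselSymbol.1.continuous.aestronglyMeasurable 1 (.of_forall fun ξ => ?_)
  rw [besselSymbol, Complex.norm_real, Real.norm_of_nonneg (by positivity)]
  exact Real.rpow_le_one_of_one_le_of_nonpos (by nlinarith [norm_nonneg ξ]) (by norm_num)

lemma star_besselSymbol (ξ : E3) : (starRingEnd ℂ) (besselSymbol ξ) = besselSymbol ξ := by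
  rw [besselSymbol, Complex.conj_ofReal]

/-- The Fourier description of `H²` functions and of their Laplacian. -/
lemma exists_bessel (f : H2 F) : ∃ b : L2v F,
    laplaceH2 f = (((2 * Real.pi) ^ 2 : ℝ) : ℂ) • ((f : L2v F) - b) ∧
    ∀ᵐ ξ, (𝓕 (f : L2v F) : L2v F) ξ = besselSymbol ξ • (𝓕 b : L2v F) ξ := by
  obtain ⟨b, hb⟩ := f.2
  refine ⟨b, ?_, ?_⟩
  · apply toTemperedDistribution_inj
    have hpi : (((2 * Real.pi) ^ 2 : ℝ) : ℂ) ≠ 0 := by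
      rw [Complex.ofReal_ne_zero]; positivity
    rw [laplaceH2_spec, toTD_smul, toTD_sub, ← hb, besselPotential_two_eq, sub_sub_cancel,
      smul_smul, mul_inv_cancel₀ hpi, one_smul]
  · have h1 : besselPotential E3 F (-2) (b : 𝓢'(E3, F)) = ((f : L2v F) : 𝓢'(E3, F)) :=
      (besselPotential_neg_apply_eq_iff _ _ _).2 hb
    have h2 := congrArg (fun T : 𝓢'(E3, F) => 𝓕 T) h1
    simp only [fourier_besselPotential_eq_smulLeftCLM_fourier_apply] at h2
    rw [Lp.fourier_toTemperedDistribution_eq, Lp.fourier_toTemperedDistribution_eq] at h2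
    have h3 := Lp.toTemperedDistribution_smul_eq (p := ⊤) (q := 2) (r := 2)
      hasTemperateGrowth_besselSymbol memLp_besselSymbol (𝓕 b : L2v F)
    have h4 : (𝓕 (f : L2v F) : L2v F) = (memLp_besselSymbol.toLp _ • (𝓕 b : L2v F) : L2v F) := by
      apply toTemperedDistribution_inj
      rw [h3, ← h2]
      rfl
    rw [h4]
    filter_upwards [Lp.coeFn_lpSMul (r := 2) (memLp_besselSymbol.toLp _) (𝓕 b : L2v F),
      memLp_besselSymbol.coeFn_toLp] with ξ h5 h6
    rw [h5, Pi.smul_apply', h6]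

/-- The Laplacian is symmetric on `H²`. -/
lemma inner_laplaceH2 (f g : H2 F) :
    inner ℂ (laplaceH2 f) (g : L2v F) = inner ℂ (f : L2v F) (laplaceH2 g) := by
  obtain ⟨b, hb, hb'⟩ := exists_bessel f
  obtain ⟨c, hc, hc'⟩ := exists_bessel g
  have key : inner ℂ b (g : L2v F) = inner ℂ (f : L2v F) c := by
    rw [← Lp.inner_fourier_eq b, ← Lp.inner_fourier_eq (f : L2v F), L2.inner_def, L2.inner_def]
    refine integral_congr_ae ?_
    filter_upwards [hb', hc'] with ξ h1 h2
    rw [h1, h2, inner_smul_left, inner_smul_right, star_besselSymbol]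
  rw [hb, hc, inner_smul_left, inner_smul_right, inner_sub_left, inner_sub_right, key,
    Complex.conj_ofReal]

lemma schwartz_mem_H2 (η : 𝓢(E3, F)) : η.toLp 2 (volume : Measure E3) ∈ H2 F := by
  change MemSobolev 2 2 ((η.toLp 2 (volume : Measure E3) : L2v F) : 𝓢'(E3, F))
  rw [Lp.toTemperedDistribution_toLp_eq]
  exact η.memSobolev

lemma dense_H2 : Dense ((H2 F : Submodule ℂ (L2v F)) : Set (L2v F)) := by
  refine (SchwartzMap.denseRange_toLpCLM (F := F) (μ := (volume : Measure E3))
    (p := 2) (by norm_num)).mono ?_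
  rintro _ ⟨η, rfl⟩
  exact schwartz_mem_H2 η

/-- Constant coefficient linear maps in the values commute with the Laplacian. -/
lemma compLp_mem_H2 {F' : Type*} [NormedAddCommGroup F'] [InnerProductSpace ℂ F'] [CompleteSpace F']
    (L : F →L[ℂ] F') (f : H2 F) : ∃ h : L.compLp (f : L2v F) ∈ H2 F',
      laplaceH2 ⟨L.compLp (f : L2v F), h⟩ = L.compLp (laplaceH2 f) := by
  have hint : ∀ (ζ : 𝓢(E3, ℂ)) (g : L2v F), Integrable fun x => ζ x • g x := fun ζ g =>
    memLp_one_iff_integrable.1 (MemLp.smul (p := 2) (q := 2) (r := 1) (Lp.memLp g) (ζ.memLp 2))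
  have hcomp : ∀ (ζ : 𝓢(E3, ℂ)) (g : L2v F),
      ∫ x, ζ x • L.compLp g x = L (∫ x, ζ x • g x) := fun ζ g => by
    rw [← L.integral_comp_comm (hint ζ g)]
    refine integral_congr_ae ?_
    filter_upwards [L.coeFn_compLp g] with x hx
    rw [hx, map_smul]
  refine mem_H2_of_forall_schwartz fun φ => ?_
  rw [hcomp, hcomp, integral_laplace_smul]

end H2lemmas

end

/-! ### The resolvent of the Laplacian as a convolution operator -/

lemma measurable_gK_norm (a : ℂ) : Measurable fun x : E3 => gK a ‖x‖ :=
  (measurable_gK a).comp measurable_norm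

lemma integral_id_mul_exp {c : ℝ} (hc : 0 < c) :
    IntegrableOn (fun r : ℝ => r * Real.exp (-(c * r))) (Set.Ioi 0) ∧
      ∫ r in Set.Ioi (0 : ℝ), r * Real.exp (-(c * r)) = 1 / c ^ 2 := by
  have h1 := Real.integral_rpow_mul_exp_neg_mul_Ioi (a := 2) (r := c) (by norm_num) hc
  have h2 := integrableOn_rpow_mul_exp_neg_mul_rpow (s := 1) (p := 1) (b := c) (by norm_num)
    one_pos hc
  refine ⟨h2.congr_fun (fun r _ => ?_) measurableSet_Ioi, ?_⟩
  · simp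
  · convert h1 using 1
    · refine setIntegral_congr_fun measurableSet_Ioi fun r _ => ?_
      norm_num
    · norm_num [Real.Gamma_two]

/-! ### Norms of the kernel `e^{-ar} / 4πr` in `L¹` and `L²` -/

section

variable {a : ℂ}

lemma integrable_gK (ha : 0 < a.re) : Integrable fun x : E3 => gK a ‖x‖ := by
  rw [← integrable_norm_iff (measurable_gK_norm a).aestronglyMeasurable]
  refine (integrable_radial (f := fun r => ‖gK a r‖)).2 ?_
  have h := (integral_id_mul_exp ha).1.const_mul ((4 * Real.pi)⁻¹)
  refine IntegrableOn.congr_fun h (fun r hr => ?_) measurableSet_Ioi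
  have hr' : 0 < r := hr
  simp only [norm_gK a hr'.le, smul_eq_mul]
  field_simp

lemma integral_norm_gK (ha : 0 < a.re) : ∫ x : E3, ‖gK a ‖x‖‖ = 1 / a.re ^ 2 := by
  rw [integral_radial (fun r => ‖gK a r‖), ← (integral_id_mul_exp ha).2, smul_eq_mul,
    ← integral_const_mul]
  refine setIntegral_congr_fun measurableSet_Ioi fun r hr => ?_
  have hr' : 0 < r := hr
  simp only [norm_gK a hr'.le, smul_eq_mul]
  field_simp

lemma sq_mul_norm_gK_sq {r : ℝ} (hr : 0 < r) : r ^ 2 • ‖gK a r‖ ^ 2 =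
    ((4 * Real.pi) ^ 2)⁻¹ * Real.exp (-(2 * a.re) * r) := by
  rw [norm_gK a hr.le, smul_eq_mul, show -(2 * a.re) * r = -(a.re * r) + -(a.re * r) by ring,
    Real.exp_add]
  field_simp

lemma integrable_norm_gK_sq (ha : 0 < a.re) : Integrable fun x : E3 => ‖gK a ‖x‖‖ ^ 2 := by
  refine (integrable_radial (f := fun r => ‖gK a r‖ ^ 2)).2 ?_
  have h := (integrableOn_exp_mul_Ioi (a := -(2 * a.re)) (by linarith) 0).const_mul
    ((4 * Real.pi) ^ 2)⁻¹
  exact IntegrableOn.congr_fun h (fun r hr => (sq_mul_norm_gK_sq hr).symm) measurableSet_Ioi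

lemma integral_norm_gK_sq (ha : 0 < a.re) :
    ∫ x : E3, ‖gK a ‖x‖‖ ^ 2 = 1 / (8 * Real.pi * a.re) := by
  rw [integral_radial (fun r => ‖gK a r‖ ^ 2),
    setIntegral_congr_fun measurableSet_Ioi fun r hr => sq_mul_norm_gK_sq hr, integral_const_mul,
    integral_exp_mul_Ioi (by linarith)]
  have := Real.pi_pos
  simp
  field_simp
  ring

end

/-! ### Convolution with the kernel inverts `-Δ + a²` -/

section Green

variable {F : Type*} [NormedAddCommGroup F] [InnerProductSpace ℂ F] {a : ℂ}

lemma integrable_gK_smul (ha : 0 < a.re) (f : L2v F) (x : E3) :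
    Integrable (fun y => gK a ‖x - y‖ • f y) ∧
      ∫ y, ‖gK a ‖x - y‖‖ * ‖f y‖ ≤ √(1 / (8 * Real.pi * a.re)) * ‖f‖ := by
  have hs : Integrable fun y => ‖gK a ‖x - y‖‖ ^ 2 := (integrable_norm_gK_sq ha).comp_sub_left x
  have hm : Measurable fun y => gK a ‖x - y‖ :=
    (measurable_gK_norm a).comp (measurable_const.sub measurable_id)
  have hg : MemLp (fun y => ‖gK a ‖x - y‖‖) 2 volume :=
    (memLp_two_iff_integrable_sq hm.norm.aestronglyMeasurable).2 hs
  obtain ⟨h1, h2⟩ := integral_mul_norm_le (fun y => norm_nonneg _) hg f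
  constructor
  · refine h1.mono' (hm.aestronglyMeasurable.smul (Lp.aestronglyMeasurable f))
      (.of_forall fun y => (norm_smul _ _).le)
  · rwa [integral_sub_left_eq_self (fun y => ‖gK a ‖y‖‖ ^ 2) volume x, integral_norm_gK_sq ha] at h2

/-- The sup bound grows only like `(Re a)^{-1/2}` as `Re a → 0`, against `(Re a)⁻²` for the bound in
`L²`. This is why `ε²` times a potential with `Re a = ε` tends to zero pointwise, whereas its `L²`
norm is merely bounded. -/
lemma norm_convolution_le (ha : 0 < a.re) (f : L2v F) (x : E3) :
    ‖∫ y, gK a ‖x - y‖ • f y‖ ≤ √(1 / (8 * Real.pi * a.re)) * ‖f‖ := by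
  refine (norm_integral_le_integral_norm _).trans ?_
  simp only [norm_smul]
  exact (integrable_gK_smul ha f x).2

lemma aesm_gK_smul_prod (a : ℂ) {f : E3 → F} (hf : AEStronglyMeasurable f volume) :
    AEStronglyMeasurable (fun p : E3 × E3 => gK a ‖p.1 - p.2‖ • f p.2) (volume.prod volume) :=
  ((measurable_gK_norm a).comp (measurable_fst.sub measurable_snd)).aestronglyMeasurable.smul
    hf.comp_snd

/-- Young's inequality for the convolution with `gK a`. -/
lemma memLp_convolution (ha : 0 < a.re) (f : L2v F) :
    MemLp (fun x => ∫ y, gK a ‖x - y‖ • f y) 2 volume ∧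
      ∫ x, ‖∫ y, gK a ‖x - y‖ • f y‖ ^ 2 ≤ (1 / a.re ^ 2 * ‖f‖) ^ 2 := by
  have hm : AEStronglyMeasurable (fun x => ∫ y, gK a ‖x - y‖ • f y) volume :=
    (aesm_gK_smul_prod a (Lp.aestronglyMeasurable f)).integral_prod_right'
  have hk := (integrable_gK ha).norm
  have hf2 : Integrable fun y => ‖f y‖ ^ 2 := memLp_two_integrable_norm_sq (Lp.memLp f)
  have hprod := hf2.convolution_integrand (ContinuousLinearMap.mul ℝ ℝ) hk
  have hleft := hprod.integral_prod_left
  simp only [ContinuousLinearMap.mul_apply'] at hprod hleft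
  have hval : ∫ x, ∫ y, ‖f y‖ ^ 2 * ‖gK a ‖x - y‖‖ = ‖f‖ ^ 2 * (1 / a.re ^ 2) := by
    have := integral_convolution (ContinuousLinearMap.mul ℝ ℝ) hf2 hk
      (μ := (volume : Measure E3))
    simp only [convolution, ContinuousLinearMap.mul_apply'] at this
    rw [this, integral_norm_gK ha, norm_sq_eq_integral]
  have hpt : ∀ᵐ x, ‖∫ y, gK a ‖x - y‖ • f y‖ ^ 2 ≤
      1 / a.re ^ 2 * ∫ y, ‖f y‖ ^ 2 * ‖gK a ‖x - y‖‖ := by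
    filter_upwards [hprod.prod_right_ae] with x hx
    have hkx : Integrable fun y => ‖gK a ‖x - y‖‖ := hk.comp_sub_left x
    -- Schur-type splitting `|g| |f| = √|g| · (√|g| |f|)`: Cauchy–Schwarz separates the mass of `g`
    -- from the convolution of `|g|` with `|f|²`, which is integrable.
    have hm1 : AEStronglyMeasurable (fun y => √‖gK a ‖x - y‖‖) volume :=
      hkx.aestronglyMeasurable.aemeasurable.sqrt.aestronglyMeasurable
    have hm2 : AEStronglyMeasurable (fun y => √‖gK a ‖x - y‖‖ * ‖f y‖) volume :=
      hm1.mul (Lp.aestronglyMeasurable f).norm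
    have l1 : MemLp (fun y => √‖gK a ‖x - y‖‖) 2 volume := by
      rw [memLp_two_iff_integrable_sq hm1]
      simpa only [Real.sq_sqrt (norm_nonneg _)] using hkx
    have l2 : MemLp (fun y => √‖gK a ‖x - y‖‖ * ‖f y‖) 2 volume := by
      rw [memLp_two_iff_integrable_sq hm2]
      refine hx.congr (.of_forall fun y => ?_)
      simp only [mul_pow, Real.sq_sqrt (norm_nonneg _)]
      ring
    have hcs := integral_mul_le_Lp_mul_Lq_of_nonneg (μ := (volume : Measure E3))
      Real.HolderConjugate.two_two
      (f := fun y => √‖gK a ‖x - y‖‖) (g := fun y => √‖gK a ‖x - y‖‖ * ‖f y‖)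
      (.of_forall fun y => Real.sqrt_nonneg _)
      (.of_forall fun y => by positivity) (by simpa using l1) (by simpa using l2)
    simp only [Real.rpow_two, mul_pow, Real.sq_sqrt (norm_nonneg _), ← Real.sqrt_eq_rpow] at hcs
    rw [integral_sub_left_eq_self (fun y => ‖gK a ‖y‖‖) volume x, integral_norm_gK ha] at hcs
    have h1 : ‖∫ y, gK a ‖x - y‖ • f y‖ ≤ √(1 / a.re ^ 2) *
        √(∫ y, ‖gK a ‖x - y‖‖ * ‖f y‖ ^ 2) := by
      refine (norm_integral_le_integral_norm _).trans (le_trans (le_of_eq ?_) hcs)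
      refine integral_congr_ae (.of_forall fun y => ?_)
      simp only [norm_smul]
      rw [← mul_assoc, Real.mul_self_sqrt (norm_nonneg _)]
    refine (pow_le_pow_left₀ (norm_nonneg _) h1 2).trans (le_of_eq ?_)
    rw [mul_pow, Real.sq_sqrt (by positivity), Real.sq_sqrt (integral_nonneg fun y => by positivity)]
    congr 2; funext y; ring
  have hint : Integrable fun x => ‖∫ y, gK a ‖x - y‖ • f y‖ ^ 2 := by
    refine (hleft.const_mul (1 / a.re ^ 2)).mono' (hm.norm.pow 2) ?_
    filter_upwards [hpt] with x hx
    rwa [Real.norm_of_nonneg (by positivity)]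
  refine ⟨(memLp_two_iff_integrable_sq_norm hm).2 hint, ?_⟩
  refine (integral_mono_ae hint (hleft.const_mul _) hpt).trans (le_of_eq ?_)
  rw [integral_const_mul, hval]
  ring

/-- The operator `(-Δ + a²)^{-1}` on `L²`, `Re a > 0`. -/
def greenOp (F : Type*) [NormedAddCommGroup F] [InnerProductSpace ℂ F] {a : ℂ} (ha : 0 < a.re) :
    L2v F →L[ℂ] L2v F :=
  LinearMap.mkContinuous
    { toFun := fun f => (memLp_convolution ha f).1.toLp _
      map_add' := fun f g => by
        rw [← MemLp.toLp_add, MemLp.toLp_eq_toLp_iff]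
        refine .of_forall fun x => ?_
        rw [Pi.add_apply, ← integral_add (integrable_gK_smul ha f x).1
          (integrable_gK_smul ha g x).1]
        refine integral_congr_ae ?_
        filter_upwards [Lp.coeFn_add f g] with y hy
        rw [hy, Pi.add_apply, smul_add]
      map_smul' := fun c f => by
        rw [RingHom.id_apply, ← MemLp.toLp_const_smul, MemLp.toLp_eq_toLp_iff]
        refine .of_forall fun x => ?_
        rw [Pi.smul_apply, ← integral_smul]
        refine integral_congr_ae ?_
        filter_upwards [Lp.coeFn_smul c f] with y hy
        rw [hy, Pi.smul_apply, smul_comm] }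
    (1 / a.re ^ 2) fun f => by
      refine le_of_sq_le_sq ?_ (by positivity)
      rw [norm_sq_eq_integral]
      refine le_trans (le_of_eq ?_) (memLp_convolution ha f).2
      refine integral_congr_ae ?_
      filter_upwards [(memLp_convolution ha f).1.coeFn_toLp] with x hx
      exact congrArg (fun t => ‖t‖ ^ 2) hx

lemma greenOp_ae (ha : 0 < a.re) (f : L2v F) :
    greenOp F ha f =ᵐ[volume] fun x => ∫ y, gK a ‖x - y‖ • f y :=
  (memLp_convolution ha f).1.coeFn_toLp

lemma norm_greenOp_le (ha : 0 < a.re) (f : L2v F) : ‖greenOp F ha f‖ ≤ 1 / a.re ^ 2 * ‖f‖ :=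
  ((greenOp F ha).le_opNorm f).trans
    (mul_le_mul_of_nonneg_right (LinearMap.mkContinuous_norm_le _ (by positivity) _)
      (norm_nonneg _))

variable [CompleteSpace F]

/-- Potentials of `L²` functions solve the Helmholtz equation. -/
lemma mem_H2_of_potential (ha : 0 ≤ a.re) {f u : L2v F}
    (hu : ∀ᵐ x, u x = ∫ y, gK a ‖x - y‖ • f y)
    (hI : ∀ φ : 𝓢(E3, ℂ), Integrable (fun p : E3 × E3 => φ p.1 • gK a ‖p.1 - p.2‖ • f p.2)
      (volume.prod volume)) :
    ∃ h : u ∈ H2 F, laplaceH2 ⟨u, h⟩ = a ^ 2 • u - f := by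
  have hint : ∀ (ζ : 𝓢(E3, ℂ)) (g : L2v F), Integrable fun x => ζ x • g x := fun ζ g =>
    memLp_one_iff_integrable.1 (MemLp.smul (p := 2) (q := 2) (r := 1) (Lp.memLp g) (ζ.memLp 2))
  have hint' : ∀ (ζ : 𝓢(E3, ℂ)) (g : L2v F), Integrable fun x => a ^ 2 • ζ x • g x := fun ζ g =>
    (hint ζ g).smul _
  refine mem_H2_of_forall_schwartz fun φ => ?_
  -- Testing `u` against `(-Δ + a²) φ` and moving the potential onto this function by Fubini
  -- recovers `φ`, since the kernel is a fundamental solution.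
  let ψ : 𝓢(E3, ℂ) := -Δ φ + a ^ 2 • φ
  have e1 : ∫ x, ψ x • u x = ∫ y, φ y • f y := by
    calc ∫ x, ψ x • u x = ∫ x, ∫ y, ψ x • gK a ‖x - y‖ • f y := by
          refine integral_congr_ae ?_
          filter_upwards [hu] with x hx
          rw [hx, integral_smul]
      _ = ∫ y, ∫ x, ψ x • gK a ‖x - y‖ • f y := integral_integral_swap (hI ψ)
      _ = ∫ y, φ y • f y := by
          refine integral_congr_ae (.of_forall fun y => ?_)
          simp only
          rw [← integral_gK_mul_schwartz ha y φ, ← integral_smul_const]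
          congr 1; funext x
          rw [smul_smul, mul_comm]
          rfl
  have e2 : ∫ x, ψ x • u x = -(∫ x, (Δ φ) x • u x) + a ^ 2 • ∫ x, φ x • u x := by
    rw [← integral_neg, ← integral_smul, ← integral_add (hint (Δ φ) u).fun_neg
      (hint' φ u)]
    congr 1; funext x
    change (-(Δ φ) x + a ^ 2 * φ x) • u x = _
    rw [add_smul, neg_smul, mul_smul]
  have e3 : ∫ x, φ x • (a ^ 2 • u - f : L2v F) x = a ^ 2 • (∫ x, φ x • u x) - ∫ x, φ x • f x := by
    rw [← integral_smul, ← integral_sub (hint' φ u) (hint φ f)]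
    refine integral_congr_ae ?_
    filter_upwards [Lp.coeFn_sub (a ^ 2 • u) f, Lp.coeFn_smul (a ^ 2) u] with x h1 h2
    rw [h1, Pi.sub_apply, h2, Pi.smul_apply, smul_sub, smul_comm]
  rw [e3, ← e1, e2]
  abel

lemma greenOp_mem (ha : 0 < a.re) (f : L2v F) :
    ∃ h : greenOp F ha f ∈ H2 F,
      laplaceH2 ⟨greenOp F ha f, h⟩ = a ^ 2 • greenOp F ha f - f := by
  refine mem_H2_of_potential ha.le (greenOp_ae ha f) fun φ => ?_
  have hm : AEStronglyMeasurable (fun p : E3 × E3 => φ p.1 • gK a ‖p.1 - p.2‖ • f p.2)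
      (volume.prod volume) :=
    φ.continuous.aestronglyMeasurable.comp_fst.smul
      (aesm_gK_smul_prod a (Lp.aestronglyMeasurable f))
  rw [integrable_prod_iff hm]
  refine ⟨.of_forall fun x => (integrable_gK_smul ha f x).1.smul (φ x), ?_⟩
  refine ((φ.integrable (μ := volume)).norm.mul_const (√(1 / (8 * Real.pi * a.re)) * ‖f‖)).mono'
    hm.norm.integral_prod_right' (.of_forall fun x => ?_)
  rw [Real.norm_of_nonneg (integral_nonneg fun _ => norm_nonneg _)]
  simp only [norm_smul]
  rw [integral_const_mul]
  exact mul_le_mul_of_nonneg_left (integrable_gK_smul ha f x).2 (norm_nonneg _)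

/-- Uniqueness for the Helmholtz equation in `H²`. -/
lemma eq_zero_of_laplaceH2_eq (ha : 0 < a.re) (f : H2 F)
    (h : laplaceH2 f = a ^ 2 • (f : L2v F)) : (f : L2v F) = 0 := by
  -- The potential `w` of `f` with parameter `ā` solves the adjoint equation `Δ w = ā² w - f`.
  -- Symmetry of `Δ` between `f` and `w` then leaves `‖f‖² = 0`.
  have hc : 0 < (starRingEnd ℂ a).re := by simpa using ha
  obtain ⟨hw, hw'⟩ := greenOp_mem hc (f : L2v F)
  have h1 := inner_laplaceH2 f ⟨_, hw⟩
  rw [h, hw', inner_sub_right, inner_smul_left, inner_smul_right, map_pow] at h1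
  have : inner ℂ (f : L2v F) (f : L2v F) = 0 := by linear_combination h1
  exact inner_self_eq_zero.1 this

/-- A right inverse together with uniqueness in `H²` is a left inverse. -/
lemma greenOp_left (ha : 0 < a.re) (f : H2 F) :
    greenOp F ha (a ^ 2 • (f : L2v F) - laplaceH2 f) = f := by
  obtain ⟨hw, hw'⟩ := greenOp_mem ha (a ^ 2 • (f : L2v F) - laplaceH2 f)
  have h := eq_zero_of_laplaceH2_eq ha (⟨_, hw⟩ - f) (by
    rw [map_sub, hw', Submodule.coe_sub, smul_sub]
    abel)
  rw [Submodule.coe_sub, sub_eq_zero] at h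
  exact h

lemma inner_greenOp (ha : 0 < a.re) (hc : 0 < (starRingEnd ℂ a).re) (f g : L2v F) :
    inner ℂ (greenOp F hc f) g = inner ℂ f (greenOp F ha g) := by
  obtain ⟨hu, hu'⟩ := greenOp_mem hc f
  obtain ⟨hw, hw'⟩ := greenOp_mem ha g
  have h1 := inner_laplaceH2 ⟨_, hu⟩ ⟨_, hw⟩
  rw [hu', hw', inner_sub_left, inner_sub_right, inner_smul_left, inner_smul_right, map_pow,
    Complex.conj_conj] at h1
  linear_combination h1

end Green

/-! ### Diagonal matrices -/

/-- The diagonal matrix with entries `p`, `q`. -/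
def dg (p q : ℂ) : Mat2 := !![p, 0; 0, q]

/-- The projection of `ℂ²` to the first component. -/
def pi1 : C2 →L[ℂ] C2 := Matrix.toEuclideanCLM (n := Fin 2) (𝕜 := ℂ) (dg 1 0)

/-- The projection of `ℂ²` to the second component. -/
def pi2 : C2 →L[ℂ] C2 := Matrix.toEuclideanCLM (n := Fin 2) (𝕜 := ℂ) (dg 0 1)

lemma pi1_eq (w : C2) : pi1 w = act (dg 1 0) w := rfl

lemma pi2_eq (w : C2) : pi2 w = act (dg 0 1) w := rfl

lemma C2_ext {w w' : C2} (h0 : w 0 = w' 0) (h1 : w 1 = w' 1) : w = w' := by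
  ext i
  fin_cases i
  · exact h0
  · exact h1

lemma act_dg (p q : ℂ) (w : C2) : act (dg p q) w = p • pi1 w + q • pi2 w := by
  apply C2_ext <;> simp [pi1_eq, pi2_eq, act_apply, dg]

lemma dg_mul (p q p' q' : ℂ) : dg p q * dg p' q' = dg (p * p') (q * q') := by
  simp [dg]

lemma dg_sub (p q p' q' : ℂ) : dg p q - dg p' q' = dg (p - p') (q - q') := by
  ext i j; fin_cases i <;> fin_cases j <;> simp [dg]

lemma dg_add (p q p' q' : ℂ) : dg p q + dg p' q' = dg (p + p') (q + q') := by
  ext i j; fin_cases i <;> fin_cases j <;> simp [dg]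

lemma smul_dg (c p q : ℂ) : c • dg p q = dg (c * p) (c * q) := by
  ext i j; fin_cases i <;> fin_cases j <;> simp [dg]

lemma dg_conjTranspose (p q : ℂ) : (dg p q).conjTranspose = dg (star p) (star q) := by
  ext i j; fin_cases i <;> fin_cases j <;> simp [dg]

lemma sigma3_eq : sigma3 = dg 1 (-1) := rfl

lemma dg_one : dg 1 1 = 1 := by
  ext i j; fin_cases i <;> fin_cases j <;> simp [dg]

lemma sigma3_mul_sigma3 : sigma3 * sigma3 = 1 := by
  rw [sigma3_eq, dg_mul, ← dg_one]; norm_num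

lemma norm_sq_C2 (w : C2) : ‖w‖ ^ 2 = ‖w 0‖ ^ 2 + ‖w 1‖ ^ 2 := by
  rw [EuclideanSpace.norm_sq_eq, Fin.sum_univ_two]

lemma norm_act_dg_le {p q : ℂ} {k : ℝ} (hp : ‖p‖ ≤ k) (hq : ‖q‖ ≤ k) (w : C2) :
    ‖act (dg p q) w‖ ≤ k * ‖w‖ := by
  have hk : 0 ≤ k := (norm_nonneg p).trans hp
  refine le_of_sq_le_sq ?_ (by positivity)
  have e0 : act (dg p q) w 0 = p * w 0 := by simp [act_apply, dg]
  have e1 : act (dg p q) w 1 = q * w 1 := by simp [act_apply, dg]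
  rw [norm_sq_C2, mul_pow, norm_sq_C2, e0, e1, norm_mul, norm_mul, mul_pow, mul_pow, mul_add]
  gcongr

lemma norm_act_le (M : Mat2) (w : C2) :
    ‖act M w‖ ≤ (‖M 0 0‖ + ‖M 0 1‖ + (‖M 1 0‖ + ‖M 1 1‖)) * ‖w‖ := by
  have hi : ∀ i, ‖w i‖ ≤ ‖w‖ := PiLp.norm_apply_le w
  have h : ‖act M w‖ ≤ ‖act M w 0‖ + ‖act M w 1‖ := by
    refine le_of_sq_le_sq ?_ (by positivity)
    rw [norm_sq_C2]
    nlinarith [norm_nonneg (act M w 0), norm_nonneg (act M w 1)]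
  refine h.trans ?_
  rw [act_apply, act_apply, add_mul, add_mul, add_mul]
  refine add_le_add ((norm_add_le _ _).trans ?_) ((norm_add_le _ _).trans ?_) <;>
  · rw [norm_mul, norm_mul]
    exact add_le_add (mul_le_mul_of_nonneg_left (hi _) (norm_nonneg _))
      (mul_le_mul_of_nonneg_left (hi _) (norm_nonneg _))

lemma measMat_dg {α : Type*} [MeasurableSpace α] {p q : α → ℂ} (hp : Measurable p)
    (hq : Measurable q) : MeasMat fun a => dg (p a) (q a) := by
  intro i j
  fin_cases i <;> fin_cases j <;> simp [dg, hp, hq]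

/-! ### Weights -/

/-- The matrix valued function `M` is measurable and bounded by `c ⟨x⟩^{-s}`. -/
structure Wt (c s : ℝ) (M : E3 → Mat2) : Prop where
  nonneg : 0 ≤ c
  meas : MeasMat M
  bound : ∀ᵐ x, ∀ w, ‖act (M x) w‖ ≤ c * bracket x ^ (-s) * ‖w‖

lemma Wt.mono {c s s' : ℝ} {M : E3 → Mat2} (h : Wt c s M) (hs : s' ≤ s) : Wt c s' M := by
  refine ⟨h.nonneg, h.meas, ?_⟩
  filter_upwards [h.bound] with x hx w
  refine (hx w).trans ?_
  gcongr
  · exact h.nonneg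
  · exact one_le_bracket x

lemma Wt.mul {c s c' s' : ℝ} {M N : E3 → Mat2} (h : Wt c s M) (h' : Wt c' s' N) :
    Wt (c * c') (s + s') fun x => M x * N x := by
  refine ⟨mul_nonneg h.nonneg h'.nonneg, h.meas.mul h'.meas, ?_⟩
  filter_upwards [h.bound, h'.bound] with x hx hx' w
  rw [act_mul, neg_add, ← bracket_rpow_mul]
  calc _ ≤ c * bracket x ^ (-s) * (c' * bracket x ^ (-s') * ‖w‖) :=
        (hx _).trans (mul_le_mul_of_nonneg_left (hx' w)
          (mul_nonneg h.nonneg (bracket_rpow_pos x _).le))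
    _ = _ := by ring

lemma Wt.const (M : Mat2) : ∃ c, Wt c 0 fun _ => M :=
  ⟨‖M 0 0‖ + ‖M 0 1‖ + (‖M 1 0‖ + ‖M 1 1‖), by positivity, .const M, .of_forall fun x w => by
    simpa using norm_act_le M w⟩

/-- The weight `⟨x⟩^{-s}` as a scalar matrix. -/
def bw (s : ℝ) (x : E3) : Mat2 := dg (bracket x ^ (-s) : ℝ) (bracket x ^ (-s) : ℝ)

lemma act_bw (s : ℝ) (x : E3) (w : C2) : act (bw s x) w = bracket x ^ (-s) • w := by
  apply C2_ext <;> simp [bw, act_apply, dg]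

lemma wt_bw (s : ℝ) : Wt 1 s (bw s) := by
  refine ⟨zero_le_one, ?_, .of_forall fun x w => ?_⟩
  · have : Measurable fun x : E3 => ((bracket x ^ (-s) : ℝ) : ℂ) :=
      Complex.measurable_ofReal.comp (continuous_bracket_rpow _).measurable
    exact measMat_dg this this
  · rw [act_bw, norm_smul, Real.norm_of_nonneg (bracket_rpow_pos x _).le, one_mul]

lemma conjTranspose_bw (s : ℝ) (x : E3) : (bw s x).conjTranspose = bw s x := by
  simp only [bw, dg_conjTranspose, RCLike.star_def, Complex.conj_ofReal]

open Classical in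
/-- The operator of multiplication by `M` (and `0` if it is not bounded). -/
def mulOp (M : E3 → Mat2) : L2 →L[ℂ] L2 :=
  if h : ∃ T : L2 →L[ℂ] L2, ∀ f : L2, T f =ᵐ[volume] fun x => act (M x) (f x) then h.choose else 0

lemma Wt.norm_act_le {c s : ℝ} {M : E3 → Mat2} (h : Wt c s M) (hs : 0 ≤ s) :
    ∀ᵐ x, ∀ w, ‖act (M x) w‖ ≤ c * ‖w‖ := by
  filter_upwards [(h.mono hs).bound] with x hx w
  simpa using hx w

lemma Wt.memLp {c s : ℝ} {M : E3 → Mat2} (h : Wt c s M) (hs : 0 ≤ s) (f : L2) :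
    MemLp (fun x => act (M x) (f x)) 2 volume := by
  refine MemLp.of_le_mul (Lp.memLp f) (h.meas.act (Lp.aestronglyMeasurable f)) (c := c) ?_
  filter_upwards [h.norm_act_le hs] with x hx using hx _

lemma Wt.exists_mulOp {c s : ℝ} {M : E3 → Mat2} (h : Wt c s M) (hs : 0 ≤ s) :
    ∃ T : L2 →L[ℂ] L2, ∀ f : L2, T f =ᵐ[volume] fun x => act (M x) (f x) := by
  refine ⟨LinearMap.mkContinuous
    { toFun := fun f => (h.memLp hs f).toLp _
      map_add' := fun f g => by
        rw [← MemLp.toLp_add, MemLp.toLp_eq_toLp_iff]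
        filter_upwards [Lp.coeFn_add f g] with x hx
        rw [hx, Pi.add_apply, Pi.add_apply, act_add]
      map_smul' := fun a f => by
        rw [RingHom.id_apply, ← MemLp.toLp_const_smul, MemLp.toLp_eq_toLp_iff]
        filter_upwards [Lp.coeFn_smul a f] with x hx
        rw [hx, Pi.smul_apply, Pi.smul_apply, act_smul] } c fun f => ?_,
    fun f => (h.memLp hs f).coeFn_toLp⟩
  refine Lp.norm_le_mul_norm_of_ae_le_mul ?_
  filter_upwards [h.norm_act_le hs, (h.memLp hs f).coeFn_toLp] with x hx hx'
  change ‖((h.memLp hs f).toLp _ : L2) x‖ ≤ _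
  rw [hx']
  exact hx _

lemma Wt.mulOp_ae {c s : ℝ} {M : E3 → Mat2} (h : Wt c s M) (hs : 0 ≤ s) (f : L2) :
    mulOp M f =ᵐ[volume] fun x => act (M x) (f x) := by
  have he := h.exists_mulOp hs
  rw [mulOp, dif_pos he]
  exact he.choose_spec f

lemma Wt.conjTranspose {c s : ℝ} {M : E3 → Mat2} (h : Wt c s M) :
    Wt c s fun x => (M x).conjTranspose := by
  refine ⟨h.nonneg, h.meas.conjTranspose, ?_⟩
  filter_upwards [h.bound] with x hx w
  exact norm_act_conjTranspose_le (mul_nonneg h.nonneg (bracket_rpow_pos x _).le) hx w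

lemma inner_mulOp {c s : ℝ} {M : E3 → Mat2} (h : Wt c s M) (hs : 0 ≤ s) (f g : L2) :
    inner ℂ (mulOp M f) g = inner ℂ f (mulOp (fun x => (M x).conjTranspose) g) := by
  rw [L2.inner_def, L2.inner_def]
  refine integral_congr_ae ?_
  filter_upwards [h.mulOp_ae hs f, h.conjTranspose.mulOp_ae hs g] with x h1 h2
  rw [h1, h2, inner_act]

lemma IsKernelOp.weighted {c s c' s' : ℝ} {M N : E3 → Mat2} {K : E3 → E3 → Mat2} {T : L2 →L[ℂ] L2}
    (hT : IsKernelOp K T) (h : Wt c s M) (hs : 0 ≤ s) (h' : Wt c' s' N) (hs' : 0 ≤ s') :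
    IsKernelOp (fun x y => M x * K x y * N y) (mulOp M ∘L T ∘L mulOp N) := by
  intro f
  filter_upwards [hT (mulOp N f), h.mulOp_ae hs (T (mulOp N f))] with x h1 h2
  have e : (fun y => act (M x * K x y * N y) (f y)) =ᵐ[volume]
      fun y => Matrix.toEuclideanCLM (n := Fin 2) (𝕜 := ℂ) (M x) (act (K x y) (mulOp N f y)) := by
    filter_upwards [h'.mulOp_ae hs' f] with y hy
    rw [act_mul, act_mul, hy]
    rfl
  refine ⟨(ContinuousLinearMap.integrable_comp _ h1.1).congr e.symm, ?_⟩
  rw [integral_congr_ae e, ContinuousLinearMap.integral_comp_comm _ h1.1, ← h1.2]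
  exact h2

lemma sigma3L_ae (f : L2) : sigma3L f =ᵐ[volume] fun x => act sigma3 (f x) :=
  ContinuousLinearMap.coeFn_compLp _ f

lemma sigma3L_eq : sigma3L = mulOp fun _ => sigma3 := by
  obtain ⟨c, hc⟩ := Wt.const sigma3
  ext1 f
  refine Lp.ext ?_
  filter_upwards [sigma3L_ae f, hc.mulOp_ae le_rfl f] with x h1 h2
  rw [h1, h2]

lemma sigma3L_sigma3L (f : L2) : sigma3L (sigma3L f) = f := by
  refine Lp.ext ?_
  filter_upwards [sigma3L_ae (sigma3L f), sigma3L_ae f] with x h1 h2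
  rw [h1, h2, ← act_mul, sigma3_mul_sigma3, act_one]

lemma sigma3_conjTranspose : sigma3.conjTranspose = sigma3 := by
  rw [sigma3_eq, dg_conjTranspose]; simp

lemma inner_sigma3L (f g : L2) : inner ℂ (sigma3L f) g = inner ℂ f (sigma3L g) := by
  obtain ⟨c, hc⟩ := Wt.const sigma3
  rw [sigma3L_eq, inner_mulOp hc le_rfl]
  simp only [sigma3_conjTranspose]

/-! ### The potential and the operator `H` -/

/-- The standing assumptions on the potential, apart from `L₋ ≥ 0`. -/
structure Pot (μ β C : ℝ) (V1 V2 : E3 → ℝ) : Prop where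
  mu_pos : 0 < μ
  five_lt : 5 < β
  nonneg : 0 ≤ C
  meas1 : Measurable V1
  meas2 : Measurable V2
  abs_le : ∀ᵐ x, |V2 x| ≤ V1 x
  decay : ∀ᵐ x, |V1 x| + |V2 x| ≤ C * bracket x ^ (-β)

/-- Multiplication by `v`. -/
def mv (V1 V2 : E3 → ℝ) : L2 →L[ℂ] L2 := mulOp (v V1 V2)

/-- The projection to the first component. -/
def P1L : L2 →L[ℂ] L2 := pi1.compLpL 2 volume

/-- The projection to the second component. -/
def P2L : L2 →L[ℂ] L2 := pi2.compLpL 2 volume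

lemma P1L_ae (f : L2) : P1L f =ᵐ[volume] fun x => pi1 (f x) := ContinuousLinearMap.coeFn_compLp _ f

lemma P2L_ae (f : L2) : P2L f =ᵐ[volume] fun x => pi2 (f x) := ContinuousLinearMap.coeFn_compLp _ f

lemma pi1_add_pi2 (w : C2) : pi1 w + pi2 w = w := by
  have := act_dg 1 1 w
  rw [dg_one, act_one, one_smul, one_smul] at this
  exact this.symm

lemma P1L_add_P2L (f : L2) : P1L f + P2L f = f := by
  refine Lp.ext ?_
  filter_upwards [Lp.coeFn_add (P1L f) (P2L f), P1L_ae f, P2L_ae f] with x h h1 h2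
  rw [h, Pi.add_apply, h1, h2, pi1_add_pi2]

lemma sigma3L_eq_sub (f : L2) : sigma3L f = P1L f - P2L f := by
  refine Lp.ext ?_
  filter_upwards [Lp.coeFn_sub (P1L f) (P2L f), P1L_ae f, P2L_ae f, sigma3L_ae f] with x h h1 h2 h3
  rw [h, Pi.sub_apply, h1, h2, h3, sigma3_eq, act_dg, one_smul, neg_one_smul, sub_eq_add_neg]

lemma pi_comp (w : C2) : pi1 (pi1 w) = pi1 w ∧ pi1 (pi2 w) = 0 ∧ pi2 (pi1 w) = 0 ∧
    pi2 (pi2 w) = pi2 w := by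
  refine ⟨?_, ?_, ?_, ?_⟩ <;> apply C2_ext <;> simp [pi1_eq, pi2_eq, act_apply, dg]

lemma P1L_P1L (f : L2) : P1L (P1L f) = P1L f := by
  refine Lp.ext ?_
  filter_upwards [P1L_ae (P1L f), P1L_ae f] with x h1 h2
  rw [h1, h2, (pi_comp _).1]

lemma P2L_P2L (f : L2) : P2L (P2L f) = P2L f := by
  refine Lp.ext ?_
  filter_upwards [P2L_ae (P2L f), P2L_ae f] with x h1 h2
  rw [h1, h2, (pi_comp _).2.2.2]

lemma P1L_P2L (f : L2) : P1L (P2L f) = 0 := by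
  refine Lp.ext ?_
  filter_upwards [P1L_ae (P2L f), P2L_ae f, Lp.coeFn_zero C2 2 (volume : Measure E3)] with x h1 h2 h3
  rw [h1, h2, (pi_comp _).2.1, h3, Pi.zero_apply]

lemma P2L_P1L (f : L2) : P2L (P1L f) = 0 := by
  refine Lp.ext ?_
  filter_upwards [P2L_ae (P1L f), P1L_ae f, Lp.coeFn_zero C2 2 (volume : Measure E3)] with x h1 h2 h3
  rw [h1, h2, (pi_comp _).2.2.1, h3, Pi.zero_apply]

lemma inner_pi1 (w w' : C2) : inner ℂ (pi1 w) w' = inner ℂ w (pi1 w') := by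
  rw [pi1_eq, inner_act, dg_conjTranspose, pi1_eq]; simp

lemma inner_pi2 (w w' : C2) : inner ℂ (pi2 w) w' = inner ℂ w (pi2 w') := by
  rw [pi2_eq, inner_act, dg_conjTranspose, pi2_eq]; simp

lemma inner_P1L (f g : L2) : inner ℂ (P1L f) g = inner ℂ f (P1L g) := by
  rw [L2.inner_def, L2.inner_def]
  refine integral_congr_ae ?_
  filter_upwards [P1L_ae f, P1L_ae g] with x h1 h2
  rw [h1, h2, inner_pi1]

lemma inner_P2L (f g : L2) : inner ℂ (P2L f) g = inner ℂ f (P2L g) := by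
  rw [L2.inner_def, L2.inner_def]
  refine integral_congr_ae ?_
  filter_upwards [P2L_ae f, P2L_ae g] with x h1 h2
  rw [h1, h2, inner_pi2]

lemma v_conjTranspose (V1 V2 : E3 → ℝ) (x : E3) : (v V1 V2 x).conjTranspose = v V1 V2 x :=
  (v_posSemidef V1 V2 x).1

section

variable {μ β C : ℝ} {V1 V2 : E3 → ℝ}

/-- `v` is a square root of the potential, so it decays with half the exponent. Each of the four
entries is at most `√(C ⟨x⟩^{-β})`, whence the factor `4`. -/
lemma Pot.wt_v (h : Pot μ β C V1 V2) : Wt (4 * √C) (β / 2) (v V1 V2) := by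
  refine ⟨by positivity, ?_, ?_⟩
  · have h1 : Measurable fun x => (((√(V1 x + V2 x) + √(V1 x - V2 x)) / 2 : ℝ) : ℂ) :=
      Complex.measurable_ofReal.comp
        (((h.meas1.add h.meas2).sqrt.add (h.meas1.sub h.meas2).sqrt).div_const 2)
    have h2 : Measurable fun x => (((√(V1 x + V2 x) - √(V1 x - V2 x)) / 2 : ℝ) : ℂ) :=
      Complex.measurable_ofReal.comp
        (((h.meas1.add h.meas2).sqrt.sub (h.meas1.sub h.meas2).sqrt).div_const 2)
    intro i j
    fin_cases i <;> fin_cases j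
    exacts [h1, h2, h2, h1]
  · filter_upwards [h.decay] with x hx w
    refine (ThresholdProjection.norm_act_le _ w).trans
      (mul_le_mul_of_nonneg_right ?_ (norm_nonneg w))
    have hb : √C * bracket x ^ (-(β / 2)) = √(C * bracket x ^ (-β)) := by
      rw [Real.sqrt_mul h.nonneg, Real.sqrt_eq_rpow (bracket x ^ (-β)),
        ← Real.rpow_mul (bracket_pos x).le]
      ring_nf
    have e1 : √(V1 x + V2 x) ≤ √(C * bracket x ^ (-β)) :=
      Real.sqrt_le_sqrt ((add_le_add (le_abs_self _) (le_abs_self _)).trans hx)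
    have e2 : √(V1 x - V2 x) ≤ √(C * bracket x ^ (-β)) := by
      rw [sub_eq_add_neg]
      refine Real.sqrt_le_sqrt ((add_le_add (le_abs_self _) ?_).trans hx)
      exact neg_le_abs _
    have p1 := Real.sqrt_nonneg (V1 x + V2 x)
    have p2 := Real.sqrt_nonneg (V1 x - V2 x)
    have a1 : |(√(V1 x + V2 x) + √(V1 x - V2 x)) / 2| ≤ √(C * bracket x ^ (-β)) :=
      _root_.abs_le.2 ⟨by linarith, by linarith⟩
    have a2 : |(√(V1 x + V2 x) - √(V1 x - V2 x)) / 2| ≤ √(C * bracket x ^ (-β)) :=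
      _root_.abs_le.2 ⟨by linarith, by linarith⟩
    rw [mul_assoc, hb]
    have d : ∀ t : ℝ, ‖(t : ℂ)‖ = |t| := fun t => Complex.norm_real t
    change ‖(((√(V1 x + V2 x) + √(V1 x - V2 x)) / 2 : ℝ) : ℂ)‖ +
      ‖(((√(V1 x + V2 x) - √(V1 x - V2 x)) / 2 : ℝ) : ℂ)‖ +
      (‖(((√(V1 x + V2 x) - √(V1 x - V2 x)) / 2 : ℝ) : ℂ)‖ +
      ‖(((√(V1 x + V2 x) + √(V1 x - V2 x)) / 2 : ℝ) : ℂ)‖) ≤ _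
    rw [d, d]
    linarith

lemma Pot.half_pos (h : Pot μ β C V1 V2) : 0 ≤ β / 2 := by linarith [h.five_lt]

lemma Pot.mv_ae (h : Pot μ β C V1 V2) (f : L2) :
    mv V1 V2 f =ᵐ[volume] fun x => act (v V1 V2 x) (f x) :=
  h.wt_v.mulOp_ae h.half_pos f

lemma Pot.inner_mv (h : Pot μ β C V1 V2) (f g : L2) :
    inner ℂ (mv V1 V2 f) g = inner ℂ f (mv V1 V2 g) := by
  have := inner_mulOp h.wt_v h.half_pos f g
  simp only [v_conjTranspose] at this
  exact this

lemma Pot.potV_eq (h : Pot μ β C V1 V2) :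
    ∀ᵐ x, potV V1 V2 x = -(sigma3 * (v V1 V2 x * v V1 V2 x)) := by
  filter_upwards [h.abs_le] with x hx
  rw [v_mul_v hx, mul_neg, neg_neg, ← mul_assoc, sigma3_mul_sigma3, one_mul]

lemma Pot.potV_ae (h : Pot μ β C V1 V2) (f : L2) :
    (-(sigma3L (mv V1 V2 (mv V1 V2 f))) : L2) =ᵐ[volume] fun x => act (potV V1 V2 x) (f x) := by
  filter_upwards [h.potV_eq, Lp.coeFn_neg (sigma3L (mv V1 V2 (mv V1 V2 f))),
    sigma3L_ae (mv V1 V2 (mv V1 V2 f)), h.mv_ae (mv V1 V2 f), h.mv_ae f] with x h1 h2 h3 h4 h5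
  rw [h2, Pi.neg_apply, h3, h4, h5, h1, act_neg_left, act_mul, act_mul]

/-- `V f = -σ₃ v (v f)` is automatically in `L²` because `v` is bounded, so the second condition on
the domain is void. -/
lemma Pot.mem_domH (h : Pot μ β C V1 V2) {f : L2} : f ∈ domH V1 V2 ↔ f ∈ H2 C2 := by
  refine ⟨fun hf => hf.1, fun hf => ⟨hf, ?_⟩⟩
  have h1 := Lp.memLp (-(sigma3L (mv V1 V2 (mv V1 V2 f))) : L2)
  exact h1.ae_eq (h.potV_ae f)

lemma Pot.opH_apply (h : Pot μ β C V1 V2) (f : (opH μ V1 V2).domain) (hf : (f : L2) ∈ H2 C2) :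
    opH μ V1 V2 f = sigma3L (-laplaceH2 (F := C2) ⟨(f : L2), hf⟩ + (μ : ℂ) • (f : L2) -
      mv V1 V2 (mv V1 V2 (f : L2))) := by
  have hV : mulV V1 V2 f = -(sigma3L (mv V1 V2 (mv V1 V2 (f : L2)))) :=
    Lp.ext (by
      refine Filter.EventuallyEq.trans ?_ (h.potV_ae (f : L2)).symm
      exact MemLp.coeFn_toLp (f := fun x => act (potV V1 V2 x) ((f : L2) x)) f.2.2)
  change sigma3L (-laplaceH2 (F := C2) ⟨(f : L2), hf⟩ + (μ : ℂ) • (f : L2)) + mulV V1 V2 f = _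
  rw [hV, map_sub sigma3L, sub_eq_add_neg]

lemma Pot.dense_domain (h : Pot μ β C V1 V2) : Dense ((opH μ V1 V2).domain : Set L2) := by
  have : ((opH μ V1 V2).domain : Set L2) = (H2 C2 : Set L2) := Set.ext fun f => h.mem_domH
  rw [this]
  exact dense_H2

end

/-! ### The free resolvent on `L² × L²` -/

/-- The kernel `diag(gK a₁ |x-y|, gK a₂ |x-y|)`. -/
def kerG (a1 a2 : ℂ) (x y : E3) : Mat2 := dg (gK a1 ‖x - y‖) (gK a2 ‖x - y‖)

lemma act_kerG (a1 a2 : ℂ) (x y : E3) (w : C2) :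
    act (kerG a1 a2 x y) w = gK a1 ‖x - y‖ • pi1 w + gK a2 ‖x - y‖ • pi2 w := act_dg _ _ _

lemma measMat_kerG (a1 a2 : ℂ) : MeasMat fun p : E3 × E3 => kerG a1 a2 p.1 p.2 :=
  measMat_dg ((measurable_gK_norm a1).comp (measurable_fst.sub measurable_snd))
    ((measurable_gK_norm a2).comp (measurable_fst.sub measurable_snd))

section

variable {F F' : Type*} [NormedAddCommGroup F] [InnerProductSpace ℂ F] [NormedAddCommGroup F']
  [InnerProductSpace ℂ F'] {a : ℂ}

lemma compLp_greenOp [CompleteSpace F] [CompleteSpace F'] (ha : 0 < a.re) (L : F →L[ℂ] F') (f : L2v F) :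
    L.compLp (greenOp F ha f) = greenOp F' ha (L.compLp f) := by
  refine Lp.ext ?_
  filter_upwards [L.coeFn_compLp (greenOp F ha f), greenOp_ae ha f,
    greenOp_ae ha (L.compLp f)] with x h1 h2 h3
  rw [h1, h2, h3, ← ContinuousLinearMap.integral_comp_comm _ (integrable_gK_smul ha f x).1]
  refine integral_congr_ae ?_
  filter_upwards [L.coeFn_compLp f] with y hy
  rw [hy, map_smul]

lemma greenOp_congr {b : ℂ} (ha : 0 < a.re) (hb : 0 < b.re) (h : b = a) :
    greenOp F hb = greenOp F ha := by
  subst h; rfl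

end

/-- `diag((-Δ + a₁²)^{-1}, (-Δ + a₂²)^{-1})`. -/
def Gop {a1 a2 : ℂ} (h1 : 0 < a1.re) (h2 : 0 < a2.re) : L2 →L[ℂ] L2 :=
  greenOp C2 h1 ∘L P1L + greenOp C2 h2 ∘L P2L

section

variable {a1 a2 : ℂ} (h1 : 0 < a1.re) (h2 : 0 < a2.re)

lemma Gop_apply (f : L2) : Gop h1 h2 f = greenOp C2 h1 (P1L f) + greenOp C2 h2 (P2L f) := rfl

lemma isKernelOp_Gop : IsKernelOp (kerG a1 a2) (Gop h1 h2) := by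
  intro f
  filter_upwards [Lp.coeFn_add (greenOp C2 h1 (P1L f)) (greenOp C2 h2 (P2L f)),
    greenOp_ae h1 (P1L f), greenOp_ae h2 (P2L f)] with x e e1 e2
  have i1 := (integrable_gK_smul h1 (P1L f) x).1
  have i2 := (integrable_gK_smul h2 (P2L f) x).1
  have h : (fun y => act (kerG a1 a2 x y) (f y)) =ᵐ[volume]
      fun y => gK a1 ‖x - y‖ • P1L f y + gK a2 ‖x - y‖ • P2L f y := by
    filter_upwards [P1L_ae f, P2L_ae f] with y hy1 hy2
    rw [act_kerG, hy1, hy2]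
  refine ⟨(i1.add i2).congr h.symm, ?_⟩
  rw [integral_congr_ae h, integral_add i1 i2, ← e1, ← e2]
  exact e

lemma P1L_greenOp {a : ℂ} (ha : 0 < a.re) (f : L2) :
    P1L (greenOp C2 ha f) = greenOp C2 ha (P1L f) := compLp_greenOp ha pi1 f

lemma P2L_greenOp {a : ℂ} (ha : 0 < a.re) (f : L2) :
    P2L (greenOp C2 ha f) = greenOp C2 ha (P2L f) := compLp_greenOp ha pi2 f

lemma P1L_Gop (f : L2) : P1L (Gop h1 h2 f) = greenOp C2 h1 (P1L f) := by
  rw [Gop_apply, map_add, P1L_greenOp, P1L_greenOp, P1L_P1L, P1L_P2L, map_zero, add_zero]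

lemma P2L_Gop (f : L2) : P2L (Gop h1 h2 f) = greenOp C2 h2 (P2L f) := by
  rw [Gop_apply, map_add, P2L_greenOp, P2L_greenOp, P2L_P2L, P2L_P1L, map_zero, zero_add]

lemma Gop_mem (f : L2) : ∃ h : Gop h1 h2 f ∈ H2 C2, laplaceH2 ⟨Gop h1 h2 f, h⟩ =
    a1 ^ 2 • P1L (Gop h1 h2 f) + a2 ^ 2 • P2L (Gop h1 h2 f) - f := by
  obtain ⟨m1, e1⟩ := greenOp_mem h1 (P1L f)
  obtain ⟨m2, e2⟩ := greenOp_mem h2 (P2L f)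
  refine ⟨add_mem m1 m2, ?_⟩
  have := map_add laplaceH2 (⟨_, m1⟩ : H2 C2) ⟨_, m2⟩
  rw [e1, e2] at this
  rw [P1L_Gop, P2L_Gop]
  refine this.trans ?_
  rw [sub_add_sub_comm, P1L_add_P2L]

lemma P1L_mem_H2 (f : H2 C2) : ∃ h : P1L (f : L2) ∈ H2 C2,
    laplaceH2 ⟨P1L (f : L2), h⟩ = P1L (laplaceH2 f) := compLp_mem_H2 pi1 f

lemma P2L_mem_H2 (f : H2 C2) : ∃ h : P2L (f : L2) ∈ H2 C2,
    laplaceH2 ⟨P2L (f : L2), h⟩ = P2L (laplaceH2 f) := compLp_mem_H2 pi2 f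

lemma Gop_left (f : H2 C2) : Gop h1 h2 (a1 ^ 2 • P1L (f : L2) + a2 ^ 2 • P2L (f : L2) -
    laplaceH2 f) = f := by
  obtain ⟨m1, e1⟩ := P1L_mem_H2 f
  obtain ⟨m2, e2⟩ := P2L_mem_H2 f
  have g1 := greenOp_left h1 ⟨_, m1⟩
  have g2 := greenOp_left h2 ⟨_, m2⟩
  rw [e1] at g1
  rw [e2] at g2
  rw [Gop_apply]
  simp only [map_sub, map_add, map_smul, P1L_P1L, P1L_P2L, P2L_P1L, P2L_P2L, smul_zero,
    add_zero, zero_add] at g1 g2 ⊢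
  rw [g1, g2, P1L_add_P2L]

lemma inner_Gop (r1 : (starRingEnd ℂ) a1 = a1) (r2 : (starRingEnd ℂ) a2 = a2) (f g : L2) :
    inner ℂ (Gop h1 h2 f) g = inner ℂ f (Gop h1 h2 g) := by
  have c1 : 0 < ((starRingEnd ℂ) a1).re := by rwa [r1]
  have c2 : 0 < ((starRingEnd ℂ) a2).re := by rwa [r2]
  have i1 := inner_greenOp h1 c1 (P1L f) g
  have i2 := inner_greenOp h2 c2 (P2L f) g
  rw [greenOp_congr h1 c1 r1] at i1
  rw [greenOp_congr h2 c2 r2] at i2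
  rw [Gop_apply, Gop_apply, inner_add_left, inner_add_right, i1, i2, inner_P1L, inner_P2L,
    P1L_greenOp, P2L_greenOp]

end

/-! ### Expansions of the free kernel -/

section Exp

lemma hasDerivAt_exp_neg (c w : ℂ) (t : ℝ) :
    HasDerivAt (fun s : ℝ => Complex.exp (-(c + s * w))) (-w * Complex.exp (-(c + t * w))) t := by
  have h : HasDerivAt (fun s : ℂ => Complex.exp (-(c + s * w)))
      (Complex.exp (-(c + t * w)) * -(1 * w)) (t : ℂ) :=
    (((hasDerivAt_id (t : ℂ)).mul_const w).const_add c).neg.cexp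
  convert h.comp_ofReal using 1
  ring

variable {c w : ℂ}

lemma norm_exp_neg_le_one (hc : 0 ≤ c.re) : ‖Complex.exp (-c)‖ ≤ 1 := by
  rw [Complex.norm_exp]
  exact Real.exp_le_one_iff.2 (by simpa using hc)

lemma re_segment_nonneg (hc : 0 ≤ c.re) (hcw : 0 ≤ (c + w).re) {t : ℝ} (h0 : 0 ≤ t) (h1 : t ≤ 1) :
    0 ≤ (c + t * w).re := by
  simp only [Complex.add_re, Complex.re_ofReal_mul] at hcw ⊢
  nlinarith

lemma norm_mul_segment_le {t : ℝ} (h0 : 0 ≤ t) (h1 : t ≤ 1) : ‖(t : ℂ) * w‖ ≤ ‖w‖ := by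
  rw [norm_mul, Complex.norm_real, Real.norm_of_nonneg h0]
  exact mul_le_of_le_one_left (norm_nonneg w) h1

/-- Mean value inequality along the segment `c + t w`, on which `Re ≥ 0` keeps the exponential
bounded by `1`. The two higher remainders follow by applying the same inequality to the preceding
remainder; the constants `1/2` and `1/6` are dropped. -/
lemma norm_exp_neg_sub_le (hc : 0 ≤ c.re) (hcw : 0 ≤ (c + w).re) :
    ‖Complex.exp (-(c + w)) - Complex.exp (-c)‖ ≤ ‖w‖ := by
  have := norm_image_sub_le_of_norm_deriv_le_segment_01' (C := ‖w‖)
    (fun t _ => (hasDerivAt_exp_neg c w t).hasDerivWithinAt) fun t ht => by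
      rw [norm_mul, norm_neg]
      exact mul_le_of_le_one_right (norm_nonneg w)
        (norm_exp_neg_le_one (re_segment_nonneg hc hcw ht.1 ht.2.le))
  simpa using this

lemma norm_exp_neg_sub_le_sq (hc : 0 ≤ c.re) (hcw : 0 ≤ (c + w).re) :
    ‖Complex.exp (-(c + w)) - Complex.exp (-c) + w * Complex.exp (-c)‖ ≤ ‖w‖ ^ 2 := by
  have hd : ∀ t : ℝ, HasDerivAt
      (fun s : ℝ => Complex.exp (-(c + s * w)) + s * (w * Complex.exp (-c)))
      (-w * (Complex.exp (-(c + t * w)) - Complex.exp (-c))) t := fun t => by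
    refine ((hasDerivAt_exp_neg c w t).add
      ((hasDerivAt_id (t : ℝ)).ofReal_comp.mul_const (w * Complex.exp (-c)))).congr_deriv ?_
    rw [Complex.ofReal_one]
    ring
  have := norm_image_sub_le_of_norm_deriv_le_segment_01' (C := ‖w‖ ^ 2)
    (fun t _ => (hd t).hasDerivWithinAt) fun t ht => by
      rw [norm_mul, norm_neg, sq]
      refine mul_le_mul_of_nonneg_left ?_ (norm_nonneg w)
      exact (norm_exp_neg_sub_le hc (re_segment_nonneg hc hcw ht.1 ht.2.le)).trans
        (norm_mul_segment_le ht.1 ht.2.le)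
  refine le_trans (le_of_eq ?_) this
  simp only [Complex.ofReal_one, Complex.ofReal_zero]
  ring_nf

lemma norm_exp_neg_sub_le_cube (hc : 0 ≤ c.re) (hcw : 0 ≤ (c + w).re) :
    ‖Complex.exp (-(c + w)) - Complex.exp (-c) + w * Complex.exp (-c) -
      w ^ 2 / 2 * Complex.exp (-c)‖ ≤ ‖w‖ ^ 3 := by
  have hd : ∀ t : ℝ, HasDerivAt
      (fun s : ℝ => Complex.exp (-(c + s * w)) + s * (w * Complex.exp (-c)) -
        (s : ℂ) ^ 2 * (w ^ 2 / 2 * Complex.exp (-c)))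
      (-w * (Complex.exp (-(c + t * w)) - Complex.exp (-c) + t * w * Complex.exp (-c))) t :=
    fun t => by
    have h1 := (hasDerivAt_id (t : ℝ)).ofReal_comp
    have h2 := ((h1.pow 2).mul_const (w ^ 2 / 2 * Complex.exp (-c)))
    refine (((hasDerivAt_exp_neg c w t).add (h1.mul_const (w * Complex.exp (-c)))).sub
      h2).congr_deriv ?_
    simp only [Complex.ofReal_one, id]
    norm_num
    ring
  have := norm_image_sub_le_of_norm_deriv_le_segment_01' (C := ‖w‖ ^ 3)
    (fun t _ => (hd t).hasDerivWithinAt) fun t ht => by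
      rw [norm_mul, norm_neg, pow_succ' ‖w‖ 2]
      refine mul_le_mul_of_nonneg_left ?_ (norm_nonneg w)
      exact (norm_exp_neg_sub_le_sq hc (re_segment_nonneg hc hcw ht.1 ht.2.le)).trans
        (pow_le_pow_left₀ (norm_nonneg _) (norm_mul_segment_le ht.1 ht.2.le) 2)
  refine le_trans (le_of_eq ?_) this
  simp only [Complex.ofReal_one, Complex.ofReal_zero]
  ring_nf

end Exp

/-! ### Taylor remainders of the kernel in the parameter `a` -/

section GK

variable {a c : ℂ} {r : ℝ}

/-- The denominator `4πr` cancels one power of `r`, so the remainder of order `n` in `a - c` grows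
only like `r^{n-1}`. -/
lemma norm_div_four_pi_mul_le {u : ℂ} {t : ℝ} (hr : 0 < r) (h : ‖u‖ ≤ t * r) :
    ‖u / (4 * Real.pi * r)‖ ≤ t := by
  have ht : 0 ≤ t := nonneg_of_mul_nonneg_left ((norm_nonneg u).trans h) hr
  have e : ‖(4 * Real.pi * r : ℂ)‖ = 4 * Real.pi * r := by
    simp [abs_of_pos hr, abs_of_pos Real.pi_pos]
  rw [norm_div, e, div_le_iff₀ (by positivity)]
  refine h.trans ?_
  nlinarith [Real.pi_gt_three, mul_nonneg ht hr.le]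

lemma norm_gK_sub_le (hc : 0 ≤ c.re) (ha : 0 ≤ a.re) (hr : 0 < r) :
    ‖gK a r - gK c r‖ ≤ ‖a - c‖ := by
  have h := norm_exp_neg_sub_le (c := c * r) (w := (a - c) * r) (by simp; positivity)
    (by rw [← add_mul]; simp; positivity)
  rw [← add_mul, norm_mul, Complex.norm_real, Real.norm_of_nonneg hr.le, add_sub_cancel] at h
  rw [gK, gK, ← sub_div]
  exact norm_div_four_pi_mul_le hr h

lemma norm_gK_sub_le_sq (hc : 0 ≤ c.re) (ha : 0 ≤ a.re) (hr : 0 < r) :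
    ‖gK a r - gK c r + (a - c) / (4 * Real.pi) * Complex.exp (-(c * r))‖ ≤ ‖a - c‖ ^ 2 * r := by
  have h := norm_exp_neg_sub_le_sq (c := c * r) (w := (a - c) * r) (by simp; positivity)
    (by rw [← add_mul]; simp; positivity)
  rw [← add_mul, norm_mul, Complex.norm_real, Real.norm_of_nonneg hr.le, add_sub_cancel] at h
  have hr' : (r : ℂ) ≠ 0 := by exact_mod_cast hr.ne'
  have hp : (Real.pi : ℂ) ≠ 0 := by exact_mod_cast Real.pi_ne_zero
  refine le_trans (le_of_eq ?_) (norm_div_four_pi_mul_le hr (h.trans (le_of_eq (by ring))))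
  congr 1
  rw [gK, gK]
  field_simp

lemma norm_gK_sub_le_cube (hc : 0 ≤ c.re) (ha : 0 ≤ a.re) (hr : 0 < r) :
    ‖gK a r - gK c r + (a - c) / (4 * Real.pi) * Complex.exp (-(c * r)) -
      (a - c) ^ 2 * r / (8 * Real.pi) * Complex.exp (-(c * r))‖ ≤ ‖a - c‖ ^ 3 * r ^ 2 := by
  have h := norm_exp_neg_sub_le_cube (c := c * r) (w := (a - c) * r) (by simp; positivity)
    (by rw [← add_mul]; simp; positivity)
  rw [← add_mul, norm_mul, Complex.norm_real, Real.norm_of_nonneg hr.le, add_sub_cancel] at h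
  have hr' : (r : ℂ) ≠ 0 := by exact_mod_cast hr.ne'
  have hp : (Real.pi : ℂ) ≠ 0 := by exact_mod_cast Real.pi_ne_zero
  refine le_trans (le_of_eq ?_) (norm_div_four_pi_mul_le hr (h.trans (le_of_eq (by ring))))
  congr 1
  rw [gK, gK]
  field_simp
  ring

end GK

/-! ### Weighted integral operators -/

/-- The operator with kernel `M(x) D(x, y) N(y)`. -/
def wop (M : E3 → Mat2) (D : E3 → E3 → Mat2) (N : E3 → Mat2) : L2 →L[ℂ] L2 :=
  kernelOp fun x y => M x * D x y * N y

/-- The Hilbert–Schmidt norm of `c ⟨x⟩^{-s} |x-y|⁻¹ ⟨y⟩^{-s'}`. -/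
def cInv (c s s' : ℝ) : ℝ :=
  hsNorm fun x y => c * (bracket x ^ (-s) * ‖x - y‖⁻¹ * bracket y ^ (-s'))

/-- The Hilbert–Schmidt norm of `c ⟨x⟩^{-s} ⟨y⟩^{-s'}`. -/
def cPow (c s s' : ℝ) : ℝ := hsNorm fun x y => c * (bracket x ^ (-s) * bracket y ^ (-s'))

/-- Weights for which `⟨x⟩^{-s} |x-y|⁻¹ ⟨y⟩^{-s'}` is a Hilbert–Schmidt kernel. -/
def WtPair (s s' : ℝ) : Prop := (1 / 2 < s ∧ 3 / 2 < s') ∨ (3 / 2 < s ∧ 1 / 2 < s')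

lemma WtPair.hs {s s' : ℝ} (h : WtPair s s') {c : ℝ} (hc : 0 ≤ c) :
    HS fun x y => c * (bracket x ^ (-s) * ‖x - y‖⁻¹ * bracket y ^ (-s')) := by
  refine HS.const_mul ?_ hc
  rcases h with ⟨h1, h2⟩ | ⟨h1, h2⟩
  · exact hs_bracket_inv_bracket h1 h2
  · have := (hs_bracket_inv_bracket h2 h1).swap
    refine ⟨fun x y => ?_, ?_, ?_⟩
    · have := this.nonneg x y
      rw [norm_sub_rev] at this
      linarith
    all_goals
      have e : (fun x y : E3 => bracket x ^ (-s) * ‖x - y‖⁻¹ * bracket y ^ (-s')) =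
          fun x y => bracket y ^ (-s') * ‖y - x‖⁻¹ * bracket x ^ (-s) := by
        funext x y; rw [norm_sub_rev]; ring
    · rw [e]; exact this.meas
    · exact this.sq.congr (.of_forall fun p => by
        simp only [norm_sub_rev]; ring)

section wop

variable {c s c' s' t m : ℝ} {M N : E3 → Mat2} {D : E3 → E3 → Mat2}

lemma domBy_weighted (hM : Wt c s M) (hN : Wt c' s' N)
    (hD : MeasMat fun p : E3 × E3 => D p.1 p.2) {d : E3 → E3 → ℝ} (hd : ∀ x y, 0 ≤ d x y)
    (hb : ∀ x y, x ≠ y → ∀ w, ‖act (D x y) w‖ ≤ d x y * ‖w‖) :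
    DomBy (fun x y => M x * D x y * N y)
      fun x y => c * bracket x ^ (-s) * d x y * (c' * bracket y ^ (-s')) := by
  refine ⟨((hM.meas.comp measurable_fst).mul hD).mul (hN.meas.comp measurable_snd), ?_⟩
  filter_upwards [hM.bound] with x hx
  filter_upwards [hN.bound, Measure.ae_ne volume x] with y hy hxy w
  rw [act_mul, act_mul]
  have n1 := mul_nonneg hM.nonneg (bracket_rpow_pos x (-s)).le
  calc _ ≤ c * bracket x ^ (-s) * (d x y * (c' * bracket y ^ (-s') * ‖w‖)) := by
        refine (hx _).trans (mul_le_mul_of_nonneg_left ?_ n1)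
        exact (hb x y hxy.symm _).trans (mul_le_mul_of_nonneg_left (hy w) (hd x y))
    _ = _ := by ring

lemma domBy_inv (hM : Wt c s M) (hN : Wt c' s' N)
    (hD : MeasMat fun p : E3 × E3 => D p.1 p.2) (ht : 0 ≤ t)
    (hb : ∀ x y, x ≠ y → ∀ w, ‖act (D x y) w‖ ≤ t * ‖x - y‖⁻¹ * ‖w‖) :
    DomBy (fun x y => M x * D x y * N y)
      fun x y => t * (c * c' * (bracket x ^ (-s) * ‖x - y‖⁻¹ * bracket y ^ (-s'))) := by
  convert domBy_weighted hM hN hD (d := fun x y => t * ‖x - y‖⁻¹) (fun x y => by positivity) hb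
    using 3
  ring

lemma domBy_pow (hM : Wt c s M) (hN : Wt c' s' N)
    (hD : MeasMat fun p : E3 × E3 => D p.1 p.2) (ht : 0 ≤ t)
    (hb : ∀ x y, x ≠ y → ∀ w, ‖act (D x y) w‖ ≤ t * (bracket x ^ m * bracket y ^ m) * ‖w‖) :
    DomBy (fun x y => M x * D x y * N y)
      fun x y => t * (c * c' * (bracket x ^ (-(s - m)) * bracket y ^ (-(s' - m)))) := by
  convert domBy_weighted hM hN hD (d := fun x y => t * (bracket x ^ m * bracket y ^ m))
    (fun x y => mul_nonneg ht (mul_nonneg (bracket_rpow_pos x m).le (bracket_rpow_pos y m).le)) hb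
    using 3
  rw [neg_sub, neg_sub, sub_eq_neg_add, sub_eq_neg_add, ← bracket_rpow_mul, ← bracket_rpow_mul]
  ring

lemma hs_pow (hc : 0 ≤ c) (h : 3 / 2 < s) (h' : 3 / 2 < s') :
    HS fun x y => c * (bracket x ^ (-s) * bracket y ^ (-s')) :=
  (hs_bracket_bracket h h').const_mul hc

lemma DomBy.isKernelOp {K : E3 → E3 → Mat2} {k : E3 → E3 → ℝ} (hK : DomBy K k) (h : HS k) :
    IsKernelOp K (kernelOp K) := by
  obtain ⟨T, hT⟩ := hK.exists_op h
  rwa [hT.kernelOp_eq]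

/-- For kernels with a Coulomb singularity one weight must exceed `3/2`, but the other only `1/2`.
-/
lemma wop_inv (hM : Wt c s M) (hN : Wt c' s' N)
    (hD : MeasMat fun p : E3 × E3 => D p.1 p.2) (ht : 0 ≤ t)
    (hb : ∀ x y, x ≠ y → ∀ w, ‖act (D x y) w‖ ≤ t * ‖x - y‖⁻¹ * ‖w‖) (hs : WtPair s s') :
    IsKernelOp (fun x y => M x * D x y * N y) (wop M D N) ∧ IsCompactOperator (wop M D N) ∧
      ∀ f, ‖wop M D N f‖ ≤ t * cInv (c * c') s s' * ‖f‖ := by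
  have h1 := domBy_inv hM hN hD ht hb
  have h0 := hs.hs (mul_nonneg hM.nonneg hN.nonneg)
  have h2 := h0.const_mul ht
  have h3 := h1.isKernelOp h2
  refine ⟨h3, h3.isCompactOperator h1 h2, fun f => ?_⟩
  have := h3.norm_le h1 h2 f
  rwa [hsNorm_const_mul _ ht] at this

/-- Growth of order `m` in each variable costs `m` from each weight, and both must still exceed
`3/2` afterwards. -/
lemma wop_pow (hM : Wt c s M) (hN : Wt c' s' N)
    (hD : MeasMat fun p : E3 × E3 => D p.1 p.2) (ht : 0 ≤ t)
    (hb : ∀ x y, x ≠ y → ∀ w, ‖act (D x y) w‖ ≤ t * (bracket x ^ m * bracket y ^ m) * ‖w‖)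
    (hs : 3 / 2 < s - m) (hs' : 3 / 2 < s' - m) :
    IsKernelOp (fun x y => M x * D x y * N y) (wop M D N) ∧ IsCompactOperator (wop M D N) ∧
      ∀ f, ‖wop M D N f‖ ≤ t * cPow (c * c') (s - m) (s' - m) * ‖f‖ := by
  have h1 := domBy_pow hM hN hD ht hb
  have h0 := hs_pow (mul_nonneg hM.nonneg hN.nonneg) hs hs'
  have h2 := h0.const_mul ht
  have h3 := h1.isKernelOp h2
  refine ⟨h3, h3.isCompactOperator h1 h2, fun f => ?_⟩
  have := h3.norm_le h1 h2 f
  rwa [hsNorm_const_mul _ ht] at this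

lemma cInv_nonneg (c s s' : ℝ) : 0 ≤ cInv c s s' := hsNorm_nonneg _

lemma cPow_nonneg (c s s' : ℝ) : 0 ≤ cPow c s s' := hsNorm_nonneg _

end wop

/-! ### The spectral parameter and the expansion of the kernel -/

/-- `z` is in the upper half plane and `a` is the square root of `2μ + z²` with `Re a > 0`. -/
structure SP (μ : ℝ) (z a : ℂ) : Prop where
  im_pos : 0 < z.im
  norm_le : ‖z‖ ≤ 1
  sq : a ^ 2 = 2 * μ + z ^ 2
  re_pos : 0 < a.re

section SP

variable {μ : ℝ} {z a : ℂ}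

/-- `|z|² < 2μ` puts `2μ + z²` in the open right half plane, so a square root cannot have zero real
part and its sign can be chosen. -/
lemma exists_sp (hz : 0 < z.im) (h1 : ‖z‖ ≤ 1) (hz2 : ‖z‖ ^ 2 < 2 * μ) : ∃ a, SP μ z a := by
  obtain ⟨b, hb⟩ := IsAlgClosed.exists_pow_nat_eq (2 * (μ : ℂ) + z ^ 2) (n := 2) (by norm_num)
  have hre : 0 < (b ^ 2).re := by
    rw [hb]
    have h2 := Complex.abs_re_le_norm (z ^ 2)
    rw [norm_pow] at h2
    have h3 := (_root_.abs_le.1 h2).1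
    simp only [Complex.add_re, Complex.mul_re, Complex.re_ofNat, Complex.ofReal_re,
      Complex.im_ofNat, Complex.ofReal_im, mul_zero, sub_zero]
    linarith
  have hb0 : b.re ≠ 0 := fun h => by
    rw [sq, Complex.mul_re, h] at hre
    nlinarith [mul_self_nonneg b.im]
  rcases lt_or_gt_of_ne hb0 with h | h
  · exact ⟨-b, hz, h1, by rw [neg_sq, hb], by simpa using h⟩
  · exact ⟨b, hz, h1, hb, h⟩

lemma sqrt_two_mul_pos (hμ : 0 < μ) : 0 < √(2 * μ) := Real.sqrt_pos.2 (by linarith)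

lemma SP.re_pos' (h : SP μ z a) : 0 < (-(Complex.I * z)).re := by simpa using h.im_pos

lemma SP.ne_zero (h : SP μ z a) : z ≠ 0 := fun h0 => by
  have := h.im_pos
  simp [h0] at this

lemma SP.mul_add (hμ : 0 < μ) (h : SP μ z a) : (a - (√(2 * μ) : ℝ)) * (a + (√(2 * μ) : ℝ)) = z ^ 2 := by
  have e : ((√(2 * μ) : ℝ) : ℂ) ^ 2 = 2 * μ := by
    rw [← Complex.ofReal_pow, Real.sq_sqrt (by linarith)]; push_cast; rfl
  linear_combination h.sq - e

lemma SP.le_norm_add (h : SP μ z a) : √(2 * μ) ≤ ‖a + (√(2 * μ) : ℝ)‖ := by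
  refine le_trans ?_ (Complex.re_le_norm _)
  simpa using h.re_pos.le

lemma SP.norm_sub_le (hμ : 0 < μ) (h : SP μ z a) :
    ‖a - (√(2 * μ) : ℝ)‖ ≤ (√(2 * μ))⁻¹ * ‖z‖ ^ 2 := by
  have hk := sqrt_two_mul_pos hμ
  have e := congrArg norm (h.mul_add hμ)
  rw [norm_mul, norm_pow] at e
  rw [← div_eq_inv_mul, le_div_iff₀ hk, ← e]
  exact mul_le_mul_of_nonneg_left h.le_norm_add (norm_nonneg _)

/-- With `κ = √(2μ)` and `(a - κ)(a + κ) = z²`, the difference to be estimated equals `-(a - κ)² /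
2κ`, already of order `z⁴`. -/
lemma SP.norm_sub_sub_le (hμ : 0 < μ) (h : SP μ z a) :
    ‖a - (√(2 * μ) : ℝ) - z ^ 2 / (2 * (√(2 * μ) : ℝ))‖ ≤ (√(2 * μ))⁻¹ ^ 3 * ‖z‖ ^ 4 := by
  have hk := sqrt_two_mul_pos hμ
  have hk' : ((√(2 * μ) : ℝ) : ℂ) ≠ 0 := by exact_mod_cast hk.ne'
  have e : a - (√(2 * μ) : ℝ) - z ^ 2 / (2 * (√(2 * μ) : ℝ)) =
      -((a - (√(2 * μ) : ℝ)) ^ 2 * (2 * ((√(2 * μ) : ℝ) : ℂ))⁻¹) := by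
    rw [← h.mul_add hμ]
    field_simp
    ring
  have h1 := h.norm_sub_le hμ
  rw [e, norm_neg, norm_mul, norm_pow, norm_inv, norm_mul, Complex.norm_real,
    Real.norm_of_nonneg hk.le, Complex.norm_ofNat, mul_inv]
  have h2 : (2⁻¹ : ℝ) * (√(2 * μ))⁻¹ ≤ (√(2 * μ))⁻¹ :=
    mul_le_of_le_one_left (by positivity) (by norm_num)
  calc _ ≤ ((√(2 * μ))⁻¹ * ‖z‖ ^ 2) ^ 2 * (√(2 * μ))⁻¹ := by gcongr
    _ = _ := by ring

/-- The constant matrix `diag(1, 0) / 4π`. -/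
def QA : Mat2 := dg (1 / (4 * Real.pi)) 0

/-- The kernel `diag(|x-y|, exp(-κ|x-y|)/κ) / 8π`. -/
def QB (μ : ℝ) (x y : E3) : Mat2 :=
  dg (‖x - y‖ / (8 * Real.pi))
    (Complex.exp (-((√(2 * μ) : ℝ) * (‖x - y‖ : ℝ))) / (8 * Real.pi * (√(2 * μ) : ℝ)))

/-- The constant in the expansion of the free kernel. -/
def cExp (μ : ℝ) : ℝ := (1 + (√(2 * μ))⁻¹) ^ 3

lemma one_le_cExp (hμ : 0 < μ) : 1 ≤ cExp μ :=
  one_le_pow₀ (by have := sqrt_two_mul_pos hμ; have : 0 < (√(2 * μ))⁻¹ := by positivity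
                  linarith)

/-- The free kernel at the threshold. -/
def kerG0 (μ : ℝ) : E3 → E3 → Mat2 := kerG 0 (√(2 * μ) : ℝ)

/-- The free kernel at `z`. -/
def kerGz (z a : ℂ) : E3 → E3 → Mat2 := kerG (-(Complex.I * z)) a

lemma norm_act_kerG_le {a1 a2 : ℂ} (h1 : 0 ≤ a1.re) (h2 : 0 ≤ a2.re) (x y : E3) (w : C2) :
    ‖act (kerG a1 a2 x y) w‖ ≤ 1 * ‖x - y‖⁻¹ * ‖w‖ := by
  have hpi : (4 * Real.pi)⁻¹ ≤ 1 := inv_le_one_of_one_le₀ (by linarith [Real.pi_gt_three])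
  have : ∀ {a : ℂ}, 0 ≤ a.re → ‖gK a ‖x - y‖‖ ≤ 1 * ‖x - y‖⁻¹ := fun ha =>
    (norm_gK_le ha (norm_nonneg _)).trans (mul_le_mul_of_nonneg_right hpi (by positivity))
  exact norm_act_dg_le (this h1) (this h2) w

lemma one_add_norm_sub_le (x y : E3) : 1 + ‖x - y‖ ≤ 3 * (bracket x * bracket y) := by
  nlinarith [norm_sub_le_bracket x y, one_le_bracket x, one_le_bracket y]

lemma inv_le_cExp (hμ : 0 < μ) : (√(2 * μ))⁻¹ ≤ cExp μ := by
  have := sqrt_two_mul_pos hμ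
  have h : 0 < (√(2 * μ))⁻¹ := by positivity
  have : 1 + (√(2 * μ))⁻¹ ≤ cExp μ := le_self_pow₀ (by linarith) (by norm_num)
  linarith

lemma norm_exp_kappa_le (μ : ℝ) {r : ℝ} (hr : 0 ≤ r) :
    ‖Complex.exp (-((√(2 * μ) : ℝ) * r : ℂ))‖ ≤ 1 :=
  norm_exp_neg_mul_le (by simp) hr

lemma norm_act_QB_le (hμ : 0 < μ) (x y : E3) (w : C2) :
    ‖act (QB μ x y) w‖ ≤ 3 * cExp μ * (bracket x ^ (1 : ℝ) * bracket y ^ (1 : ℝ)) * ‖w‖ := by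
  have hk := sqrt_two_mul_pos hμ
  have h8 : 1 ≤ 8 * Real.pi := by linarith [Real.pi_gt_three]
  have hn8 : ‖(8 * Real.pi : ℂ)‖ = 8 * Real.pi := by simp [abs_of_pos Real.pi_pos]
  have h1 := one_add_norm_sub_le x y
  have hK := one_le_cExp hμ
  have key : cExp μ * (1 + ‖x - y‖) ≤
      3 * cExp μ * (bracket x ^ (1 : ℝ) * bracket y ^ (1 : ℝ)) := by
    rw [Real.rpow_one, Real.rpow_one]
    nlinarith
  refine norm_act_dg_le ?_ ?_ w
  · refine le_trans ?_ key
    rw [norm_div, hn8, Complex.norm_real, norm_norm]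
    refine (div_le_self (norm_nonneg _) h8).trans ?_
    nlinarith [norm_nonneg (x - y)]
  · refine le_trans ?_ key
    rw [norm_div, norm_mul, hn8, Complex.norm_real, Real.norm_of_nonneg hk.le]
    have e : 8 * Real.pi * √(2 * μ) ≥ √(2 * μ) := by nlinarith
    have h2 := norm_exp_kappa_le μ (norm_nonneg (x - y))
    calc _ ≤ 1 / √(2 * μ) := div_le_div₀ zero_le_one h2 hk e
      _ ≤ cExp μ := by rw [one_div]; exact inv_le_cExp hμ
      _ ≤ _ := by nlinarith [norm_nonneg (x - y)]

lemma norm_I_mul (z : ℂ) : ‖-(Complex.I * z)‖ = ‖z‖ := by simp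

lemma norm_kerGz_sub_le (hμ : 0 < μ) (h : SP μ z a) (x y : E3) (hxy : x ≠ y) (w : C2) :
    ‖act (kerGz z a x y - kerG0 μ x y) w‖ ≤
      cExp μ * ‖z‖ * (bracket x ^ (0 : ℝ) * bracket y ^ (0 : ℝ)) * ‖w‖ := by
  have hr : 0 < ‖x - y‖ := norm_pos_iff.2 (sub_ne_zero.2 hxy)
  have hK := one_le_cExp hμ
  rw [kerGz, kerG0, kerG, kerG, dg_sub, Real.rpow_zero, Real.rpow_zero, mul_one, mul_one]
  refine norm_act_dg_le ?_ ?_ w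
  · refine (norm_gK_sub_le (by simp) h.re_pos'.le hr).trans ?_
    rw [sub_zero, norm_I_mul]
    exact le_mul_of_one_le_left (norm_nonneg z) hK
  · refine (norm_gK_sub_le (by simp) h.re_pos.le hr).trans
      ((h.norm_sub_le hμ).trans ?_)
    exact mul_le_mul (inv_le_cExp hμ) (pow_le_of_le_one (norm_nonneg z) h.norm_le (by norm_num))
      (by positivity) (by positivity)

lemma norm_kerGz_sub_le_sq (hμ : 0 < μ) (h : SP μ z a) (x y : E3) (hxy : x ≠ y) (w : C2) :
    ‖act (kerGz z a x y - kerG0 μ x y - (Complex.I * z) • QA) w‖ ≤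
      3 * cExp μ * ‖z‖ ^ 2 * (bracket x ^ (1 : ℝ) * bracket y ^ (1 : ℝ)) * ‖w‖ := by
  have hr : 0 < ‖x - y‖ := norm_pos_iff.2 (sub_ne_zero.2 hxy)
  have hK := one_le_cExp hμ
  have key : cExp μ * ‖z‖ ^ 2 * (1 + ‖x - y‖) ≤
      3 * cExp μ * ‖z‖ ^ 2 * (bracket x ^ (1 : ℝ) * bracket y ^ (1 : ℝ)) := by
    rw [Real.rpow_one, Real.rpow_one]
    calc _ ≤ cExp μ * ‖z‖ ^ 2 * (3 * (bracket x * bracket y)) :=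
          mul_le_mul_of_nonneg_left (one_add_norm_sub_le x y) (by positivity)
      _ = _ := by ring
  rw [kerGz, kerG0, kerG, kerG, QA, smul_dg, dg_sub, dg_sub]
  refine norm_act_dg_le ?_ ?_ w
  · refine le_trans ?_ key
    have h2 := norm_gK_sub_le_sq (c := 0) (by simp) h.re_pos'.le hr
    rw [sub_zero, norm_I_mul] at h2
    refine le_trans (le_of_eq ?_) (h2.trans ?_)
    · congr 1
      simp
      ring
    · have : ‖z‖ ^ 2 * ‖x - y‖ ≤ cExp μ * (‖z‖ ^ 2 * ‖x - y‖) :=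
        le_mul_of_one_le_left (by positivity) hK
      nlinarith [mul_nonneg (zero_le_one.trans hK) (sq_nonneg ‖z‖)]
  · refine le_trans ?_ key
    rw [mul_zero, sub_zero]
    refine (norm_gK_sub_le (by simp) h.re_pos.le hr).trans ((h.norm_sub_le hμ).trans ?_)
    calc _ ≤ cExp μ * ‖z‖ ^ 2 := mul_le_mul_of_nonneg_right (inv_le_cExp hμ) (by positivity)
      _ ≤ _ := le_mul_of_one_le_right (by positivity) (by linarith)

/-- The first entry is the Taylor expansion of `e^{izr} / 4πr` to second order. In the second entry
`a - κ` is itself of order `z²`, with `κ = √(2μ)`, so a first-order expansion suffices. -/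
lemma norm_kerGz_sub_le_cube (hμ : 0 < μ) (h : SP μ z a) (x y : E3) (hxy : x ≠ y) (w : C2) :
    ‖act (kerGz z a x y - kerG0 μ x y - (Complex.I * z) • QA + z ^ 2 • QB μ x y) w‖ ≤
      9 * cExp μ * ‖z‖ ^ 3 * (bracket x ^ (2 : ℝ) * bracket y ^ (2 : ℝ)) * ‖w‖ := by
  have hr : 0 < ‖x - y‖ := norm_pos_iff.2 (sub_ne_zero.2 hxy)
  have hk := sqrt_two_mul_pos hμ
  have hki : 0 < (√(2 * μ))⁻¹ := by positivity
  have hK := one_le_cExp hμ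
  have hz3 : ‖z‖ ^ 4 ≤ ‖z‖ ^ 3 := pow_le_pow_of_le_one (norm_nonneg z) h.norm_le (by norm_num)
  have key : cExp μ * ‖z‖ ^ 3 * (1 + ‖x - y‖) ^ 2 ≤
      9 * cExp μ * ‖z‖ ^ 3 * (bracket x ^ (2 : ℝ) * bracket y ^ (2 : ℝ)) := by
    rw [Real.rpow_two, Real.rpow_two]
    calc _ ≤ cExp μ * ‖z‖ ^ 3 * (3 * (bracket x * bracket y)) ^ 2 :=
          mul_le_mul_of_nonneg_left
            (pow_le_pow_left₀ (by positivity) (one_add_norm_sub_le x y) 2) (by positivity)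
      _ = _ := by ring
  rw [kerGz, kerG0, kerG, kerG, QA, QB, smul_dg, smul_dg, dg_sub, dg_sub, dg_add]
  refine norm_act_dg_le ?_ ?_ w
  · refine le_trans ?_ key
    have h2 := norm_gK_sub_le_cube (c := 0) (by simp) h.re_pos'.le hr
    rw [sub_zero, norm_I_mul] at h2
    refine le_trans (le_of_eq ?_) (h2.trans ?_)
    · congr 1
      simp [mul_pow]
      ring
    · have e1 : ‖z‖ ^ 3 * ‖x - y‖ ^ 2 ≤ cExp μ * (‖z‖ ^ 3 * ‖x - y‖ ^ 2) :=
        le_mul_of_one_le_left (by positivity) hK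
      have e2 : 0 ≤ cExp μ * ‖z‖ ^ 3 * (1 + 2 * ‖x - y‖) := by positivity
      nlinarith
  · refine le_trans ?_ key
    have h2 := norm_gK_sub_le_sq (c := (√(2 * μ) : ℝ)) (by simp) h.re_pos.le hr
    have h3 := h.norm_sub_sub_le hμ
    have h4 := h.norm_sub_le hμ
    have h5 := norm_exp_kappa_le μ hr.le
    set d := a - ((√(2 * μ) : ℝ) : ℂ) with hd
    set E := Complex.exp (-((√(2 * μ) : ℝ) * ‖x - y‖ : ℂ)) with hE
    have hk' : ((√(2 * μ) : ℝ) : ℂ) ≠ 0 := by exact_mod_cast hk.ne'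
    have hp : (Real.pi : ℂ) ≠ 0 := by exact_mod_cast Real.pi_ne_zero
    -- Replacing `a - κ` by its leading part `z² / 2κ` in the linear term produces the entry
    -- `e^{-κr} / 8πκ`; what is left over is of order `z⁴`.
    have e : gK a ‖x - y‖ - gK ((√(2 * μ) : ℝ) : ℂ) ‖x - y‖ - Complex.I * z * 0 +
        z ^ 2 * (E / (8 * Real.pi * (√(2 * μ) : ℝ))) =
        (gK a ‖x - y‖ - gK ((√(2 * μ) : ℝ) : ℂ) ‖x - y‖ + d / (4 * Real.pi) * E) -
          (d - z ^ 2 / (2 * (√(2 * μ) : ℝ))) / (4 * Real.pi) * E := by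
      field_simp
      ring
    rw [e]
    have h6 : ‖(d - z ^ 2 / (2 * (√(2 * μ) : ℝ))) / (4 * Real.pi) * E‖ ≤
        (√(2 * μ))⁻¹ ^ 3 * ‖z‖ ^ 4 := by
      rw [norm_mul, norm_div]
      have hn4 : ‖(4 * Real.pi : ℂ)‖ = 4 * Real.pi := by simp [abs_of_pos Real.pi_pos]
      rw [hn4]
      have := div_le_self (norm_nonneg (d - z ^ 2 / (2 * (√(2 * μ) : ℝ))))
        (show 1 ≤ 4 * Real.pi by linarith [Real.pi_gt_three])
      exact (mul_le_of_le_one_right (by positivity) h5).trans (this.trans h3)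
    have h7 : ‖d‖ ^ 2 * ‖x - y‖ ≤ ((√(2 * μ))⁻¹ ^ 2 * ‖z‖ ^ 4) * ‖x - y‖ := by
      refine mul_le_mul_of_nonneg_right ?_ hr.le
      calc ‖d‖ ^ 2 ≤ ((√(2 * μ))⁻¹ * ‖z‖ ^ 2) ^ 2 := pow_le_pow_left₀ (norm_nonneg _) h4 2
        _ = _ := by ring
    refine (_root_.norm_sub_le _ _).trans ((add_le_add (h2.trans h7) h6).trans ?_)
    have c1 : (√(2 * μ))⁻¹ ^ 2 ≤ cExp μ := by rw [cExp]; nlinarith [pow_pos hki 2, pow_pos hki 3]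
    have c2 : (√(2 * μ))⁻¹ ^ 3 ≤ cExp μ := by rw [cExp]; nlinarith [pow_pos hki 2, pow_pos hki 3]
    calc _ ≤ cExp μ * ‖z‖ ^ 3 * ‖x - y‖ + cExp μ * ‖z‖ ^ 3 := by gcongr
      _ ≤ cExp μ * ‖z‖ ^ 3 * (1 + ‖x - y‖) ^ 2 := by
        have : 0 ≤ cExp μ * ‖z‖ ^ 3 := by positivity
        nlinarith [mul_nonneg this hr.le, mul_nonneg this (sq_nonneg ‖x - y‖)]

lemma measMat_kerGz (z a : ℂ) : MeasMat fun p : E3 × E3 => kerGz z a p.1 p.2 := measMat_kerG _ _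

lemma measMat_kerG0 (μ : ℝ) : MeasMat fun p : E3 × E3 => kerG0 μ p.1 p.2 := measMat_kerG _ _

lemma measMat_QB (μ : ℝ) : MeasMat fun p : E3 × E3 => QB μ p.1 p.2 := by
  refine measMat_dg ?_ ?_
  · fun_prop
  · fun_prop

end SP

/-! ### The operators of the threshold expansion -/

lemma Wt.integrable {c s : ℝ} {M : E3 → Mat2} (h : Wt c s M) (hs : 3 / 2 < s) (f : L2) :
    Integrable fun x => act (M x) (f x) := by
  have hi := (integral_mul_norm_le (fun x => (bracket_rpow_pos x (-s)).le) (memLp_bracket hs) f).1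
  refine (hi.const_mul c).mono' (h.meas.act (Lp.aestronglyMeasurable f)) ?_
  filter_upwards [h.bound] with x hx
  exact (hx _).trans (le_of_eq (by ring))

lemma Wt.memLp_const {c s : ℝ} {M : E3 → Mat2} (h : Wt c s M) (hs : 3 / 2 < s) (w : C2) :
    MemLp (fun x => act (M x) w) 2 volume := by
  refine MemLp.of_le_mul (memLp_bracket hs) (h.meas.act aestronglyMeasurable_const)
    (c := c * ‖w‖) ?_
  filter_upwards [h.bound] with x hx
  rw [Real.norm_of_nonneg (bracket_rpow_pos x _).le]
  exact (hx _).trans (le_of_eq (by ring))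

/-- The first basis vector of `ℂ²`. -/
def vec1 : C2 := EuclideanSpace.single 0 1

lemma pi1_eq_smul (w : C2) : pi1 w = (w 0) • vec1 := by
  apply C2_ext <;> simp [pi1_eq, act_apply, dg, vec1]

lemma inner_vec1 (w : C2) : inner ℂ vec1 w = w 0 := by
  simp [vec1, EuclideanSpace.inner_single_left]

/-- `T₀ = v R₀ v`, so that `A₀ = 1 - T₀`. -/
def T0 (μ : ℝ) (V1 V2 : E3 → ℝ) : L2 →L[ℂ] L2 := wop (v V1 V2) (kerG0 μ) (v V1 V2)

/-- `A(z) = 1 - v G(z) v`. -/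
def Az (V1 V2 : E3 → ℝ) (z a : ℂ) : L2 →L[ℂ] L2 := 1 - wop (v V1 V2) (kerGz z a) (v V1 V2)

/-- The operator with kernel `v QB v`. -/
def Bop (μ : ℝ) (V1 V2 : E3 → ℝ) : L2 →L[ℂ] L2 := wop (v V1 V2) (QB μ) (v V1 V2)

open Classical in
/-- The function `v (1, 0)ᵗ`. -/
def eL (V1 V2 : E3 → ℝ) : L2 :=
  if h : MemLp (fun x => act (v V1 V2 x) vec1) 2 (volume : Measure E3) then h.toLp _ else 0

lemma kerR0_eq (μ : ℝ) (x y : E3) : kerR0 μ x y = kerG0 μ x y * sigma3 := by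
  rw [kerG0, kerG, sigma3_eq, dg_mul, kerR0, dg]
  simp only [gK, zero_mul, neg_zero, Complex.exp_zero]
  push_cast
  congr 3
  · simp
  · simp; ring

lemma kerVRV_eq (μ : ℝ) (V1 V2 : E3 → ℝ) :
    kerVRV μ V1 V2 = fun x y => -(v V1 V2 x * kerG0 μ x y * v V1 V2 y) := by
  funext x y
  rw [kerVRV, kerR0_eq, v1, mul_neg, ← mul_assoc (v V1 V2 x), mul_assoc _ sigma3,
    ← mul_assoc sigma3, sigma3_mul_sigma3, one_mul]

lemma kerA1_eq (V1 V2 : E3 → ℝ) :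
    kerA1 V1 V2 = fun x y => (-Complex.I) • (v V1 V2 x * QA * v V1 V2 y) := by
  funext x y
  have e : (Complex.I / (4 * Real.pi)) • dg 1 0 * sigma3 = Complex.I • QA := by
    rw [QA, sigma3_eq, smul_dg, dg_mul, smul_dg]; congr 1 <;> ring
  change (Complex.I / (4 * Real.pi)) • (v V1 V2 x * dg 1 0 * v1 V1 V2 y) = _
  rw [v1, mul_neg, smul_neg, neg_smul, ← mul_assoc, ← smul_mul_assoc, mul_assoc (v V1 V2 x),
    ← mul_smul_comm, ← smul_mul_assoc, e, mul_smul_comm, smul_mul_assoc]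

lemma kerB_eq (μ : ℝ) (V1 V2 : E3 → ℝ) :
    kerB μ V1 V2 = fun x y => v V1 V2 x * QB μ x y * v V1 V2 y := by
  funext x y
  rw [kerB, ← smul_mul_assoc, ← mul_smul_comm]
  congr 2
  change (1 / (8 * Real.pi) : ℂ) • dg _ _ = _
  rw [smul_dg, QB]
  congr 1
  · ring
  · push_cast
    rw [neg_mul]
    field_simp

section

variable {μ β C : ℝ} {V1 V2 : E3 → ℝ}

lemma Pot.wtPair (h : Pot μ β C V1 V2) : WtPair (β / 2) (β / 2) :=
  Or.inl ⟨by linarith [h.five_lt], by linarith [h.five_lt]⟩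

lemma Pot.three_half_lt (h : Pot μ β C V1 V2) : 3 / 2 < β / 2 := by linarith [h.five_lt]

lemma Pot.T0_spec (h : Pot μ β C V1 V2) :
    IsKernelOp (fun x y => v V1 V2 x * kerG0 μ x y * v V1 V2 y) (T0 μ V1 V2) ∧
      IsCompactOperator (T0 μ V1 V2) ∧
      ∀ f, ‖T0 μ V1 V2 f‖ ≤ 1 * cInv (4 * √C * (4 * √C)) (β / 2) (β / 2) * ‖f‖ :=
  wop_inv h.wt_v h.wt_v (measMat_kerG0 μ) zero_le_one
    (fun x y _ => norm_act_kerG_le (by simp) (by simp) x y) h.wtPair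

lemma Pot.isKernelOp_Bop (h : Pot μ β C V1 V2) :
    IsKernelOp (fun x y => v V1 V2 x * QB μ x y * v V1 V2 y) (Bop μ V1 V2) :=
  (wop_pow h.wt_v h.wt_v (measMat_QB μ) (by have := one_le_cExp h.mu_pos; positivity)
    (fun x y _ => norm_act_QB_le h.mu_pos x y) (by linarith [h.five_lt])
    (by linarith [h.five_lt])).1

lemma norm_act_QA_le (x y : E3) (w : C2) :
    ‖act QA w‖ ≤ 1 * (bracket x ^ (0 : ℝ) * bracket y ^ (0 : ℝ)) * ‖w‖ := by
  rw [Real.rpow_zero, Real.rpow_zero, mul_one, mul_one]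
  refine norm_act_dg_le ?_ (by simp) w
  rw [norm_div, norm_one, one_div]
  refine inv_le_one_of_one_le₀ ?_
  have : ‖(4 * Real.pi : ℂ)‖ = 4 * Real.pi := by simp [abs_of_pos Real.pi_pos]
  rw [this]; linarith [Real.pi_gt_three]

lemma Pot.isKernelOp_QA (h : Pot μ β C V1 V2) :
    IsKernelOp (fun x y => v V1 V2 x * QA * v V1 V2 y)
      (wop (v V1 V2) (fun _ _ => QA) (v V1 V2)) :=
  (wop_pow (D := fun _ _ => QA) h.wt_v h.wt_v (.const QA) zero_le_one
    (fun x y _ => norm_act_QA_le x y) (by linarith [h.five_lt])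
    (by linarith [h.five_lt])).1

lemma Pot.eL_ae (h : Pot μ β C V1 V2) : eL V1 V2 =ᵐ[volume] fun x => act (v V1 V2 x) vec1 := by
  have hm := h.wt_v.memLp_const h.three_half_lt vec1
  rw [eL, dif_pos hm]
  exact hm.coeFn_toLp

lemma Pot.inner_eL (h : Pot μ β C V1 V2) (f : L2) :
    inner ℂ (eL V1 V2) f = (∫ x, act (v V1 V2 x) (f x)) 0 := by
  rw [← inner_vec1, ← integral_inner (h.wt_v.integrable h.three_half_lt f), L2.inner_def]
  refine integral_congr_ae ?_
  filter_upwards [h.eL_ae] with x hx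
  rw [hx, inner_act, v_conjTranspose]

lemma Pot.pi1_integral (h : Pot μ β C V1 V2) (f : L2) :
    ∫ x, pi1 (act (v V1 V2 x) (f x)) = inner ℂ (eL V1 V2) f • vec1 := by
  rw [pi1.integral_comp_comm (h.wt_v.integrable h.three_half_lt f), pi1_eq_smul, h.inner_eL]

/-- The kernel `v(x) diag(1, 0) v(y)` factors through the first component of `∫ v f`, that is
through `⟨e, f⟩`, so the first-order term has rank at most one. -/
lemma Pot.QA_op (h : Pot μ β C V1 V2) (f : L2) :
    wop (v V1 V2) (fun _ _ => QA) (v V1 V2) f =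
      (1 / (4 * Real.pi) : ℂ) • inner ℂ (eL V1 V2) f • eL V1 V2 := by
  refine Lp.ext ?_
  filter_upwards [h.isKernelOp_QA f, h.eL_ae,
    Lp.coeFn_smul (1 / (4 * Real.pi) : ℂ) (inner ℂ (eL V1 V2) f • eL V1 V2),
    Lp.coeFn_smul (inner ℂ (eL V1 V2) f) (eL V1 V2)] with x h1 h2 h3 h4
  rw [h1.2, h3, Pi.smul_apply, h4, Pi.smul_apply, h2, ← act_smul, ← act_smul, ← h.pi1_integral]
  have e : ∀ y, act (v V1 V2 x * QA * v V1 V2 y) (f y) =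
      Matrix.toEuclideanCLM (n := Fin 2) (𝕜 := ℂ) (v V1 V2 x)
        ((1 / (4 * Real.pi) : ℂ) • pi1 (act (v V1 V2 y) (f y))) := fun y => by
    rw [act_mul, act_mul, QA, act_dg, zero_smul, add_zero]
    rfl
  simp only [e]
  have hi : Integrable fun y => (1 / (4 * Real.pi) : ℂ) • pi1 (act (v V1 V2 y) (f y)) :=
    (pi1.integrable_comp (h.wt_v.integrable h.three_half_lt f)).smul (1 / (4 * Real.pi) : ℂ)
  rw [ContinuousLinearMap.integral_comp_comm _ hi, integral_smul]
  rfl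

lemma Pot.A0_apply (h : Pot μ β C V1 V2) (f : L2) : A0 μ V1 V2 f = f - T0 μ V1 V2 f := by
  have : kernelOp (kerVRV μ V1 V2) = -T0 μ V1 V2 := by
    rw [kerVRV_eq]; exact h.T0_spec.1.neg.kernelOp_eq
  rw [A0, this, ← sub_eq_add_neg]
  rfl

lemma Pot.exists_kerVRV (h : Pot μ β C V1 V2) : ∃ T, IsKernelOp (kerVRV μ V1 V2) T := by
  rw [kerVRV_eq]; exact ⟨_, h.T0_spec.1.neg⟩

lemma Pot.exists_kerA1 (h : Pot μ β C V1 V2) : ∃ T, IsKernelOp (kerA1 V1 V2) T := by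
  rw [kerA1_eq]; exact ⟨_, h.isKernelOp_QA.smul _⟩

lemma Pot.exists_kerB (h : Pot μ β C V1 V2) : ∃ T, IsKernelOp (kerB μ V1 V2) T := by
  rw [kerB_eq]; exact ⟨_, h.isKernelOp_Bop⟩

lemma kernelOp_kerB (μ : ℝ) (V1 V2 : E3 → ℝ) : kernelOp (kerB μ V1 V2) = Bop μ V1 V2 := by
  rw [kerB_eq]; rfl

lemma Pot.kernelOp_kerA1 (h : Pot μ β C V1 V2) (f : L2) : kernelOp (kerA1 V1 V2) f =
    (-Complex.I) • (1 / (4 * Real.pi) : ℂ) • inner ℂ (eL V1 V2) f • eL V1 V2 := by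
  rw [kerA1_eq, (h.isKernelOp_QA.smul (-Complex.I)).kernelOp_eq, ← h.QA_op]
  rfl

lemma gK_conj {a : ℂ} (ha : (starRingEnd ℂ) a = a) (r : ℝ) : star (gK a r) = gK a r := by
  have h4 : (starRingEnd ℂ) 4 = 4 := Complex.conj_ofNat 4
  rw [gK, RCLike.star_def, map_div₀, ← Complex.exp_conj]
  simp [ha, h4]

lemma kerG0_conjTranspose (μ : ℝ) (x y : E3) :
    (kerG0 μ y x).conjTranspose = kerG0 μ x y := by
  rw [kerG0, kerG, dg_conjTranspose, gK_conj (by simp), gK_conj (by simp), norm_sub_rev]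
  rfl

lemma Pot.inner_T0 (h : Pot μ β C V1 V2) (f g : L2) :
    inner ℂ (T0 μ V1 V2 f) g = inner ℂ f (T0 μ V1 V2 g) := by
  have h1 := domBy_inv h.wt_v h.wt_v (measMat_kerG0 μ) zero_le_one
    (fun x y _ => norm_act_kerG_le (by simp) (by simp) x y)
  have h2 := (h.wtPair.hs (mul_nonneg h.wt_v.nonneg h.wt_v.nonneg)).const_mul zero_le_one
  have h3 := h.T0_spec.1.adjoint h1 h2
  have e : (fun x y => (v V1 V2 y * kerG0 μ y x * v V1 V2 x).conjTranspose) =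
      fun x y => v V1 V2 x * kerG0 μ x y * v V1 V2 y := by
    funext x y
    rw [Matrix.conjTranspose_mul, Matrix.conjTranspose_mul, v_conjTranspose, v_conjTranspose,
      kerG0_conjTranspose, mul_assoc]
  rw [e] at h3
  have h4 := h3.unique h.T0_spec.1
  rw [← ContinuousLinearMap.adjoint_inner_right, h4]

lemma Pot.mem_S1space (h : Pot μ β C V1 V2) {f : L2} :
    f ∈ S1space μ V1 V2 ↔ T0 μ V1 V2 f = f := by
  change A0 μ V1 V2 f = 0 ↔ _
  rw [h.A0_apply, sub_eq_zero, eq_comm]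

/-- `m(0) f` is a nonzero multiple of `⟨e, f⟩ S₁ e`. It vanishes if `⟨e, f⟩ = 0` or if `S₁ e = 0`,
and for `f` in `S₁` the second case entails the first. -/
lemma Pot.mem_S2space (h : Pot μ β C V1 V2) {f : L2} :
    f ∈ S2space μ V1 V2 ↔ f ∈ S1space μ V1 V2 ∧ inner ℂ (eL V1 V2) f = 0 := by
  refine and_congr_right fun hf => ?_
  change S1 μ V1 V2 (kernelOp (kerA1 V1 V2) (S1 μ V1 V2 f)) = 0 ↔ _
  have hS : S1 μ V1 V2 f = f := Submodule.starProjection_eq_self_iff.2 hf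
  have hc : (-Complex.I) * (1 / (4 * Real.pi) : ℂ) ≠ 0 := by
    simp [Real.pi_ne_zero]
  have hsym : inner ℂ (eL V1 V2) f = inner ℂ (S1 μ V1 V2 (eL V1 V2)) f := by
    conv_lhs => rw [← hS]
    exact (Submodule.inner_starProjection_left_eq_right _ _ _).symm
  rw [hS, h.kernelOp_kerA1, smul_smul, map_smul, map_smul, smul_eq_zero_iff_right hc,
    smul_eq_zero]
  refine ⟨fun h1 => h1.elim id fun h2 => ?_, Or.inl⟩
  rw [hsym, h2, inner_zero_left]

end

/-! ### Zero energy solutions -/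

/-- The free kernel at the threshold, corrected to decay in the first variable. -/
def kerTh (μ : ℝ) (x y : E3) : Mat2 := kerG0 μ x y - ((4 * Real.pi * bracket x)⁻¹ : ℂ) • dg 1 0

/-- The operator `φ ↦ R₀ v φ` on the orthogonal complement of `v (1, 0)ᵗ`. -/
def Th (μ : ℝ) (V1 V2 : E3 → ℝ) : L2 →L[ℂ] L2 := wop (fun _ => 1) (kerTh μ) (v V1 V2)

lemma wt_one : Wt 1 0 fun _ => 1 := ⟨zero_le_one, .const 1, .of_forall fun x w => by simp [act_one]⟩

lemma abs_bracket_sub_le (x y : E3) : |bracket x - ‖x - y‖| ≤ 2 * bracket y := by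
  have h1 : ‖x‖ ≤ ‖x - y‖ + ‖y‖ := by simpa using norm_add_le (x - y) y
  have h2 := _root_.norm_sub_le x y
  rw [abs_le]
  constructor <;>
    linarith [bracket_le x, norm_le_bracket x, norm_le_bracket y, one_le_bracket y]

/-- In the first entry `1/|x-y| - 1/⟨x⟩` has numerator `⟨x⟩ - |x-y| = O(⟨y⟩)`, which gains a factor
`⟨x⟩⁻¹`. In the second entry the exponential pays for the same gain, through `⟨x⟩ ≤ 2 (1 + |x-y|)
⟨y⟩`. -/
lemma norm_act_kerTh_le {μ : ℝ} (hμ : 0 < μ) (x y : E3) (hxy : x ≠ y) (w : C2) :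
    ‖act (kerTh μ x y) w‖ ≤ 2 * cExp μ * ((bracket x)⁻¹ * ‖x - y‖⁻¹ * bracket y) * ‖w‖ := by
  have hr : 0 < ‖x - y‖ := norm_pos_iff.2 (sub_ne_zero.2 hxy)
  have hk := sqrt_two_mul_pos hμ
  have hK := one_le_cExp hμ
  have hbx := bracket_pos x
  have hby := bracket_pos y
  have hpi : (4 * Real.pi)⁻¹ ≤ 1 := inv_le_one_of_one_le₀ (by linarith [Real.pi_gt_three])
  rw [kerTh, kerG0, kerG, smul_dg, dg_sub]
  refine norm_act_dg_le ?_ ?_ w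
  · have e : gK 0 ‖x - y‖ - (4 * Real.pi * bracket x : ℂ)⁻¹ * 1 =
        (((4 * Real.pi)⁻¹ * ((bracket x - ‖x - y‖) * ((bracket x)⁻¹ * ‖x - y‖⁻¹)) : ℝ) : ℂ) := by
      have h1 : (bracket x : ℂ) ≠ 0 := by exact_mod_cast hbx.ne'
      have h2 : ((‖x - y‖ : ℝ) : ℂ) ≠ 0 := by exact_mod_cast hr.ne'
      have h3 : (Real.pi : ℂ) ≠ 0 := by exact_mod_cast Real.pi_ne_zero
      rw [gK, zero_mul, neg_zero, Complex.exp_zero]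
      push_cast
      field_simp
    rw [e, Complex.norm_real, Real.norm_eq_abs, abs_mul, abs_mul, abs_of_pos (by positivity),
      abs_of_pos (show 0 < (bracket x)⁻¹ * ‖x - y‖⁻¹ by positivity)]
    calc _ ≤ 1 * (2 * bracket y * ((bracket x)⁻¹ * ‖x - y‖⁻¹)) := by
          gcongr
          exact abs_bracket_sub_le x y
      _ ≤ cExp μ * (2 * bracket y * ((bracket x)⁻¹ * ‖x - y‖⁻¹)) := by gcongr
      _ = _ := by ring
  · rw [mul_zero, sub_zero, norm_gK _ hr.le, Complex.ofReal_re]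
    have h1 : bracket x * Real.exp (-(√(2 * μ) * ‖x - y‖)) ≤ 2 * cExp μ * bracket y := by
      have h2 := Real.add_one_le_exp (√(2 * μ) * ‖x - y‖)
      have h3 : (1 + ‖x - y‖) ≤ cExp μ * (√(2 * μ) * ‖x - y‖ + 1) := by
        have h4 := mul_le_mul_of_nonneg_right (inv_le_cExp hμ) (mul_pos hk hr).le
        rw [inv_mul_cancel_left₀ hk.ne'] at h4
        linarith
      rw [Real.exp_neg, ← div_eq_mul_inv, div_le_iff₀ (Real.exp_pos _)]
      calc bracket x ≤ 2 * (1 + ‖x - y‖) * bracket y := bracket_le_mul x y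
        _ ≤ 2 * (cExp μ * Real.exp (√(2 * μ) * ‖x - y‖)) * bracket y := by
          gcongr
          exact h3.trans (mul_le_mul_of_nonneg_left h2 (by positivity))
        _ = _ := by ring
    calc _ = (4 * Real.pi)⁻¹ * ((bracket x * Real.exp (-(√(2 * μ) * ‖x - y‖))) *
          ((bracket x)⁻¹ * ‖x - y‖⁻¹)) := by field_simp
      _ ≤ 1 * ((2 * cExp μ * bracket y) * ((bracket x)⁻¹ * ‖x - y‖⁻¹)) := by gcongr
      _ = _ := by ring

lemma measMat_kerTh (μ : ℝ) : MeasMat fun p : E3 × E3 => kerTh μ p.1 p.2 := by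
  refine (measMat_kerG0 μ).sub (MeasMat.smul ?_ (.const _))
  have := continuous_bracket.measurable
  fun_prop

/-- Potentials of decaying functions. -/
lemma integrable_potential {F : Type*} [NormedAddCommGroup F] [InnerProductSpace ℂ F] {a : ℂ}
    (ha : 0 ≤ a.re) {q : ℝ} (hq : 3 / 2 < q) {f : L2v F}
    (hf : MemLp (fun x => bracket x ^ q • f x) 2 volume) (φ : 𝓢(E3, ℂ)) :
    Integrable (fun p : E3 × E3 => φ p.1 • gK a ‖p.1 - p.2‖ • f p.2) (volume.prod volume) := by
  have hk := hs_bracket_inv_bracket (p := 2) (q := q) (by norm_num) hq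
  have h1 := memLp_two_integrable_norm_sq (memLp_bracket_sq_smul φ 2)
  have h2 := memLp_two_integrable_norm_sq hf
  -- With the weights distributed, the integrand is at most `s t`, where `s` is the product of the
  -- weighted `φ` and `f` and `t` is a Hilbert–Schmidt kernel; `s² + t²` serves as integrable
  -- majorant.
  have h3 := (h1.mul_prod h2).add hk.sq
  refine h3.mono' (φ.continuous.aestronglyMeasurable.comp_fst.smul
      (aesm_gK_smul_prod a (Lp.aestronglyMeasurable f))) (.of_forall fun p => ?_)
  have hpi : (4 * Real.pi)⁻¹ ≤ 1 := inv_le_one_of_one_le₀ (by linarith [Real.pi_gt_three])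
  have hg : ‖gK a ‖p.1 - p.2‖‖ ≤ ‖p.1 - p.2‖⁻¹ :=
    (norm_gK_le ha (norm_nonneg _)).trans (mul_le_of_le_one_left (by positivity) hpi)
  have b1 := bracket_rpow_mul p.1 2 (-2)
  have b2 := bracket_rpow_mul p.2 q (-q)
  rw [add_neg_cancel, Real.rpow_zero] at b1 b2
  rw [Real.rpow_two] at b1
  have e : ‖φ p.1‖ * (‖p.1 - p.2‖⁻¹ * ‖f p.2‖) =
      (‖bracket p.1 ^ 2 • φ p.1‖ * ‖bracket p.2 ^ q • f p.2‖) *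
        (bracket p.1 ^ (-2 : ℝ) * ‖p.1 - p.2‖⁻¹ * bracket p.2 ^ (-q)) := by
    rw [norm_smul, norm_smul, Real.norm_of_nonneg (bracket_rpow_pos _ _).le,
      Real.norm_of_nonneg (sq_nonneg _)]
    calc _ = (bracket p.1 ^ 2 * bracket p.1 ^ (-2 : ℝ)) * (bracket p.2 ^ q * bracket p.2 ^ (-q)) *
          (‖φ p.1‖ * (‖p.1 - p.2‖⁻¹ * ‖f p.2‖)) := by rw [b1, b2]; ring
      _ = _ := by ring
  rw [norm_smul, norm_smul]
  refine (mul_le_mul_of_nonneg_left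
    (mul_le_mul_of_nonneg_right hg (norm_nonneg _)) (norm_nonneg _)).trans ?_
  rw [e, Pi.add_apply, ← mul_pow]
  generalize ‖bracket p.1 ^ 2 • φ p.1‖ * ‖bracket p.2 ^ q • f p.2‖ = s
  generalize bracket p.1 ^ (-2 : ℝ) * ‖p.1 - p.2‖⁻¹ * bracket p.2 ^ (-q) = t
  nlinarith [sq_nonneg (s - t), sq_nonneg s, sq_nonneg t]

/-- `ψ ∈ H²` solves `-Δψ + 2μ ψ₂ = v² ψ`, i.e. `Hψ = μψ`. -/
def IsSol (μ : ℝ) (V1 V2 : E3 → ℝ) (ψ : L2) : Prop :=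
  ∃ h : ψ ∈ H2 C2, laplaceH2 ⟨ψ, h⟩ = (2 * μ : ℂ) • P2L ψ - mv V1 V2 (mv V1 V2 ψ)

section

variable {μ β C : ℝ} {V1 V2 : E3 → ℝ}

/-- One power of `⟨y⟩` is spent on the decay in `x`, so `v` must still decay faster than
`⟨y⟩^{-3/2}` after losing it: `β/2 - 1 > 3/2`, one of the places where `β > 5` is used. -/
lemma Pot.Th_spec (h : Pot μ β C V1 V2) :
    IsKernelOp (fun x y => kerTh μ x y * v V1 V2 y) (Th μ V1 V2) := by
  have hK := one_le_cExp h.mu_pos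
  have hd := domBy_weighted wt_one h.wt_v (measMat_kerTh μ)
    (d := fun x y => 2 * cExp μ * ((bracket x)⁻¹ * ‖x - y‖⁻¹ * bracket y))
    (fun x y => by have := bracket_pos x; have := bracket_pos y; positivity)
    (fun x y hxy => norm_act_kerTh_le h.mu_pos x y hxy)
  have hs := (hs_bracket_inv_bracket (p := 1) (q := β / 2 - 1) (by norm_num)
    (by linarith [h.five_lt])).const_mul (c := 2 * cExp μ * (4 * √C)) (by positivity)
  have e : (fun x y : E3 => 1 * bracket x ^ (-0 : ℝ) *
      (2 * cExp μ * ((bracket x)⁻¹ * ‖x - y‖⁻¹ * bracket y)) *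
        (4 * √C * bracket y ^ (-(β / 2)))) =
      fun x y => 2 * cExp μ * (4 * √C) *
        (bracket x ^ (-1 : ℝ) * ‖x - y‖⁻¹ * bracket y ^ (-(β / 2 - 1))) := by
    funext x y
    rw [neg_zero, Real.rpow_zero, Real.rpow_neg_one, neg_sub, sub_eq_add_neg (1 : ℝ), ← bracket_rpow_mul,
      Real.rpow_one]
    ring
  rw [e] at hd
  have := hd.isKernelOp hs
  simpa only [one_mul, Th, wop] using this

/-- The potential of `v φ` at the threshold. -/
lemma Pot.potential_eq (h : Pot μ β C V1 V2) (φ : L2) :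
    ∀ᵐ x, Integrable (fun y => act (kerG0 μ x y) (act (v V1 V2 y) (φ y))) ∧
      ∫ y, act (kerG0 μ x y) (act (v V1 V2 y) (φ y)) =
        Th μ V1 V2 φ x + ((4 * Real.pi * bracket x)⁻¹ : ℂ) • inner ℂ (eL V1 V2) φ • vec1 := by
  have hi : Integrable fun y => pi1 (act (v V1 V2 y) (φ y)) :=
    pi1.integrable_comp (h.wt_v.integrable h.three_half_lt φ)
  filter_upwards [h.Th_spec φ] with x hx
  have hi2 : Integrable fun y =>
      ((4 * Real.pi * bracket x)⁻¹ : ℂ) • pi1 (act (v V1 V2 y) (φ y)) :=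
    hi.smul ((4 * Real.pi * bracket x)⁻¹ : ℂ)
  have e : ∀ y, act (kerG0 μ x y) (act (v V1 V2 y) (φ y)) = act (kerTh μ x y * v V1 V2 y) (φ y) +
      ((4 * Real.pi * bracket x)⁻¹ : ℂ) • pi1 (act (v V1 V2 y) (φ y)) := fun y => by
    rw [act_mul, kerTh, act_sub_left, act_smul_left, ← pi1_eq, sub_add_cancel]
  simp only [e]
  refine ⟨hx.1.add hi2, ?_⟩
  rw [integral_add hx.1 hi2, hx.2, integral_smul, h.pi1_integral]

lemma Pot.isKernelIntegral_Th (h : Pot μ β C V1 V2) {φ : L2} (hφ : inner ℂ (eL V1 V2) φ = 0) :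
    IsKernelIntegral (kerG0 μ) (fun y => act (v V1 V2 y) (φ y)) (Th μ V1 V2 φ) := by
  filter_upwards [h.potential_eq φ] with x hx
  rw [hφ, zero_smul, smul_zero, add_zero] at hx
  exact ⟨hx.1, hx.2.symm⟩

lemma IsKernelIntegral.act_left {K : E3 → E3 → Mat2} {f u : E3 → C2} (hK : IsKernelIntegral K f u)
    (M : E3 → Mat2) : IsKernelIntegral (fun x y => M x * K x y) f (fun x => act (M x) (u x)) := by
  filter_upwards [hK] with x hx
  simp only [act_mul]
  refine ⟨ContinuousLinearMap.integrable_comp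
    (Matrix.toEuclideanCLM (n := Fin 2) (𝕜 := ℂ) (M x)) hx.1, ?_⟩
  rw [hx.2]
  exact (ContinuousLinearMap.integral_comp_comm
    (Matrix.toEuclideanCLM (n := Fin 2) (𝕜 := ℂ) (M x)) hx.1).symm

/-- Orthogonality to `e` makes the subtracted `1/⟨x⟩` term integrate to zero, so `Θ φ` is the
genuine potential of `v φ`. -/
lemma Pot.mv_Th (h : Pot μ β C V1 V2) {φ : L2} (hφ : inner ℂ (eL V1 V2) φ = 0) :
    mv V1 V2 (Th μ V1 V2 φ) = T0 μ V1 V2 φ := by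
  refine Lp.ext ?_
  filter_upwards [(h.isKernelIntegral_Th hφ).act_left (v V1 V2), h.T0_spec.1 φ,
    h.mv_ae (Th μ V1 V2 φ)] with x h1 h2 h3
  rw [h3, h1.2, h2.2]
  simp only [act_mul]

lemma Pot.memLp_mv (h : Pot μ β C V1 V2) (φ : L2) (L : C2 →L[ℂ] C2) :
    MemLp (fun x => bracket x ^ (β / 2) • L.compLp (mv V1 V2 φ) x) 2 volume := by
  refine MemLp.of_le_mul (Lp.memLp φ) (c := ‖L‖ * (4 * √C))
    ((continuous_bracket_rpow _).aestronglyMeasurable.smul (Lp.aestronglyMeasurable _)) ?_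
  filter_upwards [L.coeFn_compLp (mv V1 V2 φ), h.mv_ae φ, h.wt_v.bound] with x h1 h2 h3
  have b := bracket_rpow_mul x (β / 2) (-(β / 2))
  rw [add_neg_cancel, Real.rpow_zero] at b
  rw [h1, h2, norm_smul, Real.norm_of_nonneg (bracket_rpow_pos _ _).le]
  have hb := (bracket_rpow_pos x (β / 2)).le
  calc _ ≤ bracket x ^ (β / 2) * (‖L‖ * (4 * √C * bracket x ^ (-(β / 2)) * ‖φ x‖)) :=
        mul_le_mul_of_nonneg_left ((L.le_opNorm _).trans
          (mul_le_mul_of_nonneg_left (h3 _) (norm_nonneg _))) hb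
    _ = (bracket x ^ (β / 2) * bracket x ^ (-(β / 2))) * (‖L‖ * (4 * √C) * ‖φ x‖) := by ring
    _ = _ := by rw [b, one_mul]

lemma pi1_act_kerG0 (μ : ℝ) (x y : E3) (w : C2) :
    pi1 (act (kerG0 μ x y) w) = gK 0 ‖x - y‖ • pi1 w := by
  rw [kerG0, act_kerG, map_add, map_smul, map_smul, (pi_comp w).1, (pi_comp w).2.1, smul_zero,
    add_zero]

lemma pi2_act_kerG0 (μ : ℝ) (x y : E3) (w : C2) :
    pi2 (act (kerG0 μ x y) w) = gK (√(2 * μ) : ℝ) ‖x - y‖ • pi2 w := by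
  rw [kerG0, act_kerG, map_add, map_smul, map_smul, (pi_comp w).2.2.1, (pi_comp w).2.2.2,
    smul_zero, zero_add]

lemma kappa_sq (hμ : 0 < μ) : ((√(2 * μ) : ℝ) : ℂ) ^ 2 = 2 * μ := by
  rw [← Complex.ofReal_pow, Real.sq_sqrt (by linarith)]; push_cast; rfl

/-- From `φ = T₀ φ = v Θ φ` the potential `Θ φ = G₀ v φ` equals `G₀ v² Θ φ`. Its components are
potentials with parameters `0` and `√(2μ)`, hence solve the two Helmholtz equations, and belong to
`H²` because `Θ φ` is in `L²`. -/
lemma Pot.isSol_Th (h : Pot μ β C V1 V2) {φ : L2} (hφ : φ ∈ S2space μ V1 V2) :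
    IsSol μ V1 V2 (Th μ V1 V2 φ) ∧ mv V1 V2 (Th μ V1 V2 φ) = φ := by
  obtain ⟨hφ1, hφ2⟩ := h.mem_S2space.1 hφ
  have hv : mv V1 V2 (Th μ V1 V2 φ) = φ := (h.mv_Th hφ2).trans (h.mem_S1space.1 hφ1)
  refine ⟨?_, hv⟩
  have hint := h.isKernelIntegral_Th hφ2
  have c1 : ∀ᵐ x, P1L (Th μ V1 V2 φ) x = ∫ y, gK 0 ‖x - y‖ • P1L (mv V1 V2 φ) y := by
    filter_upwards [hint, P1L_ae (Th μ V1 V2 φ)] with x h1 h2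
    rw [h2, h1.2, ← pi1.integral_comp_comm h1.1]
    refine integral_congr_ae ?_
    filter_upwards [P1L_ae (mv V1 V2 φ), h.mv_ae φ] with y h3 h4
    rw [h3, h4, pi1_act_kerG0]
  have c2 : ∀ᵐ x, P2L (Th μ V1 V2 φ) x =
      ∫ y, gK (√(2 * μ) : ℝ) ‖x - y‖ • P2L (mv V1 V2 φ) y := by
    filter_upwards [hint, P2L_ae (Th μ V1 V2 φ)] with x h1 h2
    rw [h2, h1.2, ← pi2.integral_comp_comm h1.1]
    refine integral_congr_ae ?_
    filter_upwards [P2L_ae (mv V1 V2 φ), h.mv_ae φ] with y h3 h4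
    rw [h3, h4, pi2_act_kerG0]
  obtain ⟨m1, e1⟩ := mem_H2_of_potential (by simp) c1
    (integrable_potential (by simp) h.three_half_lt (h.memLp_mv φ pi1))
  obtain ⟨m2, e2⟩ := mem_H2_of_potential (by simp) c2
    (integrable_potential (by simp) h.three_half_lt (h.memLp_mv φ pi2))
  have hm : Th μ V1 V2 φ ∈ H2 C2 := by
    rw [← P1L_add_P2L (Th μ V1 V2 φ)]; exact add_mem m1 m2
  refine ⟨hm, ?_⟩
  have e3 : (⟨Th μ V1 V2 φ, hm⟩ : H2 C2) = ⟨_, m1⟩ + ⟨_, m2⟩ :=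
    Subtype.ext (P1L_add_P2L _).symm
  rw [e3, map_add, e1, e2, hv, kappa_sq h.mu_pos]
  conv_rhs => rw [← P1L_add_P2L (mv V1 V2 φ)]
  rw [zero_pow two_ne_zero, zero_smul]
  abel

end

lemma tendsto_gK (c : ℂ) {a : ℕ → ℂ} (ha : Filter.Tendsto a Filter.atTop (nhds c)) (r : ℝ) :
    Filter.Tendsto (fun n => gK (a n) r) Filter.atTop (nhds (gK c r)) := by
  unfold gK
  exact (((ha.mul_const _).neg).cexp).div_const _

/-! ### Every threshold solution is a potential -/

section

variable {μ β C : ℝ} {V1 V2 : E3 → ℝ}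

lemma IsSol.eq_Gop {ψ : L2} (hψ : IsSol μ V1 V2 ψ) {a1 a2 : ℂ}
    (h1 : 0 < a1.re) (h2 : 0 < a2.re) :
    ψ = Gop h1 h2 (mv V1 V2 (mv V1 V2 ψ) + a1 ^ 2 • P1L ψ + (a2 ^ 2 - 2 * μ) • P2L ψ) := by
  obtain ⟨hm, e⟩ := hψ
  have := Gop_left h1 h2 ⟨ψ, hm⟩
  rw [e] at this
  refine this.symm.trans (congrArg _ ?_)
  rw [sub_smul]
  change a1 ^ 2 • P1L ψ + a2 ^ 2 • P2L ψ - _ = _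
  abel

/-- The parameter `0` of the first component is not in the resolvent set, so it is approached by `ε
= 1/(n+1)`: `ψ` is the potential with parameter `ε` of `v² ψ + ε² ψ₁`. The first part converges by
domination with `|x-y|⁻¹ |v² ψ|`; the second tends to zero by the pointwise bound
`norm_convolution_le`. -/
lemma Pot.sol_eq_potential (h : Pot μ β C V1 V2) {ψ : L2} (hψ : IsSol μ V1 V2 ψ) :
    ∀ᵐ x, ψ x = ∫ y, act (kerG0 μ x y) (act (v V1 V2 y) (mv V1 V2 ψ y)) := by
  have hpos : ∀ n : ℕ, (0 : ℝ) < 1 / ((n : ℝ) + 1) := fun n => by positivity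
  have hre : ∀ n : ℕ, 0 < (((1 / ((n : ℝ) + 1) : ℝ) : ℂ)).re := fun n => by
    rw [Complex.ofReal_re]; exact hpos n
  have hk : 0 < (((√(2 * μ) : ℝ) : ℂ)).re := by
    rw [Complex.ofReal_re]; exact sqrt_two_mul_pos h.mu_pos
  have hall : ∀ᵐ x, ∀ n : ℕ, ψ x =
      (∫ y, act (kerG ((1 / ((n : ℝ) + 1) : ℝ) : ℂ) ((√(2 * μ) : ℝ) : ℂ) x y)
        (act (v V1 V2 y) (mv V1 V2 ψ y))) + (((1 / ((n : ℝ) + 1) : ℝ) : ℂ)) ^ 2 •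
      ∫ y, gK ((1 / ((n : ℝ) + 1) : ℝ) : ℂ) ‖x - y‖ • P1L ψ y := by
    rw [ae_all_iff]
    intro n
    have e := hψ.eq_Gop (hre n) hk
    rw [kappa_sq h.mu_pos, sub_self, zero_smul, add_zero, map_add, map_smul] at e
    have e2 : Gop (hre n) hk (P1L ψ) = greenOp C2 (hre n) (P1L ψ) := by
      rw [Gop_apply, P1L_P1L, P2L_P1L, map_zero, add_zero]
    rw [e2] at e
    have i := isKernelOp_Gop (hre n) hk (mv V1 V2 (mv V1 V2 ψ))
    filter_upwards [i, greenOp_ae (hre n) (P1L ψ),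
      Lp.coeFn_add (Gop (hre n) hk (mv V1 V2 (mv V1 V2 ψ)))
        ((((1 / ((n : ℝ) + 1) : ℝ) : ℂ)) ^ 2 • greenOp C2 (hre n) (P1L ψ)),
      Lp.coeFn_smul ((((1 / ((n : ℝ) + 1) : ℝ) : ℂ)) ^ 2) (greenOp C2 (hre n) (P1L ψ))]
      with x h1 h2 h3 h4
    conv_lhs => rw [e]
    rw [h3, Pi.add_apply, h4, Pi.smul_apply, h1.2, h2]
    congr 1
    refine integral_congr_ae ?_
    filter_upwards [h.mv_ae (mv V1 V2 ψ)] with y hy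
    rw [hy]
  have hbd : ∀ᵐ x, Integrable fun y => 1 * ‖x - y‖⁻¹ * ‖act (v V1 V2 y) (mv V1 V2 ψ y)‖ := by
    have hk := (hs_bracket_inv_bracket (p := 1) (q := β / 2) (by norm_num)
      h.three_half_lt).ae_memLp
    filter_upwards [hk] with x hx
    have := (integral_mul_norm_le (fun y => by
      have := bracket_rpow_pos x (-1); have := bracket_rpow_pos y (-(β / 2)); positivity) hx
      (mv V1 V2 ψ)).1.const_mul (bracket x * (4 * √C))
    refine this.mono' (((measurable_const.sub measurable_id).norm.inv.const_mul
      1).aestronglyMeasurable.mul (h.wt_v.meas.act (Lp.aestronglyMeasurable _)).norm) ?_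
    filter_upwards [h.wt_v.bound] with y hy
    rw [norm_mul, norm_norm, Real.norm_of_nonneg (by positivity), one_mul, Real.rpow_neg_one]
    refine (mul_le_mul_of_nonneg_left (hy _) (by positivity)).trans (le_of_eq ?_)
    have := (bracket_pos x).ne'
    field_simp
  filter_upwards [hall, hbd] with x hx hbx
  refine tendsto_nhds_unique (f := fun _ : ℕ => ψ x) (l := Filter.atTop) tendsto_const_nhds ?_
  refine Filter.Tendsto.congr (fun n => (hx n).symm) ?_
  have hlim : Filter.Tendsto (fun n : ℕ => ((1 / ((n : ℝ) + 1) : ℝ) : ℂ)) Filter.atTop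
      (nhds 0) := by
    have := tendsto_one_div_add_atTop_nhds_zero_nat (𝕜 := ℝ)
    exact_mod_cast (Complex.continuous_ofReal.tendsto 0).comp this
  rw [← add_zero (∫ y, act (kerG0 μ x y) _)]
  refine Filter.Tendsto.add ?_ ?_
  · refine tendsto_integral_of_dominated_convergence _ (fun n => ?_) hbx (fun n => ?_) ?_
    · exact ((measMat_kerG _ _).comp (measurable_const.prodMk measurable_id)).act
        (h.wt_v.meas.act (Lp.aestronglyMeasurable _))
    · exact .of_forall fun y => norm_act_kerG_le (hre n).le hk.le x y _
    · refine .of_forall fun y => ?_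
      simp only [kerG0, act_kerG]
      exact ((tendsto_gK 0 hlim _).smul_const _).add_const _
  · rw [tendsto_zero_iff_norm_tendsto_zero]
    have hz : Filter.Tendsto (fun n : ℕ => 1 / ((n : ℝ) + 1) * ‖P1L ψ‖) Filter.atTop (nhds 0) := by
      simpa using (tendsto_one_div_add_atTop_nhds_zero_nat (𝕜 := ℝ)).mul_const ‖P1L ψ‖
    refine squeeze_zero (fun n => norm_nonneg _) (fun n => ?_) hz
    have hn := hpos n
    have h1 : 1 / ((n : ℝ) + 1) ≤ 1 := by
      rw [div_le_one (by positivity)]; linarith [(Nat.cast_nonneg n : (0 : ℝ) ≤ n)]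
    have h2 := norm_convolution_le (hre n) (P1L ψ) x
    rw [Complex.ofReal_re] at h2
    generalize 1 / ((n : ℝ) + 1) = ε at *
    have h3 : √(1 / (8 * Real.pi * ε)) ≤ 1 / ε := by
      rw [Real.sqrt_le_left (by positivity), div_pow, one_pow]
      refine one_div_le_one_div_of_le (by positivity) ?_
      nlinarith [Real.pi_gt_three]
    rw [norm_smul, norm_pow, Complex.norm_real, Real.norm_of_nonneg hn.le]
    calc _ ≤ ε ^ 2 * (1 / ε * ‖P1L ψ‖) := by
          refine mul_le_mul_of_nonneg_left (h2.trans ?_) (by positivity)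
          exact mul_le_mul_of_nonneg_right h3 (norm_nonneg _)
      _ = _ := by field_simp

/-- By the potential representation `ψ - Θ v ψ` is `⟨e, v ψ⟩ (1, 0)ᵗ / (4π ⟨x⟩)`. Both functions on
the left are in `L²` while `⟨x⟩⁻¹` is not, so the coefficient vanishes. -/
lemma Pot.mem_S2_of_isSol (h : Pot μ β C V1 V2) {ψ : L2} (hψ : IsSol μ V1 V2 ψ) :
    mv V1 V2 ψ ∈ S2space μ V1 V2 ∧ Th μ V1 V2 (mv V1 V2 ψ) = ψ := by
  have he : inner ℂ (eL V1 V2) (mv V1 V2 ψ) = 0 := by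
    have hm : MemLp (fun x => inner ℂ vec1 ((4 * Real.pi : ℂ) • (ψ x - Th μ V1 V2 (mv V1 V2 ψ) x)))
        2 volume :=
      (((Lp.memLp ψ).sub (Lp.memLp (Th μ V1 V2 (mv V1 V2 ψ)))).const_smul
        (4 * Real.pi : ℂ)).const_inner vec1
    refine eq_zero_of_memLp_inv_bracket (hm.ae_eq ?_)
    filter_upwards [h.sol_eq_potential hψ, h.potential_eq (mv V1 V2 ψ)] with x h1 h2
    rw [h1, h2.2, add_sub_cancel_left, smul_smul, inner_smul_right, inner_smul_right,
      inner_vec1, Real.rpow_neg_one]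
    have hb : (bracket x : ℂ) ≠ 0 := by exact_mod_cast (bracket_pos x).ne'
    have hp : (Real.pi : ℂ) ≠ 0 := by exact_mod_cast Real.pi_ne_zero
    simp only [vec1, PiLp.single_apply]
    push_cast
    field_simp
  have hT : Th μ V1 V2 (mv V1 V2 ψ) = ψ := by
    refine Lp.ext ?_
    filter_upwards [h.sol_eq_potential hψ, h.isKernelIntegral_Th he] with x h1 h2
    rw [h1, h2.2]
  refine ⟨h.mem_S2space.2 ⟨h.mem_S1space.2 ?_, he⟩, hT⟩
  rw [← h.mv_Th he, hT]

end

/-! ### The operators `A(z)` -/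

section

variable {μ β C : ℝ} {V1 V2 : E3 → ℝ} {z a : ℂ}

lemma SP.wop_kerGz (hz : SP μ z a) {c s c' s' : ℝ} {M N : E3 → Mat2}
    (hM : Wt c s M) (hs : 0 ≤ s) (hN : Wt c' s' N) (hs' : 0 ≤ s') :
    wop M (kerGz z a) N = mulOp M ∘L Gop hz.re_pos' hz.re_pos ∘L mulOp N :=
  ((isKernelOp_Gop hz.re_pos' hz.re_pos).weighted hM hs hN hs').kernelOp_eq

lemma Pot.Az_apply (h : Pot μ β C V1 V2) (hz : SP μ z a) (f : L2) :
    Az V1 V2 z a f = f - mv V1 V2 (Gop hz.re_pos' hz.re_pos (mv V1 V2 f)) := by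
  rw [Az, hz.wop_kerGz h.wt_v h.half_pos h.wt_v h.half_pos]
  rfl

lemma SP.wop_kerGz_spec (hz : SP μ z a) {c s c' s' : ℝ} {M N : E3 → Mat2}
    (hM : Wt c s M) (hN : Wt c' s' N) (hs : WtPair s s') :
    IsKernelOp (fun x y => M x * kerGz z a x y * N y) (wop M (kerGz z a) N) ∧
      IsCompactOperator (wop M (kerGz z a) N) ∧
      ∀ f, ‖wop M (kerGz z a) N f‖ ≤ 1 * cInv (c * c') s s' * ‖f‖ :=
  wop_inv hM hN (measMat_kerGz z a) zero_le_one
    (fun x y _ => norm_act_kerG_le hz.re_pos'.le hz.re_pos.le x y) hs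

lemma wop_kerG0_spec {c s c' s' : ℝ} {M N : E3 → Mat2}
    (hM : Wt c s M) (hN : Wt c' s' N) (hs : WtPair s s') :
    IsKernelOp (fun x y => M x * kerG0 μ x y * N y) (wop M (kerG0 μ) N) ∧
      IsCompactOperator (wop M (kerG0 μ) N) ∧
      ∀ f, ‖wop M (kerG0 μ) N f‖ ≤ 1 * cInv (c * c') s s' * ‖f‖ :=
  wop_inv hM hN (measMat_kerG0 μ) zero_le_one
    (fun x y _ => norm_act_kerG_le (by simp) (by simp) x y) hs

/-- The difference of the kernels is `O(z)` but the bound does not decay, so both weights have to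
exceed `3/2`; this is one use of `s > 3/2` in the resolvent expansion. -/
lemma norm_wop_sub_le (hμ : 0 < μ) (hz : SP μ z a) {c s c' s' : ℝ} {M N : E3 → Mat2}
    (hM : Wt c s M) (hN : Wt c' s' N) (hs : 3 / 2 < s) (hs' : 3 / 2 < s') (f : L2) :
    ‖wop M (kerGz z a) N f - wop M (kerG0 μ) N f‖ ≤
      cExp μ * cPow (c * c') (s - 0) (s' - 0) * ‖z‖ * ‖f‖ := by
  have hp : WtPair s s' := Or.inl ⟨by linarith, hs'⟩
  have h1 := (hz.wop_kerGz_spec hM hN hp).1.sub (wop_kerG0_spec (μ := μ) hM hN hp).1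
  have h2 := (wop_pow hM hN ((measMat_kerGz z a).sub (measMat_kerG0 μ)) (by
    have := one_le_cExp hμ; positivity) (norm_kerGz_sub_le hμ hz) (by linarith) (by linarith))
  have e : (fun x y => M x * (kerGz z a x y - kerG0 μ x y) * N y) =
      fun x y => M x * kerGz z a x y * N y - M x * kerG0 μ x y * N y := by
    funext x y; rw [mul_sub, sub_mul]
  have h3 := h2.1
  rw [e] at h3
  have h4 := congrArg (fun T : L2 →L[ℂ] L2 => T f) (h1.unique h3)
  refine le_trans (le_of_eq (congrArg norm h4)) ((h2.2.2 f).trans (le_of_eq (by ring)))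

lemma Pot.norm_Az_sub_le (h : Pot μ β C V1 V2) (hz : SP μ z a) (f : L2) :
    ‖Az V1 V2 z a f - A0 μ V1 V2 f +
        (Complex.I * z * (1 / (4 * Real.pi))) • inner ℂ (eL V1 V2) f • eL V1 V2‖ ≤
      3 * cExp μ * cPow (4 * √C * (4 * √C)) (β / 2 - 1) (β / 2 - 1) * ‖z‖ ^ 2 * ‖f‖ := by
  have h1 := ((hz.wop_kerGz_spec h.wt_v h.wt_v h.wtPair).1.sub h.T0_spec.1).sub
    (h.isKernelOp_QA.smul (Complex.I * z))
  have h2 := (wop_pow h.wt_v h.wt_v (((measMat_kerGz z a).sub (measMat_kerG0 μ)).sub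
    (.const ((Complex.I * z) • QA))) (by
    have := one_le_cExp h.mu_pos; positivity) (norm_kerGz_sub_le_sq h.mu_pos hz)
    (by linarith [h.five_lt]) (by linarith [h.five_lt]))
  have e : (fun x y => v V1 V2 x * (kerGz z a x y - kerG0 μ x y - (Complex.I * z) • QA) *
      v V1 V2 y) = fun x y => v V1 V2 x * kerGz z a x y * v V1 V2 y -
        v V1 V2 x * kerG0 μ x y * v V1 V2 y - (Complex.I * z) • (v V1 V2 x * QA * v V1 V2 y) := by
    funext x y; rw [mul_sub, sub_mul, mul_sub, sub_mul, mul_smul_comm, smul_mul_assoc]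
  have h3 := h2.1
  rw [e] at h3
  have h4 := congrArg (fun T : L2 →L[ℂ] L2 => T f) (h1.unique h3)
  have h5 := h2.2.2 f
  rw [← h4] at h5
  refine le_trans (le_of_eq ?_) (h5.trans (le_of_eq (by ring)))
  rw [← norm_neg]
  congr 1
  change _ = wop (v V1 V2) (kerGz z a) (v V1 V2) f - T0 μ V1 V2 f -
    (Complex.I * z) • wop (v V1 V2) (fun _ _ => QA) (v V1 V2) f
  rw [h.QA_op, h.A0_apply, mul_smul]
  change -(f - wop (v V1 V2) (kerGz z a) (v V1 V2) f - _ + _) = _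
  abel

lemma Pot.Th_mv (h : Pot μ β C V1 V2) {φ : L2} (hφ : φ ∈ S2space μ V1 V2) :
    mv V1 V2 (Th μ V1 V2 φ) = φ := (h.isSol_Th hφ).2

/-- The constant in `Pot.norm_inner_Az_sub_le`. -/
def cCube (μ β C : ℝ) (V1 V2 : E3 → ℝ) : ℝ :=
  9 * cExp μ * cPow (4 * √C * (4 * √C) * (4 * √C * (4 * √C))) (β / 2 + β / 2 - 2)
    (β / 2 + β / 2 - 2) * ‖Th μ V1 V2‖ ^ 2

/-- The cubic remainder of the kernel grows like `⟨x⟩² ⟨y⟩²`; one factor `v` on each side would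
absorb it only for `β > 7`. On `S₂`, however, `φ = v Θ φ`, so the form carries `v²` on each side,
with decay `β`, and `β - 2 > 3/2` holds. The terms of order `0` and `1` drop out since `T₀ φ = φ`
and `⟨e, φ⟩ = 0`. -/
lemma Pot.norm_inner_Az_sub_le (h : Pot μ β C V1 V2) (hz : SP μ z a) {φ φ' : L2}
    (hφ : φ ∈ S2space μ V1 V2) (hφ' : φ' ∈ S2space μ V1 V2) :
    ‖inner ℂ φ' (Az V1 V2 z a φ - z ^ 2 • Bop μ V1 V2 φ)‖ ≤
      cCube μ β C V1 V2 * ‖z‖ ^ 3 * ‖φ‖ * ‖φ'‖ := by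
  have hb : 0 ≤ β / 2 := h.half_pos
  have h1 := (((hz.wop_kerGz_spec h.wt_v h.wt_v h.wtPair).1.sub h.T0_spec.1).sub
    (h.isKernelOp_QA.smul (Complex.I * z))).add (h.isKernelOp_Bop.smul (z ^ 2))
  set T : L2 →L[ℂ] L2 := wop (v V1 V2) (kerGz z a) (v V1 V2) - T0 μ V1 V2 -
    (Complex.I * z) • wop (v V1 V2) (fun _ _ => QA) (v V1 V2) + z ^ 2 • Bop μ V1 V2 with hT
  have h2 := h1.weighted h.wt_v hb h.wt_v hb
  have h3 := (wop_pow (h.wt_v.mul h.wt_v) (h.wt_v.mul h.wt_v)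
    ((((measMat_kerGz z a).sub (measMat_kerG0 μ)).sub
    (.const ((Complex.I * z) • QA))).add ((measMat_QB μ).smul measurable_const)) (by
    have := one_le_cExp h.mu_pos; positivity) (norm_kerGz_sub_le_cube h.mu_pos hz)
    (by linarith [h.five_lt]) (by linarith [h.five_lt]))
  have e : (fun x y => v V1 V2 x * v V1 V2 x * (kerGz z a x y - kerG0 μ x y -
        (Complex.I * z) • QA + z ^ 2 • QB μ x y) * (v V1 V2 y * v V1 V2 y)) =
      fun x y => v V1 V2 x * (v V1 V2 x * kerGz z a x y * v V1 V2 y -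
        v V1 V2 x * kerG0 μ x y * v V1 V2 y - (Complex.I * z) • (v V1 V2 x * QA * v V1 V2 y) +
          z ^ 2 • (v V1 V2 x * QB μ x y * v V1 V2 y)) * v V1 V2 y := by
    funext x y
    simp only [mul_sub, sub_mul, mul_add, add_mul, mul_smul_comm, smul_mul_assoc, mul_assoc]
  have h4 := h3.1
  rw [e] at h4
  have h5 : ∀ f, mv V1 V2 (T (mv V1 V2 f)) = _ := fun f =>
    congrArg (fun S : L2 →L[ℂ] L2 => S f) (h2.unique h4)
  have h6 : Az V1 V2 z a φ - z ^ 2 • Bop μ V1 V2 φ = -T φ := by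
    obtain ⟨k1, k2⟩ := h.mem_S2space.1 hφ
    change φ - wop (v V1 V2) (kerGz z a) (v V1 V2) φ - _ =
      -(wop (v V1 V2) (kerGz z a) (v V1 V2) φ - T0 μ V1 V2 φ -
        (Complex.I * z) • wop (v V1 V2) (fun _ _ => QA) (v V1 V2) φ + z ^ 2 • Bop μ V1 V2 φ)
    rw [h.mem_S1space.1 k1, h.QA_op, k2, zero_smul, smul_zero, smul_zero]
    abel
  have h7 : inner ℂ φ' (T φ) =
      inner ℂ (Th μ V1 V2 φ') (mv V1 V2 (T (mv V1 V2 (Th μ V1 V2 φ)))) := by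
    rw [← h.inner_mv, h.Th_mv hφ, h.Th_mv hφ']
  rw [h6, inner_neg_right, norm_neg, h7, h5]
  refine (norm_inner_le_norm _ _).trans ?_
  have h8 := h3.2.2 (Th μ V1 V2 φ)
  have n1 := (Th μ V1 V2).le_opNorm φ
  have n2 := (Th μ V1 V2).le_opNorm φ'
  have hc := cPow_nonneg (4 * √C * (4 * √C) * (4 * √C * (4 * √C))) (β / 2 + β / 2 - 2)
    (β / 2 + β / 2 - 2)
  have hK := one_le_cExp h.mu_pos
  calc _ ≤ (‖Th μ V1 V2‖ * ‖φ'‖) * (9 * cExp μ * ‖z‖ ^ 3 *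
        cPow (4 * √C * (4 * √C) * (4 * √C * (4 * √C))) (β / 2 + β / 2 - 2)
          (β / 2 + β / 2 - 2) * (‖Th μ V1 V2‖ * ‖φ‖)) := by
        refine mul_le_mul n2 (h8.trans ?_) (norm_nonneg _) (by positivity)
        exact mul_le_mul_of_nonneg_left n1 (by positivity)
    _ = _ := by rw [cCube]; ring

end

/-! ### The quadratic form of `b(0)` -/

/-- Weak convergence of `ε² (-Δ + a²)⁻¹` to zero, with `ε = Re a`: these operators are contractions,
so `g` may be replaced by a Schwartz function, and against its `L¹` norm the sup bound
`norm_convolution_le` leaves `O(ε)`. -/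
lemma exists_inner_greenOp_le (f g : L2) {η : ℝ} (hη : 0 < η) : ∃ ε0 > 0, ε0 ≤ 1 ∧
    ∀ (a : ℂ) (ha : 0 < a.re), a.re < ε0 → a.re ^ 2 * ‖inner ℂ (greenOp C2 ha f) g‖ ≤ η := by
  obtain ⟨s, hs⟩ : ∃ s : 𝓢(E3, C2), ‖g - s.toLp 2 (volume : Measure E3)‖ < η / (2 * (‖f‖ + 1)) := by
    have hd := SchwartzMap.denseRange_toLpCLM (F := C2) (μ := (volume : Measure E3)) (p := 2)
      (by norm_num)
    obtain ⟨s, hs⟩ := Metric.denseRange_iff.1 hd g (η / (2 * (‖f‖ + 1))) (by positivity)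
    exact ⟨s, by rwa [dist_eq_norm] at hs⟩
  have hI : Integrable fun x => ‖s x‖ := (s.integrable (μ := volume)).norm
  set I := ∫ x, ‖s x‖ with hIdef
  have hI0 : 0 ≤ I := integral_nonneg fun _ => norm_nonneg _
  refine ⟨min 1 (η / (2 * (‖f‖ * I + 1))), by positivity, min_le_left _ _, fun a ha hlt => ?_⟩
  have ha1 : a.re < 1 := hlt.trans_le (min_le_left _ _)
  have ha2 : a.re < η / (2 * (‖f‖ * I + 1)) := hlt.trans_le (min_le_right _ _)
  have h3 : √(1 / (8 * Real.pi * a.re)) ≤ 1 / a.re := by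
    rw [Real.sqrt_le_left (by positivity), div_pow, one_pow]
    refine one_div_le_one_div_of_le (by positivity) ?_
    nlinarith [Real.pi_gt_three]
  have e1 : a.re ^ 2 * ‖inner ℂ (greenOp C2 ha f) (g - s.toLp 2 (volume : Measure E3))‖ ≤ η / 2 := by
    have h1 := (norm_inner_le_norm (𝕜 := ℂ) (greenOp C2 ha f)
      (g - s.toLp 2 (volume : Measure E3))).trans
      (mul_le_mul (norm_greenOp_le ha f) hs.le (norm_nonneg _) (by positivity))
    calc _ ≤ a.re ^ 2 * (1 / a.re ^ 2 * ‖f‖ * (η / (2 * (‖f‖ + 1)))) :=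
          mul_le_mul_of_nonneg_left h1 (by positivity)
      _ = η / 2 * (‖f‖ / (‖f‖ + 1)) := by field_simp
      _ ≤ η / 2 * 1 := by
        refine mul_le_mul_of_nonneg_left ?_ (by positivity)
        rw [div_le_one (by positivity)]; linarith
      _ = η / 2 := mul_one _
  have e2 : a.re ^ 2 * ‖inner ℂ (greenOp C2 ha f) (s.toLp 2 (volume : Measure E3))‖ ≤ η / 2 := by
    have h1 : ‖inner ℂ (greenOp C2 ha f) (s.toLp 2 (volume : Measure E3))‖ ≤
        1 / a.re * ‖f‖ * I := by
      rw [L2.inner_def, hIdef, ← integral_const_mul]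
      refine norm_integral_le_of_norm_le (hI.const_mul _) ?_
      filter_upwards [greenOp_ae ha f, s.coeFn_toLp 2 (volume : Measure E3)] with x h1 h2
      rw [h1, h2]
      refine (norm_inner_le_norm _ _).trans (mul_le_mul_of_nonneg_right ?_ (norm_nonneg _))
      exact (norm_convolution_le ha f x).trans (mul_le_mul_of_nonneg_right h3 (norm_nonneg _))
    rw [lt_div_iff₀ (by positivity)] at ha2
    calc _ ≤ a.re ^ 2 * (1 / a.re * ‖f‖ * I) := mul_le_mul_of_nonneg_left h1 (by positivity)
      _ = a.re * (‖f‖ * I) := by field_simp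
      _ ≤ η / 2 := by nlinarith
  have e3 : inner ℂ (greenOp C2 ha f) g =
      inner ℂ (greenOp C2 ha f) (g - s.toLp 2 (volume : Measure E3)) +
        inner ℂ (greenOp C2 ha f) (s.toLp 2 (volume : Measure E3)) := by
    rw [← inner_add_right, sub_add_cancel]
  rw [e3]
  have := mul_le_mul_of_nonneg_left (norm_add_le
    (inner ℂ (greenOp C2 ha f) (g - s.toLp 2 (volume : Measure E3)))
    (inner ℂ (greenOp C2 ha f) (s.toLp 2 (volume : Measure E3)))) (sq_nonneg a.re)
  linarith

section

variable {μ β C : ℝ} {V1 V2 : E3 → ℝ}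

/-- Resolvent identity: the equation for `Θ φ` reads `Θ φ = G(z) (v φ - z² σ₃ Θ φ)`. Multiplying by
`v` and using `v Θ φ = φ` cancels the zeroth order in `A(z) φ`. -/
lemma Pot.Az_S2 (h : Pot μ β C V1 V2) {z a : ℂ} (hz : SP μ z a) {φ : L2}
    (hφ : φ ∈ S2space μ V1 V2) :
    Gop hz.re_pos' hz.re_pos (mv V1 V2 φ) = Th μ V1 V2 φ +
      z ^ 2 • Gop hz.re_pos' hz.re_pos (sigma3L (Th μ V1 V2 φ)) ∧
    Az V1 V2 z a φ = -(z ^ 2 • mv V1 V2 (Gop hz.re_pos' hz.re_pos (sigma3L (Th μ V1 V2 φ)))) := by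
  have e := (h.isSol_Th hφ).1.eq_Gop hz.re_pos' hz.re_pos
  rw [h.Th_mv hφ, hz.sq, neg_sq, mul_pow, Complex.I_sq, add_sub_cancel_left, neg_one_mul, neg_smul,
    ← sub_eq_add_neg, sub_add, ← smul_sub, ← sigma3L_eq_sub, map_sub, map_smul] at e
  have e1 := eq_add_of_sub_eq e.symm
  refine ⟨e1, ?_⟩
  rw [h.Az_apply hz, e1, map_add, h.Th_mv hφ, map_smul]
  abel

/-- Two evaluations of `⟨φ', A(z) φ⟩` are compared: the kernel expansion `z² ⟨φ', B φ⟩ + O(z³)`, and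
the exact `-z² ⟨Θ φ', σ₃ Θ φ⟩ - z⁴ ⟨G σ₃ Θ φ', σ₃ Θ φ⟩` at `z = iε`. Division by `z²` leaves an
error that vanishes because `ε² G → 0` weakly. -/
lemma Pot.inner_Bop (h : Pot μ β C V1 V2) {φ φ' : L2} (hφ : φ ∈ S2space μ V1 V2)
    (hφ' : φ' ∈ S2space μ V1 V2) :
    inner ℂ φ' (Bop μ V1 V2 φ) = -inner ℂ (Th μ V1 V2 φ') (sigma3L (Th μ V1 V2 φ)) := by
  have hμ := h.mu_pos
  set f' := sigma3L (Th μ V1 V2 φ') with hf'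
  set f := sigma3L (Th μ V1 V2 φ) with hf
  rw [← sub_eq_zero, sub_neg_eq_add, ← norm_le_zero_iff]
  refine le_of_forall_pos_le_add fun η hη => ?_
  rw [zero_add]
  obtain ⟨ε0, hε0, hε1, hG⟩ := exists_inner_greenOp_le (P1L f') f (η := η / 3) (by positivity)
  have hc := abs_nonneg (cCube μ β C V1 V2 * ‖φ‖ * ‖φ'‖)
  set K := |cCube μ β C V1 V2 * ‖φ‖ * ‖φ'‖| with hK
  set J := ‖P2L f'‖ * ‖f‖ with hJ
  have hJ0 : 0 ≤ J := by positivity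
  obtain ⟨ε, hε, hεlt⟩ : ∃ ε : ℝ, 0 < ε ∧ ε < min (min ε0 μ) (min (η / (3 * (K + 1)))
      (η * μ / (3 * (J + 1)))) := exists_between (by positivity)
  obtain ⟨⟨k1, k2⟩, k3, k4⟩ : (ε < ε0 ∧ ε < μ) ∧ ε < η / (3 * (K + 1)) ∧
      ε < η * μ / (3 * (J + 1)) := by simpa only [lt_min_iff] using hεlt
  have hεsq : ε ^ 2 ≤ ε := by nlinarith
  have hr : μ ≤ 2 * μ - ε ^ 2 := by linarith
  -- On the imaginary axis both Helmholtz parameters, `ε` and `√(2μ - ε²)`, are real, so `G(z)` is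
  -- self-adjoint and may be moved across the inner product.
  have hz : SP μ (Complex.I * ε) ((√(2 * μ - ε ^ 2) : ℝ) : ℂ) := by
    refine ⟨by simpa using hε, ?_, ?_, ?_⟩
    · simp [abs_of_pos hε]; linarith
    · rw [← Complex.ofReal_pow, Real.sq_sqrt (by linarith), mul_pow, Complex.I_sq]
      push_cast; ring
    · rw [Complex.ofReal_re]; exact Real.sqrt_pos.2 (by linarith)
  have hre1 : (-(Complex.I * (Complex.I * ε)) : ℂ) = (ε : ℂ) := by
    rw [← mul_assoc, Complex.I_mul_I]; ring
  have hre : (-(Complex.I * (Complex.I * ε)) : ℂ).re = ε := by rw [hre1, Complex.ofReal_re]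
  have hnz : ‖(Complex.I * ε : ℂ)‖ = ε := by simp [abs_of_pos hε]
  have hz2 : (Complex.I * ε : ℂ) ^ 2 = -(ε : ℂ) ^ 2 := by rw [mul_pow, Complex.I_sq]; ring
  have b1 := h.norm_inner_Az_sub_le hz hφ hφ'
  obtain ⟨g1, g2⟩ := h.Az_S2 hz hφ
  obtain ⟨g1', -⟩ := h.Az_S2 hz hφ'
  set G := Gop hz.re_pos' hz.re_pos with hGdef
  have hsym : ∀ u w, inner ℂ (G u) w = inner ℂ u (G w) := fun u w =>
    inner_Gop _ _ (by rw [hre1, Complex.conj_ofReal]) (Complex.conj_ofReal _) u w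
  have b2 : inner ℂ φ' (Az V1 V2 (Complex.I * ε) ((√(2 * μ - ε ^ 2) : ℝ) : ℂ) φ -
      (Complex.I * ε) ^ 2 • Bop μ V1 V2 φ) = (ε : ℂ) ^ 2 * (inner ℂ φ' (Bop μ V1 V2 φ) +
        inner ℂ (Th μ V1 V2 φ') f - (ε : ℂ) ^ 2 * inner ℂ (G f') f) := by
    have c1 : inner ℂ φ' (mv V1 V2 (G f)) = inner ℂ (Th μ V1 V2 φ') f -
        (ε : ℂ) ^ 2 * inner ℂ (G f') f := by
      rw [← h.inner_mv, ← hsym, g1', inner_add_left, inner_smul_left, hz2, map_neg, map_pow,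
        Complex.conj_ofReal]
      ring
    rw [inner_sub_right, inner_smul_right, g2, inner_neg_right, inner_smul_right, c1, hz2]
    ring
  rw [b2, norm_mul, norm_pow, Complex.norm_real, Real.norm_of_nonneg hε.le, hnz] at b1
  have b3 : ‖inner ℂ φ' (Bop μ V1 V2 φ) + inner ℂ (Th μ V1 V2 φ') f -
      (ε : ℂ) ^ 2 * inner ℂ (G f') f‖ ≤ ε * K := by
    refine le_of_mul_le_mul_left (b1.trans ?_) (pow_pos hε 2)
    calc _ = ε ^ 3 * (cCube μ β C V1 V2 * ‖φ‖ * ‖φ'‖) := by ring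
      _ ≤ ε ^ 3 * K := mul_le_mul_of_nonneg_left (le_abs_self _) (by positivity)
      _ = _ := by ring
  have b4 : ε ^ 2 * ‖inner ℂ (G f') f‖ ≤ 2 * (η / 3) := by
    rw [hGdef, Gop_apply, inner_add_left]
    have d1 := hG _ hz.re_pos' (by rw [hre]; exact k1)
    rw [hre] at d1
    have d2 : ε ^ 2 * ‖inner ℂ (greenOp C2 hz.re_pos (P2L f')) f‖ ≤ η / 3 := by
      have d3 := norm_greenOp_le hz.re_pos (P2L f')
      rw [Complex.ofReal_re, Real.sq_sqrt (by linarith)] at d3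
      have d4 : 1 / (2 * μ - ε ^ 2) * ‖P2L f'‖ ≤ 1 / μ * ‖P2L f'‖ :=
        mul_le_mul_of_nonneg_right (one_div_le_one_div_of_le hμ hr) (norm_nonneg _)
      have d5 := (norm_inner_le_norm (𝕜 := ℂ) (greenOp C2 hz.re_pos (P2L f')) f).trans
        (mul_le_mul_of_nonneg_right (d3.trans d4) (norm_nonneg f))
      rw [lt_div_iff₀ (by positivity)] at k4
      calc _ ≤ ε * (1 / μ * ‖P2L f'‖ * ‖f‖) := by gcongr
        _ = ε * J / μ := by rw [hJ]; field_simp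
        _ ≤ η / 3 := by rw [div_le_iff₀ hμ]; nlinarith
    have := mul_le_mul_of_nonneg_left (norm_add_le (inner ℂ (greenOp C2 hz.re_pos' (P1L f')) f)
      (inner ℂ (greenOp C2 hz.re_pos (P2L f')) f)) (sq_nonneg ε)
    linarith
  have b5 : ε * K ≤ η / 3 := by
    rw [lt_div_iff₀ (by positivity)] at k3
    nlinarith
  have b6 := norm_add_le (inner ℂ φ' (Bop μ V1 V2 φ) + inner ℂ (Th μ V1 V2 φ') f -
      (ε : ℂ) ^ 2 * inner ℂ (G f') f) ((ε : ℂ) ^ 2 * inner ℂ (G f') f)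
  rw [sub_add_cancel, norm_mul, norm_pow, Complex.norm_real, Real.norm_of_nonneg hε.le] at b6
  linarith

/-! ### Definiteness -/

/-- The sum of the components. -/
def sumC : C2 →L[ℂ] ℂ := EuclideanSpace.proj 0 + EuclideanSpace.proj 1

/-- The difference of the components. -/
def diffC : C2 →L[ℂ] ℂ := EuclideanSpace.proj 0 - EuclideanSpace.proj 1

lemma sumC_apply (w : C2) : sumC w = w 0 + w 1 := rfl

lemma diffC_apply (w : C2) : diffC w = w 0 - w 1 := rfl

/-- The vector `(c, -c) / 2`. -/
def antiC : ℂ →L[ℂ] C2 := (ContinuousLinearMap.id ℂ ℂ).smulRight (!₂[1 / 2, -1 / 2] : C2)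

lemma antiC_apply (c : ℂ) : antiC c 0 = c / 2 ∧ antiC c 1 = -c / 2 := by
  constructor <;> simp [antiC] <;> ring

/-- Multiplication by `V₁ - V₂`. -/
def mU (V1 V2 : E3 → ℝ) : L2v ℂ →L[ℂ] L2v ℂ :=
  diffC.compLpL 2 volume ∘L mv V1 V2 ∘L mv V1 V2 ∘L antiC.compLpL 2 volume

lemma Pot.v_mul_v_ae (h : Pot μ β C V1 V2) : ∀ᵐ x, v V1 V2 x * v V1 V2 x =
    !![(V1 x : ℂ), (V2 x : ℂ); (V2 x : ℂ), (V1 x : ℂ)] := by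
  filter_upwards [h.abs_le] with x hx
  rw [v_mul_v hx]
  ext i j
  fin_cases i <;> fin_cases j <;> simp [sigma3, potV]

lemma Pot.mv_mv_ae (h : Pot μ β C V1 V2) (f : L2) : ∀ᵐ x,
    mv V1 V2 (mv V1 V2 f) x 0 = V1 x * f x 0 + V2 x * f x 1 ∧
      mv V1 V2 (mv V1 V2 f) x 1 = V2 x * f x 0 + V1 x * f x 1 := by
  filter_upwards [h.mv_ae f, h.mv_ae (mv V1 V2 f), h.v_mul_v_ae] with x h1 h2 h3
  rw [h2, h1, ← act_mul, h3, act_apply, act_apply]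
  simp

lemma Pot.mU_ae (h : Pot μ β C V1 V2) (f : L2v ℂ) :
    ∀ᵐ x, mU V1 V2 f x = (V1 x - V2 x) * f x := by
  filter_upwards [h.mv_mv_ae (antiC.compLp f), antiC.coeFn_compLp f,
    diffC.coeFn_compLp (mv V1 V2 (mv V1 V2 (antiC.compLp f)))] with x h1 h2 h3
  refine h3.trans ?_
  rw [diffC_apply, h1.1, h1.2, h2, (antiC_apply _).1, (antiC_apply _).2]
  ring

lemma Pot.inner_mU (h : Pot μ β C V1 V2) (f g : L2v ℂ) :
    inner ℂ (mU V1 V2 f) g = inner ℂ f (mU V1 V2 g) := by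
  rw [L2.inner_def, L2.inner_def]
  refine integral_congr_ae ?_
  filter_upwards [h.mU_ae f, h.mU_ae g] with x h1 h2
  rw [h1, h2]
  simp only [RCLike.inner_apply, map_mul, map_sub, Complex.conj_ofReal]
  ring

/-- A test of positivity for symmetric forms. -/
lemma eq_zero_of_form_nonneg {H : Type*} [NormedAddCommGroup H] [InnerProductSpace ℂ H]
    {S : Submodule ℂ H} {L : S →ₗ[ℂ] H} (hs : ∀ f g : S, inner ℂ (L f) (g : H) = inner ℂ (f : H) (L g))
    (hL : ∀ f : S, 0 ≤ (inner ℂ (f : H) (L f)).re) {μ : ℝ} (hμ : 0 < μ) {w u : S}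
    (hw : L w = (μ : ℂ) • (u : H)) (h0 : (inner ℂ (w : H) (u : H)).re = 0) : (u : H) = 0 := by
  by_contra hne
  have hnu : 0 < ‖(u : H)‖ := norm_pos_iff.2 hne
  set q := (inner ℂ (u : H) (L u)).re with hq
  have hm0 : 0 < 2 * μ * ‖(u : H)‖ ^ 2 := by positivity
  set m := 2 * μ * ‖(u : H)‖ ^ 2 with hm
  -- The form on `w + t u`: the constant term vanishes by the hypothesis on `⟨w, u⟩`, and the two
  -- cross terms are both `t μ ‖u‖²` because `L w = μ u` and `L` is symmetric.
  have key : ∀ t : ℝ, 0 ≤ t * m + t ^ 2 * q := by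
    intro t
    have k := hL (w + (t : ℂ) • u)
    have e2 : inner ℂ (w : H) (L u) = (μ : ℂ) * inner ℂ (u : H) (u : H) := by
      rw [← hs, hw, inner_smul_left, Complex.conj_ofReal]
    have e3 : inner ℂ ((w + (t : ℂ) • u : S) : H) (L (w + (t : ℂ) • u)) =
        (μ : ℂ) * inner ℂ (w : H) (u : H) + ((2 * t * μ * ‖(u : H)‖ ^ 2 : ℝ) : ℂ) +
          ((t ^ 2 : ℝ) : ℂ) * inner ℂ (u : H) (L u) := by
      rw [Submodule.coe_add, Submodule.coe_smul, map_add, map_smul, hw, inner_add_left,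
        inner_add_right, inner_add_right, inner_smul_left, inner_smul_left, inner_smul_right,
        inner_smul_right, inner_smul_right, inner_smul_right, e2, inner_self_eq_norm_sq_to_K]
      simp only [Complex.conj_ofReal, Complex.coe_algebraMap, Complex.ofReal_mul,
        Complex.ofReal_pow, Complex.ofReal_ofNat]
      ring
    rw [e3, Complex.add_re, Complex.add_re, Complex.re_ofReal_mul, Complex.re_ofReal_mul,
      Complex.ofReal_re, h0] at k
    linarith
  have hq1 : 0 < |q| + 1 := by positivity
  -- A negative `t` small enough for the linear term to dominate, whatever the sign of `q`.
  have k := key (-m / (|q| + 1))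
  have hqq := le_abs_self q
  have k2 : -m / (|q| + 1) * m + (-m / (|q| + 1)) ^ 2 * q =
      m ^ 2 * (q - |q| - 1) / (|q| + 1) ^ 2 := by
    field_simp
    ring
  rw [k2] at k
  have : m ^ 2 * (q - |q| - 1) / (|q| + 1) ^ 2 < 0 :=
    div_neg_of_neg_of_pos (mul_neg_of_pos_of_neg (by positivity) (by linarith)) (by positivity)
  linarith

/-- The operator `L₋` on `H²`. -/
def Lminus (μ : ℝ) (V1 V2 : E3 → ℝ) : H2 ℂ →ₗ[ℂ] L2v ℂ :=
  -laplaceH2 + (μ : ℂ) • (H2 ℂ).subtype - (mU V1 V2).toLinearMap ∘ₗ (H2 ℂ).subtype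

lemma Lminus_apply (f : H2 ℂ) :
    Lminus μ V1 V2 f = -laplaceH2 f + (μ : ℂ) • (f : L2v ℂ) - mU V1 V2 f := rfl

lemma Pot.inner_Lminus (h : Pot μ β C V1 V2) (f g : H2 ℂ) :
    inner ℂ (Lminus μ V1 V2 f) (g : L2v ℂ) = inner ℂ (f : L2v ℂ) (Lminus μ V1 V2 g) := by
  rw [Lminus_apply, Lminus_apply, inner_sub_right, inner_add_right, inner_neg_right,
    inner_smul_right, inner_sub_left, inner_add_left, inner_neg_left, inner_smul_left,
    Complex.conj_ofReal, h.inner_mU, inner_laplaceH2]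

/-- The quadratic form of `L₋`. -/
lemma Pot.Lminus_form (h : Pot μ β C V1 V2) (hL : LminusNonneg μ V1 V2) (f : H2 ℂ) :
    0 ≤ (inner ℂ (f : L2v ℂ) (Lminus μ V1 V2 f)).re := by
  rw [Lminus_apply]
  refine (hL f).trans (le_of_eq (congrArg Complex.re ?_))
  rw [L2.inner_def]
  refine integral_congr_ae ?_
  filter_upwards [Lp.coeFn_sub (-laplaceH2 f + (μ : ℂ) • (f : L2v ℂ)) (mU V1 V2 f),
    Lp.coeFn_add (-laplaceH2 f) ((μ : ℂ) • (f : L2v ℂ)), Lp.coeFn_neg (laplaceH2 f),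
    Lp.coeFn_smul (μ : ℂ) (f : L2v ℂ), h.mU_ae (f : L2v ℂ)] with x h1 h2 h3 h4 h5
  rw [h1, Pi.sub_apply, h2, Pi.add_apply, h3, Pi.neg_apply, h4, Pi.smul_apply, h5]
  simp only [RCLike.inner_apply, smul_eq_mul, RCLike.star_def]
  push_cast
  ring

/-- Sum `u` and difference `w` of the components turn the system into `L₋ w = μ u` and `Δ u = 2μ ψ₂
- (V₁ + V₂) u`, and `⟨ψ, σ₃ ψ⟩ = Re ⟨w, u⟩`. Positivity of `L₋` gives `u = 0`; the second equation
then gives `ψ₂ = 0`, hence `ψ₁ = 0`. -/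
lemma Pot.eq_zero_of_isSol (h : Pot μ β C V1 V2) (hL : LminusNonneg μ V1 V2) {ψ : L2}
    (hψ : IsSol μ V1 V2 ψ) (h0 : inner ℂ ψ (sigma3L ψ) = 0) : ψ = 0 := by
  obtain ⟨hm, e⟩ := hψ
  obtain ⟨mu, eu⟩ := compLp_mem_H2 sumC ⟨ψ, hm⟩
  obtain ⟨mw, ew⟩ := compLp_mem_H2 diffC ⟨ψ, hm⟩
  rw [e] at eu ew
  set u := sumC.compLp ψ with hu
  set w := diffC.compLp ψ with hw
  have hae := Lp.coeFn_sub ((2 * μ : ℂ) • P2L ψ) (mv V1 V2 (mv V1 V2 ψ))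
  have hae2 := Lp.coeFn_smul (2 * μ : ℂ) (P2L ψ)
  have hpi : ∀ c : C2, pi2 c 0 = 0 ∧ pi2 c 1 = c 1 := fun c => by
    constructor <;> simp [pi2_eq, act_apply, dg]
  have Lw : Lminus μ V1 V2 ⟨w, mw⟩ = (μ : ℂ) • u := by
    rw [Lminus_apply, ew]
    refine Lp.ext ?_
    filter_upwards [hae, hae2, P2L_ae ψ, h.mv_mv_ae ψ, h.mU_ae w, sumC.coeFn_compLp ψ,
      diffC.coeFn_compLp ψ, diffC.coeFn_compLp ((2 * μ : ℂ) • P2L ψ - mv V1 V2 (mv V1 V2 ψ)),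
      Lp.coeFn_sub (-diffC.compLp ((2 * μ : ℂ) • P2L ψ - mv V1 V2 (mv V1 V2 ψ)) + (μ : ℂ) • w)
        (mU V1 V2 w),
      Lp.coeFn_add (-diffC.compLp ((2 * μ : ℂ) • P2L ψ - mv V1 V2 (mv V1 V2 ψ))) ((μ : ℂ) • w),
      Lp.coeFn_neg (diffC.compLp ((2 * μ : ℂ) • P2L ψ - mv V1 V2 (mv V1 V2 ψ))),
      Lp.coeFn_smul (μ : ℂ) w, Lp.coeFn_smul (μ : ℂ) u]
      with x h1 h2 h3 h4 h5 h6 h7 h8 h9 h10 h11 h12 h13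
    rw [h9, Pi.sub_apply, h10, Pi.add_apply, h11, Pi.neg_apply, h12, h13, Pi.smul_apply,
      Pi.smul_apply, h8, h5, h6, h7, diffC_apply, diffC_apply, sumC_apply, h1, Pi.sub_apply,
      h2, Pi.smul_apply, h3, PiLp.sub_apply, PiLp.sub_apply, PiLp.smul_apply, PiLp.smul_apply,
      (hpi _).1, (hpi _).2, h4.1, h4.2]
    simp only [smul_eq_mul]
    ring
  have Qw : (inner ℂ w u).re = 0 := by
    rw [← Complex.zero_re, ← h0]
    rw [L2.inner_def, L2.inner_def]
    rw [← RCLike.re_eq_complex_re, ← integral_re (L2.integrable_inner w u),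
      ← integral_re (L2.integrable_inner ψ (sigma3L ψ))]
    refine integral_congr_ae ?_
    filter_upwards [sumC.coeFn_compLp ψ, diffC.coeFn_compLp ψ, sigma3L_ae ψ] with x h1 h2 h3
    rw [h1, h2, h3, sumC_apply, diffC_apply, PiLp.inner_apply, Fin.sum_univ_two, act_apply,
      act_apply]
    simp [sigma3, RCLike.inner_apply]
    rw [← Complex.ofReal_pow, Complex.ofReal_re, Complex.sq_norm, Complex.normSq_apply]
    ring
  have hu0 : u = 0 := eq_zero_of_form_nonneg (L := Lminus μ V1 V2) h.inner_Lminus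
    (h.Lminus_form hL) h.mu_pos (w := ⟨w, mw⟩) (u := ⟨u, mu⟩) Lw Qw
  have hz : ∀ᵐ x, u x = 0 := by
    rw [hu0]; exact Lp.coeFn_zero ℂ 2 (volume : Measure E3)
  have hz' : ∀ᵐ x, laplaceH2 ⟨u, mu⟩ x = 0 := by
    have : (⟨u, mu⟩ : H2 ℂ) = 0 := Subtype.ext hu0
    rw [this, map_zero]; exact Lp.coeFn_zero ℂ 2 (volume : Measure E3)
  rw [eu] at hz'
  refine Lp.ext ?_
  filter_upwards [hae, hae2, P2L_ae ψ, h.mv_mv_ae ψ, sumC.coeFn_compLp ψ, hz, hz',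
      sumC.coeFn_compLp ((2 * μ : ℂ) • P2L ψ - mv V1 V2 (mv V1 V2 ψ)),
      Lp.coeFn_zero C2 2 (volume : Measure E3)] with x h1 h2 h3 h4 h6 h7 h8 h9 h10
  rw [h6, sumC_apply] at h7
  rw [h9, sumC_apply, h1, Pi.sub_apply, h2, Pi.smul_apply, h3, PiLp.sub_apply, PiLp.sub_apply,
    PiLp.smul_apply, PiLp.smul_apply, (hpi _).1, (hpi _).2, h4.1, h4.2, smul_eq_mul,
    smul_eq_mul] at h8
  have h11 : (2 * μ : ℂ) * ψ x 1 = 0 := by linear_combination h8 + (V1 x + V2 x) * h7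
  have h12 : ψ x 1 = 0 := by
    refine (mul_eq_zero.1 h11).resolve_left ?_
    have : (μ : ℂ) ≠ 0 := by exact_mod_cast h.mu_pos.ne'
    simpa using this
  rw [h12, add_zero] at h7
  rw [h10]
  exact C2_ext h7 h12

end

/-! ### The projection `P` -/

section

variable {μ β C : ℝ} {V1 V2 : E3 → ℝ}

/-- `S₂` lies in the eigenspace of the compact operator `T₀` for the eigenvalue `1`. -/
lemma Pot.finiteDimensional_S2 (h : Pot μ β C V1 V2) : FiniteDimensional ℂ (S2space μ V1 V2) := by
  have h1 : FiniteDimensional ℂ (Module.End.eigenspace (T0 μ V1 V2).toLinearMap 1) :=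
    ContinuousLinearMap.finite_dimensional_eigenspace h.T0_spec.2.1 1 one_ne_zero
  refine Submodule.finiteDimensional_of_le (S₂ := Module.End.eigenspace (T0 μ V1 V2).toLinearMap 1)
    fun φ hφ => ?_
  rw [Module.End.mem_eigenspace_iff, one_smul]
  exact h.mem_S1space.1 (h.mem_S2space.1 hφ).1

lemma inner_b0 (p q : S2space μ V1 V2) :
    inner ℂ (q : L2) (b0 μ V1 V2 p : L2) = inner ℂ (q : L2) (Bop μ V1 V2 p) := by
  rw [b0, kernelOp_kerB]
  exact Submodule.inner_orthogonalProjectionOnto_eq_of_mem_left q (Bop μ V1 V2 p)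

lemma Pot.Th_eq_zero (h : Pot μ β C V1 V2) {φ : L2} (hφ : φ ∈ S2space μ V1 V2)
    (h0 : Th μ V1 V2 φ = 0) : φ = 0 := by
  rw [← h.Th_mv hφ, h0, map_zero]

/-- If `b(0) p = 0` then `⟨Θ p, σ₃ Θ p⟩ = -⟨p, B p⟩ = 0`, so `Θ p = 0` by the definiteness argument
and `p = v Θ p = 0`. Injectivity suffices in finite dimension. -/
lemma Pot.b0_isInvertible (h : Pot μ β C V1 V2) (hL : LminusNonneg μ V1 V2) :
    (b0 μ V1 V2).IsInvertible := by
  have := h.finiteDimensional_S2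
  have hinj : Function.Injective (b0 μ V1 V2).toLinearMap := by
    rw [← LinearMap.ker_eq_bot, LinearMap.ker_eq_bot']
    intro p hp
    have h1 := inner_b0 p p
    have h2 : (b0 μ V1 V2 p : L2) = 0 := congrArg Subtype.val hp
    rw [h2, inner_zero_right, h.inner_Bop p.2 p.2, eq_comm, neg_eq_zero] at h1
    exact Subtype.ext (h.Th_eq_zero p.2 (h.eq_zero_of_isSol hL (h.isSol_Th p.2).1 h1))
  exact ⟨(LinearEquiv.ofInjectiveEndo _ hinj).toContinuousLinearEquiv, by ext1 x; rfl⟩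

lemma Gam_mem (f : L2) : S2b0invS2 μ V1 V2 f ∈ S2space μ V1 V2 := Submodule.coe_mem _

lemma Pot.inner_Bop_Gam (h : Pot μ β C V1 V2) (hL : LminusNonneg μ V1 V2) (f : L2) {φ : L2}
    (hφ : φ ∈ S2space μ V1 V2) :
    inner ℂ φ (Bop μ V1 V2 (S2b0invS2 μ V1 V2 f)) = inner ℂ φ f := by
  have h1 := inner_b0 ((b0 μ V1 V2).inverse ((S2space μ V1 V2).orthogonalProjectionOnto f)) ⟨φ, hφ⟩
  rw [(h.b0_isInvertible hL).self_apply_inverse] at h1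
  exact h1.symm.trans
    (Submodule.inner_orthogonalProjectionOnto_eq_of_mem_left (⟨φ, hφ⟩ : S2space μ V1 V2) f)

/-- `Γ = S₂ b(0)⁻¹ S₂` sees only the projection of its argument to `S₂`. This permits exchanging
operators, such as `v G₀` and `Θ*`, that agree only when tested against `S₂`. -/
lemma Gam_congr {f g : L2} (hfg : ∀ φ ∈ S2space μ V1 V2, inner ℂ φ f = inner ℂ φ g) :
    S2b0invS2 μ V1 V2 f = S2b0invS2 μ V1 V2 g := by
  have : (S2space μ V1 V2).orthogonalProjectionOnto f =
      (S2space μ V1 V2).orthogonalProjectionOnto g := by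
    rw [← sub_eq_zero, ← map_sub, Submodule.orthogonalProjectionOnto_eq_zero_iff]
    intro φ hφ
    rw [inner_sub_right, hfg φ hφ, sub_self]
  exact congrArg (fun p => ((b0 μ V1 V2).inverse p : L2)) this

lemma Pot.Gam_Bop (h : Pot μ β C V1 V2) (hL : LminusNonneg μ V1 V2) {p : L2}
    (hp : p ∈ S2space μ V1 V2) : S2b0invS2 μ V1 V2 (Bop μ V1 V2 p) = p := by
  have e : (S2space μ V1 V2).orthogonalProjectionOnto (Bop μ V1 V2 p) = b0 μ V1 V2 ⟨p, hp⟩ := by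
    rw [b0, kernelOp_kerB]; rfl
  change ((b0 μ V1 V2).inverse ((S2space μ V1 V2).orthogonalProjectionOnto (Bop μ V1 V2 p)) : L2) = p
  rw [e, (h.b0_isInvertible hL).inverse_apply_self]

/-- The projection `-Θ b(0)⁻¹ Θ* σ₃`. -/
def Pop (μ : ℝ) (V1 V2 : E3 → ℝ) : L2 →L[ℂ] L2 :=
  -(Th μ V1 V2 ∘L S2b0invS2 μ V1 V2 ∘L ContinuousLinearMap.adjoint (Th μ V1 V2) ∘L sigma3L)

lemma Pop_apply (f : L2) : Pop μ V1 V2 f = -Th μ V1 V2 (S2b0invS2 μ V1 V2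
    (ContinuousLinearMap.adjoint (Th μ V1 V2) (sigma3L f))) := rfl

/-- Tested against `S₂`, the operator `Θ* σ₃ Θ` is `-B`, and `Γ B` is the identity there. -/
lemma Pot.Pop_Th (h : Pot μ β C V1 V2) (hL : LminusNonneg μ V1 V2) {φ : L2}
    (hφ : φ ∈ S2space μ V1 V2) : Pop μ V1 V2 (Th μ V1 V2 φ) = Th μ V1 V2 φ := by
  have : S2b0invS2 μ V1 V2 (ContinuousLinearMap.adjoint (Th μ V1 V2) (sigma3L (Th μ V1 V2 φ))) =
      S2b0invS2 μ V1 V2 (-Bop μ V1 V2 φ) := by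
    refine Gam_congr fun φ' hφ' => ?_
    rw [ContinuousLinearMap.adjoint_inner_right, inner_neg_right, h.inner_Bop hφ hφ', neg_neg]
  rw [Pop_apply, this, map_neg, h.Gam_Bop hL hφ, map_neg, neg_neg]

lemma Pot.Pop_isIdempotent (h : Pot μ β C V1 V2) (hL : LminusNonneg μ V1 V2) :
    IsIdempotentElem (Pop μ V1 V2) := by
  ext1 f
  change Pop μ V1 V2 (Pop μ V1 V2 f) = Pop μ V1 V2 f
  conv_lhs => rw [Pop_apply f, map_neg, h.Pop_Th hL (Gam_mem _)]
  rw [Pop_apply]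

lemma Pot.mem_range_Pop (h : Pot μ β C V1 V2) (hL : LminusNonneg μ V1 V2) {ψ : L2} :
    ψ ∈ LinearMap.range (Pop μ V1 V2).toLinearMap ↔ IsSol μ V1 V2 ψ := by
  constructor
  · rintro ⟨f, rfl⟩
    change IsSol μ V1 V2 (-Th μ V1 V2 _)
    rw [← map_neg]
    exact (h.isSol_Th (neg_mem (Gam_mem _))).1
  · intro hψ
    obtain ⟨h1, h2⟩ := h.mem_S2_of_isSol hψ
    exact ⟨ψ, by rw [← h2]; exact h.Pop_Th hL h1⟩

/-- `Θ` is injective on `S₂` and `b(0)⁻¹` on its domain, so `P f = 0` means that `Θ* σ₃ f` is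
orthogonal to `S₂`, i.e. that `f` is orthogonal to `σ₃ Θ S₂`. -/
lemma Pot.mem_ker_Pop (h : Pot μ β C V1 V2) (hL : LminusNonneg μ V1 V2) {f : L2} :
    f ∈ LinearMap.ker (Pop μ V1 V2).toLinearMap ↔
      ∀ ψ, IsSol μ V1 V2 ψ → inner ℂ (sigma3L ψ) f = 0 := by
  constructor
  · intro hf ψ hψ
    obtain ⟨h1, h2⟩ := h.mem_S2_of_isSol hψ
    have h3 : Pop μ V1 V2 f = 0 := hf
    rw [Pop_apply, neg_eq_zero] at h3
    have h4 := h.inner_Bop_Gam hL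
      (ContinuousLinearMap.adjoint (Th μ V1 V2) (sigma3L f)) h1
    rw [h.Th_eq_zero (Gam_mem _) h3, map_zero, inner_zero_right,
      ContinuousLinearMap.adjoint_inner_right, h2] at h4
    rw [inner_sigma3L, ← h4]
  · intro hf
    have : S2b0invS2 μ V1 V2 (ContinuousLinearMap.adjoint (Th μ V1 V2) (sigma3L f)) =
        S2b0invS2 μ V1 V2 0 := by
      refine Gam_congr fun φ hφ => ?_
      rw [ContinuousLinearMap.adjoint_inner_right, ← inner_sigma3L, hf _ (h.isSol_Th hφ).1,
        inner_zero_right]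
    change Pop μ V1 V2 f = 0
    rw [Pop_apply, this, map_zero, map_zero, neg_zero]

/-! ### The formula for `P` on weighted spaces and its uniqueness -/

lemma conjTranspose_weighted (s : ℝ) (x y : E3) :
    (v V1 V2 y * kerG0 μ y x * bw s x).conjTranspose = bw s x * kerG0 μ x y * v V1 V2 y := by
  rw [Matrix.conjTranspose_mul, Matrix.conjTranspose_mul, v_conjTranspose, conjTranspose_bw,
    kerG0_conjTranspose, mul_assoc]

lemma Pot.wtPair_bw (h : Pot μ β C V1 V2) {s : ℝ} (hs : 1 / 2 < s) : WtPair (β / 2) s :=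
  Or.inr ⟨h.three_half_lt, hs⟩

lemma Pot.wop_bw_Th (h : Pot μ β C V1 V2) {s : ℝ} (hs : 1 / 2 < s) {φ : L2}
    (hφ : φ ∈ S2space μ V1 V2) :
    wop (bw s) (kerG0 μ) (v V1 V2) φ = mulOp (bw s) (Th μ V1 V2 φ) := by
  refine Lp.ext ?_
  filter_upwards [(wop_kerG0_spec (μ := μ) (wt_bw s) h.wt_v (Or.inl ⟨hs, h.three_half_lt⟩)).1 φ,
    (h.isKernelIntegral_Th (h.mem_S2space.1 hφ).2).act_left (bw s),
    (wt_bw s).mulOp_ae (by linarith) (Th μ V1 V2 φ)] with x h1 h2 h3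
  rw [h1.2, h3, h2.2]
  simp only [act_mul]

/-- By taking the adjoint of the kernel: on weighted functions `v G₀` acts like `Θ*` when tested
against `S₂`. This connects the integral formula for `P` with the bounded operator `-Θ Γ Θ* σ₃`. -/
lemma Pot.inner_wop_bw (h : Pot μ β C V1 V2) {s : ℝ} (hs : 1 / 2 < s) {φ : L2}
    (hφ : φ ∈ S2space μ V1 V2) (F : L2) :
    inner ℂ φ (wop (v V1 V2) (kerG0 μ) (bw s) F) =
      inner ℂ (Th μ V1 V2 φ) (mulOp (bw s) F) := by
  have h1 := domBy_inv h.wt_v (wt_bw s) (measMat_kerG0 μ) zero_le_one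
    (fun x y _ => norm_act_kerG_le (by simp) (by simp) x y)
  have h2 := ((h.wtPair_bw hs).hs (mul_nonneg h.wt_v.nonneg zero_le_one)).const_mul zero_le_one
  have h3 := (wop_kerG0_spec (μ := μ) h.wt_v (wt_bw s) (h.wtPair_bw hs)).1.adjoint h1 h2
  simp only [conjTranspose_weighted] at h3
  have h4 := h3.unique
    (wop_kerG0_spec (μ := μ) (wt_bw s) h.wt_v (Or.inl ⟨hs, h.three_half_lt⟩)).1
  rw [← ContinuousLinearMap.adjoint_inner_left, h4, h.wop_bw_Th hs hφ,
    inner_mulOp (wt_bw s) (by linarith)]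
  simp only [conjTranspose_bw]

lemma Pot.isPmu_Pop (h : Pot μ β C V1 V2) : IsPmu μ V1 V2 (Pop μ V1 V2) := by
  intro s hs f hf
  have hs2 : 1 / 2 < s := by linarith
  have hF : MemLp (fun x => bracket x ^ s • sigma3L f x) 2 volume := by
    obtain ⟨c, hc⟩ := Wt.const sigma3
    refine MemLp.of_le_mul hf (c := c) ((continuous_bracket_rpow _).aestronglyMeasurable.smul
      (Lp.aestronglyMeasurable _)) ?_
    filter_upwards [sigma3L_ae f, hc.norm_act_le le_rfl] with x h1 h2
    rw [h1, norm_smul, norm_smul, mul_left_comm]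
    exact mul_le_mul_of_nonneg_left (h2 _) (norm_nonneg _)
  -- `σ₃ f = ⟨x⟩^{-s} F` with `F` in `L²`; moving the weight into the kernel makes `v G₀ ⟨·⟩^{-s}`
  -- Hilbert–Schmidt, for which `s > 1/2` would suffice.
  set F : L2 := hF.toLp _ with hFdef
  have hFae : ∀ᵐ x, act (bw s x) (F x) = act sigma3 (f x) := by
    filter_upwards [hF.coeFn_toLp, sigma3L_ae f] with x h1 h2
    rw [hFdef, h1, act_bw, h2, smul_smul, bracket_rpow_mul, neg_add_cancel, Real.rpow_zero,
      one_smul]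
  have hFm : mulOp (bw s) F = sigma3L f := by
    refine Lp.ext ?_
    filter_upwards [(wt_bw s).mulOp_ae (by linarith) F, hFae, sigma3L_ae f] with x h1 h2 h3
    rw [h1, h2, h3]
  have hR : ∀ x, (fun y => act (kerR0 μ x y) (f y)) =ᵐ[volume]
      fun y => act (kerG0 μ x y) (act (bw s y) (F y)) := fun x => by
    filter_upwards [hFae] with y hy
    rw [kerR0_eq, act_mul, hy]
  have hint : ∀ᵐ x, Integrable (fun y => act (kerR0 μ x y) (f y)) := by
    -- The weight `⟨x⟩⁻²` serves only to obtain a Hilbert–Schmidt kernel; at a fixed `x` it is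
    -- divided out again.
    filter_upwards [(wop_kerG0_spec (μ := μ) (wt_bw 2) (wt_bw s)
      (Or.inr ⟨by norm_num, hs2⟩)).1 F] with x hx
    refine Integrable.congr ?_ (hR x).symm
    have h1 := hx.1.smul (bracket x ^ (2 : ℝ))
    refine h1.congr (.of_forall fun y => ?_)
    simp only [Pi.smul_apply]
    rw [act_mul, act_mul, act_bw, smul_smul, bracket_rpow_mul, add_neg_cancel, Real.rpow_zero,
      one_smul]
  refine ⟨fun x => ∫ y, act (kerR0 μ x y) (f y), wop (v V1 V2) (kerG0 μ) (bw s) F, ?_, ?_, ?_⟩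
  · filter_upwards [hint] with x hx using ⟨hx, rfl⟩
  · filter_upwards [hint, (wop_kerG0_spec (μ := μ) h.wt_v (wt_bw s) (h.wtPair_bw hs2)).1 F]
      with x h1 h2
    rw [h2.2]
    refine Eq.trans ?_ (ContinuousLinearMap.integral_comp_comm
      (Matrix.toEuclideanCLM (n := Fin 2) (𝕜 := ℂ) (v V1 V2 x)) h1)
    refine integral_congr_ae ?_
    filter_upwards [hR x] with y hy
    rw [hy, act_mul, act_mul]
    rfl
  · have hg : S2b0invS2 μ V1 V2 (wop (v V1 V2) (kerG0 μ) (bw s) F) =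
        S2b0invS2 μ V1 V2 (ContinuousLinearMap.adjoint (Th μ V1 V2) (sigma3L f)) :=
      Gam_congr fun φ hφ => by
        rw [h.inner_wop_bw hs2 hφ, hFm, ContinuousLinearMap.adjoint_inner_right]
    rw [hg]
    set q := S2b0invS2 μ V1 V2 (ContinuousLinearMap.adjoint (Th μ V1 V2) (sigma3L f)) with hq
    have hqm : q ∈ S2space μ V1 V2 := Gam_mem _
    have e : ∀ x y, act (kerR0 μ x y) (act (sigma3 * v V1 V2 y) (q y)) =
        act (kerG0 μ x y) (act (v V1 V2 y) (q y)) := fun x y => by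
      rw [kerR0_eq, ← act_mul, ← act_mul, mul_assoc, ← mul_assoc sigma3, sigma3_mul_sigma3, one_mul]
    filter_upwards [h.isKernelIntegral_Th (h.mem_S2space.1 hqm).2,
      Lp.coeFn_neg (Th μ V1 V2 q)] with x h1 h2
    simp only [e]
    refine ⟨h1.1, ?_⟩
    rw [Pop_apply, ← hq, h2, Pi.neg_apply, neg_neg, h1.2]

lemma dense_weighted : Dense {f : L2 | MemLp (fun x => bracket x ^ (2 : ℝ) • f x) 2 volume} := by
  refine (SchwartzMap.denseRange_toLpCLM (F := C2) (μ := (volume : Measure E3))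
    (p := 2) (by norm_num)).mono ?_
  rintro _ ⟨η, rfl⟩
  refine (memLp_bracket_sq_smul η 2).ae_eq ?_
  filter_upwards [η.coeFn_toLp 2 (volume : Measure E3)] with x hx
  change _ = bracket x ^ (2 : ℝ) • (η.toLp 2 (volume : Measure E3) : L2) x
  rw [hx, Real.rpow_two]

/-- On functions with weight `s = 2`, which contain the Schwartz functions and are dense, the
formula determines `u`, `g` and `P f` in turn almost everywhere. -/
lemma IsPmu.unique {P P' : L2 →L[ℂ] L2} (h : IsPmu μ V1 V2 P) (h' : IsPmu μ V1 V2 P') : P = P' := by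
  refine ContinuousLinearMap.coeFn_injective
    (Continuous.ext_on dense_weighted P.continuous P'.continuous fun f hf => ?_)
  obtain ⟨u, g, h1, h2, h3⟩ := h 2 (by norm_num) f hf
  obtain ⟨u', g', h1', h2', h3'⟩ := h' 2 (by norm_num) f hf
  have hg : g = g' := by
    refine Lp.ext ?_
    filter_upwards [h1, h1', h2, h2'] with x k1 k2 k3 k4
    rw [k3, k4, k1.2, k2.2]
  subst hg
  refine Lp.ext ?_
  filter_upwards [h3, h3'] with x k1 k2
  exact neg_injective (k1.2.trans k2.2.symm)

end

/-! ### The kernels of `H - μ` and `H* - μ` -/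

section

variable {μ β C : ℝ} {V1 V2 : E3 → ℝ}

lemma mem_kerSub {T : L2 →ₗ.[ℂ] L2} {c : ℂ} {f : L2} :
    f ∈ kerSub T c ↔ ∃ h : f ∈ T.domain, T ⟨f, h⟩ = c • f := by
  constructor
  · rintro ⟨g, hg, rfl⟩
    refine ⟨g.2, ?_⟩
    have h1 : T g - c • (g : L2) = 0 := hg
    exact sub_eq_zero.1 h1
  · rintro ⟨h, e⟩
    refine ⟨⟨f, h⟩, ?_, rfl⟩
    change T ⟨f, h⟩ - c • f = 0
    rw [e, sub_self]

lemma two_smul_P2L (f : L2) : (2 * μ : ℂ) • P2L f = (μ : ℂ) • f - (μ : ℂ) • sigma3L f := by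
  rw [sigma3L_eq_sub]
  conv_rhs => rw [← P1L_add_P2L f]
  simp only [map_add, P1L_P1L, P1L_P2L, P2L_P1L, P2L_P2L]
  module

lemma Pot.mem_kerSub_iff (h : Pot μ β C V1 V2) {ψ : L2} :
    ψ ∈ kerSub (opH μ V1 V2) (μ : ℂ) ↔ IsSol μ V1 V2 ψ := by
  rw [mem_kerSub]
  have key : ∀ (hd : ψ ∈ (opH μ V1 V2).domain) (hm : ψ ∈ H2 C2),
      opH μ V1 V2 ⟨ψ, hd⟩ = (μ : ℂ) • ψ ↔
        laplaceH2 ⟨ψ, hm⟩ = (2 * μ : ℂ) • P2L ψ - mv V1 V2 (mv V1 V2 ψ) := by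
    intro hd hm
    rw [h.opH_apply ⟨ψ, hd⟩ hm, two_smul_P2L]
    constructor
    · intro e
      have e1 := congrArg sigma3L e
      rw [sigma3L_sigma3L, map_smul] at e1
      change -laplaceH2 ⟨ψ, hm⟩ + (μ : ℂ) • ψ - mv V1 V2 (mv V1 V2 ψ) = _ at e1
      rw [← e1]
      abel
    · intro e
      change sigma3L (-laplaceH2 ⟨ψ, hm⟩ + (μ : ℂ) • ψ - mv V1 V2 (mv V1 V2 ψ)) = _
      rw [e]
      have : -((μ : ℂ) • ψ - (μ : ℂ) • sigma3L ψ - mv V1 V2 (mv V1 V2 ψ)) + (μ : ℂ) • ψ -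
          mv V1 V2 (mv V1 V2 ψ) = (μ : ℂ) • sigma3L ψ := by abel
      rw [this, map_smul, sigma3L_sigma3L]
  constructor
  · rintro ⟨hd, e⟩
    exact ⟨h.mem_domH.1 hd, (key hd _).1 e⟩
  · rintro ⟨hm, e⟩
    exact ⟨h.mem_domH.2 hm, (key _ hm).2 e⟩

lemma Pot.mem_kerSub_adjoint (h : Pot μ β C V1 V2) {y : L2} :
    y ∈ kerSub (opH μ V1 V2).adjoint (μ : ℂ) ↔
      ∀ x : (opH μ V1 V2).domain, inner ℂ y (opH μ V1 V2 x - (μ : ℂ) • (x : L2)) = 0 := by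
  rw [mem_kerSub]
  constructor
  · rintro ⟨hy, e⟩ x
    have := LinearPMap.adjoint_isFormalAdjoint h.dense_domain ⟨y, hy⟩ x
    rw [e, inner_smul_left, Complex.conj_ofReal] at this
    rw [inner_sub_right, inner_smul_right, this, sub_self]
  · intro hx
    have hx' : ∀ x : (opH μ V1 V2).domain,
        inner ℂ ((μ : ℂ) • y) (x : L2) = inner ℂ y (opH μ V1 V2 x) := fun x => by
      have := hx x
      rw [inner_sub_right, inner_smul_right, sub_eq_zero] at this
      rw [inner_smul_left, Complex.conj_ofReal, this]
    have hy := LinearPMap.mem_adjoint_domain_of_exists (T := opH μ V1 V2) y ⟨_, hx'⟩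
    exact ⟨hy, LinearPMap.adjoint_apply_eq h.dense_domain ⟨y, hy⟩ hx'⟩

lemma Pot.inner_opH_sub (h : Pot μ β C V1 V2) (y : L2) (g : (opH μ V1 V2).domain)
    (hg : (g : L2) ∈ H2 C2) : inner ℂ y (opH μ V1 V2 g - (μ : ℂ) • (g : L2)) =
      inner ℂ (sigma3L y) (-laplaceH2 ⟨(g : L2), hg⟩ + (2 * μ : ℂ) • P2L (g : L2) -
        mv V1 V2 (mv V1 V2 (g : L2))) := by
  rw [h.opH_apply g hg, inner_sigma3L, two_smul_P2L]
  congr 1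
  simp only [map_sub, map_add, map_smul, sigma3L_sigma3L]
  abel

/-- On kernels this is `H* = σ₃ H σ₃`. The content is regularity: a priori `y` is only in `L²`, and
membership of `σ₃ y` in `H²` comes from representing it as a Green potential. -/
lemma Pot.isSol_iff_mem_kerSub_adjoint (h : Pot μ β C V1 V2) {y : L2} :
    y ∈ kerSub (opH μ V1 V2).adjoint (μ : ℂ) ↔ IsSol μ V1 V2 (sigma3L y) := by
  rw [h.mem_kerSub_adjoint]
  set y' := sigma3L y with hy'
  constructor
  · intro hx
    -- Any positive parameter would do. Testing with `x = G f`, `G = (-Δ + 1)⁻¹`, turns the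
    -- orthogonality into `⟨y', f⟩ = ⟨k, G f⟩` for all `f`, that is `y' = G k`.
    have h1 : 0 < (1 : ℂ).re := by simp
    set k := y' - (2 * μ : ℂ) • P2L y' + mv V1 V2 (mv V1 V2 y') with hk
    have key : y' = Gop h1 h1 k := by
      refine ext_inner_right ℂ fun f => ?_
      obtain ⟨hm, e⟩ := Gop_mem h1 h1 f
      have h2 := hx ⟨_, h.mem_domH.2 hm⟩
      rw [h.inner_opH_sub y ⟨_, h.mem_domH.2 hm⟩ hm, e, one_pow, one_smul, one_smul,
        P1L_add_P2L] at h2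
      rw [inner_Gop h1 h1 (by simp) (by simp), hk]
      simp only [inner_sub_right, inner_add_right, inner_neg_right, inner_smul_right] at h2
      simp only [inner_sub_left, inner_add_left, inner_smul_left, map_mul, Complex.conj_ofReal,
        Complex.conj_ofNat]
      rw [inner_P2L, h.inner_mv, h.inner_mv]
      linear_combination h2
    obtain ⟨hm, e⟩ := Gop_mem h1 h1 k
    have e2 : laplaceH2 ⟨Gop h1 h1 k, hm⟩ = (2 * μ : ℂ) • P2L y' - mv V1 V2 (mv V1 V2 y') := by
      rw [e, one_pow, one_smul, one_smul, P1L_add_P2L, ← key, hk]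
      abel
    have hm' : y' ∈ H2 C2 := by rw [key]; exact hm
    refine ⟨hm', ?_⟩
    have e3 : (⟨y', hm'⟩ : H2 C2) = ⟨Gop h1 h1 k, hm⟩ := Subtype.ext key
    rw [e3, e2]
  · rintro ⟨hm, e⟩ x
    have hx : (x : L2) ∈ H2 C2 := h.mem_domH.1 x.2
    rw [h.inner_opH_sub y x hx]
    have hs := inner_laplaceH2 ⟨y', hm⟩ ⟨(x : L2), hx⟩
    rw [e] at hs
    simp only [inner_sub_left, inner_smul_left, map_mul, Complex.conj_ofReal,
        Complex.conj_ofNat] at hs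
    rw [inner_P2L, h.inner_mv, h.inner_mv] at hs
    simp only [inner_sub_right, inner_add_right, inner_neg_right, inner_smul_right]
    linear_combination hs

lemma Pot.range_Pop (h : Pot μ β C V1 V2) (hL : LminusNonneg μ V1 V2) :
    LinearMap.range (Pop μ V1 V2).toLinearMap = kerSub (opH μ V1 V2) (μ : ℂ) := by
  ext ψ
  rw [h.mem_range_Pop hL, h.mem_kerSub_iff]

lemma Pot.ker_Pop (h : Pot μ β C V1 V2) (hL : LminusNonneg μ V1 V2) :
    LinearMap.ker (Pop μ V1 V2).toLinearMap = (kerSub (opH μ V1 V2).adjoint (μ : ℂ))ᗮ := by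
  ext f
  rw [h.mem_ker_Pop hL, Submodule.mem_orthogonal]
  constructor
  · intro hf y hy
    have := hf _ (h.isSol_iff_mem_kerSub_adjoint.1 hy)
    rwa [sigma3L_sigma3L] at this
  · intro hf ψ hψ
    refine hf _ (h.isSol_iff_mem_kerSub_adjoint.2 ?_)
    rwa [sigma3L_sigma3L]

end

/-! ### Inversion of a family of operators near a threshold -/

section

variable {H : Type*} [NormedAddCommGroup H] [InnerProductSpace ℂ H]

/-- Self-adjointness makes `S^⊥` invariant under `T`. The eigenspace for `1` has been removed, so
`1` is not an eigenvalue of the compact restriction and `1 - T` is bounded below there. -/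
lemma exists_norm_le_of_mem_orthogonal [CompleteSpace H] {T : H →L[ℂ] H} (hT : IsCompactOperator T)
    (hs : ∀ f g, inner ℂ (T f) g = inner ℂ f (T g)) {S : Submodule ℂ H}
    (hS : ∀ f, f ∈ S ↔ T f = f) : ∃ c : ℝ, 0 ≤ c ∧ ∀ q ∈ Sᗮ, ‖q‖ ≤ c * ‖q - T q‖ := by
  have hV : ∀ q ∈ Sᗮ, T.toLinearMap q ∈ Sᗮ := fun q hq => by
    rw [Submodule.mem_orthogonal] at hq ⊢
    intro u hu
    change inner ℂ u (T q) = 0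
    rw [← hs, (hS u).1 hu, hq u hu]
  have hC : IsCompactOperator (T.toLinearMap.restrict hV) := IsCompactOperator.restrict' hT hV
  have hne : ¬ Module.End.HasEigenvalue
      ((T.restrict hV : Sᗮ →L[ℂ] Sᗮ) : Module.End ℂ Sᗮ) 1 := by
    intro he
    obtain ⟨q, hq⟩ := he.exists_hasEigenvector
    refine hq.2 (Subtype.ext ?_)
    have h1 := hq.apply_eq_smul
    rw [one_smul] at h1
    have h2 : T (q : H) = q := congrArg Subtype.val h1
    have h3 := (Submodule.mem_orthogonal _ _).1 q.2 q ((hS _).2 h2)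
    exact inner_self_eq_zero.1 h3
  obtain ⟨K, hK⟩ := IsCompactOperator.antilipschitz_of_not_hasEigenvalue
    (T := (T.restrict hV : Sᗮ →L[ℂ] Sᗮ)) hC one_ne_zero hne
  refine ⟨K, K.2, fun q hq => ?_⟩
  have h1 := hK.le_mul_norm (map_zero _) ⟨q, hq⟩
  refine h1.trans_eq ?_
  congr 1
  rw [norm_sub_rev, one_smul]
  rfl

/-- The operator `A` is a perturbation of `A₀ - (iz / 4π) ⟨e, ·⟩ e` of size `z²`, whose compression
to `S₂` is `z² B` up to an error of size `z³`. -/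
structure NearThreshold (S2 : Submodule ℂ H) (A0 B : H →L[ℂ] H) (e : H) (c : ℝ) (z : ℂ)
    (A : H →L[ℂ] H) : Prop where
  first : ∀ f, ‖A f - A0 f + (Complex.I * z * (1 / (4 * Real.pi))) • inner ℂ e f • e‖ ≤
    c * ‖z‖ ^ 2 * ‖f‖
  second : ∀ p ∈ S2, ∀ p' ∈ S2, ‖inner ℂ p' (A p - z ^ 2 • B p)‖ ≤ c * ‖z‖ ^ 3 * ‖p‖ * ‖p'‖

variable {S1 S2 : Submodule ℂ H} {A0 B : H →L[ℂ] H} {e : H}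

/-- `S₂` is the orthogonal complement of `e1` in `S₁`, so `p` is a multiple of `e1` and is recovered
from `⟨e, p⟩`. If `e1 = 0` then `p = 0`, in accordance with `0⁻¹ = 0`. -/
lemma norm_le_inv_mul_norm_inner {e1 : H} (he1 : e1 ∈ S1)
    (hin : ∀ f ∈ S1, inner ℂ e f = inner ℂ e1 f)
    (hS2 : ∀ f, f ∈ S2 ↔ f ∈ S1 ∧ inner ℂ e f = 0) {p : H} (hp : p ∈ S1) (hp' : p ∈ S2ᗮ) :
    ‖p‖ ≤ ‖e1‖⁻¹ * ‖inner ℂ e p‖ := by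
  rw [Submodule.mem_orthogonal] at hp'
  by_cases h0 : e1 = 0
  · have : p ∈ S2 := (hS2 p).2 ⟨hp, by rw [hin p hp, h0, inner_zero_left]⟩
    rw [inner_self_eq_zero.1 (hp' p this), norm_zero]
    positivity
  have hn : (‖e1‖ : ℂ) ≠ 0 := by exact_mod_cast norm_ne_zero_iff.2 h0
  set t : ℂ := inner ℂ e1 p / ‖e1‖ ^ 2 with ht
  have hr : p - t • e1 ∈ S2 := by
    refine (hS2 _).2 ⟨sub_mem hp (Submodule.smul_mem _ _ he1), ?_⟩
    rw [inner_sub_right, inner_smul_right, hin p hp, hin e1 he1, inner_self_eq_norm_sq_to_K, ht]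
    field_simp
    simp
  have h1 := hp' _ hr
  have h2 : inner ℂ (p - t • e1) e1 = 0 := by
    rw [← inner_conj_symm, ← hin _ ((hS2 _).1 hr).1, ((hS2 _).1 hr).2, map_zero]
  have h3 : p = t • e1 := by
    rw [← sub_eq_zero, ← inner_self_eq_zero (𝕜 := ℂ)]
    conv_lhs => rw [inner_sub_right, inner_smul_right, h1, h2]
    simp
  have h4 : ‖p‖ = ‖t‖ * ‖e1‖ := by conv_lhs => rw [h3, norm_smul]
  rw [h4, hin p hp, ht, norm_div, norm_pow, Complex.norm_real, norm_norm]
  refine le_of_eq ?_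
  have := norm_ne_zero_iff.2 h0
  field_simp

/-- Pairing the first-order expansion with `e1` removes `A₀` by symmetry and isolates `(iz/4π) ⟨e,
φ⟩ ‖e1‖²`. -/
lemma norm_inner_le_of_nearThreshold {c : ℝ} (hc : 0 ≤ c) {e1 : H}
    (hin : ∀ f ∈ S1, inner ℂ e f = inner ℂ e1 f) (he1 : e1 ∈ S1)
    (hsymm : ∀ f g, inner ℂ (A0 f) g = inner ℂ f (A0 g)) (hS1 : ∀ f ∈ S1, A0 f = 0)
    {z : ℂ} {A : H →L[ℂ] H} (hA : NearThreshold S2 A0 B e c z A) {q p : H} (hp : p ∈ S1) :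
    ‖z‖ * ‖inner ℂ e (q + p)‖ ≤
      4 * Real.pi * (1 + c) * ‖e1‖⁻¹ * (‖A (q + p)‖ + ‖z‖ ^ 2 * ‖q + p‖) + ‖z‖ * (‖e‖ * ‖q‖) := by
  have hpi := Real.pi_pos
  -- Here `⟨e, p⟩ = 0`, so only `⟨e, q⟩` remains; the last summand of the bound is there for this
  -- case.
  by_cases h0 : e1 = 0
  · rw [inner_add_right, hin p hp, h0, inner_zero_left, add_zero, norm_zero, inv_zero, mul_zero,
      zero_mul, zero_add]
    exact mul_le_mul_of_nonneg_left (norm_inner_le_norm _ _) (norm_nonneg _)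
  have hn : 0 < ‖e1‖ := norm_pos_iff.2 h0
  set φ := q + p
  have h1 := (norm_inner_le_norm (𝕜 := ℂ) e1 _).trans
    (mul_le_mul_of_nonneg_left (hA.first φ) (norm_nonneg e1))
  have e2 : inner ℂ e1 e = (‖e1‖ : ℂ) ^ 2 := by
    rw [← inner_conj_symm, hin e1 he1, inner_self_eq_norm_sq_to_K]
    simp
  rw [inner_add_right, inner_sub_right, ← hsymm, hS1 e1 he1, inner_zero_left, sub_zero,
    inner_smul_right, inner_smul_right, e2] at h1
  have h2 := norm_sub_norm_le (Complex.I * z * (1 / (4 * Real.pi)) * (inner ℂ e φ * ‖e1‖ ^ 2))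
    (-inner ℂ e1 (A φ))
  rw [sub_neg_eq_add, add_comm _ (inner ℂ e1 (A φ)), norm_neg] at h2
  have h3 : ‖Complex.I * z * (1 / (4 * Real.pi)) * (inner ℂ e φ * ‖e1‖ ^ 2)‖ =
      ‖z‖ * ‖inner ℂ e φ‖ * ‖e1‖ ^ 2 / (4 * Real.pi) := by
    simp only [norm_mul, norm_div, norm_pow, Complex.norm_I, norm_one, Complex.norm_real,
      Complex.norm_ofNat, Real.norm_eq_abs, abs_of_pos hpi, abs_norm]
    ring
  have h4 := norm_inner_le_norm (𝕜 := ℂ) e1 (A φ)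
  rw [h3] at h2
  have h5 : ‖z‖ * ‖inner ℂ e φ‖ * ‖e1‖ ^ 2 / (4 * Real.pi) ≤
      ‖e1‖ * (‖A φ‖ + c * ‖z‖ ^ 2 * ‖φ‖) := by linarith
  rw [div_le_iff₀ (by positivity)] at h5
  have h6 : ‖z‖ * ‖inner ℂ e φ‖ ≤ 4 * Real.pi * ‖e1‖⁻¹ * (‖A φ‖ + c * ‖z‖ ^ 2 * ‖φ‖) := by
    rw [← mul_le_mul_iff_left₀ (show 0 < ‖e1‖ ^ 2 by positivity)]
    refine h5.trans_eq ?_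
    field_simp
  have h7 : ‖A φ‖ + c * ‖z‖ ^ 2 * ‖φ‖ ≤ (1 + c) * (‖A φ‖ + ‖z‖ ^ 2 * ‖φ‖) := by
    nlinarith [mul_nonneg hc (norm_nonneg (A φ)), mul_nonneg (sq_nonneg ‖z‖) (norm_nonneg φ)]
  have h8 := mul_le_mul_of_nonneg_left h7 (show 0 ≤ 4 * Real.pi * ‖e1‖⁻¹ by positivity)
  have h9 : 0 ≤ ‖z‖ * (‖e‖ * ‖q‖) := by positivity
  nlinarith

/-- The component of `φ` orthogonal to `S₂` is controlled by `A φ`. -/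
lemma exists_norm_le_of_nearThreshold {c c0 : ℝ} (hc : 0 ≤ c) (hc0 : 0 ≤ c0) {e1 : H}
    (hin : ∀ f ∈ S1, inner ℂ e f = inner ℂ e1 f) (he1 : e1 ∈ S1)
    (hsymm : ∀ f g, inner ℂ (A0 f) g = inner ℂ f (A0 g)) (hS1 : ∀ f ∈ S1, A0 f = 0)
    (hS2 : ∀ f, f ∈ S2 ↔ f ∈ S1 ∧ inner ℂ e f = 0) (hcoer : ∀ q ∈ S1ᗮ, ‖q‖ ≤ c0 * ‖A0 q‖) :
    ∃ K δ : ℝ, 0 ≤ K ∧ 0 < δ ∧ ∀ (z : ℂ) (A : H →L[ℂ] H), ‖z‖ < δ →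
      NearThreshold S2 A0 B e c z A → ∀ q ∈ S1ᗮ, ∀ p3 ∈ S1, p3 ∈ S2ᗮ → ∀ p2 ∈ S2,
      ‖z‖ * (‖q‖ + ‖p3‖) ≤ K * (‖A (q + (p3 + p2))‖ + ‖z‖ ^ 2 * ‖q + (p3 + p2)‖) := by
  have hpi := Real.pi_pos
  set K1 := 4 * Real.pi * (1 + c) * ‖e1‖⁻¹ with hK1
  have hK1p : 0 ≤ K1 := by positivity
  set k := 1 / (4 * Real.pi) with hk
  have hkp : 0 ≤ k := by positivity
  set K2 := 2 * c0 * (1 + c + k * ‖e‖ * K1) with hK2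
  have hK2p : 0 ≤ K2 := by positivity
  -- The bound for `q` contains `c0 k ‖e‖² |z| ‖q‖` on the right. The choice of `δ` makes this
  -- coefficient at most `1/2`, and absorbing it accounts for the factor `2` in `K2`.
  refine ⟨K2 + ‖e1‖⁻¹ * (K1 + 2 * (‖e‖ * K2)), min 1 (1 / (2 * (c0 * k * ‖e‖ ^ 2 + 1))),
    by positivity, by positivity, fun z A hz hA q hq p3 hp3 hp3' p2 hp2 => ?_⟩
  have hz1 : ‖z‖ < 1 := hz.trans_le (min_le_left _ _)
  have hz2 : ‖z‖ * (c0 * k * ‖e‖ ^ 2) ≤ 1 / 2 := by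
    have h1 := hz.le.trans (min_le_right _ _)
    rw [le_div_iff₀ (by positivity)] at h1
    nlinarith [norm_nonneg z]
  have h1 := norm_inner_le_of_nearThreshold hc hin he1 hsymm hS1 hA (q := q)
    (add_mem hp3 ((hS2 p2).1 hp2).1)
  have h2 : A0 q = A0 (q + (p3 + p2)) := by
    rw [map_add, map_add, hS1 p3 hp3, hS1 p2 ((hS2 p2).1 hp2).1, add_zero, add_zero]
  have h2' : inner ℂ e p3 = inner ℂ e (q + (p3 + p2)) - inner ℂ e q := by
    rw [inner_add_right, inner_add_right, ((hS2 p2).1 hp2).2]; ring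
  set φ := q + (p3 + p2)
  set X := ‖A φ‖ + ‖z‖ ^ 2 * ‖φ‖ with hX
  have hXp : 0 ≤ X := by positivity
  have hAX : ‖A φ‖ ≤ X := le_add_of_nonneg_right (by positivity)
  have hφX : ‖z‖ ^ 2 * ‖φ‖ ≤ X := le_add_of_nonneg_left (by positivity)
  have h3 : ‖A0 q‖ ≤ ‖A φ‖ + c * ‖z‖ ^ 2 * ‖φ‖ + k * ‖e‖ * (‖z‖ * ‖inner ℂ e φ‖) := by
    have e3 : A0 q = A φ - (A φ - A0 φ +
        (Complex.I * z * (1 / (4 * Real.pi))) • inner ℂ e φ • e) +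
        (Complex.I * z * (1 / (4 * Real.pi))) • inner ℂ e φ • e := by rw [h2]; abel
    have e4 : ‖(Complex.I * z * (1 / (4 * Real.pi))) • inner ℂ e φ • e‖ =
        k * ‖e‖ * (‖z‖ * ‖inner ℂ e φ‖) := by
      simp only [norm_smul, norm_mul, norm_div, Complex.norm_I, norm_one, Complex.norm_real,
        Complex.norm_ofNat, Real.norm_eq_abs, abs_of_pos hpi, hk]
      ring
    rw [e3, ← e4]
    exact (norm_add_le _ _).trans (add_le_add_left ((norm_sub_le _ _).trans
      (add_le_add_right (hA.first φ) _)) _)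
  have h4 : ‖q‖ ≤ K2 * X := by
    have h5 := (hcoer q hq).trans (mul_le_mul_of_nonneg_left h3 hc0)
    have h6 : c * ‖z‖ ^ 2 * ‖φ‖ ≤ c * X := by
      rw [mul_assoc]; exact mul_le_mul_of_nonneg_left hφX hc
    have h7 := mul_le_mul_of_nonneg_left h1 (show 0 ≤ k * ‖e‖ by positivity)
    have h8 : ‖q‖ ≤ c0 * (X + c * X + k * ‖e‖ * (K1 * X + ‖z‖ * (‖e‖ * ‖q‖))) :=
      h5.trans (mul_le_mul_of_nonneg_left (by linarith) hc0)
    have h9 := mul_le_mul_of_nonneg_right hz2 (norm_nonneg q)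
    rw [hK2]
    linarith
  have h5 : ‖p3‖ ≤ ‖e1‖⁻¹ * (‖inner ℂ e φ‖ + ‖e‖ * ‖q‖) := by
    refine (norm_le_inv_mul_norm_inner he1 hin hS2 hp3 hp3').trans
      (mul_le_mul_of_nonneg_left ?_ (by positivity))
    rw [h2']
    exact (norm_sub_le _ _).trans (add_le_add_right (norm_inner_le_norm _ _) _)
  have hzq : ‖z‖ * ‖q‖ ≤ K2 * X := by nlinarith [norm_nonneg q, norm_nonneg z]
  have h6 : ‖z‖ * ‖p3‖ ≤ ‖e1‖⁻¹ * (K1 + 2 * (‖e‖ * K2)) * X := by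
    have h7 := mul_le_mul_of_nonneg_left h5 (norm_nonneg z)
    have h8 := mul_le_mul_of_nonneg_left hzq (norm_nonneg e)
    have h9 : ‖z‖ * ‖inner ℂ e φ‖ + ‖e‖ * (‖z‖ * ‖q‖) ≤ (K1 + 2 * (‖e‖ * K2)) * X := by linarith
    have h10 := mul_le_mul_of_nonneg_left h9 (show 0 ≤ ‖e1‖⁻¹ by positivity)
    linarith
  linarith

variable {Γ : H →L[ℂ] H}

/-- Write `φ = q + p3 + p2` along `S₁^⊥`, `S₁ ⊖ S₂`, `S₂`. As `Γ B p2 = p2`, the quantity to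
estimate is `q + p3 - z⁻² Γ g` with `g = A φ - z² B p2`. Projected to `S₂`, where `A₀` and `e`
vanish, `A (q + p3)` is `O(z²)` and `A p2 - z² B p2` is `O(z³)`, which compensates `z⁻²`. -/
lemma exists_norm_sub_le_of_nearThreshold [CompleteSpace S1] [CompleteSpace S2] {c c0 : ℝ}
    (hc : 0 ≤ c) (hc0 : 0 ≤ c0)
    (hsymm : ∀ f g, inner ℂ (A0 f) g = inner ℂ f (A0 g)) (hS1 : ∀ f ∈ S1, A0 f = 0)
    (hS2 : ∀ f, f ∈ S2 ↔ f ∈ S1 ∧ inner ℂ e f = 0) (hcoer : ∀ q ∈ S1ᗮ, ‖q‖ ≤ c0 * ‖A0 q‖)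
    (hΓ : ∀ f g, (∀ p ∈ S2, inner ℂ p f = inner ℂ p g) → Γ f = Γ g)
    (hΓB : ∀ p ∈ S2, Γ (B p) = p) :
    ∃ K δ : ℝ, 0 ≤ K ∧ 0 < δ ∧ ∀ (z : ℂ) (A : H →L[ℂ] H), z ≠ 0 → ‖z‖ < δ →
      NearThreshold S2 A0 B e c z A → ∀ φ,
      ‖φ - (z ^ 2)⁻¹ • Γ (A φ)‖ ≤ K / ‖z‖ * ‖A φ‖ := by
  obtain ⟨K1, δ1, hK1, hδ1, h1⟩ := exists_norm_le_of_nearThreshold (B := B) (e := e)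
    (e1 := S1.starProjection e) hc hc0
    (fun f hf => by
      rw [Submodule.inner_starProjection_left_eq_right, Submodule.starProjection_eq_self_iff.2 hf])
    (Submodule.starProjection_apply_mem _ _) hsymm hS1 hS2 hcoer
  set G := ‖Γ‖ with hG
  have hGp : 0 ≤ G := norm_nonneg _
  set K2 := (1 + 2 * (G * c)) * K1 + G * c with hK2
  have hK2p : 0 ≤ K2 := by positivity
  -- The estimates yield `|z| Y ≤ K2 (‖A φ‖ + |z|² ‖φ‖)` for the norm `Y` to be bounded, and `|z|²
  -- ‖φ‖ ≤ |z|² Y + G ‖A φ‖`. With `|z| K2 ≤ 1/2` the `Y` on the right is absorbed, at the price of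
  -- the factor `2`.
  refine ⟨2 * (K2 * (1 + G)), min (min 1 δ1) (1 / (2 * (K2 + 1))), by positivity, by positivity,
    fun z A hz0 hz hA φ => ?_⟩
  have hw : 0 < ‖z‖ := norm_pos_iff.2 hz0
  have hz1 : ‖z‖ < 1 := hz.trans_le ((min_le_left _ _).trans (min_le_left _ _))
  have hz2 : ‖z‖ < δ1 := hz.trans_le ((min_le_left _ _).trans (min_le_right _ _))
  have hz3 : ‖z‖ * K2 ≤ 1 / 2 := by
    have h1 := hz.le.trans (min_le_right _ _)
    rw [le_div_iff₀ (by positivity)] at h1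
    nlinarith
  set p := S1.starProjection φ with hp
  set p2 := S2.starProjection p with hp2
  set q := φ - p with hq
  set p3 := p - p2 with hp3
  have m1 : q ∈ S1ᗮ := Submodule.sub_starProjection_mem_orthogonal _
  have m2 : p2 ∈ S2 := Submodule.starProjection_apply_mem _ _
  have m3 : p3 ∈ S2ᗮ := Submodule.sub_starProjection_mem_orthogonal _
  have m4 : p3 ∈ S1 := sub_mem (Submodule.starProjection_apply_mem _ _) ((hS2 _).1 m2).1
  have hφ : q + (p3 + p2) = φ := by rw [hq, hp3]; abel
  have h2 := h1 z A hz2 hA q m1 p3 m4 m3 p2 m2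
  rw [hφ] at h2
  -- the component in `S₂`
  set g := A φ - z ^ 2 • B p2 with hg
  have h3 : ‖Γ g‖ ≤ G * (c * ‖z‖ ^ 2 * (‖q‖ + ‖p3‖) + c * ‖z‖ ^ 3 * ‖p2‖) := by
    set r := S2.starProjection g with hr
    have hrm : r ∈ S2 := Submodule.starProjection_apply_mem _ _
    have e1 : Γ g = Γ r := hΓ _ _ fun p' hp' => by
      rw [hr, ← Submodule.inner_starProjection_left_eq_right,
        Submodule.starProjection_eq_self_iff.2 hp']
    have e2 : ‖r‖ ^ 2 = ‖inner ℂ r g‖ := by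
      have : inner ℂ r g = inner ℂ r r := by
        conv_rhs => rw [hr, ← Submodule.inner_starProjection_left_eq_right, ← hr,
          Submodule.starProjection_eq_self_iff.2 hrm]
      rw [this, inner_self_eq_norm_sq_to_K]
      simp
    have e3 : inner ℂ r (A (q + p3)) = inner ℂ r (A (q + p3) - A0 (q + p3) +
        (Complex.I * z * (1 / (4 * Real.pi))) • inner ℂ e (q + p3) • e) := by
      have : inner ℂ r e = 0 := by
        rw [← inner_conj_symm, ((hS2 r).1 hrm).2, map_zero]
      rw [inner_add_right, inner_sub_right, ← hsymm, hS1 r ((hS2 r).1 hrm).1, inner_zero_left,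
        inner_smul_right, inner_smul_right, this]
      ring
    have e4 : inner ℂ r g = inner ℂ r (A (q + p3)) + inner ℂ r (A p2 - z ^ 2 • B p2) := by
      rw [← inner_add_right, hg, ← hφ, ← add_assoc, map_add A]
      congr 1
      abel
    have e5 : ‖r‖ ^ 2 ≤ ‖r‖ * (c * ‖z‖ ^ 2 * (‖q‖ + ‖p3‖) + c * ‖z‖ ^ 3 * ‖p2‖) := by
      rw [e2, e4, e3]
      refine (norm_add_le _ _).trans ?_
      have e6 := (norm_inner_le_norm (𝕜 := ℂ) r _).trans
        (mul_le_mul_of_nonneg_left (hA.first (q + p3)) (norm_nonneg r))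
      have e7 := hA.second p2 m2 r hrm
      have e8 := mul_le_mul_of_nonneg_left (norm_add_le q p3)
        (show 0 ≤ ‖r‖ * (c * ‖z‖ ^ 2) by positivity)
      linarith
    have e6 : ‖r‖ ≤ c * ‖z‖ ^ 2 * (‖q‖ + ‖p3‖) + c * ‖z‖ ^ 3 * ‖p2‖ := by
      by_cases hr0 : ‖r‖ = 0
      · rw [hr0]; positivity
      · exact le_of_mul_le_mul_left (by linarith)
          (lt_of_le_of_ne (norm_nonneg r) (Ne.symm hr0))
    rw [e1]
    exact (Γ.le_opNorm r).trans (mul_le_mul_of_nonneg_left e6 hGp)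
  have h4 : φ - (z ^ 2)⁻¹ • Γ (A φ) = q + p3 - (z ^ 2)⁻¹ • Γ g := by
    rw [hg, map_sub, map_smul, hΓB p2 m2, smul_sub, smul_smul, inv_mul_cancel₀ (pow_ne_zero 2 hz0),
      one_smul]
    have : φ - p2 = q + p3 := by rw [← hφ]; abel
    rw [← this]
    abel
  have h5 : ‖z‖ * ‖(z ^ 2)⁻¹ • Γ g‖ ≤ G * c * (‖z‖ * (‖q‖ + ‖p3‖) + ‖z‖ ^ 2 * ‖p2‖) := by
    rw [norm_smul, norm_inv, norm_pow]
    have := mul_le_mul_of_nonneg_left h3 (show 0 ≤ ‖z‖ * (‖z‖ ^ 2)⁻¹ by positivity)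
    rw [mul_assoc] at this
    refine this.trans_eq ?_
    field_simp
  have h6 : ‖p2‖ ≤ ‖φ‖ + (‖q‖ + ‖p3‖) := by
    have : p2 = φ - (q + p3) := by rw [← hφ]; abel
    rw [this]
    exact (norm_sub_le _ _).trans (add_le_add_right (norm_add_le _ _) _)
  have h7 : ‖z‖ ^ 2 * ‖p2‖ ≤ ‖z‖ ^ 2 * ‖φ‖ + ‖z‖ * (‖q‖ + ‖p3‖) := by
    have a1 := mul_le_mul_of_nonneg_left h6 (sq_nonneg ‖z‖)
    have a2 : ‖z‖ ^ 2 * (‖q‖ + ‖p3‖) ≤ ‖z‖ * (‖q‖ + ‖p3‖) :=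
      mul_le_mul_of_nonneg_right (by nlinarith) (by positivity)
    linarith
  set Y := ‖φ - (z ^ 2)⁻¹ • Γ (A φ)‖ with hY
  set Z := ‖z‖ * (‖q‖ + ‖p3‖)
  have hGc : 0 ≤ G * c := by positivity
  have h8 : ‖z‖ * Y ≤ K2 * (‖A φ‖ + ‖z‖ ^ 2 * ‖φ‖) := by
    have a1 : Y ≤ ‖q‖ + ‖p3‖ + ‖(z ^ 2)⁻¹ • Γ g‖ := by
      rw [hY, h4]
      exact (norm_sub_le _ _).trans (add_le_add_left (norm_add_le _ _) _)
    have a2 := mul_le_mul_of_nonneg_left a1 hw.le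
    have a3 := mul_le_mul_of_nonneg_left h7 hGc
    have a4 : ‖z‖ * Y ≤ (1 + 2 * (G * c)) * Z + G * c * (‖z‖ ^ 2 * ‖φ‖) := by
      simp only [Z] at *
      linarith
    have a5 := mul_le_mul_of_nonneg_left h2 (show 0 ≤ 1 + 2 * (G * c) by positivity)
    have a6 : G * c * (‖z‖ ^ 2 * ‖φ‖) ≤ G * c * (‖A φ‖ + ‖z‖ ^ 2 * ‖φ‖) :=
      mul_le_mul_of_nonneg_left (le_add_of_nonneg_left (norm_nonneg _)) hGc
    rw [hK2]
    simp only [Z] at *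
    linarith
  have h9 : ‖z‖ ^ 2 * ‖φ‖ ≤ ‖z‖ ^ 2 * Y + G * ‖A φ‖ := by
    have a1 : ‖φ‖ ≤ Y + (‖z‖ ^ 2)⁻¹ * (G * ‖A φ‖) := by
      have : φ = (φ - (z ^ 2)⁻¹ • Γ (A φ)) + (z ^ 2)⁻¹ • Γ (A φ) := by abel
      conv_lhs => rw [this]
      refine (norm_add_le _ _).trans (add_le_add_right ?_ _)
      rw [norm_smul, norm_inv, norm_pow]
      exact mul_le_mul_of_nonneg_left (Γ.le_opNorm _) (by positivity)
    have a2 := mul_le_mul_of_nonneg_left a1 (sq_nonneg ‖z‖)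
    refine a2.trans_eq ?_
    field_simp
  have hYp : 0 ≤ Y := norm_nonneg _
  rw [div_mul_eq_mul_div, le_div_iff₀ hw]
  have b1 := mul_le_mul_of_nonneg_left h9 hK2p
  have b2 := mul_le_mul_of_nonneg_left hz3 (show 0 ≤ ‖z‖ * Y by positivity)
  linarith

end

/-! ### The resolvent near the threshold -/

section

variable {μ β C : ℝ} {V1 V2 : E3 → ℝ} {z a : ℂ}

lemma Pot.exists_norm_sub_le (h : Pot μ β C V1 V2) (hL : LminusNonneg μ V1 V2) :
    ∃ K δ : ℝ, 0 ≤ K ∧ 0 < δ ∧ ∀ z a : ℂ, SP μ z a → ‖z‖ < δ → ∀ φ,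
      ‖φ - (z ^ 2)⁻¹ • S2b0invS2 μ V1 V2 (Az V1 V2 z a φ)‖ ≤ K / ‖z‖ * ‖Az V1 V2 z a φ‖ := by
  obtain ⟨c0, hc0, hcoer⟩ := exists_norm_le_of_mem_orthogonal h.T0_spec.2.1 h.inner_T0
    (S := S1space μ V1 V2) (fun f => h.mem_S1space)
  set c1 := 3 * cExp μ * cPow (4 * √C * (4 * √C)) (β / 2 - 1) (β / 2 - 1)
  obtain ⟨K, δ, hK, hδ, hz⟩ := exists_norm_sub_le_of_nearThreshold (A0 := A0 μ V1 V2)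
    (B := Bop μ V1 V2) (e := eL V1 V2) (S1 := S1space μ V1 V2) (S2 := S2space μ V1 V2)
    (Γ := S2b0invS2 μ V1 V2) (c := max (max c1 (cCube μ β C V1 V2)) 0)
    (le_max_right _ _) hc0
    (fun f g => by
      rw [h.A0_apply, h.A0_apply, inner_sub_left, inner_sub_right, h.inner_T0])
    (fun f hf => hf) (fun f => h.mem_S2space)
    (fun q hq => by rw [h.A0_apply]; exact hcoer q hq)
    (fun f g => Gam_congr) (fun p => h.Gam_Bop hL)
  refine ⟨K, δ, hK, hδ, fun z a hs hzδ => hz z _ hs.ne_zero hzδ ⟨fun f => ?_, fun p hp p' hp' => ?_⟩⟩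
  · refine (h.norm_Az_sub_le hs f).trans ?_
    gcongr
    exact (le_max_left _ _).trans (le_max_left _ _)
  · refine (h.norm_inner_Az_sub_le hs hp hp').trans ?_
    gcongr
    exact (le_max_right _ _).trans (le_max_left _ _)

/-- Fredholm alternative for the compact operator `v G(z) v` at the point `1`. -/
lemma Pot.exists_inverse_Az (h : Pot μ β C V1 V2) (hz : SP μ z a)
    (h0 : ∀ f, Az V1 V2 z a f = 0 → f = 0) :
    ∃ E : L2 →L[ℂ] L2, (∀ f, Az V1 V2 z a (E f) = f) ∧ ∀ f, E (Az V1 V2 z a f) = f := by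
  rcases IsCompactOperator.hasEigenvalue_or_mem_resolventSet
    (hz.wop_kerGz_spec h.wt_v h.wt_v h.wtPair).2.1 one_ne_zero with h1 | h1
  · obtain ⟨q, hq⟩ := h1.exists_hasEigenvector
    refine absurd (h0 q ?_) hq.2
    have h2 := hq.apply_eq_smul
    rw [one_smul] at h2
    change q - wop (v V1 V2) (kerGz z a) (v V1 V2) q = 0
    exact sub_eq_zero.2 h2.symm
  · rw [spectrum.mem_resolventSet_iff, map_one] at h1
    obtain ⟨u, hu⟩ := h1
    refine ⟨(u⁻¹ : (L2 →L[ℂ] L2)ˣ), fun f => ?_, fun f => ?_⟩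
    · have := congrArg (fun T : L2 →L[ℂ] L2 => T f) u.mul_inv
      rw [hu] at this
      exact this
    · have := congrArg (fun T : L2 →L[ℂ] L2 => T f) u.inv_mul
      rw [hu] at this
      exact this

/-- The resolvent `(G + G v A(z)⁻¹ v G) σ₃`. -/
def Rop (V1 V2 : E3 → ℝ) (G E : L2 →L[ℂ] L2) : L2 →L[ℂ] L2 :=
  (G + G ∘L mv V1 V2 ∘L E ∘L mv V1 V2 ∘L G) ∘L sigma3L

lemma Rop_apply (G E : L2 →L[ℂ] L2) (f : L2) : Rop V1 V2 G E f =
    G (sigma3L f) + G (mv V1 V2 (E (mv V1 V2 (G (sigma3L f))))) := rfl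

/-- For `(H - μ - z²) u = f` the equation becomes `u = G (σ₃ f + v w)` with `w = v u`, and
multiplication by `v` gives `A(z) w = v G σ₃ f`. The two identities for `E` correspond to the two
sides of the resolvent. -/
lemma Pot.isResolventAt_Rop (h : Pot μ β C V1 V2) (hz : SP μ z a) {E : L2 →L[ℂ] L2}
    (hE : ∀ f, Az V1 V2 z a (E f) = f) (hE' : ∀ f, E (Az V1 V2 z a f) = f) :
    IsResolventAt (opH μ V1 V2) ((μ : ℂ) + z ^ 2)
      (Rop V1 V2 (Gop hz.re_pos' hz.re_pos) E) := by
  set G := Gop hz.re_pos' hz.re_pos with hG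
  have hsq : (-(Complex.I * z)) ^ 2 = -z ^ 2 := by
    rw [neg_sq, mul_pow, Complex.I_sq]; ring
  refine ⟨fun f => ?_, fun f => ?_⟩
  · set w := E (mv V1 V2 (G (sigma3L f))) with hw
    set u := Rop V1 V2 G E f with hu
    have hu1 : u = G (sigma3L f + mv V1 V2 w) := by rw [hu, Rop_apply, map_add]
    have hw1 : mv V1 V2 u = w := by
      have := hE (mv V1 V2 (G (sigma3L f)))
      rw [← hw, h.Az_apply hz, sub_eq_iff_eq_add] at this
      rw [this, hu1, map_add, map_add]
    obtain ⟨hm, e⟩ := Gop_mem hz.re_pos' hz.re_pos (sigma3L f + mv V1 V2 w)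
    have e3 : ∀ hm' : u ∈ H2 C2, laplaceH2 (⟨u, hm'⟩ : H2 C2) =
        (-z ^ 2) • P1L u + (2 * μ + z ^ 2) • P2L u - (sigma3L f + mv V1 V2 w) := by
      rw [hu1]
      intro hm'
      rw [e, hsq, hz.sq]
    have hm' : u ∈ H2 C2 := by rw [hu1]; exact hm
    refine ⟨h.mem_domH.2 hm', ?_⟩
    rw [h.opH_apply ⟨u, h.mem_domH.2 hm'⟩ hm']
    rw [e3 hm', hw1]
    have e4 : ((μ : ℂ) + z ^ 2) • u = sigma3L (((μ : ℂ) + z ^ 2) • sigma3L u) := by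
      rw [map_smul, sigma3L_sigma3L]
    rw [e4, ← map_sub]
    conv_rhs => rw [← sigma3L_sigma3L f]
    congr 1
    rw [sigma3L_eq_sub u]
    change -(_ : L2) + (μ : ℂ) • u - _ - _ = _
    conv_lhs => enter [1, 1, 2]; rw [← P1L_add_P2L u]
    module
  · have hf : (f : L2) ∈ H2 C2 := h.mem_domH.1 f.2
    have e1 : sigma3L (opH μ V1 V2 f - ((μ : ℂ) + z ^ 2) • (f : L2)) =
        ((-z ^ 2) • P1L (f : L2) + (2 * μ + z ^ 2) • P2L (f : L2) -
          laplaceH2 (⟨f, hf⟩ : H2 C2)) - mv V1 V2 (mv V1 V2 f) := by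
      rw [map_sub, h.opH_apply f hf, sigma3L_sigma3L, map_smul, sigma3L_eq_sub]
      conv_lhs => enter [1, 1, 2]; rw [← P1L_add_P2L (f : L2)]
      module
    have e2 := Gop_left hz.re_pos' hz.re_pos ⟨(f : L2), hf⟩
    rw [hsq, hz.sq] at e2
    have e3 : G (sigma3L (opH μ V1 V2 f - ((μ : ℂ) + z ^ 2) • (f : L2))) =
        f - G (mv V1 V2 (mv V1 V2 f)) := by
      rw [e1, map_sub]
      exact congrArg (· - G (mv V1 V2 (mv V1 V2 (f : L2)))) e2
    rw [Rop_apply, e3, map_sub (mv V1 V2), ← h.Az_apply hz, hE', sub_add_cancel]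

end

/-! ### The leading term of the resolvent -/

section

variable {H : Type*} [NormedAddCommGroup H] [NormedSpace ℂ H]

/-- Telescoping of `Y E X - c Y₀ Γ X₀`: either `E` is replaced by `c Γ` with error `O(1/w)`, or an
outer factor by its limit, with error `O(w)` against `|c| = w⁻²`. Each exchange costs `O(1/w)`. -/
lemma norm_sandwich_sub_le {Y Y0 E Γ X X0 : H →L[ℂ] H} {w ky kx kd kd' ke : ℝ} {c : ℂ}
    (hw : 0 < w) (hc : ‖c‖ = (w ^ 2)⁻¹) (hky : 0 ≤ ky) (hke : 0 ≤ ke) (hkd : 0 ≤ kd)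
    (hY : ∀ f, ‖Y f‖ ≤ ky * ‖f‖) (hY0 : ∀ f, ‖Y0 f‖ ≤ ky * ‖f‖) (hX : ∀ f, ‖X f‖ ≤ kx * ‖f‖)
    (hE : ∀ f, ‖E f - c • Γ f‖ ≤ ke / w * ‖f‖) (hYd : ∀ f, ‖Y f - Y0 f‖ ≤ kd * w * ‖f‖)
    (hXd : ∀ f, ‖X f - X0 f‖ ≤ kd' * w * ‖f‖) (f : H) :
    ‖Y (E (X f)) - c • Y0 (Γ (X0 f))‖ ≤
      (ky * ke * kx + kd * ‖Γ‖ * kx + ky * ‖Γ‖ * kd') / w * ‖f‖ := by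
  have e : Y (E (X f)) - c • Y0 (Γ (X0 f)) = Y (E (X f) - c • Γ (X f)) +
      c • (Y (Γ (X f)) - Y0 (Γ (X f))) + c • Y0 (Γ (X f - X0 f)) := by
    simp only [map_sub, map_smul]
    module
  have h1 : ‖Y (E (X f) - c • Γ (X f))‖ ≤ ky * (ke / w * (kx * ‖f‖)) :=
    (hY _).trans (mul_le_mul_of_nonneg_left ((hE _).trans
      (mul_le_mul_of_nonneg_left (hX f) (by positivity))) hky)
  have h2 : ‖c • (Y (Γ (X f)) - Y0 (Γ (X f)))‖ ≤
      (w ^ 2)⁻¹ * (kd * w * (‖Γ‖ * (kx * ‖f‖))) := by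
    rw [norm_smul, hc]
    exact mul_le_mul_of_nonneg_left ((hYd _).trans (mul_le_mul_of_nonneg_left
      ((Γ.le_opNorm _).trans (mul_le_mul_of_nonneg_left (hX f) (norm_nonneg _)))
      (by positivity))) (by positivity)
  have h3 : ‖c • Y0 (Γ (X f - X0 f))‖ ≤ (w ^ 2)⁻¹ * (ky * (‖Γ‖ * (kd' * w * ‖f‖))) := by
    rw [norm_smul, hc]
    exact mul_le_mul_of_nonneg_left ((hY0 _).trans (mul_le_mul_of_nonneg_left
      ((Γ.le_opNorm _).trans (mul_le_mul_of_nonneg_left (hXd f) (norm_nonneg _))) hky))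
      (by positivity)
  rw [e]
  refine (norm_add₃_le).trans ((add_le_add (add_le_add h1 h2) h3).trans_eq ?_)
  field_simp

end

section

variable {μ β C : ℝ} {V1 V2 : E3 → ℝ} {z a : ℂ}

/-- The unbounded `R₀(μ)` disappears behind the weights: with `σ₃ f = ⟨x⟩^{-s} F`, every factor is a
Hilbert–Schmidt operator with a limit at `z = 0`, and `P` becomes the sandwich of `Γ` between the
limiting factors. -/
lemma Pot.mulOp_bw_Rop_add (h : Pot μ β C V1 V2) (hz : SP μ z a) {s : ℝ} (hs : 1 / 2 < s)
    (E : L2 →L[ℂ] L2) {f F : L2} (hF : mulOp (bw s) F = sigma3L f) :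
    mulOp (bw s) (Rop V1 V2 (Gop hz.re_pos' hz.re_pos) E f + (z ^ 2)⁻¹ • Pop μ V1 V2 f) =
      wop (bw s) (kerGz z a) (bw s) F +
        (wop (bw s) (kerGz z a) (v V1 V2) (E (wop (v V1 V2) (kerGz z a) (bw s) F)) -
        (z ^ 2)⁻¹ • wop (bw s) (kerG0 μ) (v V1 V2)
          (S2b0invS2 μ V1 V2 (wop (v V1 V2) (kerG0 μ) (bw s) F))) := by
  have hs0 : 0 ≤ s := by linarith
  have hg : S2b0invS2 μ V1 V2 (wop (v V1 V2) (kerG0 μ) (bw s) F) =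
      S2b0invS2 μ V1 V2 (ContinuousLinearMap.adjoint (Th μ V1 V2) (sigma3L f)) :=
    Gam_congr fun φ hφ => by
      rw [h.inner_wop_bw hs hφ, hF, ContinuousLinearMap.adjoint_inner_right]
  rw [h.wop_bw_Th hs (Gam_mem _), hg, hz.wop_kerGz (wt_bw s) hs0 (wt_bw s) hs0,
    hz.wop_kerGz (wt_bw s) hs0 h.wt_v h.half_pos, hz.wop_kerGz h.wt_v h.half_pos (wt_bw s) hs0]
  simp only [ContinuousLinearMap.comp_apply, hF]
  rw [Rop_apply, Pop_apply, map_add, map_add, map_smul, map_neg, smul_neg]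
  simp only [mv]
  abel

lemma Pot.exists_norm_mulOp_bw_le (h : Pot μ β C V1 V2) (hL : LminusNonneg μ V1 V2) {s : ℝ}
    (hs : 3 / 2 < s) : ∃ K δ : ℝ, 0 ≤ K ∧ 0 < δ ∧ ∀ z : ℂ, 0 < z.im → ‖z‖ < δ →
      ∃ R : L2 →L[ℂ] L2, IsResolventAt (opH μ V1 V2) ((μ : ℂ) + z ^ 2) R ∧
        ∀ f F : L2, mulOp (bw s) F = sigma3L f →
          ‖mulOp (bw s) (R f + (z ^ 2)⁻¹ • Pop μ V1 V2 f)‖ ≤ K / ‖z‖ * ‖F‖ := by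
  obtain ⟨ke, δ, hke, hδ, hE⟩ := h.exists_norm_sub_le hL
  have hs2 : 1 / 2 < s := by linarith
  set k := 1 * cInv (1 * 1) s s
  set ky := 1 * cInv (1 * (4 * √C)) s (β / 2)
  set kx := 1 * cInv (4 * √C * 1) (β / 2) s
  set kd := cExp μ * cPow (1 * (4 * √C)) (s - 0) (β / 2 - 0)
  set kd' := cExp μ * cPow (4 * √C * 1) (β / 2 - 0) (s - 0)
  have hk : 0 ≤ k := mul_nonneg zero_le_one (cInv_nonneg _ _ _)
  have hky : 0 ≤ ky := mul_nonneg zero_le_one (cInv_nonneg _ _ _)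
  have hkx : 0 ≤ kx := mul_nonneg zero_le_one (cInv_nonneg _ _ _)
  have hce : 0 ≤ cExp μ := zero_le_one.trans (one_le_cExp h.mu_pos)
  have hkd : 0 ≤ kd := mul_nonneg hce (cPow_nonneg _ _ _)
  have hkd' : 0 ≤ kd' := mul_nonneg hce (cPow_nonneg _ _ _)
  set G := ‖S2b0invS2 μ V1 V2‖ with hG
  have hGp : 0 ≤ G := norm_nonneg _
  have hμ := h.mu_pos
  refine ⟨k + (ky * ke * kx + kd * G * kx + ky * G * kd'), min δ (min 1 (√(2 * μ))),
    by positivity, by positivity, fun z hz hzδ => ?_⟩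
  have hz1 : ‖z‖ < 1 := hzδ.trans_le ((min_le_right _ _).trans (min_le_left _ _))
  have hz2 : ‖z‖ < √(2 * μ) := hzδ.trans_le ((min_le_right _ _).trans (min_le_right _ _))
  rw [Real.lt_sqrt (norm_nonneg _)] at hz2
  obtain ⟨a, ha⟩ := exists_sp hz hz1.le hz2
  have hEz := hE z a ha (hzδ.trans_le (min_le_left _ _))
  -- The a priori bound with `A(z) f = 0` gives `f = 0`; the same bound at `E g` afterwards
  -- estimates `E - z⁻² Γ`.
  obtain ⟨E, hE1, hE2⟩ := h.exists_inverse_Az ha fun f hf => by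
    have := hEz f
    rw [hf, map_zero, smul_zero, sub_zero, norm_zero, mul_zero] at this
    exact norm_le_zero_iff.1 this
  have hw : 0 < ‖z‖ := norm_pos_iff.2 ha.ne_zero
  refine ⟨_, h.isResolventAt_Rop ha hE1 hE2, fun f F hF => ?_⟩
  rw [h.mulOp_bw_Rop_add ha hs2 E hF]
  have h1 := (ha.wop_kerGz_spec (wt_bw s) (wt_bw s) (Or.inl ⟨hs2, hs⟩)).2.2 F
  have h2 : k ≤ k / ‖z‖ := by
    rw [le_div_iff₀ hw]
    exact mul_le_of_le_one_right hk hz1.le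
  have h3 := norm_sandwich_sub_le (c := (z ^ 2)⁻¹) (w := ‖z‖) (Γ := S2b0invS2 μ V1 V2) (E := E)
    hw (by rw [norm_inv, norm_pow]) hky hke hkd
    (ha.wop_kerGz_spec (wt_bw s) h.wt_v (Or.inl ⟨hs2, h.three_half_lt⟩)).2.2
    (wop_kerG0_spec (μ := μ) (wt_bw s) h.wt_v (Or.inl ⟨hs2, h.three_half_lt⟩)).2.2
    (ha.wop_kerGz_spec h.wt_v (wt_bw s) (h.wtPair_bw hs2)).2.2
    (fun g => by have := hEz (E g); rwa [hE1] at this)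
    (norm_wop_sub_le h.mu_pos ha (wt_bw s) h.wt_v hs h.three_half_lt)
    (norm_wop_sub_le h.mu_pos ha h.wt_v (wt_bw s) h.three_half_lt hs) F
  refine (norm_add_le _ _).trans ((add_le_add (h1.trans
    (mul_le_mul_of_nonneg_right h2 (norm_nonneg _))) h3).trans_eq ?_)
  ring

lemma enorm_mulOp_bw {s : ℝ} (hs : 0 ≤ s) (u : L2) :
    eLpNorm (fun x => bracket x ^ (-s) • u x) 2 volume = ENNReal.ofReal ‖mulOp (bw s) u‖ := by
  rw [ofReal_norm, Lp.enorm_def]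
  refine eLpNorm_congr_ae ?_
  filter_upwards [(wt_bw s).mulOp_ae hs u] with x hx
  rw [hx, act_bw]

lemma mulOp_bw_toLp {s : ℝ} (hs : 0 ≤ s) {f : L2}
    (hf : MemLp (fun x => bracket x ^ s • f x) 2 volume) :
    mulOp (bw s) (sigma3L (hf.toLp _)) = sigma3L f := by
  refine Lp.ext ?_
  filter_upwards [(wt_bw s).mulOp_ae hs (sigma3L (hf.toLp _)), sigma3L_ae (hf.toLp _),
    sigma3L_ae f, hf.coeFn_toLp] with x h1 h2 h3 h4
  rw [h1, h2, h3, h4, act_bw, ← Complex.coe_smul (bracket x ^ s), act_smul, Complex.coe_smul, smul_smul, bracket_rpow_mul, neg_add_cancel,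
    Real.rpow_zero, one_smul]

lemma Pot.leadingResolventTerm (h : Pot μ β C V1 V2) (hL : LminusNonneg μ V1 V2) :
    LeadingResolventTerm μ V1 V2 (Pop μ V1 V2) := by
  intro s hs
  have hs0 : 0 ≤ s := by linarith
  obtain ⟨K, δ, hK, hδ, hR⟩ := h.exists_norm_mulOp_bw_le hL hs
  have hσ : 0 ≤ ‖sigma3L‖ := norm_nonneg _
  -- The summand `1` makes the constant strictly positive; this is required by the statement and is
  -- used when the right-hand norm is infinite, where the product must be `∞`.
  refine ⟨K * ‖sigma3L‖ + 1, δ, by positivity, hδ, fun z hz hzδ => ?_⟩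
  obtain ⟨R, hR1, hR2⟩ := hR z hz hzδ
  have hw : 0 < ‖z‖ := norm_pos_iff.2 fun h0 => by simp [h0] at hz
  refine ⟨R, hR1, fun f => ?_⟩
  by_cases hf : MemLp (fun x => bracket x ^ s • f x) 2 volume
  · have h1 := hR2 f _ (mulOp_bw_toLp hs0 hf)
    have h2 : ‖hf.toLp _‖ₑ = eLpNorm (fun x => bracket x ^ s • f x) 2 volume := by
      rw [Lp.enorm_def]
      exact eLpNorm_congr_ae hf.coeFn_toLp
    rw [enorm_mulOp_bw hs0, ← h2, ← ofReal_norm, ← ENNReal.ofReal_mul (by positivity)]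
    refine ENNReal.ofReal_le_ofReal (h1.trans ?_)
    have h3 := mul_le_mul_of_nonneg_left (sigma3L.le_opNorm (hf.toLp _))
      (show 0 ≤ K / ‖z‖ by positivity)
    refine h3.trans ?_
    rw [← mul_assoc, div_mul_eq_mul_div]
    gcongr
    linarith
  · have hm : AEStronglyMeasurable (fun x => bracket x ^ s • f x) volume :=
      (continuous_bracket_rpow _).aestronglyMeasurable.smul (Lp.aestronglyMeasurable _)
    have h1 : eLpNorm (fun x => bracket x ^ s • f x) 2 volume = ⊤ := by
      by_contra hne
      exact hf ⟨hm, lt_top_iff_ne_top.2 hne⟩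
    rw [h1, ENNReal.mul_top]
    · exact le_top
    · exact (ENNReal.ofReal_pos.2 (by positivity)).ne'

/-- The pointwise form of the positivity of `-σ₃ V`. -/
lemma abs_le_of_posDef {x : E3} (h : (-(sigma3 * potV V1 V2 x)).PosDef) : |V2 x| ≤ V1 x := by
  have e : -(sigma3 * potV V1 V2 x) = !![(V1 x : ℂ), (V2 x : ℂ); (V2 x : ℂ), (V1 x : ℂ)] := by
    ext i j
    fin_cases i <;> fin_cases j <;> simp [sigma3, potV]
  rw [e] at h
  have h1 := h.posSemidef.dotProduct_mulVec_nonneg ![1, 1]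
  have h2 := h.posSemidef.dotProduct_mulVec_nonneg ![1, -1]
  simp [Matrix.mulVec, dotProduct, Fin.sum_univ_two] at h1 h2
  norm_cast at h1 h2
  rw [abs_le]
  constructor <;> linarith

end

end ThresholdProjection

end

theorem mainTheorem3 (μ : ℝ) (hμ : 0 < μ) (V1 V2 : ThresholdProjection.E3 → ℝ)
    (hV1 : Measurable V1) (hV2 : Measurable V2)
    (hA1 : ∀ᵐ x, (-(ThresholdProjection.sigma3 * ThresholdProjection.potV V1 V2 x)).PosDef)
    (hA2 : ThresholdProjection.LminusNonneg μ V1 V2)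
    (β : ℝ) (hβ : 5 < β)
    (hA3 : ∃ C : ℝ, ∀ᵐ x, |V1 x| + |V2 x| ≤ C * ThresholdProjection.bracket x ^ (-β)) :
    -- the ingredients of the formula for `P_μ` are well defined
    Dense ((ThresholdProjection.opH μ V1 V2).domain : Set ThresholdProjection.L2) ∧
    (∃ T, ThresholdProjection.IsKernelOp (ThresholdProjection.kerVRV μ V1 V2) T) ∧
    (∃ T, ThresholdProjection.IsKernelOp (ThresholdProjection.kerA1 V1 V2) T) ∧
    (∃ T, ThresholdProjection.IsKernelOp (ThresholdProjection.kerB μ V1 V2) T) ∧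
    (ThresholdProjection.b0 μ V1 V2).IsInvertible ∧
    -- the formula defines a unique bounded operator, with the asserted properties
    (∃! P : ThresholdProjection.L2 →L[ℂ] ThresholdProjection.L2,
      ThresholdProjection.IsPmu μ V1 V2 P) ∧
    ∀ P : ThresholdProjection.L2 →L[ℂ] ThresholdProjection.L2,
      ThresholdProjection.IsPmu μ V1 V2 P →
        IsIdempotentElem P ∧
        LinearMap.range P.toLinearMap =
          ThresholdProjection.kerSub (ThresholdProjection.opH μ V1 V2) (μ : ℂ) ∧
        LinearMap.ker P.toLinearMap =
          (ThresholdProjection.kerSub (ThresholdProjection.opH μ V1 V2).adjoint (μ : ℂ))ᗮ ∧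
        ThresholdProjection.LeadingResolventTerm μ V1 V2 P := by
  obtain ⟨C, hC⟩ := hA3
  -- The decay constant is not assumed nonnegative, and later estimates use `√C`; hence `max C 0`.
  have h : ThresholdProjection.Pot μ β (max C 0) V1 V2 :=
    { mu_pos := hμ
      five_lt := hβ
      nonneg := le_max_right _ _
      meas1 := hV1
      meas2 := hV2
      abs_le := hA1.mono fun x hx => ThresholdProjection.abs_le_of_posDef hx
      decay := hC.mono fun x hx => hx.trans (mul_le_mul_of_nonneg_right (le_max_left _ _)
        (ThresholdProjection.bracket_rpow_pos x _).le) }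
  refine ⟨h.dense_domain, h.exists_kerVRV, h.exists_kerA1, h.exists_kerB, h.b0_isInvertible hA2,
    ⟨_, h.isPmu_Pop, fun P hP => hP.unique h.isPmu_Pop⟩, fun P hP => ?_⟩
  rw [hP.unique h.isPmu_Pop]
  exact ⟨h.Pop_isIdempotent hA2, h.range_Pop hA2, h.ker_Pop hA2, h.leadingResolventTerm hA2⟩
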